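/- **Theorem 1.1.** Let $M$ be a three-dimensional manifold (Hausdorff, second countable, without boundary) with a contact form $\lambda$, Reeb vector field $X$, contact planes $\xi=\ker\lambda$, and projection $\pi_\lambda v=v-\lambda(v)X$ onto $\xi$. Let $\mathcal L\subset M$ be a Legendrian knot with a fixed orientation, and let $\mathcal D'\subset M$ be a compact smoothly embedded surface with $\partial\mathcal D'=\mathcal L$ which has only finitely many singular points, i.e. points $p$ with $T_p\mathcal D'=\xi_p$. A singular point is called *elliptic* if the linearization there of a vector field directing the characteristic foliation has positive determinant. For every $C^0$-neighbourhood of the embedding of $\mathcal D'$ there are a smoothly embedded surface $\mathcal D$ (an embedding of the same abstract surface, belonging to that neighbourhood and agreeing with the given one on the boundary) with $\partial \mathcal D=\mathcal L$, with the same singular points as $\mathcal D'$ and with the same elliptic singular points on $\mathcal L$, and a smooth complex structure $J$ on $\xi$ compatible with $d\lambda$ (that is, $d\lambda(\cdot,J\cdot)$ is a metric on $\xi$), such that the following holds. Let $\tilde J$ be the almost complex structure on $\mathbb R\times M$ with $\tilde J|_\xi=J$, $\tilde J\partial_\tau=X$, $\tilde JX=-\partial_\tau$, where $\partial_\tau$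 is the unit vector field of the factor $\mathbb R$. Let $S=\mathbb R\times[0,1]$, and let $\mathcal D^*$ be $\mathcal D$ without its singular points. For each elliptic singular point $e\in\partial\mathcal D=\mathcal L$ of $\mathcal D$ there are embeddings $\tilde u_\tau=(a_\tau,u_\tau):S\to\mathbb R\times M$, $0<\tau<1$, which solve $$\partial_s\tilde u+\tilde J(\tilde u)\,\partial_t\tilde u=0,\qquad \tilde u(s,0)\in\mathbb R\times\mathcal L,\qquad \tilde u(s,1)\in\{0\}\times\mathcal D^*,\qquad E(\tilde u)<\infty, \tag{1}$$ where $E(\tilde u)=\sup_\phi\int_S\tilde u^*d(\phi\lambda)$ over all smooth $\phi:\mathbb R\to[0,1]$ with $\phi'\ge 0$, and which have the following properties: 1. $\tilde u_\tau(S)\cap\tilde u_{\tau'}(S)=\emptyset$ if $\tau\ne\tau'$; 2. $\tilde u_\tau\to(0,e)$ uniformly on $S$ with all derivatives (in a chart around $e$) as $\tau\to0$; 3. the family $\tilde u_\tau$ depends smoothly on $\tau$, i.e. $(\tau,s,t)\mapsto\tilde u_\tau(s,t)$ is smooth on $(0,1)\times S$; 4. each $u_\tau$ is transverse to the Reeb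 field: $\pi_\lambda\partial_su_\tau(z)\ne0$ for all $z\in S$; 5. each $\tilde u_\tau$ tends to points $(0,p_\pm)$, $p_\pm\in\mathcal L$, as $s\to\pm\infty$, with decay rates $\mp\pi/2$, and its Maslov index is $0$; 6. there are coordinates $(\theta,x,y)$ of $M$ around $e$, centred at $e$, in which $\lambda=dy+x\,d\theta$, $\mathcal L=\{x=y=0\}$ with $\theta$ increasing along $\mathcal L$, $\mathcal D=\{y=-\tfrac12\theta x,\ \sigma x\le0\}$ with some $\sigma\in\{1,-1\}$, and $Je_1=-e_2$, $Je_2=e_1$ for $e_1=\partial_\theta-x\,\partial_y$, $e_2=\partial_x$; and there is a constant $c>0$ such that $\tilde u_\tau$ stays in the domain of these coordinates and with $\varepsilon=\sigma c\tau$, $D=\cos\frac{\pi t}2+\cosh\frac{\pi s}2$, $$\tilde u_\tau(s,t)=(a,\theta,x,y)=\Bigl(-\frac{\varepsilon^2\cos\frac{\pi t}2}{2D},\ \frac{\varepsilon\sinh\frac{\pi s}2}{D},\ -\frac{\varepsilon\sin\frac{\pi t}2}{D},\ \frac{\varepsilon^2\sin\frac{\pi t}2\,\sinh\frac{\pi s}2}{2D^2}\Bigr).$$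 Here *decay rate $\rho$* at an end means that in a chart around $p_\pm$ in which $(0,p_\pm)$ is the origin one has $\tilde u(s,t)=e^{\int_{s_0}^s\alpha}\,(e_\pm(t)+r(s,t))$ for large $|s|$, with $\alpha$ smooth, $\alpha(s)\to\rho$, $e_\pm$ continuous and nowhere zero on $[0,1]$, and $r(s,t)\to0$ uniformly in $t$. The *Maslov index* of a strip $\tilde u$ solving (1) with decay rates $\mp\pi/2$ is defined as follows. Choose a continuous section $n$ of $\tilde u^*T(\mathbb R\times M)$ with $n\notin\operatorname{Span}\{\partial_s\tilde u,\partial_t\tilde u\}$ everywhere, $n(s,0)\in T(\mathbb R\times\mathcal L)$, and, uniformly in $t$, $n(s,t)\to(0,v_+)$ as $s\to+\infty$ and $n(s,t)\to(0,-v_-)$ as $s\to-\infty$, where $v_\pm\ne 0$ are positive tangent vectors of $\mathcal L$ at $p_\pm$, for which there is a continuous path $\gamma=a_1+ia_2:\mathbb R\to\mathbb C\setminus\{0\}$ with $a_1(s)\,n(s,1)+a_2(s)\,\tilde J n(s,1)\in T(\{0\}\times\mathcal D)$. If $\gamma=|\gamma|e^{i\varphi}$ with $\varphi$ continuous, the index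 is $\frac1\pi\bigl(\lim_{s\to+\infty}\varphi(s)-\lim_{s\to-\infty}\varphi(s)\bigr)$. -/

import Mathlib

open Set Filter Topology MeasureTheory Manifold ContDiff

noncomputable section

/-- Coordinate three-space, with coordinates `(θ, x, y)` indexed by `0, 1, 2`. -/
abbrev E3 : Type := EuclideanSpace ℝ (Fin 3)

/-- Coordinate two-space, in which surfaces with boundary are modelled on a half-plane. -/
abbrev E2 : Type := EuclideanSpace ℝ (Fin 2)

/-- The closed strip `S = ℝ × [0, 1]`, with coordinates `(s, t)`. -/
def strip : Set (ℝ × ℝ) := univ ×ˢ Icc 0 1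

section ContactGeometry

variable {M : Type*} [TopologicalSpace M] [ChartedSpace E3 M]

/-- A 1-form, viewed as a family of cotangent vectors. -/
abbrev OneForm (M : Type*) [TopologicalSpace M] [ChartedSpace E3 M] : Type _ :=
  (p : M) → TangentSpace (𝓡 3) p →L[ℝ] ℝ

/-- A field of endomorphisms of the tangent spaces. -/
abbrev EndField (M : Type*) [TopologicalSpace M] [ChartedSpace E3 M] : Type _ :=
  (p : M) → TangentSpace (𝓡 3) p →L[ℝ] TangentSpace (𝓡 3) p

/-- The pullback of a 1-form by the inverse of the preferred chart at `p`. -/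
def OneForm.inChart (lam : OneForm M) (p : M) (x : E3) : E3 →L[ℝ] ℝ :=
  (lam ((extChartAt (𝓡 3) p).symm x)).comp
    (mfderiv 𝓘(ℝ, E3) (𝓡 3) (extChartAt (𝓡 3) p).symm x)

/-- The exterior derivative `dλ`, computed at `p` in the preferred chart at `p`:
`dλ (v, w) = (D_v λ) w - (D_w λ) v`. -/
def OneForm.extD (lam : OneForm M) (p : M) (v w : TangentSpace (𝓡 3) p) : ℝ :=
  let D := mfderiv (𝓡 3) 𝓘(ℝ, E3) (extChartAt (𝓡 3) p) p
  let A := fderiv ℝ (lam.inChart p) (extChartAt (𝓡 3) p p)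
  A (D v) (D w) - A (D w) (D v)

/-- `λ` is a contact form: it is smooth and `λ ∧ dλ` vanishes nowhere. -/
structure IsContactForm [IsManifold (𝓡 3) ∞ M] (lam : OneForm M) : Prop where
  smooth : ContMDiff (𝓡 3).tangent 𝓘(ℝ, ℝ) ∞
    (fun v : TangentBundle (𝓡 3) M => lam v.proj v.2)
  wedge_ne_zero : ∀ p : M, ∃ v₁ v₂ v₃ : TangentSpace (𝓡 3) p,
    lam p v₁ * lam.extD p v₂ v₃ + lam p v₂ * lam.extD p v₃ v₁
      + lam p v₃ * lam.extD p v₁ v₂ ≠ 0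

/-- The Reeb vector field: for a contact form it is the unique vector field `X` with
`λ(X) = 1` and `dλ(X, ·) = 0`. -/
def reeb (lam : OneForm M) (p : M) : TangentSpace (𝓡 3) p :=
  Classical.epsilon fun X : TangentSpace (𝓡 3) p =>
    lam p X = 1 ∧ ∀ w : TangentSpace (𝓡 3) p, lam.extD p X w = 0

/-- The projection `π_λ` of a tangent space onto `ξ = ker λ` along the Reeb field. -/
def contactProj (lam : OneForm M) (p : M) (v : TangentSpace (𝓡 3) p) :
    TangentSpace (𝓡 3) p :=
  v - lam p v • reeb lam p

/-- `J` is a smooth `dλ`-compatible complex structure on `ξ = ker λ`: `J` maps `ξ` to `ξ`,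
`J² = -1` on `ξ`, and `dλ(·, J ·)` is a metric on `ξ`. To have an endomorphism of the whole
tangent space, `J` is extended by `0` to the Reeb direction. -/
structure IsCompatible [IsManifold (𝓡 3) ∞ M] (lam : OneForm M) (J : EndField M) : Prop where
  smooth : ContMDiff (𝓡 3).tangent (𝓡 3).tangent ∞
    (fun v : TangentBundle (𝓡 3) M => (⟨v.proj, J v.proj v.2⟩ : TangentBundle (𝓡 3) M))
  map_reeb : ∀ p : M, J p (reeb lam p) = 0
  map_ker : ∀ (p : M) (v : TangentSpace (𝓡 3) p), lam p v = 0 → lam p (J p v) = 0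
  sq : ∀ (p : M) (v : TangentSpace (𝓡 3) p), lam p v = 0 → J p (J p v) = -v
  symm : ∀ (p : M) (v w : TangentSpace (𝓡 3) p), lam p v = 0 → lam p w = 0 →
    lam.extD p v (J p w) = lam.extD p w (J p v)
  pos : ∀ (p : M) (v : TangentSpace (𝓡 3) p), lam p v = 0 → v ≠ 0 →
    0 < lam.extD p v (J p v)

/-- The almost complex structure on `ℝ × M` which extends `J` on `ξ` and satisfies
`J̃ ∂_τ = X`, `J̃ X = -∂_τ` (it does not depend on the point of the `ℝ`-factor). -/
def symplJ (lam : OneForm M) (J : EndField M) (p : M) (V : ℝ × TangentSpace (𝓡 3) p) :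
    ℝ × TangentSpace (𝓡 3) p :=
  (-lam p V.2, V.1 • reeb lam p + J p (contactProj lam p V.2))

/-- The velocity of a 1-periodic parametrization of a knot. -/
def velocity (k : ℝ → M) (r : ℝ) : TangentSpace (𝓡 3) (k r) :=
  mfderiv 𝓘(ℝ, ℝ) (𝓡 3) k r (1 : ℝ)

/-- `k` is a smooth embedding of the circle `ℝ/ℤ`, written as a 1-periodic map, and its image
is Legendrian. -/
structure IsLegendrianKnot (lam : OneForm M) (k : ℝ → M) : Prop where
  smooth : ContMDiff 𝓘(ℝ, ℝ) (𝓡 3) ∞ k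
  periodic : Function.Periodic k 1
  injOn : InjOn k (Ico 0 1)
  immersed : ∀ r, velocity k r ≠ 0
  legendrian : ∀ r, lam (k r) (velocity k r) = 0

/-- The tangent vectors of the knot parametrized by `k`. -/
def knotTangent (k : ℝ → M) : Set (TangentBundle (𝓡 3) M) :=
  {v | ∃ r c : ℝ, v = ⟨k r, c • velocity k r⟩}

end ContactGeometry

section Surfaces

variable {M : Type*} [TopologicalSpace M] [ChartedSpace E3 M]
  {F : Type*} [TopologicalSpace F] [ChartedSpace (EuclideanHalfSpace 2) F]

/-- `z` is a singular point of the parametrized surface `f`: the tangent plane of the surface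
equals the contact plane. -/
def IsSingularPt (lam : OneForm M) (f : F → M) (z : F) : Prop :=
  ∀ v : TangentSpace (𝓡 3) (f z),
    (∃ w : TangentSpace (𝓡∂ 2) z, mfderiv (𝓡∂ 2) (𝓡 3) f z w = v) ↔ lam (f z) v = 0

/-- The form `f^*λ`, whose kernel is the characteristic foliation, in the preferred chart
of the surface at `z`. -/
def foliationForm (lam : OneForm M) (f : F → M) (z : F) (w : E2) : E2 →L[ℝ] ℝ :=
  (lam (f ((extChartAt (𝓡∂ 2) z).symm w))).comp
    (mfderivWithin 𝓘(ℝ, E2) (𝓡 3) (f ∘ (extChartAt (𝓡∂ 2) z).symm) (range (𝓡∂ 2)) w)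

/-- The matrix `∂_i β_j` at `z`, where `β = f^*λ`. A vector field directing the
characteristic foliation is `V = (β_1, -β_0)`, up to a nonvanishing factor; at a zero of `β` its
linearization has the same determinant as this matrix, up to a positive factor. -/
def foliationMatrix (lam : OneForm M) (f : F → M) (z : F) : Matrix (Fin 2) (Fin 2) ℝ :=
  Matrix.of fun i j =>
    fderivWithin ℝ (foliationForm lam f z) (range (𝓡∂ 2)) (extChartAt (𝓡∂ 2) z z)
      (EuclideanSpace.single i 1) (EuclideanSpace.single j 1)

/-- An elliptic singular point: the linearization there of a vector field directing the
characteristic foliation has positive determinant. -/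
def IsEllipticPt (lam : OneForm M) (f : F → M) (z : F) : Prop :=
  IsSingularPt lam f z ∧ 0 < (foliationMatrix lam f z).det

end Surfaces

section Strips

variable {M : Type*} [TopologicalSpace M] [ChartedSpace E3 M]

/-- The derivative at `z` of `ũ = (a, u) : S → ℝ × M` in the direction `c`. -/
def dStrip (U : ℝ × ℝ → ℝ × M) (z c : ℝ × ℝ) : ℝ × TangentSpace (𝓡 3) (U z).2 :=
  (fderivWithin ℝ (fun w => (U w).1) strip z c,
    mfderivWithin 𝓘(ℝ, ℝ × ℝ) (𝓡 3) (fun w => (U w).2) strip z c)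

/-- `∂_s ũ`. -/
def partialS (U : ℝ × ℝ → ℝ × M) (z : ℝ × ℝ) : ℝ × TangentSpace (𝓡 3) (U z).2 :=
  dStrip U z (1, 0)

/-- `∂_t ũ`. -/
def partialT (U : ℝ × ℝ → ℝ × M) (z : ℝ × ℝ) : ℝ × TangentSpace (𝓡 3) (U z).2 :=
  dStrip U z (0, 1)

/-- The coefficient of `ds ∧ dt` in `ũ^* d(φ λ) = φ'(a) da ∧ u^*λ + φ(a) u^*dλ`. -/
def energyDensity (lam : OneForm M) (φ : ℝ → ℝ) (U : ℝ × ℝ → ℝ × M) (z : ℝ × ℝ) : ℝ :=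
  deriv φ (U z).1 * ((partialS U z).1 * lam (U z).2 (partialT U z).2
      - (partialT U z).1 * lam (U z).2 (partialS U z).2)
    + φ (U z).1 * lam.extD (U z).2 (partialS U z).2 (partialT U z).2

/-- The energy `sup_φ ∫_S ũ^* d(φ λ)` is finite, the supremum being over the smooth functions
`φ : ℝ → [0, 1]` with `φ' ≥ 0`. -/
def HasFiniteEnergy (lam : OneForm M) (U : ℝ × ℝ → ℝ × M) : Prop :=
  ∃ C : ℝ, ∀ φ : ℝ → ℝ, ContDiff ℝ ∞ φ → (∀ x, φ x ∈ Icc (0 : ℝ) 1) → (∀ x, 0 ≤ deriv φ x) →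
    IntegrableOn (energyDensity lam φ U) strip ∧
      ∫ z in strip, energyDensity lam φ U z ≤ C

/-- The mixed boundary value problem for a strip `ũ = (a, u)`, with boundary values in
`ℝ × L` at `t = 0`, where `L` is the image of `k`, and in `{0} × D^*` at `t = 1`, where `D^*` is
the surface parametrized by `f` without its singular points. -/
structure IsSolution {F : Type*} [TopologicalSpace F] [ChartedSpace (EuclideanHalfSpace 2) F]
    (lam : OneForm M) (J : EndField M) (k : ℝ → M) (f : F → M) (U : ℝ × ℝ → ℝ × M) : Prop where
  smooth : ContMDiffOn 𝓘(ℝ, ℝ × ℝ) (𝓘(ℝ, ℝ).prod (𝓡 3)) ∞ U strip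
  holomorphic : ∀ z ∈ strip, partialS U z + symplJ lam J (U z).2 (partialT U z) = 0
  boundary_zero : ∀ s : ℝ, (U (s, 0)).2 ∈ range k
  boundary_one : ∀ s : ℝ, (U (s, 1)).1 = 0 ∧ (U (s, 1)).2 ∈ f '' {z | ¬ IsSingularPt lam f z}
  energy : HasFiniteEnergy lam U

/-- A smooth map on the strip is an embedding: an immersion which is a homeomorphism onto its
image. -/
structure IsEmbeddedStrip (U : ℝ × ℝ → ℝ × M) : Prop where
  smooth : ContMDiffOn 𝓘(ℝ, ℝ × ℝ) (𝓘(ℝ, ℝ).prod (𝓡 3)) ∞ U strip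
  immersed : ∀ z ∈ strip, Function.Injective (dStrip U z)
  embedded : IsEmbedding (strip.domRestrict U)

/-- At the end of the strip given by `l` (`atTop` or `atBot`), the map `ũ` tends to `(0, p)` with
decay rate `rate`: in a chart around `p` in which `p` is moved to the origin one has
`ũ(s, t) = exp (∫_{s₀}^s α) (e(t) + r(s, t))`, where `α` tends to `rate`, `e(t)` never vanishes, and
`r` tends to zero uniformly in `t`. -/
def HasDecayRate (U : ℝ × ℝ → ℝ × M) (l : Filter ℝ) (p : M) (rate : ℝ) : Prop :=
  ∃ Ψ ∈ IsManifold.maximalAtlas (𝓡 3) ∞ M, p ∈ Ψ.source ∧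
    ∃ (α : ℝ → ℝ) (e : ℝ → ℝ × E3) (r : ℝ × ℝ → ℝ × E3) (s₀ : ℝ),
      ContDiff ℝ ∞ α ∧ Tendsto α l (𝓝 rate) ∧
      ContinuousOn e (Icc 0 1) ∧ (∀ t ∈ Icc (0 : ℝ) 1, e t ≠ 0) ∧
      Tendsto r (l ×ˢ 𝓟 (Icc 0 1)) (𝓝 0) ∧
      ∀ᶠ s in l, ∀ t ∈ Icc (0 : ℝ) 1, (U (s, t)).2 ∈ Ψ.source ∧
        ((U (s, t)).1, Ψ (U (s, t)).2 - Ψ p) =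
          Real.exp (∫ x in s₀..s, α x) • (e t + r (s, t))

/-- A section `n` along `ũ`, as a map to `ℝ × TM`, read off without its `ℝ`-component. -/
def sectionM (U : ℝ × ℝ → ℝ × M) (n : (z : ℝ × ℝ) → ℝ × TangentSpace (𝓡 3) (U z).2)
    (z : ℝ × ℝ) : TangentBundle (𝓡 3) M :=
  ⟨(U z).2, (n z).2⟩

/-- Admissible normal vectors along a strip `ũ` both of whose ends have the slowest possible
decay (`-π/2` at `+∞` and `π/2` at `-∞`). Here `ũ` tends to `(0, k r₊)` and to
`(0, k r₋)` at the ends. The limits of `n` are the positive tangent direction of the knot at `+∞`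
and the negative one at `-∞`; their lengths depend on the coordinate along the knot and
are left free. -/
structure IsAdmissibleNormal [IsManifold (𝓡 3) ∞ M] (k : ℝ → M) (U : ℝ × ℝ → ℝ × M) (rp rm : ℝ)
    (n : (z : ℝ × ℝ) → ℝ × TangentSpace (𝓡 3) (U z).2) : Prop where
  continuous_fst : ContinuousOn (fun z => (n z).1) strip
  continuous_snd : ContinuousOn (sectionM U n) strip
  normal : ∀ z ∈ strip, n z ∉ Submodule.span ℝ {partialS U z, partialT U z}
  boundary_zero : ∀ s : ℝ, sectionM U n (s, 0) ∈ knotTangent k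
  limit_fst_top : Tendsto (fun z => (n z).1) (atTop ×ˢ 𝓟 (Icc 0 1)) (𝓝 0)
  limit_fst_bot : Tendsto (fun z => (n z).1) (atBot ×ˢ 𝓟 (Icc 0 1)) (𝓝 0)
  limit_snd_top : ∃ c : ℝ, 0 < c ∧
    Tendsto (sectionM U n) (atTop ×ˢ 𝓟 (Icc 0 1)) (𝓝 ⟨k rp, c • velocity k rp⟩)
  limit_snd_bot : ∃ c : ℝ, 0 < c ∧
    Tendsto (sectionM U n) (atBot ×ˢ 𝓟 (Icc 0 1)) (𝓝 ⟨k rm, -(c • velocity k rm)⟩)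

/-- `μ` is the Maslov index of a strip `ũ` whose ends decay at the rates `∓π/2`: there are
an admissible normal vector `n` and a path `γ = |γ| e^{iφ}` in `ℂ ∖ {0}` such that
`Re γ(s) n(s, 1) + Im γ(s) J̃ n(s, 1)` is tangent to `{0} × D`, the tangent bundle of `D` being
the image of the tangent map of `f`, and `μ = (φ(+∞) - φ(-∞)) / π`. -/
def HasMaslovIndex [IsManifold (𝓡 3) ∞ M]
    {F : Type*} [TopologicalSpace F] [ChartedSpace (EuclideanHalfSpace 2) F]
    (lam : OneForm M) (J : EndField M) (k : ℝ → M) (f : F → M) (U : ℝ × ℝ → ℝ × M)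
    (μ : ℝ) : Prop :=
  ∃ rp rm : ℝ, HasDecayRate U atTop (k rp) (-(Real.pi / 2)) ∧
    HasDecayRate U atBot (k rm) (Real.pi / 2) ∧
  ∃ (n : (z : ℝ × ℝ) → ℝ × TangentSpace (𝓡 3) (U z).2) (γ : ℝ → ℂ) (φ : ℝ → ℝ) (φp φm : ℝ),
    IsAdmissibleNormal k U rp rm n ∧
    Continuous γ ∧ (∀ s, γ s ≠ 0) ∧
    (∀ s : ℝ,
      let V := (γ s).re • n (s, 1) + (γ s).im • symplJ lam J (U (s, 1)).2 (n (s, 1))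
      V.1 = 0 ∧
        (⟨(U (s, 1)).2, V.2⟩ : TangentBundle (𝓡 3) M) ∈ range (tangentMap (𝓡∂ 2) (𝓡 3) f)) ∧
    Continuous φ ∧ (∀ s, γ s = ‖γ s‖ * Complex.exp (φ s * Complex.I)) ∧
    Tendsto φ atTop (𝓝 φp) ∧ Tendsto φ atBot (𝓝 φm) ∧
    μ = (φp - φm) / Real.pi

/-- As `τ → 0+`, the maps `ũ_τ` tend to the constant map `(0, p)` uniformly on the strip with
all derivatives, as seen in a chart around `p`. -/
def ShrinksTo (U : ℝ → ℝ × ℝ → ℝ × M) (p : M) : Prop :=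
  ∃ Ψ ∈ IsManifold.maximalAtlas (𝓡 3) ∞ M, p ∈ Ψ.source ∧
    (∀ᶠ τ in 𝓝[>] (0 : ℝ), ∀ z ∈ strip, (U τ z).2 ∈ Ψ.source) ∧
    ∀ m : ℕ, TendstoUniformlyOn
      (fun τ => iteratedFDerivWithin ℝ m (fun z => ((U τ z).1, Ψ (U τ z).2)) strip)
      (iteratedFDerivWithin ℝ m (fun _ => ((0 : ℝ), Ψ p)) strip) (𝓝[>] 0) strip

/-- The derivative at `q` of a map from a manifold without boundary to its model space. -/
def modelDeriv {E : Type*} [NormedAddCommGroup E] [NormedSpace ℝ E] {N : Type*}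
    [TopologicalSpace N] [ChartedSpace E N] (Φ : N → E) (q : N) :
    TangentSpace 𝓘(ℝ, E) q →L[ℝ] E :=
  mfderiv 𝓘(ℝ, E) 𝓘(ℝ, E) Φ q

/-- The `(∂_θ, ∂_x, ∂_y)`-components of a tangent vector `v` at `q` in the coordinates `Φ`. -/
def coordD (Φ : M → E3) (q : M) (v : TangentSpace (𝓡 3) q) : E3 :=
  modelDeriv Φ q v

/-- Coordinates `Φ = (θ, x, y)` around the boundary singular point `p` in which the contact form
is `dy + x dθ`, the knot is the `θ`-axis with `θ` increasing along it, the surface is the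
part of `y = -θx/2` with `σ x ≤ 0`, and `J e₁ = -e₂`, `J e₂ = e₁` for the frame
`e₁ = ∂_θ - x ∂_y`, `e₂ = ∂_x` of the contact planes. -/
structure IsNormalChart {F : Type*} [TopologicalSpace F] [ChartedSpace (EuclideanHalfSpace 2) F]
    (lam : OneForm M) (J : EndField M) (k : ℝ → M) (f : F → M) (p : M) (σ : ℝ)
    (Φ : OpenPartialHomeomorph M E3) : Prop where
  mem_atlas : Φ ∈ IsManifold.maximalAtlas (𝓡 3) ∞ M
  mem_source : p ∈ Φ.source
  center : Φ p = 0
  form : ∀ q ∈ Φ.source, ∀ v : TangentSpace (𝓡 3) q,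
    lam q v = coordD Φ q v 2 + Φ q 1 * coordD Φ q v 0
  knot : ∀ q ∈ Φ.source, q ∈ range k ↔ Φ q 1 = 0 ∧ Φ q 2 = 0
  oriented : ∀ r : ℝ, k r ∈ Φ.source →
    0 < coordD Φ (k r) (velocity k r) 0
  surface : ∀ q ∈ Φ.source,
    q ∈ range f ↔ Φ q 2 = -(1 / 2) * Φ q 0 * Φ q 1 ∧ σ * Φ q 1 ≤ 0
  complex : ∀ q ∈ Φ.source, ∀ v : TangentSpace (𝓡 3) q, lam q v = 0 →
    coordD Φ q (J q v) 0 = coordD Φ q v 1 ∧ coordD Φ q (J q v) 1 = -coordD Φ q v 0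

end Strips

/-- The explicit strip in `ℝ × ℝ³`, with components `a` and `(θ, x, y)`. -/
def modelStrip (ε : ℝ) (z : ℝ × ℝ) : ℝ × E3 :=
  let C := Real.cos (Real.pi * z.2 / 2)
  let D := C + Real.cosh (Real.pi * z.1 / 2)
  let Y := Real.sin (Real.pi * z.2 / 2)
  let H := Real.sinh (Real.pi * z.1 / 2)
  (-(ε ^ 2 * C) / (2 * D), !₂[ε * H / D, -(ε * Y) / D, ε ^ 2 * Y * H / (2 * D ^ 2)])

end

/-! Everything rests on an explicit local model. In coordinates with λ = dy + x dθ the Reeb field is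
∂_y, and on the surface y = -θx/2 the form λ restricts to the rotationally symmetric form (x dθ - θ
dx)/2. Consider a map whose M-part lies in this surface and for which θ + ix is anti-holomorphic in
s + it. For the standard J it solves the equation as soon as ∂_s a = λ(∂_t u) and ∂_t a = -λ(∂_s u),
and a = (θ² + x² - ε²)/4 does this. The function tanh(π(s + it)/4) maps the strip conformally onto a
half-disc without its two corners, taking t = 0 to the diameter and t = 1 to the arc. Its conjugate,
scaled by ε, makes the diameter part of the knot and the arc a curve in the surface on which a = 0.
Each strip is thus the graph of a over a half-disc of radius |ε| in the surface.

The required properties can be read off from this picture. The strips lie on the disjoint quadrics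
θ² + x² - 4a = ε². The energy density is the divergence of φ(a)∇a, so the energy is a boundary term
bounded independently of φ. The derivative with respect to ε is a normal field which is tangent to
the knot at t = 0 and to {0} × D at t = 1, so γ = 1 is admissible and the Maslov index is zero. All
derivatives of tanh are polynomials in tanh, hence bounded on the strip, and the strips shrink with
ε. This is collected in `IsNormalChart.exists_strips`.

It remains to produce the model around each elliptic boundary point. A Darboux chart can be chosen
in which the knot is the θ-axis (`exists_darboux`, built from the flows of the Reeb field and of a
second field transverse to the knot in ξ). At a singular boundary point the surface is tangent to ξ
= {dy = 0}, so it is one half of a graph y = h(θ, x) with h = 0 on the axis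
(`IsContactForm.exists_isGraphChart`). Singular points are the zeros of dh + x dθ. With m = h_θx at
the origin, the determinant deciding ellipticity is a negative multiple of m(m + 1), because h_θθ =
0. So elliptic means -1 < m < 0. The model has m = -1/2, and the interval is convex. One can
therefore interpolate from h to -θx/2 with a cutoff χ for which ‖p‖‖dχ‖ is small: the linear part
stays uniformly invertible and dominates the errors, so no new singular point appears
(`exists_interpolation`). The new surface is the image of the old one under the shear y ↦ y + u(θ,
x), supported near the point and fixing the knot. Carrying this out at one point after another gives
`IsContactForm.exists_normal_surface`.

The complex structure comes from a metric on ξ: a partition of unity glues the forms dθ² + dx² of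
contact charts, and J is the rotation determined by the conformal class of this metric and the
orientation dλ. If only one function of the partition is nonzero near each of the finitely many
chosen points, J is standard there (`IsContactForm.exists_isCompatible`). -/

set_option linter.unusedSectionVars false

/-! ### Inverse function theorem on open sets. -/

section InverseFunction

/-- The inverse function theorem, with smoothness of both the map and its inverse on whole open
sets. -/
theorem exists_openPartialHomeomorph_contDiffOn {E F : Type*} [NormedAddCommGroup E]
    [NormedSpace ℝ E] [CompleteSpace E] [NormedAddCommGroup F] [NormedSpace ℝ F]
    {f : E → F} {U : Set E} (hU : IsOpen U) (hf : ContDiffOn ℝ ∞ f U) {a : E} (ha : a ∈ U)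
    (f' : E ≃L[ℝ] F) (hf' : HasFDerivAt f (f' : E →L[ℝ] F) a) :
    ∃ Φ : OpenPartialHomeomorph E F, a ∈ Φ.source ∧ Φ.source ⊆ U ∧ (Φ : E → F) = f ∧
      ContDiffOn ℝ ∞ Φ Φ.source ∧ ContDiffOn ℝ ∞ Φ.symm Φ.target := by
  have hfa : ContDiffAt ℝ ∞ f a := hf.contDiffAt (hU.mem_nhds ha)
  let Φ₀ := hfa.toOpenPartialHomeomorph f hf' (by simp)
  have hΦ₀ : (Φ₀ : E → F) = f := rfl
  -- Restricting to points with invertible derivative makes the inverse smooth on the whole target,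
  -- not only at the image of `a`.
  let V : Set E := U ∩ (fderiv ℝ f) ⁻¹' (range ((↑) : (E ≃L[ℝ] F) → E →L[ℝ] F))
  have hV : IsOpen V := (hf.continuousOn_fderiv_of_isOpen hU (by simp)).isOpen_inter_preimage hU
    ContinuousLinearEquiv.isOpen
  have haV : a ∈ V := ⟨ha, f', hf'.fderiv.symm⟩
  refine ⟨Φ₀.restrOpen V hV, ⟨hfa.mem_toOpenPartialHomeomorph_source hf' (by simp), haV⟩,
    fun x hx => hx.2.1, rfl, fun x hx => ?_, fun y hy => ?_⟩
  · exact ((hf.contDiffAt (hU.mem_nhds hx.2.1))).contDiffWithinAt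
  · have hx := (Φ₀.restrOpen V hV).map_target hy
    obtain ⟨hx1, hx2, e, he⟩ := hx
    have hd : HasFDerivAt f (e : E →L[ℝ] F) ((Φ₀.restrOpen V hV).symm y) := by
      rw [he]
      exact ((hf.contDiffAt (hU.mem_nhds hx2)).differentiableAt (by simp)).hasFDerivAt
    exact ((Φ₀.restrOpen V hV).contDiffAt_symm hy hd
      (hf.contDiffAt (hU.mem_nhds hx2))).contDiffWithinAt

end InverseFunction

/-! ### Smoothness of composition operators on spaces of continuous maps. -/

section Nemytskii

universe u

variable {K : Type*} [TopologicalSpace K] [CompactSpace K]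
  {E F : Type u} [NormedAddCommGroup E] [NormedSpace ℝ E] [NormedAddCommGroup F] [NormedSpace ℝ F]

/-- Pointwise application of a continuous family of operators, as a bounded bilinear map. -/
noncomputable def pointwiseApply (K : Type*) [TopologicalSpace K] [CompactSpace K]
    (E F : Type u) [NormedAddCommGroup E] [NormedSpace ℝ E] [NormedAddCommGroup F]
    [NormedSpace ℝ F] : C(K, E →L[ℝ] F) →L[ℝ] C(K, E) →L[ℝ] C(K, F) :=
  LinearMap.mkContinuous₂
    (LinearMap.mk₂ ℝ (fun (A : C(K, E →L[ℝ] F)) (h : C(K, E)) =>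
        (⟨fun t => A t (h t), by fun_prop⟩ : C(K, F)))
      (fun A B h => by ext t; simp) (fun c A h => by ext t; simp)
      (fun A h h' => by ext t; simp) (fun c A h => by ext t; simp)) 1 (fun A h => by
        rw [one_mul, ContinuousMap.norm_le _ (by positivity)]
        intro t
        exact ((A t).le_opNorm _).trans (mul_le_mul (A.norm_coe_le_norm t) (h.norm_coe_le_norm t)
          (norm_nonneg _) (norm_nonneg A)))

@[simp]
theorem pointwiseApply_apply (A : C(K, E →L[ℝ] F)) (h : C(K, E)) (t : K) :
    pointwiseApply K E F A h t = A t (h t) := rfl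

/-- The mean value inequality on a ball around each `γ t` bounds the remainder; one radius serves
all `t` because `f'` is uniformly continuous near the compact range of `γ`. -/
theorem hasFDerivAt_comp_left {f : C(E, F)} {f' : C(E, E →L[ℝ] F)}
    (hf : ∀ x, HasFDerivAt f (f' x) x) (γ : C(K, E)) :
    HasFDerivAt (fun γ : C(K, E) => f.comp γ) (pointwiseApply K E F (f'.comp γ)) γ := by
  rw [hasFDerivAt_iff_isLittleO_nhds_zero, Asymptotics.isLittleO_iff]
  intro c hc
  have hK : IsCompact (range γ) := isCompact_range γ.continuous
  have h1 : {p : (E →L[ℝ] F) × (E →L[ℝ] F) | dist p.1 p.2 < c} ∈ uniformity (E →L[ℝ] F) :=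
    Metric.dist_mem_uniformity hc
  have := hK.uniformContinuousAt_of_continuousAt f' (fun x _ => f'.continuous.continuousAt) h1
  obtain ⟨δ, hδ, hδ'⟩ := Metric.mem_uniformity_dist.1 this
  filter_upwards [Metric.ball_mem_nhds (0 : C(K, E)) hδ] with h hh
  rw [mem_ball_zero_iff] at hh
  rw [ContinuousMap.norm_le _ (by positivity)]
  intro t
  have hmv := (convex_ball (γ t) δ).norm_image_sub_le_of_norm_hasFDerivWithin_le'
    (f := f) (f' := f') (φ := f' (γ t)) (C := c) (x := γ t) (y := γ t + h t)
    (fun x _ => (hf x).hasFDerivWithinAt)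
    (fun x hx => by
      have := hδ' (a := γ t) (b := x) (by rw [dist_comm]; exact hx) ⟨t, rfl⟩
      rw [← dist_eq_norm, dist_comm]
      exact le_of_lt this) (Metric.mem_ball_self hδ)
    (by simpa [Metric.mem_ball, dist_eq_norm] using (h.norm_coe_le_norm t).trans_lt hh)
  simp only [add_sub_cancel_left] at hmv
  simpa using hmv.trans (mul_le_mul_of_nonneg_left (h.norm_coe_le_norm t) hc.le)

/-- The composition operator `γ ↦ f ∘ γ` on continuous maps of a compact space is as smooth
as `f`. -/
theorem contDiff_comp_left (n : ℕ) : ∀ {E F : Type u} [NormedAddCommGroup E] [NormedSpace ℝ E]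
    [NormedAddCommGroup F] [NormedSpace ℝ F] {f : C(E, F)}, ContDiff ℝ n f →
    ContDiff ℝ n (fun γ : C(K, E) => f.comp γ) := by
  induction n with
  | zero =>
    intro E F _ _ _ _ f _
    exact contDiff_zero.2 (ContinuousMap.continuous_postcomp f)
  | succ n ih =>
    intro E F _ _ _ _ f hf
    have hf1 := (contDiff_succ_iff_fderiv (n := n)).1 (by exact_mod_cast hf)
    -- The derivative of composition with `f` is built from composition with `f'`, whose target is
    -- another space; hence the induction quantifies over all spaces.
    let f' : C(E, E →L[ℝ] F) := ⟨fderiv ℝ f, hf1.2.2.continuous⟩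
    have hd := fun γ : C(K, E) => hasFDerivAt_comp_left (f := f) (f' := f')
      (fun x => (hf1.1 x).hasFDerivAt) γ
    have : ContDiff ℝ ((n : WithTop ℕ∞) + 1) (fun γ : C(K, E) => f.comp γ) := by
      rw [contDiff_succ_iff_hasFDerivAt]
      refine ⟨fun γ => pointwiseApply K E F (f'.comp γ), ?_, hd⟩
      exact (pointwiseApply K E F).contDiff.comp (ih (f := f') hf1.2.2)
    exact_mod_cast this

theorem contDiff_comp_left_infty {f : C(E, F)} (hf : ContDiff ℝ ∞ f) :
    ContDiff ℝ ∞ (fun γ : C(K, E) => f.comp γ) :=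
  contDiff_infty.2 fun n => contDiff_comp_left n (contDiff_infty.1 hf n)

end Nemytskii

/-! ### Smooth local flows, from the inverse function theorem in path space. -/

section Flow

variable {E : Type*} [NormedAddCommGroup E] [NormedSpace ℝ E]

/-- Constant paths, as a bounded linear map. -/
noncomputable def constPath (E : Type*) [NormedAddCommGroup E] [NormedSpace ℝ E] :
    E →L[ℝ] C(Icc (0 : ℝ) 1, E) :=
  LinearMap.mkContinuous
    { toFun := fun x => ContinuousMap.const _ x
      map_add' := fun x y => by ext; simp
      map_smul' := fun c x => by ext; simp } 1 (fun x => by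
        rw [one_mul, ContinuousMap.norm_le _ (norm_nonneg _)]
        intro t
        simp)

@[simp]
theorem constPath_apply (x : E) (t : Icc (0 : ℝ) 1) : constPath E x t = x := rfl

/-- The primitive `t ↦ ∫₀ᵗ γ` of a path, as a bounded linear map. -/
noncomputable def primitivePath (E : Type*) [NormedAddCommGroup E] [NormedSpace ℝ E] :
    C(Icc (0 : ℝ) 1, E) →L[ℝ] C(Icc (0 : ℝ) 1, E) :=
  LinearMap.mkContinuous
    { toFun := fun γ => ⟨fun t => ∫ s in (0 : ℝ)..t, γ (projIcc 0 1 zero_le_one s),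
        (intervalIntegral.continuous_primitive (fun a b =>
          (γ.continuous.comp continuous_projIcc).intervalIntegrable a b) 0).comp
            continuous_subtype_val⟩
      map_add' := fun γ δ => by
        ext t
        exact intervalIntegral.integral_add
          ((γ.continuous.comp continuous_projIcc).intervalIntegrable _ _)
          ((δ.continuous.comp continuous_projIcc).intervalIntegrable _ _)
      map_smul' := fun c γ => by
        ext t
        exact intervalIntegral.integral_smul _ _ } 1 (fun γ => by
          rw [one_mul, ContinuousMap.norm_le _ (norm_nonneg _)]
          intro t
          refine (intervalIntegral.norm_integral_le_of_norm_le_const (C := ‖γ‖)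
            (fun s _ => γ.norm_coe_le_norm _)).trans ?_
          rw [sub_zero, abs_of_nonneg t.2.1]
          exact mul_le_of_le_one_right (norm_nonneg _) t.2.2)

theorem primitivePath_apply (γ : C(Icc (0 : ℝ) 1, E)) (t : Icc (0 : ℝ) 1) :
    primitivePath E γ t = ∫ s in (0 : ℝ)..t, γ (projIcc 0 1 zero_le_one s) := rfl

/-- The path `r ↦ γ (s r)`. -/
def shrinkPath (γ : C(Icc (0 : ℝ) 1, E)) (s : Icc (0 : ℝ) 1) : C(Icc (0 : ℝ) 1, E) :=
  γ.comp ⟨fun r => s * r, by fun_prop⟩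

/-- A change of variables in the integral. It shows that a solution path traversed up to the
fraction `s` solves the integral equation for the time scaled by `s`. -/
theorem primitivePath_shrinkPath (γ : C(Icc (0 : ℝ) 1, E)) (s r : Icc (0 : ℝ) 1) :
    (s : ℝ) • primitivePath E (shrinkPath γ s) r = primitivePath E γ (s * r) := by
  rw [primitivePath_apply, primitivePath_apply]
  have h := intervalIntegral.smul_integral_comp_mul_left
    (fun x => γ (projIcc 0 1 zero_le_one x)) (s : ℝ) (a := 0) (b := r)
  rw [mul_zero] at h
  rw [Icc.coe_mul, ← h]
  congr 1
  refine intervalIntegral.integral_congr fun x hx => ?_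
  rw [uIcc_of_le r.2.1] at hx
  have hx' : x ∈ Icc (0 : ℝ) 1 := ⟨hx.1, hx.2.trans r.2.2⟩
  have hsx : (s : ℝ) * x ∈ Icc (0 : ℝ) 1 :=
    ⟨mul_nonneg s.2.1 hx'.1, mul_le_one₀ s.2.2 hx'.1 hx'.2⟩
  simp only [shrinkPath, ContinuousMap.comp_apply, ContinuousMap.coe_mk]
  rw [projIcc_of_mem _ hx', projIcc_of_mem _ hsx]
  rfl

/-- The local flow of a smooth vector field is smooth in time and initial value. -/
theorem exists_contDiffOn_flow [CompleteSpace E] {f : E → E} (hf : ContDiff ℝ ∞ f) (x₀ : E) :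
    ∃ (φ : E × ℝ → E) (U : Set (E × ℝ)), IsOpen U ∧ (x₀, 0) ∈ U ∧ ContDiffOn ℝ ∞ φ U ∧
      (∀ x, (x, 0) ∈ U → φ (x, 0) = x) ∧ ∀ p ∈ U, fderiv ℝ φ p (0, 1) = f (φ p) := by
  let Γ := C(Icc (0 : ℝ) 1, E)
  let fc : C(E, E) := ⟨f, hf.continuous⟩
  let c₀ : Γ := constPath E x₀
  -- The second component vanishes when `γ t = x + T ∫₀ᵗ f ∘ γ`, that is, when `γ t` is the solution
  -- at time `T t`. Rescaling time to the unit interval makes `T` a parameter like `x`.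
  let Ξ : (E × ℝ) × Γ → (E × ℝ) × Γ := fun q =>
    (q.1, q.2 - (constPath E q.1.1 + q.1.2 • primitivePath E (fc.comp q.2)))
  have hN : ContDiff ℝ ∞ (fun γ : Γ => fc.comp γ) := contDiff_comp_left_infty hf
  have hΞ : ContDiff ℝ ∞ Ξ := by
    refine contDiff_fst.prodMk (contDiff_snd.sub (ContDiff.add ?_ ?_))
    · exact (constPath E).contDiff.comp (contDiff_fst.comp contDiff_fst)
    · have h1 : ContDiff ℝ ∞ (fun q : (E × ℝ) × Γ => q.1.2) := contDiff_snd.comp contDiff_fst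
      exact h1.smul ((primitivePath E).contDiff.comp (hN.comp contDiff_snd))
  let L : E × ℝ →L[ℝ] Γ := -((constPath E).comp (ContinuousLinearMap.fst ℝ E ℝ) +
    (ContinuousLinearMap.snd ℝ E ℝ).smulRight (primitivePath E (fc.comp c₀)))
  -- At `T = 0` the nonlinear term contributes nothing to the derivative in `γ`, so the derivative
  -- of `Ξ` is triangular with identities on the diagonal.
  let A : ((E × ℝ) × Γ) ≃L[ℝ] ((E × ℝ) × Γ) :=
    (ContinuousLinearEquiv.refl ℝ (E × ℝ)).skewProd (ContinuousLinearEquiv.refl ℝ Γ) L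
  have hA : HasFDerivAt Ξ (A : ((E × ℝ) × Γ) →L[ℝ] ((E × ℝ) × Γ)) ((x₀, 0), c₀) := by
    have hg : DifferentiableAt ℝ (fun q : (E × ℝ) × Γ => primitivePath E (fc.comp q.2))
        ((x₀, 0), c₀) :=
      (((primitivePath E).contDiff.comp (hN.comp contDiff_snd)).differentiable (by simp)) _
    have h1 : HasFDerivAt (fun q : (E × ℝ) × Γ => q.1.2)
        ((ContinuousLinearMap.snd ℝ E ℝ).comp (ContinuousLinearMap.fst ℝ (E × ℝ) Γ))
        ((x₀, 0), c₀) := ((ContinuousLinearMap.snd ℝ E ℝ).comp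
          (ContinuousLinearMap.fst ℝ (E × ℝ) Γ)).hasFDerivAt
    have h2 : HasFDerivAt (fun q : (E × ℝ) × Γ => constPath E q.1.1)
        ((constPath E).comp ((ContinuousLinearMap.fst ℝ E ℝ).comp
          (ContinuousLinearMap.fst ℝ (E × ℝ) Γ))) ((x₀, 0), c₀) :=
      ((constPath E).comp ((ContinuousLinearMap.fst ℝ E ℝ).comp
          (ContinuousLinearMap.fst ℝ (E × ℝ) Γ))).hasFDerivAt
    have := (hasFDerivAt_fst (𝕜 := ℝ) (p := ((x₀, (0 : ℝ)), c₀))).prodMk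
      ((hasFDerivAt_snd (𝕜 := ℝ) (p := ((x₀, (0 : ℝ)), c₀))).sub (h2.add (h1.smul hg.hasFDerivAt)))
    refine this.congr_fderiv ?_
    ext q <;> simp [A, L]
  obtain ⟨Φ, h0, -, hΦ, -, hΦs⟩ := exists_openPartialHomeomorph_contDiffOn isOpen_univ
    hΞ.contDiffOn (mem_univ _) A hA
  have hΞ0 : Ξ ((x₀, 0), c₀) = ((x₀, 0), 0) := by simp [Ξ, c₀]
  obtain ⟨r, hr, hball⟩ := Metric.isOpen_iff.1 Φ.open_source _ h0
  let ι : E × ℝ → (E × ℝ) × Γ := fun p => (p, 0)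
  have hι : ContDiff ℝ ∞ ι := contDiff_id.prodMk contDiff_const
  let G : E × ℝ → Γ := fun p => (Φ.symm (ι p)).2
  let U₀ : Set (E × ℝ) := ι ⁻¹' Φ.target
  have hU₀ : IsOpen U₀ := Φ.open_target.preimage hι.continuous
  have hG : ContDiffOn ℝ ∞ G U₀ :=
    contDiff_snd.comp_contDiffOn (hΦs.comp hι.contDiffOn (fun p hp => hp))
  have hx0 : (x₀, (0 : ℝ)) ∈ U₀ := by
    have := Φ.map_source h0
    rwa [hΦ, hΞ0] at this
  have hG0 : G (x₀, 0) = c₀ := by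
    have := Φ.left_inv h0
    rw [hΦ, hΞ0] at this
    simp [G, ι, this]
  let U : Set (E × ℝ) := (U₀ ∩ G ⁻¹' Metric.ball c₀ r) ∩ Metric.ball (x₀, 0) r
  have hU : IsOpen U := (hG.continuousOn.isOpen_inter_preimage hU₀ Metric.isOpen_ball).inter
    Metric.isOpen_ball
  have heq : ∀ p ∈ U₀, G p = constPath E p.1 + p.2 • primitivePath E (fc.comp (G p)) := by
    intro p hp
    have h1 : Ξ (Φ.symm (ι p)) = ι p := by rw [← hΦ]; exact Φ.right_inv hp
    have h2 : (Φ.symm (ι p)).1 = p := congrArg Prod.fst h1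
    have h3 := congrArg Prod.snd h1
    simp only [Ξ, ι] at h3
    rw [sub_eq_zero] at h3
    rw [h2] at h3
    exact h3
  -- Uniqueness of solution paths near `c₀`, from the injectivity of `Ξ` on the ball.
  have huniq : ∀ p ∈ Metric.ball (x₀, (0 : ℝ)) r, ∀ γ ∈ Metric.ball c₀ r,
      γ = constPath E p.1 + p.2 • primitivePath E (fc.comp γ) → p ∈ U ∧ G p = γ := by
    intro p hp γ hγ h
    have hmem : (p, γ) ∈ Φ.source := hball (by
      rw [← ball_prod_same]
      exact ⟨hp, hγ⟩)
    have h1 : Φ (p, γ) = ι p := by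
      rw [hΦ]
      simp only [Ξ, ι]
      rw [← h, sub_self]
    have hp0 : p ∈ U₀ := by
      have := Φ.map_source hmem
      rwa [h1] at this
    have h2 : G p = γ := by
      simp only [G]
      rw [← h1, Φ.left_inv hmem]
    exact ⟨⟨⟨hp0, by rw [mem_preimage, h2]; exact hγ⟩, hp⟩, h2⟩
  let one : Icc (0 : ℝ) 1 := ⟨1, by simp⟩
  let φ : E × ℝ → E := fun p => G p one
  have hφ : ContDiffOn ℝ ∞ φ U :=
    (ContinuousLinearMap.contDiff (ContinuousMap.evalCLM ℝ one : Γ →L[ℝ] E)).comp_contDiffOn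
      (hG.mono (inter_subset_left.trans inter_subset_left))
  -- The shrunk path solves the equation for the shorter time, so by uniqueness the end point map
  -- `φ` along `s ↦ (x, sT)` traces out the whole path `G p`.
  have hscale : ∀ p ∈ U, ∀ s : Icc (0 : ℝ) 1, (p.1, s * p.2) ∈ U ∧ φ (p.1, s * p.2) = G p s := by
    rintro p ⟨⟨hp0, hpG⟩, hpr⟩ s
    have h := huniq (p.1, s * p.2) ?_ (shrinkPath (G p) s) ?_ ?_
    · refine ⟨h.1, ?_⟩
      simp only [φ]
      rw [h.2]
      exact congrArg (G p) (mul_one s)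
    · rw [Metric.mem_ball, Prod.dist_eq, max_lt_iff] at hpr ⊢
      refine ⟨hpr.1, ?_⟩
      rw [dist_zero_right, norm_mul]
      rw [dist_zero_right] at hpr
      refine lt_of_le_of_lt (mul_le_of_le_one_left (norm_nonneg _) ?_) hpr.2
      rw [Real.norm_of_nonneg s.2.1]
      exact s.2.2
    · rw [mem_preimage, Metric.mem_ball, dist_eq_norm] at hpG
      rw [Metric.mem_ball, dist_eq_norm]
      refine lt_of_le_of_lt ?_ hpG
      rw [ContinuousMap.norm_le _ (norm_nonneg _)]
      intro t
      exact (G p - c₀).norm_coe_le_norm (s * t)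
    · ext t
      have h1 : fc.comp (shrinkPath (G p) s) = shrinkPath (fc.comp (G p)) s := rfl
      have h2 := DFunLike.congr_fun (heq p hp0) (s * t)
      rw [ContinuousMap.add_apply, ContinuousMap.smul_apply, ← primitivePath_shrinkPath] at h2
      rw [h1, ContinuousMap.add_apply, ContinuousMap.smul_apply]
      change G p (s * t) = _
      rw [h2, smul_smul, mul_comm p.2]
      rfl
  have hderiv : ∀ p ∈ U, ∀ s : Icc (0 : ℝ) 1,
      p.2 • fderiv ℝ φ (p.1, s * p.2) (0, 1) = p.2 • f (φ (p.1, s * p.2)) := by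
    intro p hp s
    obtain ⟨hs1, hs2⟩ := hscale p hp s
    have hd : HasFDerivAt φ (fderiv ℝ φ (p.1, s * p.2)) (p.1, s * p.2) :=
      ((hφ.contDiffAt (hU.mem_nhds hs1)).differentiableAt (by simp)).hasFDerivAt
    have hl : HasDerivAt (fun x : ℝ => (p.1, x * p.2)) (0, p.2) (s : ℝ) := by
      have := (hasDerivAt_const (s : ℝ) p.1).prodMk ((hasDerivAt_id (s : ℝ)).mul_const p.2)
      simpa using this
    have h1 : HasDerivWithinAt (fun x : ℝ => φ (p.1, x * p.2))
        (fderiv ℝ φ (p.1, s * p.2) (0, p.2)) (Icc 0 1) s :=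
      (HasFDerivAt.comp_hasDerivAt (f := fun x : ℝ => (p.1, x * p.2)) (s : ℝ) hd
        hl).hasDerivWithinAt
    let g : ℝ → E := fun x => f (G p (projIcc 0 1 zero_le_one x))
    have hg : Continuous g := hf.continuous.comp ((G p).continuous.comp continuous_projIcc)
    have h2 : HasDerivWithinAt (fun x : ℝ => p.1 + p.2 • ∫ y in (0 : ℝ)..x, g y)
        (p.2 • g s) (Icc 0 1) s :=
      (((hg.integral_hasStrictDerivAt 0 (s : ℝ)).hasDerivAt.const_smul p.2).const_add
        p.1).hasDerivWithinAt
    have h3 : HasDerivWithinAt (fun x : ℝ => φ (p.1, x * p.2)) (p.2 • g s) (Icc 0 1) s := by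
      refine h2.congr_of_mem (fun x hx => ?_) s.2
      rw [(hscale p hp ⟨x, hx⟩).2]
      exact DFunLike.congr_fun (heq p hp.1.1) ⟨x, hx⟩
    have h4 := (uniqueDiffOn_Icc (zero_lt_one' ℝ) s s.2).eq_deriv _ h1 h3
    have h5 : ((0 : E), p.2) = p.2 • ((0 : E), (1 : ℝ)) := by simp
    rw [h5, map_smul] at h4
    rw [h4, hs2]
    simp [g]
  refine ⟨φ, U, hU, ⟨⟨hx0, ?_⟩, Metric.mem_ball_self hr⟩, hφ, fun x hx => ?_, ?_⟩
  · rw [mem_preimage, hG0]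
    exact Metric.mem_ball_self hr
  · have := heq _ hx.1.1
    simp only [φ]
    rw [this]
    simp only [zero_smul, add_zero]
    rfl
  · rintro ⟨x, T⟩ hp
    -- The identity in `hderiv` carries a factor `T`. At `T = 0` it is used for a nearby nonzero
    -- time at the parameter `s = 0`.
    by_cases hT : T = 0
    · subst hT
      have hev : ∀ᶠ t : ℝ in 𝓝 0, (x, t) ∈ U :=
        (Continuous.prodMk_right x).continuousAt.eventually (hU.mem_nhds hp)
      obtain ⟨t, ht, ht0⟩ := ((hev.filter_mono nhdsWithin_le_nhds).and
        (self_mem_nhdsWithin : {0}ᶜ ∈ 𝓝[≠] (0 : ℝ))).exists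
      have := hderiv _ ht ⟨0, by simp⟩
      simp only [zero_mul] at this
      exact smul_right_injective E ht0 this
    · have := hderiv _ hp one
      simp only [one, one_mul] at this
      exact smul_right_injective E hT this

end Flow

/-! ### Extending germs of smooth maps. -/

section Extension

/-- A map which is smooth near a point agrees near this point with a globally smooth map. -/
theorem exists_contDiff_eventuallyEq {E F : Type*} [NormedAddCommGroup E] [NormedSpace ℝ E]
    [HasContDiffBump E] [NormedAddCommGroup F] [NormedSpace ℝ F] [FiniteDimensional ℝ E]
    {f : E → F} {U : Set E} (hU : IsOpen U) (hf : ContDiffOn ℝ ∞ f U) {a : E} (ha : a ∈ U) :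
    ∃ g : E → F, ContDiff ℝ ∞ g ∧ g =ᶠ[𝓝 a] f := by
  obtain ⟨r, hr, hb⟩ := Metric.nhds_basis_closedBall.mem_iff.1 (hU.mem_nhds ha)
  let ψ : ContDiffBump a := ⟨r / 2, r, by positivity, by linarith⟩
  refine ⟨fun x => ψ x • f x, ?_, ?_⟩
  · refine contDiff_iff_contDiffAt.2 fun x => ?_
    by_cases hx : x ∈ U
    · exact ψ.contDiff.contDiffAt.smul (hf.contDiffAt (hU.mem_nhds hx))
    · have h : (fun x => ψ x • f x) =ᶠ[𝓝 x] fun _ => 0 := by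
        have : (tsupport ψ)ᶜ ∈ 𝓝 x := by
          refine (isClosed_tsupport _).isOpen_compl.mem_nhds fun h => hx (hb ?_)
          rwa [ψ.tsupport_eq] at h
        filter_upwards [this] with y hy
        rw [image_eq_zero_of_notMem_tsupport hy, zero_smul]
      exact contDiffAt_const.congr_of_eventuallyEq h
  · filter_upwards [ψ.eventuallyEq_one] with x hx
    simp [hx]

end Extension

/-! ### Exterior derivative and pullback of 1-forms on vector spaces. -/

section ExteriorDerivative

variable {E E' : Type*} [NormedAddCommGroup E] [NormedSpace ℝ E] [NormedAddCommGroup E']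
  [NormedSpace ℝ E']

/-- The exterior derivative of a 1-form on a vector space, evaluated on two vectors. -/
noncomputable def extDer (α : E → E →L[ℝ] ℝ) (x v w : E) : ℝ :=
  fderiv ℝ α x v w - fderiv ℝ α x w v

/-- The pullback of a 1-form. -/
noncomputable def formPullback (K : E → E') (α : E' → E' →L[ℝ] ℝ) (q : E) : E →L[ℝ] ℝ :=
  (α (K q)).comp (fderiv ℝ K q)

theorem formPullback_apply (K : E → E') (α : E' → E' →L[ℝ] ℝ) (q v : E) :
    formPullback K α q v = α (K q) (fderiv ℝ K q v) := rfl

theorem hasFDerivAt_formPullback {K : E → E'} {α : E' → E' →L[ℝ] ℝ} {q : E}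
    (hK : ContDiffAt ℝ 2 K q) (hα : DifferentiableAt ℝ α (K q)) :
    HasFDerivAt (formPullback K α)
      ((ContinuousLinearMap.compL ℝ E E' ℝ (α (K q))).comp (fderiv ℝ (fderiv ℝ K) q) +
        ((ContinuousLinearMap.compL ℝ E E' ℝ).flip (fderiv ℝ K q)).comp
          ((fderiv ℝ α (K q)).comp (fderiv ℝ K q))) q := by
  have h1 : HasFDerivAt (fun q => α (K q)) ((fderiv ℝ α (K q)).comp (fderiv ℝ K q)) q :=
    hα.hasFDerivAt.comp q (hK.differentiableAt (by simp)).hasFDerivAt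
  have h2 : HasFDerivAt (fderiv ℝ K) (fderiv ℝ (fderiv ℝ K) q) q :=
    ((hK.fderiv_right (m := 1) (by norm_num)).differentiableAt (by simp)).hasFDerivAt
  exact h1.clm_comp h2

/-- The terms with the second derivative of `K` cancel by symmetry; what remains is the pullback of
the derivative of `α`. -/
theorem extDer_formPullback {K : E → E'} {α : E' → E' →L[ℝ] ℝ} {q : E}
    (hK : ContDiffAt ℝ 2 K q) (hα : DifferentiableAt ℝ α (K q)) (v w : E) :
    extDer (formPullback K α) q v w = extDer α (K q) (fderiv ℝ K q v) (fderiv ℝ K q w) := by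
  have hs : fderiv ℝ (fderiv ℝ K) q v w = fderiv ℝ (fderiv ℝ K) q w v :=
    (hK.isSymmSndFDerivAt (by simp)) v w
  simp only [extDer, (hasFDerivAt_formPullback hK hα).fderiv]
  simp [hs]

theorem extDer_congr {α β : E → E →L[ℝ] ℝ} {x : E} (h : α =ᶠ[𝓝 x] β) :
    extDer α x = extDer β x := by
  funext v w
  simp only [extDer, h.fderiv_eq]

end ExteriorDerivative

/-! ### Contact forms on three-space through the curl. -/

section ThreeSpace

/-- The standard basis vectors of coordinate three-space. -/
noncomputable def stdVec (i : Fin 3) : E3 := EuclideanSpace.single i 1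

@[simp]
theorem stdVec_apply (i j : Fin 3) : stdVec i j = if j = i then 1 else 0 := by
  simp [stdVec]

theorem eq_sum_stdVec (v : E3) : v = v 0 • stdVec 0 + v 1 • stdVec 1 + v 2 • stdVec 2 := by
  ext i
  fin_cases i <;> simp

theorem clm_eq_sum_stdVec (a : E3 →L[ℝ] ℝ) (v : E3) :
    a v = v 0 * a (stdVec 0) + v 1 * a (stdVec 1) + v 2 * a (stdVec 2) := by
  conv_lhs => rw [eq_sum_stdVec v]
  simp

/-- The vector field spanning the kernel of the exterior derivative of a 1-form. -/
noncomputable def curl (α : E3 → E3 →L[ℝ] ℝ) (x : E3) : E3 :=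
  !₂[extDer α x (stdVec 1) (stdVec 2), extDer α x (stdVec 2) (stdVec 0),
    extDer α x (stdVec 0) (stdVec 1)]

theorem extDer_eq_curl (α : E3 → E3 →L[ℝ] ℝ) (x v w : E3) :
    extDer α x v w = curl α x 0 * (v 1 * w 2 - v 2 * w 1) + curl α x 1 * (v 2 * w 0 - v 0 * w 2)
      + curl α x 2 * (v 0 * w 1 - v 1 * w 0) := by
  have h : ∀ v w : E3, fderiv ℝ α x v w = v 0 * (w 0 * fderiv ℝ α x (stdVec 0) (stdVec 0)
      + w 1 * fderiv ℝ α x (stdVec 0) (stdVec 1) + w 2 * fderiv ℝ α x (stdVec 0) (stdVec 2))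
      + v 1 * (w 0 * fderiv ℝ α x (stdVec 1) (stdVec 0)
      + w 1 * fderiv ℝ α x (stdVec 1) (stdVec 1) + w 2 * fderiv ℝ α x (stdVec 1) (stdVec 2))
      + v 2 * (w 0 * fderiv ℝ α x (stdVec 2) (stdVec 0)
      + w 1 * fderiv ℝ α x (stdVec 2) (stdVec 1) + w 2 * fderiv ℝ α x (stdVec 2) (stdVec 2)) := by
    intro v w
    conv_lhs => rw [eq_sum_stdVec v, clm_eq_sum_stdVec]
    simp only [map_add, map_smul, add_apply, smul_apply,
      smul_eq_mul]
    ring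
  have h0 : curl α x 0 = extDer α x (stdVec 1) (stdVec 2) := by simp [curl]
  have h1 : curl α x 1 = extDer α x (stdVec 2) (stdVec 0) := by simp [curl]
  have h2 : curl α x 2 = extDer α x (stdVec 0) (stdVec 1) := by simp [curl]
  rw [h0, h1, h2]
  simp only [extDer]
  rw [h v w, h w v]
  ring

/-- The wedge product of a 1-form with its exterior derivative. -/
noncomputable def wedgeExtDer (α : E3 → E3 →L[ℝ] ℝ) (x v₁ v₂ v₃ : E3) : ℝ :=
  α x v₁ * extDer α x v₂ v₃ + α x v₂ * extDer α x v₃ v₁ + α x v₃ * extDer α x v₁ v₂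

/-- In dimension three α ∧ dα is α(curl α) times the volume form, so the contact condition becomes
`α x (curl α x) ≠ 0`. -/
theorem wedgeExtDer_eq (α : E3 → E3 →L[ℝ] ℝ) (x v₁ v₂ v₃ : E3) :
    wedgeExtDer α x v₁ v₂ v₃ = α x (curl α x) * (v₁ 0 * (v₂ 1 * v₃ 2 - v₂ 2 * v₃ 1)
      + v₁ 1 * (v₂ 2 * v₃ 0 - v₂ 0 * v₃ 2) + v₁ 2 * (v₂ 0 * v₃ 1 - v₂ 1 * v₃ 0)) := by
  rw [wedgeExtDer, extDer_eq_curl, extDer_eq_curl, extDer_eq_curl, clm_eq_sum_stdVec (α x) v₁,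
    clm_eq_sum_stdVec (α x) v₂, clm_eq_sum_stdVec (α x) v₃, clm_eq_sum_stdVec (α x) (curl α x)]
  ring

/-- The kernel of dα is spanned by the curl, on which α does not vanish. The coefficients come from
the identity for a triple cross product. -/
theorem eq_zero_of_extDer_eq_zero {α : E3 → E3 →L[ℝ] ℝ} {x : E3} (hα : α x (curl α x) ≠ 0)
    {v : E3} (hv : α x v = 0) (hd : ∀ w, extDer α x v w = 0) : v = 0 := by
  have h0 := hd (stdVec 0)
  have h1 := hd (stdVec 1)
  have h2 := hd (stdVec 2)
  rw [extDer_eq_curl] at h0 h1 h2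
  simp at h0 h1 h2
  rw [clm_eq_sum_stdVec] at hv hα
  have key : ∀ i : Fin 3, v i = 0 := by
    intro i
    refine (mul_eq_zero.1 (?_ : (curl α x 0 * α x (stdVec 0) + curl α x 1 * α x (stdVec 1)
      + curl α x 2 * α x (stdVec 2)) * v i = 0)).resolve_left hα
    fin_cases i
    · simp only [Fin.zero_eta]
      linear_combination curl α x 0 * hv - α x (stdVec 1) * h2 + α x (stdVec 2) * h1
    · simp only [Fin.mk_one]
      linear_combination curl α x 1 * hv + α x (stdVec 0) * h2 - α x (stdVec 2) * h0
    · simp only [Fin.reduceFinMk]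
      linear_combination curl α x 2 * hv - α x (stdVec 0) * h1 + α x (stdVec 1) * h0
  ext i
  simpa using key i

theorem contDiff_curl {α : E3 → E3 →L[ℝ] ℝ} (hα : ContDiff ℝ ∞ α) : ContDiff ℝ ∞ (curl α) := by
  have h : ∀ v w : E3, ContDiff ℝ ∞ (fun x => extDer α x v w) := fun v w =>
    have h1 : ContDiff ℝ ∞ (fderiv ℝ α) := hα.fderiv_right (by simp)
    ((h1.clm_apply contDiff_const).clm_apply contDiff_const).sub
      ((h1.clm_apply contDiff_const).clm_apply contDiff_const)
  rw [contDiff_euclidean]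
  intro i
  fin_cases i
  · simpa [curl] using h _ _
  · simpa [curl] using h _ _
  · simpa [curl] using h _ _

/-- Near a point where a 1-form is contact there is a smooth vector field which is
its Reeb field. -/
theorem exists_contDiff_reeb {α : E3 → E3 →L[ℝ] ℝ} (hα : ContDiff ℝ ∞ α) {x₀ : E3}
    (h : α x₀ (curl α x₀) ≠ 0) : ∃ X : E3 → E3, ContDiff ℝ ∞ X ∧
      ∀ᶠ x in 𝓝 x₀, α x (X x) = 1 ∧ ∀ w, extDer α x (X x) w = 0 := by
  have hs : ContDiff ℝ ∞ (fun x => α x (curl α x)) := hα.clm_apply (contDiff_curl hα)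
  let U : Set E3 := {x | α x (curl α x) ≠ 0}
  have hU : IsOpen U := isOpen_ne_fun hs.continuous continuous_const
  obtain ⟨X, hX, hXe⟩ := exists_contDiff_eventuallyEq (f := fun x => (α x (curl α x))⁻¹ • curl α x)
    hU ((hs.contDiffOn.inv fun x hx => hx).smul (contDiff_curl hα).contDiffOn) (a := x₀) h
  refine ⟨X, hX, ?_⟩
  filter_upwards [hXe, hU.mem_nhds h] with x hx hxU
  rw [hx]
  refine ⟨by simpa using inv_mul_cancel₀ hxU, fun w => ?_⟩
  rw [extDer_eq_curl]
  simp only [PiLp.smul_apply, smul_eq_mul]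
  ring

end ThreeSpace

/-! ### Darboux coordinates adapted to a curve. -/

section Darboux

theorem two_le_infty : (2 : WithTop ℕ∞) ≤ ∞ := WithTop.coe_le_coe.2 le_top

theorem fderiv_flow_initial {E : Type*} [NormedAddCommGroup E] [NormedSpace ℝ E]
    {φ : E × ℝ → E} {U : Set (E × ℝ)} (hU : IsOpen U) (hφ : ContDiffOn ℝ ∞ φ U)
    (h0 : ∀ x, (x, 0) ∈ U → φ (x, 0) = x) {x : E} (hx : (x, 0) ∈ U) (u : E) :
    fderiv ℝ φ (x, 0) (u, 0) = u := by
  have hd : HasFDerivAt φ (fderiv ℝ φ (x, 0)) (x, 0) :=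
    ((hφ.contDiffAt (hU.mem_nhds hx)).differentiableAt (by simp)).hasFDerivAt
  have h1 : HasFDerivAt (fun y => φ (y, 0))
      ((fderiv ℝ φ (x, 0)).comp (ContinuousLinearMap.inl ℝ E ℝ)) x :=
    HasFDerivAt.comp (f := fun y : E => (y, (0 : ℝ))) x hd (hasFDerivAt_prodMk_left x 0)
  have hev : (fun y => φ (y, 0)) =ᶠ[𝓝 x] fun y => y := by
    filter_upwards [(Continuous.prodMk_left (0 : ℝ)).continuousAt.eventually (hU.mem_nhds hx)]
      with y hy using h0 y hy
  have h2 := (h1.congr_of_eventuallyEq hev.symm).unique (hasFDerivAt_id x)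
  simpa using DFunLike.congr_fun h2 u

theorem injective_continuousLinearEquiv {E : Type*} [NormedAddCommGroup E] [NormedSpace ℝ E]
    [FiniteDimensional ℝ E] (A : E →L[ℝ] E) (hA : ∀ v, A v = 0 → v = 0) :
    ∃ B : E ≃L[ℝ] E, (B : E →L[ℝ] E) = A := by
  have hinj : Function.Injective (A : E →ₗ[ℝ] E) :=
    (injective_iff_map_eq_zero (A : E →ₗ[ℝ] E)).2 hA
  refine ⟨(LinearEquiv.ofInjectiveEndo (A : E →ₗ[ℝ] E) hinj).toContinuousLinearEquiv, ?_⟩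
  ext v
  rfl

/-- Darboux coordinates of a contact form around the initial point of a curve starting in a
contact direction. If the curve is Legendrian then it is the first coordinate axis. -/
theorem exists_darboux {α : E3 → E3 →L[ℝ] ℝ} (hα : ContDiff ℝ ∞ α) {c : ℝ → E3}
    (hc : ContDiff ℝ ∞ c) (hcontact : α (c 0) (curl α (c 0)) ≠ 0)
    (hc0 : α (c 0) (deriv c 0) = 0) (hne : deriv c 0 ≠ 0) {V : Set E3} (hV : V ∈ 𝓝 (c 0)) :
    ∃ Ψ : OpenPartialHomeomorph E3 E3, c 0 ∈ Ψ.source ∧ Ψ.source ⊆ V ∧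
      ContDiffOn ℝ ∞ Ψ Ψ.source ∧ ContDiffOn ℝ ∞ Ψ.symm Ψ.target ∧ Ψ (c 0) = 0 ∧
      (∀ x ∈ Ψ.source, ∀ v, α x v = fderiv ℝ Ψ x v 2 + Ψ x 1 * fderiv ℝ Ψ x v 0) ∧
      ((∀ᶠ r in 𝓝 0, α (c r) (deriv c r) = 0) → ∀ᶠ r in 𝓝 0, Ψ (c r) = r • stdVec 0) := by
  obtain ⟨X, hX, hXev⟩ := exists_contDiff_reeb hα hcontact
  obtain ⟨w, hw⟩ : ∃ w, extDer α (c 0) (deriv c 0) w ≠ 0 := by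
    by_contra! h
    exact hne (eq_zero_of_extDer_eq_zero hcontact hc0 h)
  -- The projection of `w` to the kernel of α along the Reeb field; since X is in the kernel of dα,
  -- this does not change the value of dα on the pair formed with `deriv c 0`.
  let W : E3 → E3 := fun x => w - α x w • X x
  have hW : ContDiff ℝ ∞ W := contDiff_const.sub ((hα.clm_apply contDiff_const).smul hX)
  obtain ⟨φX, UX, hUX, h0X, hφX, hinitX, hflowX⟩ := exists_contDiffOn_flow hX (c 0)
  obtain ⟨φW, UW, hUW, h0W, hφW, hinitW, hflowW⟩ := exists_contDiffOn_flow hW (c 0)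
  obtain ⟨G, hG, hGo, h0G⟩ := eventually_nhds_iff.1 (hXev.and hV)
  let π : Fin 3 → E3 →L[ℝ] ℝ := fun i => EuclideanSpace.proj i
  -- The map `K` below runs along the curve to the parameter `q 0`, then along `W` for the time `q
  -- 1`, then along the Reeb field for the time `q 2`.
  let p : E3 → E3 × ℝ := fun q => (c (q 0), q 1)
  have hp : ContDiff ℝ ∞ p := (hc.comp (π 0).contDiff).prodMk (π 1).contDiff
  let P : E3 → E3 := fun q => φW (p q)
  let O₁ : Set E3 := p ⁻¹' UW
  have hO₁ : IsOpen O₁ := hUW.preimage hp.continuous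
  have hP : ContDiffOn ℝ ∞ P O₁ := hφW.comp hp.contDiffOn fun q hq => hq
  let p' : E3 → E3 × ℝ := fun q => (P q, q 2)
  have hp' : ContDiffOn ℝ ∞ p' O₁ := hP.prodMk (π 2).contDiff.contDiffOn
  let O₂ : Set E3 := O₁ ∩ p' ⁻¹' UX
  have hO₂ : IsOpen O₂ := hp'.continuousOn.isOpen_inter_preimage hO₁ hUX
  let K : E3 → E3 := fun q => φX (p' q)
  have hK : ContDiffOn ℝ ∞ K O₂ := hφX.comp (hp'.mono inter_subset_left) fun q hq => hq.2
  let O : Set E3 := O₂ ∩ K ⁻¹' G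
  have hO : IsOpen O := hK.continuousOn.isOpen_inter_preimage hO₂ hGo
  have hP0 : P 0 = c 0 := hinitW _ h0W
  have hp'0 : p' 0 = (c 0, 0) := Prod.ext hP0 rfl
  have hK0 : K 0 = c 0 := by
    simp only [K]
    rw [hp'0]
    exact hinitX _ h0X
  have h0O : (0 : E3) ∈ O := by
    refine ⟨⟨h0W, ?_⟩, ?_⟩
    · rw [mem_preimage, hp'0]; exact h0X
    · rw [mem_preimage, hK0]; exact h0G
  have hKd : ∀ q ∈ O, ContDiffAt ℝ ∞ K q := fun q hq => hK.contDiffAt (hO₂.mem_nhds hq.1)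
  have hDp : ∀ q v, fderiv ℝ p q v = (v 0 • deriv c (q 0), v 1) := by
    intro q v
    have h1 : HasFDerivAt (fun q : E3 => c (q 0)) ((π 0).smulRight (deriv c (q 0))) q := by
      have h0 : HasDerivAt c (deriv c (q 0)) (π 0 q) :=
        (hc.differentiable (by simp) (q 0)).hasDerivAt
      exact (h0.hasFDerivAt.comp q (π 0).hasFDerivAt).congr_fderiv (by ext; simp)
    have h2 := h1.prodMk (π 1).hasFDerivAt
    have h3 : HasFDerivAt p (((π 0).smulRight (deriv c (q 0))).prod (π 1)) q := h2
    rw [h3.fderiv]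
    rfl
  have hDP : ∀ q ∈ O₁, ∀ v, fderiv ℝ P q v = fderiv ℝ φW (p q) (v 0 • deriv c (q 0), v 1) := by
    intro q hq v
    have h1 : HasFDerivAt P _ q := HasFDerivAt.comp q
      ((hφW.contDiffAt (hUW.mem_nhds hq)).differentiableAt (by simp)).hasFDerivAt
      (hp.differentiable (by simp) q).hasFDerivAt
    rw [h1.fderiv, ContinuousLinearMap.comp_apply, hDp]
  have hDK : ∀ q ∈ O, ∀ v, fderiv ℝ K q v = fderiv ℝ φX (p' q) (fderiv ℝ P q v, v 2) := by
    intro q hq v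
    have h0 : HasFDerivAt p' ((fderiv ℝ P q).prod (π 2)) q :=
      ((hP.contDiffAt (hO₁.mem_nhds hq.1.1)).differentiableAt (by simp)).hasFDerivAt.prodMk
        (π 2).hasFDerivAt
    have h1 : HasFDerivAt K _ q := HasFDerivAt.comp q
      ((hφX.contDiffAt (hUX.mem_nhds hq.1.2)).differentiableAt (by simp)).hasFDerivAt h0
    rw [h1.fderiv]
    rfl
  have hK2 : ∀ q ∈ O, fderiv ℝ K q (stdVec 2) = X (K q) := by
    intro q hq
    rw [hDK q hq, hDP q hq.1.1]
    simpa [stdVec_apply, Prod.mk_zero_zero] using hflowX _ hq.1.2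
  have hK1 : ∀ q ∈ O, q 2 = 0 → fderiv ℝ K q (stdVec 1) = W (K q) := by
    intro q hq hq2
    have h1 : p' q = (P q, 0) := Prod.ext rfl hq2
    have hmem : (P q, (0 : ℝ)) ∈ UX := by rw [← h1]; exact hq.1.2
    have h2 : K q = P q := by
      simp only [K]
      rw [h1]
      exact hinitX _ hmem
    rw [hDK q hq, hDP q hq.1.1, h1, h2]
    have h3 := fderiv_flow_initial hUX hφX hinitX hmem (W (P q))
    simpa [stdVec_apply, hflowW _ hq.1.1, P] using h3
  have hK00 : fderiv ℝ K 0 (stdVec 0) = deriv c 0 := by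
    rw [hDK 0 h0O, hDP 0 h0O.1.1, hp'0]
    have h1 : p 0 = (c 0, 0) := rfl
    rw [h1]
    simp [stdVec_apply, fderiv_flow_initial hUW hφW hinitW h0W,
      fderiv_flow_initial hUX hφX hinitX h0X]
  obtain ⟨r, hr, hball⟩ := Metric.isOpen_iff.1 hO 0 h0O
  -- Since ∂₂ is mapped to the Reeb field, `β ∂₂ = 1` and dβ(∂₂, ·) = 0. So `β ∂₁` is constant along
  -- vertical lines, and it vanishes at `q 2 = 0`, where ∂₁ is mapped to `W`. Hence β = dq₂ + b dq₀
  -- with `b = β ∂₀`.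
  let β : E3 → E3 →L[ℝ] ℝ := formPullback K α
  have hβd : ∀ q ∈ O, ContDiffAt ℝ ∞ β q := fun q hq =>
    ((hα.contDiffAt).comp q (hKd q hq)).clm_comp ((hKd q hq).fderiv_right (by simp))
  have hβext : ∀ q ∈ O, ∀ v w, extDer β q v w
      = extDer α (K q) (fderiv ℝ K q v) (fderiv ℝ K q w) := fun q hq v w =>
    extDer_formPullback ((hKd q hq).of_le two_le_infty)
      (hα.differentiable (by simp) _) v w
  have hβ2 : ∀ q ∈ O, β q (stdVec 2) = 1 := by
    intro q hq
    rw [formPullback_apply, hK2 q hq]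
    exact (hG _ hq.2).1.1
  have hβ1' : ∀ q ∈ O, q 2 = 0 → β q (stdVec 1) = 0 := by
    intro q hq hq2
    rw [formPullback_apply, hK1 q hq hq2]
    simp [W, (hG _ hq.2).1.1]
  have hDβ : ∀ q ∈ O, ∀ u v, fderiv ℝ (fun q => β q u) q v = fderiv ℝ β q v u := by
    intro q hq u v
    rw [((hβd q hq).differentiableAt (by simp)).hasFDerivAt.clm_apply
      (hasFDerivAt_const u q) |>.fderiv]
    simp
  have hDβ2 : ∀ q ∈ O, ∀ v, fderiv ℝ β q v (stdVec 2) = 0 := by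
    intro q hq v
    have : (fun q => β q (stdVec 2)) =ᶠ[𝓝 q] fun _ => 1 := by
      filter_upwards [hO.mem_nhds hq] with q' hq' using hβ2 q' hq'
    rw [← hDβ q hq, this.fderiv_eq]
    simp
  have hDβ21 : ∀ q ∈ O, fderiv ℝ β q (stdVec 2) (stdVec 1) = 0 := by
    intro q hq
    have h1 := hβext q hq (stdVec 2) (stdVec 1)
    rw [hK2 q hq, (hG _ hq.2).1.2, extDer, hDβ2 q hq, sub_zero] at h1
    exact h1
  have hβ1 : ∀ q ∈ Metric.ball (0 : E3) r, β q (stdVec 1) = 0 := by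
    intro q hq
    -- The vertical segment from the projection of `q` to the plane `q 2 = 0` up to `q`; it stays in
    -- the ball because only the third coordinate shrinks.
    let ℓ : ℝ → E3 := fun t => q + (t - 1) • q 2 • stdVec 2
    have hℓO : ∀ t ∈ Icc (0 : ℝ) 1, ℓ t ∈ O := by
      intro t ht
      refine hball ?_
      rw [mem_ball_zero_iff] at hq ⊢
      refine lt_of_le_of_lt ?_ hq
      rw [EuclideanSpace.norm_eq, EuclideanSpace.norm_eq]
      refine Real.sqrt_le_sqrt (Finset.sum_le_sum fun i _ => ?_)
      have : |t * q 2| ≤ |q 2| := by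
        rw [abs_mul, abs_of_nonneg ht.1]
        exact mul_le_of_le_one_left (abs_nonneg _) ht.2
      rw [Real.norm_eq_abs, Real.norm_eq_abs, sq_abs, sq_abs]
      fin_cases i
      · simp [ℓ]
      · simp [ℓ]
      · have h2 : ℓ t 2 = t * q 2 := by simp [ℓ]; ring
        simpa [h2] using sq_le_sq.2 this
    have hℓd : ∀ t, HasDerivAt ℓ (q 2 • stdVec 2) t := by
      intro t
      simpa [ℓ] using ((hasDerivAt_id t).sub_const 1).smul_const (q 2 • stdVec 2)
    have hcomp : ∀ t ∈ Icc (0 : ℝ) 1, HasDerivAt (fun t => β (ℓ t) (stdVec 1)) 0 t := by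
      intro t ht
      have h1 : HasFDerivAt (fun q => β q (stdVec 1))
          (fderiv ℝ (fun q => β q (stdVec 1)) (ℓ t)) (ℓ t) :=
        (((hβd _ (hℓO t ht)).clm_apply contDiffAt_const).differentiableAt (by simp)).hasFDerivAt
      have h2 := HasFDerivAt.comp_hasDerivAt (f := ℓ) t h1 (hℓd t)
      rw [hDβ _ (hℓO t ht), map_smul, smul_apply, hDβ21 _ (hℓO t ht), smul_zero] at h2
      exact h2
    have h := constant_of_has_deriv_right_zero (a := 0) (b := 1)
      (f := fun t => β (ℓ t) (stdVec 1))
      (fun t ht => (hcomp t ht).continuousAt.continuousWithinAt)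
      (fun t ht => (hcomp t ⟨ht.1, ht.2.le⟩).hasDerivWithinAt) 1 (by simp)
    have hℓ1 : ℓ 1 = q := by simp [ℓ]
    simp only [hℓ1] at h
    rw [h]
    exact hβ1' _ (hℓO 0 (by simp)) (by simp [ℓ])
  have hβeq : ∀ q ∈ Metric.ball (0 : E3) r, ∀ v, β q v = v 2 + β q (stdVec 0) * v 0 := by
    intro q hq v
    rw [clm_eq_sum_stdVec (β q) v, hβ1 q hq, hβ2 q (hball hq)]
    ring
  have hB0 : (0 : E3) ∈ Metric.ball (0 : E3) r := Metric.mem_ball_self hr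
  -- With `b` as second coordinate β becomes dy + x dθ. The change of coordinates is invertible at
  -- the origin because ∂₁b = -dβ(∂₀, ∂₁) is nonzero there, by the choice of `w`.
  let N : E3 → E3 := fun q => !₂[q 0, β q (stdVec 0), q 2]
  have hN : ContDiffOn ℝ ∞ N (Metric.ball 0 r) := by
    rw [contDiffOn_euclidean]
    intro i
    fin_cases i
    · exact (π 0).contDiff.contDiffOn
    · exact fun q hq => ((hβd q (hball hq)).clm_apply contDiffAt_const).contDiffWithinAt
    · exact (π 2).contDiff.contDiffOn
  have hDN : ∀ q ∈ Metric.ball (0 : E3) r, ∀ v, fderiv ℝ N q v 0 = v 0 ∧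
      fderiv ℝ N q v 1 = fderiv ℝ β q v (stdVec 0) ∧ fderiv ℝ N q v 2 = v 2 := by
    intro q hq v
    have hd : HasFDerivAt N (fderiv ℝ N q) q :=
      ((hN.contDiffAt (Metric.isOpen_ball.mem_nhds hq)).differentiableAt (by simp)).hasFDerivAt
    have hi : ∀ i, fderiv ℝ (fun q => N q i) q v = fderiv ℝ N q v i := by
      intro i
      have := ((π i).hasFDerivAt.comp q hd).fderiv
      rw [show (fun q => N q i) = π i ∘ N from rfl, this]
      rfl
    rw [← hi, ← hi, ← hi]
    refine ⟨?_, ?_, ?_⟩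
    · exact DFunLike.congr_fun (π 0).hasFDerivAt.fderiv v
    · exact hDβ q (hball hq) _ _
    · exact DFunLike.congr_fun (π 2).hasFDerivAt.fderiv v
  have hcX : α (c 0) (X (c 0)) = 1 := (hG _ h0G).1.1
  have hWext : extDer α (c 0) (deriv c 0) (W (c 0)) = extDer α (c 0) (deriv c 0) w := by
    have : extDer α (c 0) (deriv c 0) (X (c 0)) = 0 := by
      have := (hG _ h0G).1.2 (deriv c 0)
      simp only [extDer] at this ⊢
      linarith
    simp only [extDer] at this ⊢
    simp only [W, map_sub, map_smul, sub_apply, smul_apply, smul_eq_mul]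
    linear_combination (-α (c 0) w) * this
  have hKv : ∀ v, fderiv ℝ K 0 v = v 0 • deriv c 0 + v 1 • W (c 0) + v 2 • X (c 0) := by
    intro v
    conv_lhs => rw [eq_sum_stdVec v]
    rw [map_add, map_add, map_smul, map_smul, map_smul, hK00, hK1 0 h0O rfl, hK2 0 h0O, hK0]
  obtain ⟨AK, hAK⟩ := injective_continuousLinearEquiv (fderiv ℝ K 0) (by
    intro v hv
    rw [hKv] at hv
    have hαW : α (c 0) (W (c 0)) = 0 := by simp [W, hcX]
    have h2 : v 2 = 0 := by
      have := congrArg (α (c 0)) hv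
      simpa [hc0, hαW, hcX] using this
    have h1 : v 1 = 0 := by
      rw [h2, zero_smul, add_zero] at hv
      have h3 : extDer α (c 0) (deriv c 0) (v 0 • deriv c 0 + v 1 • W (c 0))
          = v 1 * extDer α (c 0) (deriv c 0) (W (c 0)) := by
        simp only [extDer, map_add, map_smul, add_apply, smul_apply, smul_eq_mul]
        ring
      rw [hv, hWext] at h3
      simp only [extDer, map_zero, zero_apply, sub_self] at h3
      exact (mul_eq_zero.1 h3.symm).resolve_right hw
    have h0 : v 0 = 0 := by
      rw [h2, h1, zero_smul, zero_smul, add_zero, add_zero] at hv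
      exact (smul_eq_zero.1 hv).resolve_right hne
    rw [eq_sum_stdVec v, h0, h1, h2]
    simp)
  obtain ⟨AN, hAN⟩ := injective_continuousLinearEquiv (fderiv ℝ N 0) (by
    intro v hv
    obtain ⟨h0, h1, h2⟩ := hDN 0 hB0 v
    rw [hv] at h0 h1 h2
    simp only [PiLp.zero_apply] at h0 h1 h2
    have hv' : v = v 1 • stdVec 1 := by
      conv_lhs => rw [eq_sum_stdVec v, ← h0, ← h2]
      simp
    have h3 : fderiv ℝ β 0 (stdVec 0) (stdVec 1) = 0 := by
      have : (fun q => β q (stdVec 1)) =ᶠ[𝓝 0] fun _ => 0 := by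
        filter_upwards [Metric.isOpen_ball.mem_nhds hB0] with q' hq' using hβ1 q' hq'
      rw [← hDβ 0 h0O, this.fderiv_eq]
      simp
    have h4 := hβext 0 h0O (stdVec 0) (stdVec 1)
    rw [hK00, hK1 0 h0O rfl, hK0, hWext, extDer, h3, zero_sub] at h4
    rw [hv', map_smul, smul_apply, smul_eq_mul] at h1
    have h5 : fderiv ℝ β 0 (stdVec 1) (stdVec 0) ≠ 0 := fun h => hw (by rw [← h4, h, neg_zero])
    have h6 : v 1 = 0 := (mul_eq_zero.1 h1.symm).resolve_right h5
    rw [hv', h6, zero_smul])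
  have hKfd : HasFDerivAt K (AK : E3 →L[ℝ] E3) 0 := by
    rw [hAK]; exact ((hKd 0 h0O).differentiableAt (by simp)).hasFDerivAt
  have hNfd : HasFDerivAt N (AN : E3 →L[ℝ] E3) 0 := by
    rw [hAN]
    exact ((hN.contDiffAt (Metric.isOpen_ball.mem_nhds hB0)).differentiableAt
      (by simp)).hasFDerivAt
  obtain ⟨ΦK, h0K, hsK, hcK, hΦK, hΦK'⟩ := exists_openPartialHomeomorph_contDiffOn
    Metric.isOpen_ball (hK.mono fun q hq => (hball hq).1) hB0 AK hKfd
  obtain ⟨ΦN, h0N, hsN, hcN, hΦN, hΦN'⟩ := exists_openPartialHomeomorph_contDiffOn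
    Metric.isOpen_ball hN hB0 AN hNfd
  have hN0 : N 0 = 0 := by
    ext i
    fin_cases i
    · simp [N]
    · simp [N, β, formPullback_apply, hK0, hK00, hc0]
    · simp [N]
  have hKs0 : ΦK.symm (c 0) = 0 := by
    rw [← hK0, ← hcK]
    exact ΦK.left_inv h0K
  have hc0t : c 0 ∈ ΦK.target := by
    rw [← hK0, ← hcK]
    exact ΦK.map_source h0K
  refine ⟨ΦK.symm.trans ΦN, ⟨hc0t, ?_⟩, ?_, ?_, ?_, ?_, ?_, ?_⟩
  · change ΦK.symm (c 0) ∈ ΦN.source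
    rw [hKs0]
    exact h0N
  · rintro x ⟨hx, -⟩
    have h1 := (hball (hsK (ΦK.map_target hx))).2
    rw [mem_preimage, ← hcK, ΦK.right_inv hx] at h1
    exact (hG _ h1).2
  · exact hΦN.comp (hΦK'.mono fun x hx => hx.1) fun x hx => hx.2
  · exact hΦK.comp (hΦN'.mono fun x hx => hx.1) fun x hx => hx.2
  · change ΦN (ΦK.symm (c 0)) = 0
    rw [hKs0, hcN, hN0]
  · rintro x ⟨hx, hx'⟩ v
    set q := ΦK.symm x with hq
    have hqs : q ∈ ΦK.source := ΦK.map_target hx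
    have hqB := hsK hqs
    have hKq : K q = x := by rw [← hcK]; exact ΦK.right_inv hx
    have hS : HasFDerivAt ΦK.symm (fderiv ℝ ΦK.symm x) x :=
      ((hΦK'.contDiffAt (ΦK.open_target.mem_nhds hx)).differentiableAt (by simp)).hasFDerivAt
    have hKd' : HasFDerivAt K (fderiv ℝ K q) q :=
      ((hKd q (hball hqB)).differentiableAt (by simp)).hasFDerivAt
    have hNd : HasFDerivAt N (fderiv ℝ N q) q :=
      ((hN.contDiffAt (Metric.isOpen_ball.mem_nhds hqB)).differentiableAt (by simp)).hasFDerivAt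
    have hid : fderiv ℝ K q (fderiv ℝ ΦK.symm x v) = v := by
      have h1 : HasFDerivAt (K ∘ ΦK.symm) ((fderiv ℝ K q).comp (fderiv ℝ ΦK.symm x)) x :=
        HasFDerivAt.comp x hKd' hS
      have h2 : K ∘ ΦK.symm =ᶠ[𝓝 x] id := by
        filter_upwards [ΦK.open_target.mem_nhds hx] with y hy
        rw [Function.comp_apply, ← hcK]
        exact ΦK.right_inv hy
      exact DFunLike.congr_fun ((h1.congr_of_eventuallyEq h2.symm).unique (hasFDerivAt_id x)) v
    have hcomp : fderiv ℝ (ΦK.symm.trans ΦN) x v = fderiv ℝ N q (fderiv ℝ ΦK.symm x v) := by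
      have h1 : HasFDerivAt (N ∘ ΦK.symm) ((fderiv ℝ N q).comp (fderiv ℝ ΦK.symm x)) x :=
        HasFDerivAt.comp x hNd hS
      have h2 : ((ΦK.symm.trans ΦN : OpenPartialHomeomorph E3 E3) : E3 → E3) = N ∘ ΦK.symm := by
        rw [OpenPartialHomeomorph.coe_trans, hcN]
      rw [h2, h1.fderiv]
      rfl
    obtain ⟨h0, -, h2⟩ := hDN q hqB (fderiv ℝ ΦK.symm x v)
    rw [hcomp, h0, h2]
    have h3 : (ΦK.symm.trans ΦN) x 1 = β q (stdVec 0) := by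
      change ΦN (ΦK.symm x) 1 = _
      rw [hcN]
      rfl
    rw [h3, ← hβeq q hqB, formPullback_apply, hid, hKq]
  -- On the curve both flow times vanish and `b = α (c')`, which is zero in the Legendrian case.
  · intro hleg
    have hcont : Tendsto (fun r : ℝ => r • stdVec 0) (𝓝 0) (𝓝 0) := by
      have : Continuous (fun r : ℝ => r • stdVec 0) := by fun_prop
      simpa using this.tendsto 0
    have hcont' : ∀ᶠ r : ℝ in 𝓝 0, ∀ᶠ r' in 𝓝 r, r' • stdVec 0 ∈ O :=
      (hcont.eventually (hO.mem_nhds h0O)).eventually_nhds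
    filter_upwards [hleg, hcont', hcont.eventually (ΦK.open_source.mem_nhds h0K)]
      with t ht htO htK
    have hKt : ∀ t : ℝ, t • stdVec 0 ∈ O → K (t • stdVec 0) = c t := by
      intro t htO
      have h1 : p (t • stdVec 0) = (c t, 0) := by simp [p]
      have hm1 : (c t, (0 : ℝ)) ∈ UW := by rw [← h1]; exact htO.1.1
      have h2 : p' (t • stdVec 0) = (c t, 0) := by
        refine Prod.ext ?_ (by simp [p'])
        change φW (p (t • stdVec 0)) = c t
        rw [h1]
        exact hinitW _ hm1
      have hm2 : (c t, (0 : ℝ)) ∈ UX := by rw [← h2]; exact htO.1.2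
      simp only [K]
      rw [h2]
      exact hinitX _ hm2
    have htO' := htO.self_of_nhds
    have h1 : ΦK.symm (c t) = t • stdVec 0 := by
      rw [← hKt t htO', ← hcK]
      exact ΦK.left_inv htK
    have h2 : fderiv ℝ K (t • stdVec 0) (stdVec 0) = deriv c t := by
      have ha : HasDerivAt (fun t : ℝ => t • stdVec 0) (stdVec 0) t := by
        simpa using (hasDerivAt_id t).smul_const (stdVec 0)
      have hb := HasFDerivAt.comp_hasDerivAt (f := fun t : ℝ => t • stdVec 0) t
        ((hKd _ htO').differentiableAt (by simp)).hasFDerivAt ha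
      have hc' : K ∘ (fun t : ℝ => t • stdVec 0) =ᶠ[𝓝 t] c := by
        filter_upwards [htO] with s hs using hKt s hs
      rw [← hc'.deriv_eq, hb.deriv]
    change ΦN (ΦK.symm (c t)) = _
    rw [h1, hcN]
    ext i
    fin_cases i
    · simp [N]
    · simp [N, β, formPullback_apply, h2, hKt t htO', ht]
    · simp [N]

end Darboux

/-! ### Components of tangent vectors in charts; contact charts. -/

section ChartDerivatives

variable {M : Type*} [TopologicalSpace M] [ChartedSpace E3 M]

theorem coordD_add (Φ : M → E3) (q : M) (v w : TangentSpace (𝓡 3) q) :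
    coordD Φ q (v + w) = coordD Φ q v + coordD Φ q w := (modelDeriv Φ q).map_add v w

theorem coordD_sub (Φ : M → E3) (q : M) (v w : TangentSpace (𝓡 3) q) :
    coordD Φ q (v - w) = coordD Φ q v - coordD Φ q w := (modelDeriv Φ q).map_sub v w

theorem coordD_neg (Φ : M → E3) (q : M) (v : TangentSpace (𝓡 3) q) :
    coordD Φ q (-v) = -coordD Φ q v := (modelDeriv Φ q).map_neg v

theorem coordD_smul (Φ : M → E3) (q : M) (c : ℝ) (v : TangentSpace (𝓡 3) q) :
    coordD Φ q (c • v) = c • coordD Φ q v := (modelDeriv Φ q).map_smul c v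

theorem coordD_zero (Φ : M → E3) (q : M) : coordD Φ q 0 = 0 := (modelDeriv Φ q).map_zero

/-- The tangent vector with prescribed components in a chart. -/
noncomputable def coordInv (Φ : OpenPartialHomeomorph M E3) (q : M) :
    E3 →L[ℝ] TangentSpace (𝓡 3) q :=
  mfderiv 𝓘(ℝ, E3) (𝓡 3) Φ.symm (Φ q)

variable {Φ : OpenPartialHomeomorph M E3}

theorem mdifferentiable_of_mem_maximalAtlas (hΦ : Φ ∈ IsManifold.maximalAtlas (𝓡 3) ∞ M) :
    Φ.MDifferentiable (𝓡 3) 𝓘(ℝ, E3) :=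
  ⟨(contMDiffOn_of_mem_maximalAtlas hΦ).mdifferentiableOn (by simp),
    (contMDiffOn_symm_of_mem_maximalAtlas hΦ).mdifferentiableOn (by simp)⟩

theorem coordInv_coordD (hΦ : Φ ∈ IsManifold.maximalAtlas (𝓡 3) ∞ M) {q : M} (hq : q ∈ Φ.source)
    (v : TangentSpace (𝓡 3) q) : coordInv Φ q (coordD Φ q v) = v :=
  DFunLike.congr_fun ((mdifferentiable_of_mem_maximalAtlas hΦ).symm_comp_deriv hq) v

theorem coordD_injective (hΦ : Φ ∈ IsManifold.maximalAtlas (𝓡 3) ∞ M) {q : M}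
    (hq : q ∈ Φ.source) : Function.Injective (coordD Φ q) :=
  Function.LeftInverse.injective (g := coordInv Φ q) (coordInv_coordD hΦ hq)

theorem coordD_coordInv (hΦ : Φ ∈ IsManifold.maximalAtlas (𝓡 3) ∞ M) {q : M} (hq : q ∈ Φ.source)
    (w : E3) : coordD Φ q (coordInv Φ q w) = w := by
  have hs : Function.Surjective (coordD Φ q) :=
    (mdifferentiable_of_mem_maximalAtlas hΦ).mfderiv_surjective hq
  obtain ⟨v, rfl⟩ := hs w
  rw [coordInv_coordD hΦ hq]

theorem coordD_eq_zero (hΦ : Φ ∈ IsManifold.maximalAtlas (𝓡 3) ∞ M) {q : M} (hq : q ∈ Φ.source)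
    {v : TangentSpace (𝓡 3) q} : coordD Φ q v = 0 ↔ v = 0 := by
  constructor
  · intro h
    exact coordD_injective hΦ hq (h.trans (coordD_zero Φ q).symm)
  · rintro rfl
    exact coordD_zero Φ q

/-- A chart in which the 1-form is `dy + x dθ`. -/
structure IsContactChart (lam : OneForm M) (Φ : OpenPartialHomeomorph M E3) : Prop where
  mem_atlas : Φ ∈ IsManifold.maximalAtlas (𝓡 3) ∞ M
  form : ∀ q ∈ Φ.source, ∀ v : TangentSpace (𝓡 3) q,
    lam q v = coordD Φ q v 2 + Φ q 1 * coordD Φ q v 0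

/-- The 1-form `dy + x dθ` on coordinate space. -/
noncomputable def stdForm (x : E3) : E3 →L[ℝ] ℝ :=
  EuclideanSpace.proj (𝕜 := ℝ) (2 : Fin 3) + x 1 • EuclideanSpace.proj (𝕜 := ℝ) (0 : Fin 3)

theorem stdForm_apply (x v : E3) : stdForm x v = v 2 + x 1 * v 0 := rfl

theorem hasFDerivAt_stdForm (x : E3) : HasFDerivAt stdForm
    ((EuclideanSpace.proj (𝕜 := ℝ) (1 : Fin 3)).smulRight
      (EuclideanSpace.proj (𝕜 := ℝ) (0 : Fin 3))) x := by
  have h : HasFDerivAt (fun y : E3 => y 1) (EuclideanSpace.proj (𝕜 := ℝ) (1 : Fin 3)) x :=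
    (EuclideanSpace.proj (𝕜 := ℝ) (1 : Fin 3)).hasFDerivAt
  exact (h.smul_const (EuclideanSpace.proj (𝕜 := ℝ) (0 : Fin 3))).const_add _

theorem extDer_stdForm (x v w : E3) : extDer stdForm x v w = v 1 * w 0 - w 1 * v 0 := by
  simp only [extDer, (hasFDerivAt_stdForm x).fderiv]
  rfl

theorem OneForm.extD_eq_extDer (lam : OneForm M) (p : M) (v w : TangentSpace (𝓡 3) p) :
    lam.extD p v w = extDer (lam.inChart p) (chartAt E3 p p)
      (coordD (chartAt E3 p) p v) (coordD (chartAt E3 p) p w) := rfl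

namespace IsContactChart

variable [IsManifold (𝓡 3) ∞ M] {lam : OneForm M}

/-- Naturality of the exterior derivative under the transition from the preferred chart at `q` to
`Φ`, together with d(dy + x dθ) = dx ∧ dθ. -/
theorem extD_eq (h : IsContactChart lam Φ) {q : M} (hq : q ∈ Φ.source)
    (v w : TangentSpace (𝓡 3) q) :
    lam.extD q v w = coordD Φ q v 1 * coordD Φ q w 0 - coordD Φ q w 1 * coordD Φ q v 0 := by
  set φ := chartAt E3 q with hφ
  have hφa : φ ∈ IsManifold.maximalAtlas (𝓡 3) ∞ M := IsManifold.chart_mem_maximalAtlas q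
  have hqφ : q ∈ φ.source := mem_chart_source E3 q
  let τ : E3 → E3 := Φ ∘ φ.symm
  have hmem : φ q ∈ (φ.symm.trans Φ).source := by
    refine ⟨φ.map_source hqφ, ?_⟩
    change φ.symm (φ q) ∈ Φ.source
    rwa [φ.left_inv hqφ]
  have hτ : ContDiffOn ℝ ∞ τ (φ.symm.trans Φ).source :=
    ((contMDiffOn_of_mem_maximalAtlas h.mem_atlas).comp
      ((contMDiffOn_symm_of_mem_maximalAtlas hφa).mono fun x hx => hx.1)
        fun x hx => hx.2).contDiffOn
  have hopen := (φ.symm.trans Φ).open_source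
  have hDτ : ∀ x ∈ (φ.symm.trans Φ).source, ∀ u, fderiv ℝ τ x u
      = coordD Φ (φ.symm x) (mfderiv 𝓘(ℝ, E3) (𝓡 3) φ.symm x u) := by
    intro x hx u
    have hx1 : x ∈ φ.target := hx.1
    have hx2 : φ.symm x ∈ Φ.source := hx.2
    have := mfderiv_comp (I := 𝓘(ℝ, E3)) (I' := 𝓡 3) (I'' := 𝓘(ℝ, E3)) x
      ((mdifferentiable_of_mem_maximalAtlas h.mem_atlas).mdifferentiableAt hx2)
      ((mdifferentiable_of_mem_maximalAtlas hφa).mdifferentiableAt_symm hx1)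
    exact (DFunLike.congr_fun (mfderiv_eq_fderiv (f := τ) (x := x)) u).symm.trans
      (DFunLike.congr_fun this u)
  have hev : lam.inChart q =ᶠ[𝓝 (φ q)] formPullback τ stdForm := by
    filter_upwards [hopen.mem_nhds hmem] with x hx
    ext u
    rw [formPullback_apply, stdForm_apply, hDτ x hx]
    exact h.form _ hx.2 _
  have hτq : ∀ u : TangentSpace (𝓡 3) q, fderiv ℝ τ (φ q) (coordD φ q u) = coordD Φ q u := by
    intro u
    rw [hDτ _ hmem]
    have h1 := coordInv_coordD hφa hqφ u
    have h2 : mfderiv 𝓘(ℝ, E3) (𝓡 3) φ.symm (φ q) (coordD φ q u) = u := h1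
    rw [h2]
    -- The base point `φ.symm (φ q)` equals `q` only propositionally; generalizing it allows the
    -- substitution.
    have h3 : ∀ q', q' = q → coordD Φ q' u = coordD Φ q u := by rintro _ rfl; rfl
    exact h3 _ (φ.left_inv hqφ)
  rw [OneForm.extD_eq_extDer, extDer_congr hev,
    extDer_formPullback ((hτ.contDiffAt (hopen.mem_nhds hmem)).of_le two_le_infty)
      (hasFDerivAt_stdForm _).differentiableAt, extDer_stdForm, hτq, hτq]

/-- ∂_y satisfies the defining conditions, so the choice in `reeb` is a valid one, and these
conditions leave no other vector: testing dλ on ∂_θ and ∂_x removes the other components. -/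
theorem coordD_reeb (h : IsContactChart lam Φ) {q : M} (hq : q ∈ Φ.source) :
    coordD Φ q (reeb lam q) = stdVec 2 := by
  have hex : ∃ X : TangentSpace (𝓡 3) q, lam q X = 1 ∧ ∀ w, lam.extD q X w = 0 := by
    refine ⟨coordInv Φ q (stdVec 2), ?_, fun w => ?_⟩
    · rw [h.form q hq, coordD_coordInv h.mem_atlas hq]
      simp
    · rw [h.extD_eq hq, coordD_coordInv h.mem_atlas hq]
      simp
  obtain ⟨h1, h2⟩ := Classical.epsilon_spec hex
  change lam q (reeb lam q) = 1 at h1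
  change ∀ w, lam.extD q (reeb lam q) w = 0 at h2
  have h3 : coordD Φ q (reeb lam q) 1 = 0 := by
    have := h2 (coordInv Φ q (stdVec 0))
    rw [h.extD_eq hq, coordD_coordInv h.mem_atlas hq] at this
    simpa using this
  have h4 : coordD Φ q (reeb lam q) 0 = 0 := by
    have := h2 (coordInv Φ q (stdVec 1))
    rw [h.extD_eq hq, coordD_coordInv h.mem_atlas hq] at this
    simpa using this
  rw [h.form q hq, h4, mul_zero, add_zero] at h1
  ext i
  fin_cases i
  · simpa using h4
  · simpa using h3
  · simpa using h1

theorem mono (h : IsContactChart lam Φ) {s : Set M} (hs : IsOpen s) :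
    IsContactChart lam (Φ.restrOpen s hs) where
  mem_atlas := by
    rw [IsManifold.mem_maximalAtlas_iff_contMDiffOn]
    refine ⟨(contMDiffOn_of_mem_maximalAtlas h.mem_atlas).mono inter_subset_left, ?_⟩
    exact (contMDiffOn_symm_of_mem_maximalAtlas h.mem_atlas).mono fun x hx => hx.1
  form q hq v := h.form q hq.1 v

end IsContactChart

end ChartDerivatives

/-! ### Existence of contact charts on the manifold. -/

section ExistenceOfContactCharts

variable {M : Type*} [TopologicalSpace M] [ChartedSpace E3 M] [IsManifold (𝓡 3) ∞ M]

/-- Tangent vectors depend smoothly on base point and components in a chart. -/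
theorem contMDiffOn_tangent_symm {Φ : OpenPartialHomeomorph M E3}
    (hΦ : Φ ∈ IsManifold.maximalAtlas (𝓡 3) ∞ M) :
    ContMDiffOn 𝓘(ℝ, E3 × E3) (𝓡 3).tangent ∞
      (fun y : E3 × E3 => (⟨Φ.symm y.1, mfderiv 𝓘(ℝ, E3) (𝓡 3) Φ.symm y.1 y.2⟩ :
        TangentBundle (𝓡 3) M)) (Φ.target ×ˢ univ) := by
  have h1 := (contMDiffOn_symm_of_mem_maximalAtlas hΦ).contMDiffOn_tangentMapWithin
    (m := ∞) (by simp) Φ.open_target.uniqueMDiffOn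
  have h2 : ContMDiff 𝓘(ℝ, E3 × E3) 𝓘(ℝ, E3).tangent ∞
      (fun y : E3 × E3 => (⟨y.1, y.2⟩ : TangentBundle 𝓘(ℝ, E3) E3)) := by
    intro y
    refine Bundle.contMDiffAt_totalSpace.2
      ⟨contMDiffAt_iff_contDiffAt.2 contDiff_fst.contDiffAt, ?_⟩
    have : (fun x : E3 × E3 => (trivializationAt E3 (TangentSpace 𝓘(ℝ, E3)) y.1
        (⟨x.1, x.2⟩ : TangentBundle 𝓘(ℝ, E3) E3)).2) = fun x => x.2 := by
      funext x
      simp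
    exact (contMDiffAt_iff_contDiffAt.2 contDiff_snd.contDiffAt).congr_of_eventuallyEq
      (Eventually.of_forall fun x => congrFun this x)
  refine (h1.comp h2.contMDiffOn (s := Φ.target ×ˢ univ) fun y hy => hy.1).congr fun y hy => ?_
  have h3 : mfderivWithin 𝓘(ℝ, E3) (𝓡 3) Φ.symm Φ.target y.1
      = mfderiv 𝓘(ℝ, E3) (𝓡 3) Φ.symm y.1 := mfderivWithin_of_isOpen Φ.open_target hy.1
  simp only [Function.comp, tangentMapWithin, h3]

variable {lam : OneForm M}

/-- A vector that is constant in a chart is a smooth local section of the tangent bundle, on which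
`lam` is smooth. -/
theorem IsContactForm.contDiffOn_inChart (hlam : IsContactForm lam) (p : M) :
    ContDiffOn ℝ ∞ (lam.inChart p) (chartAt E3 p).target := by
  rw [contDiffOn_clm_apply]
  intro u
  have h1 := contMDiffOn_tangent_symm (IsManifold.chart_mem_maximalAtlas (I := 𝓡 3) (n := ∞) p)
  have h2 : ContMDiffOn 𝓘(ℝ, E3) 𝓘(ℝ, E3 × E3) ∞ (fun x : E3 => (x, u)) (chartAt E3 p).target :=
    contMDiffOn_iff_contDiffOn.2 (contDiff_id.prodMk contDiff_const).contDiffOn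
  exact (hlam.smooth.comp_contMDiffOn (h1.comp h2 fun x hx => ⟨hx, mem_univ _⟩)).contDiffOn

theorem OneForm.apply_eq_inChart (lam : OneForm M) (p : M) (v : TangentSpace (𝓡 3) p) :
    lam p v = lam.inChart p (chartAt E3 p p) (coordD (chartAt E3 p) p v) := by
  have h1 := coordInv_coordD (IsManifold.chart_mem_maximalAtlas (I := 𝓡 3) (n := ∞) p)
    (mem_chart_source E3 p) v
  have h2 : ∀ p', p' = p → lam p' (coordInv (chartAt E3 p) p (coordD (chartAt E3 p) p v))
      = lam p v := by
    rintro _ rfl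
    rw [h1]
  exact (h2 _ ((chartAt E3 p).left_inv (mem_chart_source E3 p))).symm

theorem IsContactForm.curl_inChart (hlam : IsContactForm lam) (p : M) :
    lam.inChart p (chartAt E3 p p) (curl (lam.inChart p) (chartAt E3 p p)) ≠ 0 := by
  obtain ⟨v₁, v₂, v₃, h⟩ := hlam.wedge_ne_zero p
  rw [lam.extD_eq_extDer, lam.extD_eq_extDer, lam.extD_eq_extDer, lam.apply_eq_inChart,
    lam.apply_eq_inChart, lam.apply_eq_inChart] at h
  intro h0
  refine h ?_
  have := wedgeExtDer_eq (lam.inChart p) (chartAt E3 p p) (coordD (chartAt E3 p) p v₁)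
    (coordD (chartAt E3 p) p v₂) (coordD (chartAt E3 p) p v₃)
  rw [h0, zero_mul] at this
  exact this

/-- A contact form has Darboux charts adapted to any curve which starts in a contact
direction. -/
theorem IsContactForm.exists_chart_of_curve (hlam : IsContactForm lam) {p : M} {c : ℝ → E3}
    (hc : ContDiff ℝ ∞ c) (hcp : c 0 = chartAt E3 p p)
    (hc0 : lam.inChart p (c 0) (deriv c 0) = 0) (hne : deriv c 0 ≠ 0) :
    ∃ Φ : OpenPartialHomeomorph M E3, IsContactChart lam Φ ∧ p ∈ Φ.source ∧ Φ p = 0 ∧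
      ((∀ᶠ r in 𝓝 0, lam.inChart p (c r) (deriv c r) = 0) →
        ∀ᶠ r in 𝓝 0, Φ ((chartAt E3 p).symm (c r)) = r • stdVec 0) := by
  set φ := chartAt E3 p with hφ
  have hφa : φ ∈ IsManifold.maximalAtlas (𝓡 3) ∞ M := IsManifold.chart_mem_maximalAtlas p
  have hpφ : p ∈ φ.source := mem_chart_source E3 p
  have hpt : c 0 ∈ φ.target := by rw [hcp]; exact φ.map_source hpφ
  obtain ⟨α, hα, hαe⟩ := exists_contDiff_eventuallyEq φ.open_target
    (hlam.contDiffOn_inChart p) hpt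
  have hcurl : α (c 0) (curl α (c 0)) ≠ 0 := by
    have h1 : curl α (c 0) = curl (lam.inChart p) (c 0) := by
      simp only [curl, extDer_congr hαe]
    rw [h1, hαe.self_of_nhds, hcp]
    exact hlam.curl_inChart p
  have hV : {x | α x = lam.inChart p x} ∩ φ.target ∈ 𝓝 (c 0) :=
    inter_mem hαe (φ.open_target.mem_nhds hpt)
  obtain ⟨Ψ, h0, hsub, hΨ, hΨs, hΨ0, hform, hcurve⟩ := exists_darboux hα hc hcurl
    (by rw [hαe.self_of_nhds]; exact hc0) hne hV
  have hmem : φ.trans Ψ ∈ IsManifold.maximalAtlas (𝓡 3) ∞ M := by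
    rw [IsManifold.mem_maximalAtlas_iff_contMDiffOn]
    constructor
    · exact (contMDiffOn_iff_contDiffOn.2 hΨ).comp
        ((contMDiffOn_of_mem_maximalAtlas hφa).mono fun x hx => hx.1) fun x hx => hx.2
    · exact (contMDiffOn_symm_of_mem_maximalAtlas hφa).comp
        ((contMDiffOn_iff_contDiffOn.2 hΨs).mono fun x hx => hx.1) fun x hx => hx.2
  refine ⟨φ.trans Ψ, ⟨hmem, ?_⟩, ⟨hpφ, ?_⟩, ?_, ?_⟩
  · rintro q ⟨hq, hq'⟩ v
    have hq' : φ q ∈ Ψ.source := hq'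
    have hD : coordD (φ.trans Ψ) q v = fderiv ℝ Ψ (φ q) (coordD φ q v) := by
      have hΨd : DifferentiableAt ℝ Ψ (φ q) :=
        (hΨ.contDiffAt (Ψ.open_source.mem_nhds hq')).differentiableAt (by simp)
      have h1 := mfderiv_comp (I := 𝓡 3) (I' := 𝓘(ℝ, E3)) (I'' := 𝓘(ℝ, E3)) q
        hΨd.mdifferentiableAt
        ((mdifferentiable_of_mem_maximalAtlas hφa).mdifferentiableAt hq)
      exact (DFunLike.congr_fun h1 v).trans
        (DFunLike.congr_fun (mfderiv_eq_fderiv (f := Ψ) (x := φ q)) (coordD φ q v))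
    rw [hD]
    refine Eq.trans ?_ (hform (φ q) hq' (coordD φ q v))
    rw [(hsub hq').1]
    have h1 := coordInv_coordD hφa hq v
    have h2 : ∀ q', q' = q → lam q' (coordInv φ q (coordD φ q v)) = lam q v := by
      rintro _ rfl
      rw [h1]
    exact (h2 _ (φ.left_inv hq)).symm
  · change φ p ∈ Ψ.source
    rwa [← hcp]
  · change Ψ (φ p) = 0
    rw [← hcp, hΨ0]
  · intro h
    have hct : ∀ᶠ r in 𝓝 0, c r ∈ {x | α x = lam.inChart p x} ∩ φ.target :=
      hc.continuous.continuousAt.eventually hV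
    filter_upwards [hcurve (by
      filter_upwards [h, hct] with r hr hr'
      rw [hr'.1]
      exact hr), hct] with r hr hr'
    change Ψ (φ (φ.symm (c r))) = _
    rw [φ.right_inv hr'.2, hr]

/-- Any straight line in a contact direction serves as the curve; it need not be Legendrian, since
nothing is claimed about its image. -/
theorem IsContactForm.exists_chart (hlam : IsContactForm lam) (p : M) :
    ∃ Φ : OpenPartialHomeomorph M E3, IsContactChart lam Φ ∧ p ∈ Φ.source := by
  obtain ⟨e, hne, he⟩ : ∃ e : E3, e ≠ 0 ∧ lam.inChart p (chartAt E3 p p) e = 0 := by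
    set a := lam.inChart p (chartAt E3 p p)
    by_cases h : a (stdVec 0) = 0
    · exact ⟨stdVec 0, fun h0 => by simpa using congrArg (fun v : E3 => v 0) h0, h⟩
    -- Any covector on three-space kills this combination of two basis vectors.
    · refine ⟨a (stdVec 1) • stdVec 0 - a (stdVec 0) • stdVec 1, fun h0 => h ?_, ?_⟩
      · simpa using congrArg (fun v : E3 => v 1) h0
      · simp only [map_sub, map_smul, smul_eq_mul]
        ring
  let c : ℝ → E3 := fun r => chartAt E3 p p + r • e
  have hc' : ∀ r, HasDerivAt c e r := fun r => by
    simpa [c] using (hasDerivAt_id r).smul_const e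
  obtain ⟨Φ, h1, h2, -⟩ := hlam.exists_chart_of_curve (p := p) (c := c)
    (contDiff_const.add (contDiff_id.smul contDiff_const)) (by simp [c])
    (by rw [(hc' 0).deriv]; simpa [c] using he) (by rwa [(hc' 0).deriv])
  exact ⟨Φ, h1, h2⟩

/-- The knot itself is used as the adapted curve, shifted so that `r₀` becomes the parameter zero
and extended from its germ to a global smooth curve in coordinates. -/
theorem IsLegendrianKnot.exists_chart (hlam : IsContactForm lam) {k : ℝ → M}
    (hk : IsLegendrianKnot lam k) (r₀ : ℝ) :
    ∃ Φ : OpenPartialHomeomorph M E3, IsContactChart lam Φ ∧ k r₀ ∈ Φ.source ∧ Φ (k r₀) = 0 ∧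
      ∀ᶠ r in 𝓝 r₀, Φ (k r) = (r - r₀) • stdVec 0 := by
  set φ := chartAt E3 (k r₀) with hφ
  have hφa : φ ∈ IsManifold.maximalAtlas (𝓡 3) ∞ M := IsManifold.chart_mem_maximalAtlas _
  have hpφ : k r₀ ∈ φ.source := mem_chart_source E3 _
  let d : ℝ → E3 := fun r => φ (k (r + r₀))
  let U : Set ℝ := (fun r => k (r + r₀)) ⁻¹' φ.source
  have hks : ContMDiff 𝓘(ℝ, ℝ) (𝓡 3) ∞ (fun r => k (r + r₀)) :=
    hk.smooth.comp (contMDiff_iff_contDiff.2 (contDiff_id.add contDiff_const))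
  have hU : IsOpen U := φ.open_source.preimage hks.continuous
  have h0U : (0 : ℝ) ∈ U := by simpa [U] using hpφ
  have hd : ContDiffOn ℝ ∞ d U :=
    ((contMDiffOn_of_mem_maximalAtlas hφa).comp hks.contMDiffOn fun r hr => hr).contDiffOn
  obtain ⟨c, hc, hcd⟩ := exists_contDiff_eventuallyEq hU hd h0U
  have hsym : ∀ r ∈ U, φ.symm (d r) = k (r + r₀) := fun r hr => φ.left_inv hr
  have hdd : ∀ r ∈ U, deriv d r = coordD φ (k (r + r₀)) (velocity k (r + r₀)) := by
    intro r hr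
    have h1 := mfderiv_comp (I := 𝓘(ℝ, ℝ)) (I' := 𝓡 3) (I'' := 𝓘(ℝ, E3)) (r + r₀)
      ((mdifferentiable_of_mem_maximalAtlas hφa).mdifferentiableAt hr)
      (hk.smooth.mdifferentiable (by simp) (r + r₀))
    have h2 : deriv (φ ∘ k) (r + r₀) = coordD φ (k (r + r₀)) (velocity k (r + r₀)) := by
      rw [← fderiv_apply_one_eq_deriv]
      exact (DFunLike.congr_fun (mfderiv_eq_fderiv (f := φ ∘ k) (x := r + r₀)) (1 : ℝ)).symm.trans
        (DFunLike.congr_fun h1 (1 : ℝ))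
    rw [← h2]
    exact deriv_comp_add_const (f := φ ∘ k) r₀ r
  have hleg : ∀ r ∈ U, lam.inChart (k r₀) (d r) (deriv d r) = 0 := by
    intro r hr
    rw [hdd r hr]
    have h1 := coordInv_coordD hφa hr (velocity k (r + r₀))
    have h2 : ∀ q', q' = k (r + r₀) → lam q' (coordInv φ (k (r + r₀))
        (coordD φ (k (r + r₀)) (velocity k (r + r₀)))) = 0 := by
      rintro _ rfl
      rw [h1]
      exact hk.legendrian _
    exact h2 _ (hsym r hr)
  have hcd' : ∀ᶠ r in 𝓝 0, deriv c r = deriv d r := by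
    filter_upwards [hcd.eventuallyEq_nhds] with r hr using hr.deriv_eq
  obtain ⟨Φ, h1, h2, h3, h4⟩ := hlam.exists_chart_of_curve (p := k r₀) hc
    (by rw [hcd.self_of_nhds]; simp [d, hφ])
    (by rw [hcd'.self_of_nhds, hcd.self_of_nhds]; exact hleg 0 h0U) (by
      rw [hcd'.self_of_nhds, hdd 0 h0U]
      intro h
      exact hk.immersed _ ((coordD_eq_zero hφa h0U).1 h))
  refine ⟨Φ, h1, h2, h3, ?_⟩
  have h5 : ∀ᶠ r in 𝓝 0, Φ (k (r + r₀)) = r • stdVec 0 := by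
    filter_upwards [h4 (by
      filter_upwards [hcd, hcd', hU.mem_nhds h0U] with r hr hr' hrU
      rw [hr, hr']
      exact hleg r hrU), hcd, hU.mem_nhds h0U] with r hr hr' hrU
    rw [← hr, hr', hsym r hrU]
  have h6 : Tendsto (fun r => r - r₀) (𝓝 r₀) (𝓝 0) := by
    have : Continuous (fun r : ℝ => r - r₀) := by fun_prop
    simpa using this.tendsto r₀
  filter_upwards [h6.eventually h5] with r hr
  simpa using hr

end ExistenceOfContactCharts

/-! ### The function tanh on the strip: formulas, bounds and derivatives. -/

section ModelStrip

/-- The denominator `cos (πt/2) + cosh (πs/2)` of the model strips. -/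
noncomputable def stripDen (z : ℝ × ℝ) : ℝ :=
  Real.cos (Real.pi * z.2 / 2) + Real.cosh (Real.pi * z.1 / 2)

/-- The real part of `tanh (π (s + it) / 4)`. -/
noncomputable def stripRe (z : ℝ × ℝ) : ℝ := Real.sinh (Real.pi * z.1 / 2) / stripDen z

/-- The negative of the imaginary part of `tanh (π (s + it) / 4)`. -/
noncomputable def stripIm (z : ℝ × ℝ) : ℝ := -(Real.sin (Real.pi * z.2 / 2)) / stripDen z

/-- The derivative of `stripRe` along the strip. -/
noncomputable def stripP (z : ℝ × ℝ) : ℝ := Real.pi / 4 * (1 - stripRe z ^ 2 + stripIm z ^ 2)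

/-- The derivative of `stripIm` along the strip. -/
noncomputable def stripQ (z : ℝ × ℝ) : ℝ := -(Real.pi / 2) * (stripRe z * stripIm z)

/-- The open set on which the model strips are smooth. -/
def stripDom : Set (ℝ × ℝ) := {z | 0 < stripDen z}

theorem contDiff_stripDen : ContDiff ℝ ∞ stripDen := by
  unfold stripDen
  fun_prop

theorem isOpen_stripDom : IsOpen stripDom :=
  isOpen_lt continuous_const contDiff_stripDen.continuous

theorem strip_cos_nonneg {z : ℝ × ℝ} (hz : z ∈ strip) : 0 ≤ Real.cos (Real.pi * z.2 / 2) := by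
  have h1 := hz.2.1
  have h2 := hz.2.2
  refine Real.cos_nonneg_of_mem_Icc ⟨?_, ?_⟩ <;> nlinarith [Real.pi_pos]

theorem cosh_le_stripDen {z : ℝ × ℝ} (hz : z ∈ strip) :
    Real.cosh (Real.pi * z.1 / 2) ≤ stripDen z := by
  have := strip_cos_nonneg hz
  unfold stripDen
  linarith

theorem one_le_stripDen {z : ℝ × ℝ} (hz : z ∈ strip) : 1 ≤ stripDen z :=
  (Real.one_le_cosh _).trans (cosh_le_stripDen hz)

theorem strip_subset_stripDom : strip ⊆ stripDom := fun _ hz =>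
  zero_lt_one.trans_le (one_le_stripDen hz)

theorem isClosed_strip : IsClosed strip := isClosed_univ.prod isClosed_Icc

theorem uniqueDiffOn_strip : UniqueDiffOn ℝ strip :=
  uniqueDiffOn_univ.prod (uniqueDiffOn_Icc zero_lt_one)

/-- The squared modulus of tanh. At `t = 1` the cosine vanishes, so this side is mapped into the
unit circle. -/
theorem stripRe_sq_add_stripIm_sq {z : ℝ × ℝ} (hz : z ∈ stripDom) :
    stripRe z ^ 2 + stripIm z ^ 2 = 1 - 2 * Real.cos (Real.pi * z.2 / 2) / stripDen z := by
  have hD : stripDen z ≠ 0 := ne_of_gt hz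
  have h1 := Real.cosh_sq (Real.pi * z.1 / 2)
  have h2 := Real.sin_sq_add_cos_sq (Real.pi * z.2 / 2)
  unfold stripRe stripIm
  field_simp
  unfold stripDen
  linear_combination h2 - h1

/-- The real part of (π/4)(1 - tanh²) in closed form, from which both the positivity and the decay
at the ends are visible. -/
theorem stripP_eq {z : ℝ × ℝ} (hz : z ∈ stripDom) : stripP z = Real.pi / 2 *
    (1 + Real.cos (Real.pi * z.2 / 2) * Real.cosh (Real.pi * z.1 / 2)) / stripDen z ^ 2 := by
  have hD : stripDen z ≠ 0 := ne_of_gt hz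
  have h1 := Real.cosh_sq (Real.pi * z.1 / 2)
  have h2 := Real.sin_sq_add_cos_sq (Real.pi * z.2 / 2)
  unfold stripP stripRe stripIm
  field_simp
  unfold stripDen
  linear_combination 2 * (h1 + h2)

theorem abs_stripRe_le {z : ℝ × ℝ} (hz : z ∈ strip) : |stripRe z| ≤ 1 := by
  have h := stripRe_sq_add_stripIm_sq (strip_subset_stripDom hz)
  have h2 : 0 ≤ 2 * Real.cos (Real.pi * z.2 / 2) / stripDen z :=
    div_nonneg (by linarith [strip_cos_nonneg hz]) (by linarith [one_le_stripDen hz])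
  rw [← sq_le_one_iff_abs_le_one]
  nlinarith [sq_nonneg (stripIm z)]

theorem abs_stripIm_le {z : ℝ × ℝ} (hz : z ∈ strip) : |stripIm z| ≤ (stripDen z)⁻¹ := by
  have hD := one_le_stripDen hz
  rw [stripIm, abs_div, abs_neg, abs_of_pos (zero_lt_one.trans_le hD), div_eq_mul_inv]
  exact mul_le_of_le_one_left (by positivity) (Real.abs_sin_le_one _)

theorem inv_stripDen_le_one {z : ℝ × ℝ} (hz : z ∈ strip) : (stripDen z)⁻¹ ≤ 1 :=
  inv_le_one_of_one_le₀ (one_le_stripDen hz)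

theorem abs_stripIm_le_one {z : ℝ × ℝ} (hz : z ∈ strip) : |stripIm z| ≤ 1 :=
  (abs_stripIm_le hz).trans (inv_stripDen_le_one hz)

theorem stripP_pos {z : ℝ × ℝ} (hz : z ∈ strip) : 0 < stripP z := by
  rw [stripP_eq (strip_subset_stripDom hz)]
  have h1 := strip_cos_nonneg hz
  have h2 := one_le_stripDen hz
  have h3 := Real.cosh_pos (Real.pi * z.1 / 2)
  have := Real.pi_pos
  positivity

theorem abs_stripP_le {z : ℝ × ℝ} (hz : z ∈ strip) : |stripP z| ≤ 2 * (stripDen z)⁻¹ := by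
  rw [abs_of_pos (stripP_pos hz), stripP_eq (strip_subset_stripDom hz)]
  have h2 := one_le_stripDen hz
  have h3 := Real.one_le_cosh (Real.pi * z.1 / 2)
  have h4 : 1 + Real.cos (Real.pi * z.2 / 2) * Real.cosh (Real.pi * z.1 / 2) ≤ stripDen z := by
    unfold stripDen
    nlinarith [Real.cos_le_one (Real.pi * z.2 / 2)]
  rw [mul_div_assoc]
  refine mul_le_mul (by linarith [Real.pi_le_four]) ?_ ?_ (by norm_num)
  · rw [div_le_iff₀ (by positivity), sq, ← mul_assoc, inv_mul_cancel₀ (by positivity), one_mul]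
    exact h4
  · have := strip_cos_nonneg hz
    positivity

theorem abs_stripQ_le {z : ℝ × ℝ} (hz : z ∈ strip) : |stripQ z| ≤ 2 * (stripDen z)⁻¹ := by
  have h0 : 0 < (stripDen z)⁻¹ := inv_pos.2 (zero_lt_one.trans_le (one_le_stripDen hz))
  rw [stripQ, abs_mul, abs_mul, abs_neg, abs_of_pos (by linarith [Real.pi_pos] : 0 < Real.pi / 2)]
  refine mul_le_mul (by linarith [Real.pi_le_four]) ?_ (by positivity) (by norm_num)
  calc |stripRe z| * |stripIm z| ≤ 1 * (stripDen z)⁻¹ :=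
        mul_le_mul (abs_stripRe_le hz) (abs_stripIm_le hz) (abs_nonneg _) zero_le_one
    _ = _ := one_mul _

theorem one_add_sq_div_two_le_cosh (x : ℝ) : 1 + x ^ 2 / 2 ≤ Real.cosh x := by
  have h1 : Real.cosh x = 1 + 2 * Real.sinh (x / 2) ^ 2 := by
    have h2 := Real.cosh_two_mul (x / 2)
    rw [mul_div_cancel₀ x two_ne_zero] at h2
    rw [h2, Real.cosh_sq]
    ring
  have h2 : (x / 2) ^ 2 ≤ Real.sinh (x / 2) ^ 2 := by
    rw [sq_le_sq, Real.abs_sinh]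
    exact Real.self_le_sinh_iff.2 (abs_nonneg _)
  rw [h1]
  nlinarith

/-- Quadratic growth of the denominator is all that the energy estimate needs, since (1 + s²)⁻¹ is
integrable. -/
theorem one_add_sq_le_stripDen {z : ℝ × ℝ} (hz : z ∈ strip) : 1 + z.1 ^ 2 ≤ stripDen z := by
  refine le_trans ?_ (cosh_le_stripDen hz)
  refine le_trans ?_ (one_add_sq_div_two_le_cosh _)
  have : (1 : ℝ) ≤ Real.pi ^ 2 / 8 := by nlinarith [Real.pi_gt_three]
  nlinarith [sq_nonneg z.1]

theorem inv_stripDen_le {z : ℝ × ℝ} (hz : z ∈ strip) : (stripDen z)⁻¹ ≤ (1 + z.1 ^ 2)⁻¹ :=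
  inv_anti₀ (by positivity) (one_add_sq_le_stripDen hz)

theorem contDiffOn_stripRe : ContDiffOn ℝ ∞ stripRe stripDom := by
  have h : ContDiff ℝ ∞ (fun z : ℝ × ℝ => Real.sinh (Real.pi * z.1 / 2)) := by fun_prop
  exact h.contDiffOn.div contDiff_stripDen.contDiffOn fun z hz => ne_of_gt hz

theorem contDiffOn_stripIm : ContDiffOn ℝ ∞ stripIm stripDom := by
  have h : ContDiff ℝ ∞ (fun z : ℝ × ℝ => -(Real.sin (Real.pi * z.2 / 2))) := by fun_prop
  exact h.contDiffOn.div contDiff_stripDen.contDiffOn fun z hz => ne_of_gt hz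

theorem hasFDerivAt_stripDen (z : ℝ × ℝ) : HasFDerivAt stripDen
    ((Real.sinh (Real.pi * z.1 / 2) * (Real.pi / 2)) • ContinuousLinearMap.fst ℝ ℝ ℝ
      - (Real.sin (Real.pi * z.2 / 2) * (Real.pi / 2)) • ContinuousLinearMap.snd ℝ ℝ ℝ) z := by
  have h1 : HasDerivAt (fun s : ℝ => Real.cosh (Real.pi * s / 2))
      (Real.sinh (Real.pi * z.1 / 2) * (Real.pi / 2)) z.1 := by
    have := ((hasDerivAt_id z.1).const_mul Real.pi).div_const 2
    simpa using this.cosh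
  have h2 : HasDerivAt (fun s : ℝ => Real.cos (Real.pi * s / 2))
      (-Real.sin (Real.pi * z.2 / 2) * (Real.pi / 2)) z.2 := by
    have := ((hasDerivAt_id z.2).const_mul Real.pi).div_const 2
    simpa using this.cos
  have h3 := h1.hasFDerivAt.comp z (hasFDerivAt_fst (𝕜 := ℝ) (p := z))
  have h4 := h2.hasFDerivAt.comp z (hasFDerivAt_snd (𝕜 := ℝ) (p := z))
  refine (h4.add h3).congr_fderiv ?_
  ext <;> simp

/-- From tanh' = 1 - tanh². The derivatives of `stripRe` and `stripIm` use the same `stripP` and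
`stripQ`, which is the Cauchy–Riemann system of an anti-holomorphic function. -/
theorem hasFDerivAt_stripRe {z : ℝ × ℝ} (hz : z ∈ stripDom) : HasFDerivAt stripRe
    (stripP z • ContinuousLinearMap.fst ℝ ℝ ℝ + stripQ z • ContinuousLinearMap.snd ℝ ℝ ℝ) z := by
  have hD : stripDen z ≠ 0 := ne_of_gt hz
  have h1 : HasDerivAt (fun s : ℝ => Real.sinh (Real.pi * s / 2))
      (Real.cosh (Real.pi * z.1 / 2) * (Real.pi / 2)) z.1 := by
    have := ((hasDerivAt_id z.1).const_mul Real.pi).div_const 2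
    simpa using this.sinh
  have h3 := h1.hasFDerivAt.comp z (hasFDerivAt_fst (𝕜 := ℝ) (p := z))
  have hq := h3.mul ((hasDerivAt_inv hD).hasFDerivAt.comp z (hasFDerivAt_stripDen z))
  have e1 := Real.cosh_sq (Real.pi * z.1 / 2)
  have e2 := Real.sin_sq_add_cos_sq (Real.pi * z.2 / 2)
  refine (hq.congr_of_eventuallyEq (Eventually.of_forall fun w => div_eq_mul_inv _ _)).congr_fderiv ?_
  ext
  · simp [stripP_eq hz]
    field_simp
    unfold stripDen
    linear_combination e1
  · simp [stripQ, stripRe, stripIm]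
    field_simp

theorem hasFDerivAt_stripIm {z : ℝ × ℝ} (hz : z ∈ stripDom) : HasFDerivAt stripIm
    (stripQ z • ContinuousLinearMap.fst ℝ ℝ ℝ - stripP z • ContinuousLinearMap.snd ℝ ℝ ℝ) z := by
  have hD : stripDen z ≠ 0 := ne_of_gt hz
  have h1 : HasDerivAt (fun s : ℝ => -Real.sin (Real.pi * s / 2))
      (-(Real.cos (Real.pi * z.2 / 2) * (Real.pi / 2))) z.2 := by
    have := ((hasDerivAt_id z.2).const_mul Real.pi).div_const 2
    simpa using this.sin.fun_neg
  have h3 := h1.hasFDerivAt.comp z (hasFDerivAt_snd (𝕜 := ℝ) (p := z))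
  have hq := h3.mul ((hasDerivAt_inv hD).hasFDerivAt.comp z (hasFDerivAt_stripDen z))
  have e1 := Real.cosh_sq (Real.pi * z.1 / 2)
  have e2 := Real.sin_sq_add_cos_sq (Real.pi * z.2 / 2)
  refine (hq.congr_of_eventuallyEq (Eventually.of_forall fun w => div_eq_mul_inv _ _)).congr_fderiv ?_
  ext
  · simp [stripQ, stripRe, stripIm]
    field_simp
  · simp [stripP_eq hz]
    field_simp
    unfold stripDen
    linear_combination -e2

end ModelStrip

/-! ### The model strips: components, left inverse, bounds on all derivatives. -/

section ModelStrip

theorem modelStrip_fst (ε : ℝ) {z : ℝ × ℝ} (hz : z ∈ stripDom) :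
    (modelStrip ε z).1 = ε ^ 2 * ((stripRe z ^ 2 + stripIm z ^ 2 - 1) / 4) := by
  rw [stripRe_sq_add_stripIm_sq hz]
  have hD : stripDen z ≠ 0 := ne_of_gt hz
  have : (modelStrip ε z).1 = -(ε ^ 2 * Real.cos (Real.pi * z.2 / 2)) / (2 * stripDen z) := rfl
  rw [this]
  field_simp
  ring

theorem modelStrip_zero (ε : ℝ) (z : ℝ × ℝ) : (modelStrip ε z).2 0 = ε * stripRe z :=
  mul_div_assoc _ _ _

theorem modelStrip_one (ε : ℝ) (z : ℝ × ℝ) : (modelStrip ε z).2 1 = ε * stripIm z := by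
  have : (modelStrip ε z).2 1 = -(ε * Real.sin (Real.pi * z.2 / 2)) / stripDen z := rfl
  rw [this, stripIm]
  ring

theorem modelStrip_two (ε : ℝ) (z : ℝ × ℝ) :
    (modelStrip ε z).2 2 = -ε ^ 2 / 2 * (stripRe z * stripIm z) := by
  have : (modelStrip ε z).2 2 = ε ^ 2 * Real.sin (Real.pi * z.2 / 2) *
    Real.sinh (Real.pi * z.1 / 2) / (2 * stripDen z ^ 2) := rfl
  rw [this, stripRe, stripIm]
  ring

theorem contDiffOn_modelStrip : ContDiffOn ℝ ∞ (fun q : ℝ × (ℝ × ℝ) => modelStrip q.1 q.2)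
    (univ ×ˢ stripDom) := by
  have h0 : ContDiffOn ℝ ∞ (fun q : ℝ × (ℝ × ℝ) => q.1) (univ ×ˢ stripDom) :=
    contDiff_fst.contDiffOn
  have h1 : ContDiffOn ℝ ∞ (fun q : ℝ × (ℝ × ℝ) => stripRe q.2) (univ ×ˢ stripDom) :=
    contDiffOn_stripRe.comp contDiff_snd.contDiffOn fun q hq => hq.2
  have h2 : ContDiffOn ℝ ∞ (fun q : ℝ × (ℝ × ℝ) => stripIm q.2) (univ ×ˢ stripDom) :=
    contDiffOn_stripIm.comp contDiff_snd.contDiffOn fun q hq => hq.2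
  refine ContDiffOn.prodMk ?_ (contDiffOn_euclidean.2 fun i => ?_)
  · exact ((h0.pow 2).mul ((((h1.pow 2).add (h2.pow 2)).sub contDiffOn_const).div_const 4)).congr
      fun q hq => modelStrip_fst _ hq.2
  · fin_cases i
    · exact (h0.mul h1).congr fun q _ => modelStrip_zero _ _
    · exact (h0.mul h2).congr fun q _ => modelStrip_one _ _
    · exact (((h0.pow 2).neg.div_const 2).mul (h1.mul h2)).congr fun q _ => modelStrip_two _ _

theorem contDiffOn_modelStrip_right (ε : ℝ) : ContDiffOn ℝ ∞ (modelStrip ε) stripDom :=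
  contDiffOn_modelStrip.comp (contDiff_const.prodMk contDiff_id).contDiffOn
    fun _ hz => ⟨mem_univ _, hz⟩

theorem differentiableAt_modelStrip (ε : ℝ) {z : ℝ × ℝ} (hz : z ∈ stripDom) :
    DifferentiableAt ℝ (modelStrip ε) z :=
  ((contDiffOn_modelStrip_right ε).contDiffAt (isOpen_stripDom.mem_nhds hz)).differentiableAt
    (by simp)

theorem fderiv_modelStrip_fst (ε : ℝ) {z : ℝ × ℝ} (hz : z ∈ stripDom) (c : ℝ × ℝ) :
    fderiv ℝ (fun w => (modelStrip ε w).1) z c = ε ^ 2 / 2 *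
      (stripRe z * (stripP z * c.1 + stripQ z * c.2)
        + stripIm z * (stripQ z * c.1 - stripP z * c.2)) := by
  have h1 := hasFDerivAt_stripRe hz
  have h2 := hasFDerivAt_stripIm hz
  have h : HasFDerivAt (fun w => (modelStrip ε w).1) _ z :=
    (((((h1.mul h1).add (h2.mul h2)).sub_const 1).const_mul (ε ^ 2 / 4))).congr_of_eventuallyEq
      (by
        filter_upwards [isOpen_stripDom.mem_nhds hz] with w hw
        rw [modelStrip_fst ε hw]
        simp only [Pi.add_apply, Pi.mul_apply]
        ring)
  rw [h.fderiv]
  simp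
  ring

theorem fderiv_modelStrip_snd (ε : ℝ) {z : ℝ × ℝ} (hz : z ∈ stripDom) (c : ℝ × ℝ) :
    fderiv ℝ (fun w => (modelStrip ε w).2) z c =
      !₂[ε * (stripP z * c.1 + stripQ z * c.2), ε * (stripQ z * c.1 - stripP z * c.2),
        -ε ^ 2 / 2 * (stripRe z * (stripQ z * c.1 - stripP z * c.2)
          + stripIm z * (stripP z * c.1 + stripQ z * c.2))] := by
  have h1 := hasFDerivAt_stripRe hz
  have h2 := hasFDerivAt_stripIm hz
  have hd : DifferentiableAt ℝ (fun w => (modelStrip ε w).2) z :=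
    (differentiableAt_modelStrip ε hz).snd
  have hi : ∀ i, (fderiv ℝ (fun w => (modelStrip ε w).2) z c) i
      = fderiv ℝ (fun w => (modelStrip ε w).2 i) z c := fun i =>
    (DFunLike.congr_fun (((EuclideanSpace.proj (𝕜 := ℝ) i).hasFDerivAt.comp z
      hd.hasFDerivAt).fderiv) c).symm
  ext i
  rw [hi]
  fin_cases i
  · have : HasFDerivAt (fun w => (modelStrip ε w).2 0) _ z :=
      (h1.const_mul ε).congr_of_eventuallyEq (Eventually.of_forall fun w => modelStrip_zero ε w)
    refine (DFunLike.congr_fun this.fderiv c).trans ?_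
    simp
    ring
  · have : HasFDerivAt (fun w => (modelStrip ε w).2 1) _ z :=
      (h2.const_mul ε).congr_of_eventuallyEq (Eventually.of_forall fun w => modelStrip_one ε w)
    refine (DFunLike.congr_fun this.fderiv c).trans ?_
    simp
  · have : HasFDerivAt (fun w => (modelStrip ε w).2 2) _ z :=
      ((h1.mul h2).const_mul (-ε ^ 2 / 2)).congr_of_eventuallyEq
        (Eventually.of_forall fun w => modelStrip_two ε w)
    refine (DFunLike.congr_fun this.fderiv c).trans ?_
    simp
    ring

/-- The strips of parameter `ε` lie on the hypersurface `θ² + x² - 4a = ε²`. -/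
theorem modelStrip_quadric (ε : ℝ) {z : ℝ × ℝ} (hz : z ∈ stripDom) :
    (modelStrip ε z).2 0 ^ 2 + (modelStrip ε z).2 1 ^ 2 - 4 * (modelStrip ε z).1 = ε ^ 2 := by
  rw [modelStrip_zero, modelStrip_one, modelStrip_fst ε hz]
  ring

theorem norm_modelStrip_snd_le {ε : ℝ} (hε : |ε| ≤ 1) {z : ℝ × ℝ} (hz : z ∈ strip) :
    ‖(modelStrip ε z).2‖ ≤ 3 * |ε| := by
  have h1 := abs_stripRe_le hz
  have h2 := abs_stripIm_le_one hz
  have hsum : (modelStrip ε z).2 = (modelStrip ε z).2 0 • stdVec 0 + (modelStrip ε z).2 1 • stdVec 1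
      + (modelStrip ε z).2 2 • stdVec 2 := by
    ext i
    fin_cases i <;> simp
  have hn : ∀ i, ‖(stdVec i : E3)‖ = 1 := fun i => by simp [stdVec]
  rw [hsum]
  have a0 : ‖(modelStrip ε z).2 0 • (stdVec 0 : E3)‖ ≤ |ε| := by
    rw [norm_smul, hn, mul_one, modelStrip_zero, norm_mul, Real.norm_eq_abs, Real.norm_eq_abs]
    exact mul_le_of_le_one_right (abs_nonneg _) h1
  have a1 : ‖(modelStrip ε z).2 1 • (stdVec 1 : E3)‖ ≤ |ε| := by
    rw [norm_smul, hn, mul_one, modelStrip_one, norm_mul, Real.norm_eq_abs, Real.norm_eq_abs]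
    exact mul_le_of_le_one_right (abs_nonneg _) h2
  have a2 : ‖(modelStrip ε z).2 2 • (stdVec 2 : E3)‖ ≤ |ε| := by
    rw [norm_smul, hn, mul_one, modelStrip_two, norm_mul, norm_mul, Real.norm_eq_abs,
      Real.norm_eq_abs, Real.norm_eq_abs, abs_div, abs_neg, abs_pow, abs_two]
    have h3 : |stripRe z| * |stripIm z| ≤ 1 * 1 := mul_le_mul h1 h2 (abs_nonneg _) zero_le_one
    calc |ε| ^ 2 / 2 * (|stripRe z| * |stripIm z|) ≤ |ε| ^ 2 / 2 * (1 * 1) :=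
          mul_le_mul_of_nonneg_left h3 (by positivity)
      _ ≤ |ε| := by nlinarith [abs_nonneg ε]
  calc _ ≤ _ := norm_add₃_le
    _ ≤ 3 * |ε| := by linarith

/-- A continuous left inverse of `(stripRe, stripIm)` on the strip. -/
noncomputable def stripInv (w : ℝ × ℝ) : ℝ × ℝ :=
  (1 / Real.pi * Real.log (((1 + w.1) ^ 2 + w.2 ^ 2) / ((1 - w.1) ^ 2 + w.2 ^ 2)),
    2 / Real.pi * Real.arccos ((1 - w.1 ^ 2 - w.2 ^ 2)
      / √((1 - w.1 ^ 2 - w.2 ^ 2) ^ 2 + 4 * w.2 ^ 2)))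

/-- With w = tanh(π(s + it)/4), the quotient of |1 + w|² by |1 - w|² is exp(πs), and its logarithm
recovers `s`. This explains the first component of `stripInv`. -/
theorem one_add_stripRe_sq {z : ℝ × ℝ} (hz : z ∈ stripDom) : (1 + stripRe z) ^ 2 + stripIm z ^ 2
    = 2 * Real.exp (Real.pi * z.1 / 2) / stripDen z := by
  have h := stripRe_sq_add_stripIm_sq hz
  have hD : stripDen z ≠ 0 := ne_of_gt hz
  have h1 : (1 + stripRe z) ^ 2 + stripIm z ^ 2
      = (stripRe z ^ 2 + stripIm z ^ 2) + 1 + 2 * stripRe z := by ring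
  rw [h1, h, stripRe, ← Real.cosh_add_sinh]
  field_simp
  unfold stripDen
  ring

theorem one_sub_stripRe_sq {z : ℝ × ℝ} (hz : z ∈ stripDom) : (1 - stripRe z) ^ 2 + stripIm z ^ 2
    = 2 * Real.exp (-(Real.pi * z.1 / 2)) / stripDen z := by
  have h := stripRe_sq_add_stripIm_sq hz
  have hD : stripDen z ≠ 0 := ne_of_gt hz
  have h1 : (1 - stripRe z) ^ 2 + stripIm z ^ 2
      = (stripRe z ^ 2 + stripIm z ^ 2) + 1 - 2 * stripRe z := by ring
  rw [h1, h, stripRe, ← Real.cosh_sub_sinh]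
  field_simp
  unfold stripDen
  ring

/-- 1 - |w|² is 2 cos(πt/2)/D, and 2 Im w is 2 sin(πt/2)/D; dividing the former by the root of the
sum of squares isolates cos(πt/2), from which the arccosine recovers `t`. -/
theorem strip_angle_sq {z : ℝ × ℝ} (hz : z ∈ stripDom) :
    (1 - stripRe z ^ 2 - stripIm z ^ 2) ^ 2 + 4 * stripIm z ^ 2 = (2 / stripDen z) ^ 2 := by
  have h := stripRe_sq_add_stripIm_sq hz
  have hD : stripDen z ≠ 0 := ne_of_gt hz
  have e2 := Real.sin_sq_add_cos_sq (Real.pi * z.2 / 2)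
  have h1 : 1 - stripRe z ^ 2 - stripIm z ^ 2
      = 2 * Real.cos (Real.pi * z.2 / 2) / stripDen z := by linarith
  rw [h1, stripIm]
  field_simp
  linear_combination 4 * e2

theorem stripInv_apply {z : ℝ × ℝ} (hz : z ∈ strip) : stripInv (stripRe z, stripIm z) = z := by
  have hz' := strip_subset_stripDom hz
  have hD : 0 < stripDen z := hz'
  have hpi := Real.pi_pos
  have h := stripRe_sq_add_stripIm_sq hz'
  refine Prod.ext ?_ ?_
  · simp only [stripInv, one_add_stripRe_sq hz', one_sub_stripRe_sq hz']
    rw [div_div_div_cancel_right₀ hD.ne', mul_div_mul_left _ _ two_ne_zero, ← Real.exp_sub,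
      Real.log_exp]
    field_simp
    ring
  · simp only [stripInv, strip_angle_sq hz']
    rw [Real.sqrt_sq (by positivity)]
    have h1 : (1 - stripRe z ^ 2 - stripIm z ^ 2) / (2 / stripDen z)
        = Real.cos (Real.pi * z.2 / 2) := by
      have : 1 - stripRe z ^ 2 - stripIm z ^ 2
        = 2 * Real.cos (Real.pi * z.2 / 2) / stripDen z := by linarith
      rw [this]
      field_simp
    rw [h1, Real.arccos_cos]
    · field_simp
    · have := hz.2.1
      positivity
    · nlinarith [hz.2.2]

theorem continuousAt_stripInv {z : ℝ × ℝ} (hz : z ∈ strip) :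
    ContinuousAt stripInv (stripRe z, stripIm z) := by
  have hz' := strip_subset_stripDom hz
  have hD : 0 < stripDen z := hz'
  have h1 := one_add_stripRe_sq hz'
  have h2 := one_sub_stripRe_sq hz'
  have h3 := strip_angle_sq hz'
  have p1 : (1 + stripRe z) ^ 2 + stripIm z ^ 2 ≠ 0 := by rw [h1]; positivity
  have p2 : (1 - stripRe z) ^ 2 + stripIm z ^ 2 ≠ 0 := by rw [h2]; positivity
  have p3 : √((1 - stripRe z ^ 2 - stripIm z ^ 2) ^ 2 + 4 * stripIm z ^ 2) ≠ 0 := by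
    rw [h3, Real.sqrt_sq (by positivity)]
    positivity
  unfold stripInv
  refine ContinuousAt.prodMk (ContinuousAt.mul continuousAt_const (ContinuousAt.log ?_ ?_))
    (ContinuousAt.mul continuousAt_const (Real.continuous_arccos.continuousAt.comp ?_))
  · exact ContinuousAt.div (by fun_prop) (by fun_prop) p2
  · exact div_ne_zero p1 p2
  · exact ContinuousAt.div (by fun_prop) (by fun_prop) p3

/-- All derivatives of a smooth function of `(stripRe, stripIm)` are bounded on the strip. -/
theorem exists_bound_iteratedFDerivWithin_strip (m : ℕ) : ∀ {G : Type} [NormedAddCommGroup G]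
    [NormedSpace ℝ G] {P : ℝ × ℝ → G}, ContDiff ℝ ∞ P → ∃ K : ℝ, ∀ z ∈ strip,
      ‖iteratedFDerivWithin ℝ m (fun w => P (stripRe w, stripIm w)) strip z‖ ≤ K := by
  induction m with
  | zero =>
    intro G _ _ P hP
    obtain ⟨K, hK⟩ := (isCompact_closedBall (0 : ℝ × ℝ) 1).exists_bound_of_continuousOn
      hP.continuous.continuousOn
    refine ⟨K, fun z hz => ?_⟩
    rw [norm_iteratedFDerivWithin_zero]
    refine hK _ ?_
    rw [mem_closedBall_zero_iff, Prod.norm_def]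
    exact max_le (abs_stripRe_le hz) (abs_stripIm_le_one hz)
  | succ m ih =>
    intro G _ _ P hP
    -- The derivative of the pair is a polynomial in the pair itself, so differentiating a smooth
    -- function of it gives another one. The pair stays in a compact set, so there is nothing else
    -- to bound.
    let A : ℝ × ℝ → (ℝ × ℝ →L[ℝ] ℝ × ℝ) := fun w =>
      ContinuousLinearMap.prod
        ((Real.pi / 4 * (1 - w.1 ^ 2 + w.2 ^ 2)) • ContinuousLinearMap.fst ℝ ℝ ℝ
          + (-(Real.pi / 2) * (w.1 * w.2)) • ContinuousLinearMap.snd ℝ ℝ ℝ)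
        ((-(Real.pi / 2) * (w.1 * w.2)) • ContinuousLinearMap.fst ℝ ℝ ℝ
          - (Real.pi / 4 * (1 - w.1 ^ 2 + w.2 ^ 2)) • ContinuousLinearMap.snd ℝ ℝ ℝ)
    have hA : ContDiff ℝ ∞ A := by
      rw [contDiff_clm_apply_iff]
      intro y
      simp only [A, ContinuousLinearMap.prod_apply]
      refine ContDiff.prodMk ?_ ?_
      · simp
        fun_prop
      · simp
        fun_prop
    obtain ⟨K, hK⟩ := ih (P := fun w => (fderiv ℝ P w).comp (A w))
      ((hP.fderiv_right (m := ∞) (by simp)).clm_comp hA)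
    refine ⟨K, fun z hz => ?_⟩
    rw [← norm_iteratedFDerivWithin_fderivWithin uniqueDiffOn_strip hz]
    refine le_of_eq_of_le ?_ (hK z hz)
    congr 1
    refine iteratedFDerivWithin_congr (fun w hw => ?_) hz m
    have hw' := strip_subset_stripDom hw
    have h1 := (hasFDerivAt_stripRe hw').prodMk (hasFDerivAt_stripIm hw')
    have h2 : HasFDerivAt (fun w => P (stripRe w, stripIm w)) _ w :=
      (hP.differentiable (by simp) (stripRe w, stripIm w)).hasFDerivAt.comp w h1
    exact h2.hasFDerivWithinAt.fderivWithin (uniqueDiffOn_strip w hw)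

end ModelStrip

/-! ### Finite energy through the divergence theorem. -/

section StripEnergy

theorem volume_restrict_strip : (volume : Measure (ℝ × ℝ)).restrict strip
    = (volume : Measure ℝ).prod (volume.restrict (Icc (0 : ℝ) 1)) := by
  rw [strip, Measure.volume_eq_prod, ← Measure.prod_restrict, Measure.restrict_univ]

theorem integrableOn_strip_of_le {g : ℝ × ℝ → ℝ} (hg : ContinuousOn g strip) {K : ℝ}
    (hK : ∀ z ∈ strip, |g z| ≤ K * (1 + z.1 ^ 2)⁻¹) : IntegrableOn g strip := by
  have h1 : IntegrableOn (fun z : ℝ × ℝ => K * (1 + z.1 ^ 2)⁻¹) strip := by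
    rw [IntegrableOn, volume_restrict_strip]
    have := (integrable_inv_one_add_sq.const_mul K).mul_prod
      (integrable_const (1 : ℝ) (μ := volume.restrict (Icc (0 : ℝ) 1)))
    simpa using this
  refine h1.mono' (hg.aestronglyMeasurable isClosed_strip.measurableSet) ?_
  filter_upwards [ae_restrict_mem isClosed_strip.measurableSet] with z hz using hK z hz

theorem tendsto_zero_of_abs_le {g : ℝ → ℝ} {K : ℝ} (hg : ∀ s, |g s| ≤ K * (1 + s ^ 2)⁻¹)
    {l : Filter ℝ} (hl : Tendsto (fun s : ℝ => s ^ 2) l atTop) : Tendsto g l (𝓝 0) := by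
  refine squeeze_zero_norm hg ?_
  have h1 : Tendsto (fun s : ℝ => (1 + s ^ 2)⁻¹) l (𝓝 0) :=
    (tendsto_atTop_add_const_left l 1 hl).inv_tendsto_atTop
  simpa using h1.const_mul K

/-- The divergence theorem on the strip, for fields which decay at the ends. -/
theorem integral_strip_divergence_le {P R P' R' : ℝ × ℝ → ℝ} {K : ℝ}
    (hP : ∀ s, ∀ t ∈ Icc (0 : ℝ) 1, HasDerivAt (fun x => P (x, t)) (P' (s, t)) s)
    (hR : ∀ s, ∀ t ∈ Icc (0 : ℝ) 1, HasDerivAt (fun x => R (s, x)) (R' (s, t)) t)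
    (hP' : IntegrableOn P' strip) (hR' : IntegrableOn R' strip)
    (hPK : ∀ z ∈ strip, |P z| ≤ K * (1 + z.1 ^ 2)⁻¹)
    (hRK : ∀ z ∈ strip, |R z| ≤ K * (1 + z.1 ^ 2)⁻¹) :
    ∫ z in strip, (P' z + R' z) ≤ ∫ s : ℝ, 2 * K * (1 + s ^ 2)⁻¹ := by
  rw [integral_add hP' hR']
  rw [IntegrableOn, volume_restrict_strip] at hP' hR'
  rw [volume_restrict_strip, integral_prod_symm _ hP', integral_prod _ hR']
  -- The horizontal flux cancels because the field decays at both ends; only the flux through the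
  -- sides t = 0 and t = 1 remains.
  have h1 : ∫ t in Icc (0 : ℝ) 1, ∫ s : ℝ, P' (s, t) = 0 := by
    refine (integral_congr_ae (g := fun _ => (0 : ℝ)) ?_).trans (integral_zero _ _)
    filter_upwards [ae_restrict_mem measurableSet_Icc, hP'.prod_left_ae] with t ht hi
    have hb : ∀ s, |P (s, t)| ≤ K * (1 + s ^ 2)⁻¹ := fun s => hPK (s, t) ⟨mem_univ _, ht⟩
    have h2 := integral_of_hasDerivAt_of_tendsto (fun s => hP s t ht) hi
      (tendsto_zero_of_abs_le hb (by
        simpa [Function.comp_def] using (tendsto_pow_atTop two_ne_zero).comp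
          (tendsto_abs_atBot_atTop (G := ℝ))))
      (tendsto_zero_of_abs_le hb (tendsto_pow_atTop two_ne_zero))
    simpa using h2
  rw [h1, zero_add]
  refine (le_abs_self _).trans ?_
  rw [← Real.norm_eq_abs]
  refine norm_integral_le_of_norm_le (integrable_inv_one_add_sq.const_mul (2 * K)) ?_
  filter_upwards [hR'.prod_right_ae] with s hi
  have h3 : ∫ t in Icc (0 : ℝ) 1, R' (s, t) = R (s, 1) - R (s, 0) := by
    rw [integral_Icc_eq_integral_Ioc, ← intervalIntegral.integral_of_le zero_le_one]
    refine intervalIntegral.integral_eq_sub_of_hasDerivAt (f := fun t => R (s, t))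
      (fun t ht => hR s t ?_) ?_
    · rwa [uIcc_of_le zero_le_one] at ht
    · rw [intervalIntegrable_iff_integrableOn_Icc_of_le zero_le_one]
      exact hi
  rw [h3]
  have b1 := hRK (s, 1) ⟨mem_univ _, by simp⟩
  have b0 := hRK (s, 0) ⟨mem_univ _, by simp⟩
  calc ‖R (s, 1) - R (s, 0)‖ ≤ |R (s, 1)| + |R (s, 0)| := abs_sub _ _
    _ ≤ 2 * K * (1 + s ^ 2)⁻¹ := by
      simp only at b0 b1
      linarith

theorem hasDerivAt_strip_horizontal {g : ℝ × ℝ → ℝ} {a b : ℝ} {s t : ℝ}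
    (h : HasFDerivAt g (a • ContinuousLinearMap.fst ℝ ℝ ℝ + b • ContinuousLinearMap.snd ℝ ℝ ℝ)
      (s, t)) : HasDerivAt (fun x => g (x, t)) a s := by
  have := HasFDerivAt.comp_hasDerivAt (f := fun x : ℝ => (x, t)) s h
    ((hasDerivAt_id s).prodMk (hasDerivAt_const s t))
  simpa [Function.comp_def] using this

theorem hasDerivAt_strip_vertical {g : ℝ × ℝ → ℝ} {a b : ℝ} {s t : ℝ}
    (h : HasFDerivAt g (a • ContinuousLinearMap.fst ℝ ℝ ℝ + b • ContinuousLinearMap.snd ℝ ℝ ℝ)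
      (s, t)) : HasDerivAt (fun x => g (s, x)) b t := by
  have := HasFDerivAt.comp_hasDerivAt (f := fun x : ℝ => (s, x)) t h
    ((hasDerivAt_const t s).prodMk (hasDerivAt_id t))
  simpa [Function.comp_def] using this

theorem strip_hasDerivAt_horizontal (s : ℝ) {t : ℝ} (hz : (s, t) ∈ stripDom) :
    HasDerivAt (fun x => stripRe (x, t)) (stripP (s, t)) s ∧
      HasDerivAt (fun x => stripIm (x, t)) (stripQ (s, t)) s := by
  refine ⟨hasDerivAt_strip_horizontal (hasFDerivAt_stripRe hz),
    hasDerivAt_strip_horizontal (b := -stripP (s, t)) ?_⟩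
  refine (hasFDerivAt_stripIm hz).congr_fderiv ?_
  ext <;> simp

theorem strip_hasDerivAt_vertical (s : ℝ) {t : ℝ} (hz : (s, t) ∈ stripDom) :
    HasDerivAt (fun x => stripRe (s, x)) (stripQ (s, t)) t ∧
      HasDerivAt (fun x => stripIm (s, x)) (-stripP (s, t)) t := by
  refine ⟨hasDerivAt_strip_vertical (hasFDerivAt_stripRe hz),
    hasDerivAt_strip_vertical (a := stripQ (s, t)) ?_⟩
  refine (hasFDerivAt_stripIm hz).congr_fderiv ?_
  ext <;> simp

/-- The derivative of the `a`-component of a model strip along the strip. -/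
noncomputable def stripAs (ε : ℝ) (z : ℝ × ℝ) : ℝ :=
  ε ^ 2 / 2 * (stripRe z * stripP z + stripIm z * stripQ z)

/-- The derivative of the `a`-component of a model strip across the strip. -/
noncomputable def stripAt (ε : ℝ) (z : ℝ × ℝ) : ℝ :=
  ε ^ 2 / 2 * (stripRe z * stripQ z - stripIm z * stripP z)

/-- The energy density of a model strip. -/
noncomputable def modelEnergy (φ : ℝ → ℝ) (ε : ℝ) (z : ℝ × ℝ) : ℝ :=
  deriv φ (modelStrip ε z).1 * (stripAs ε z ^ 2 + stripAt ε z ^ 2)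
    + φ (modelStrip ε z).1 * (ε ^ 2 * (stripP z ^ 2 + stripQ z ^ 2))

theorem abs_stripAs_le (ε : ℝ) {z : ℝ × ℝ} (hz : z ∈ strip) :
    |stripAs ε z| ≤ 2 * ε ^ 2 * (1 + z.1 ^ 2)⁻¹ := by
  have h1 := abs_stripRe_le hz
  have h2 := abs_stripIm_le_one hz
  have h3 := (abs_stripP_le hz).trans (mul_le_mul_of_nonneg_left (inv_stripDen_le hz) zero_le_two)
  have h4 := (abs_stripQ_le hz).trans (mul_le_mul_of_nonneg_left (inv_stripDen_le hz) zero_le_two)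
  rw [stripAs, abs_mul, abs_of_nonneg (by positivity : 0 ≤ ε ^ 2 / 2)]
  have h5 : |stripRe z * stripP z + stripIm z * stripQ z| ≤ 4 * (1 + z.1 ^ 2)⁻¹ := by
    refine (abs_add_le _ _).trans ?_
    rw [abs_mul, abs_mul]
    nlinarith [abs_nonneg (stripP z), abs_nonneg (stripQ z)]
  nlinarith [sq_nonneg ε]

theorem abs_stripAt_le (ε : ℝ) {z : ℝ × ℝ} (hz : z ∈ strip) :
    |stripAt ε z| ≤ 2 * ε ^ 2 * (1 + z.1 ^ 2)⁻¹ := by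
  have h1 := abs_stripRe_le hz
  have h2 := abs_stripIm_le_one hz
  have h3 := (abs_stripP_le hz).trans (mul_le_mul_of_nonneg_left (inv_stripDen_le hz) zero_le_two)
  have h4 := (abs_stripQ_le hz).trans (mul_le_mul_of_nonneg_left (inv_stripDen_le hz) zero_le_two)
  rw [stripAt, abs_mul, abs_of_nonneg (by positivity : 0 ≤ ε ^ 2 / 2)]
  have h5 : |stripRe z * stripQ z - stripIm z * stripP z| ≤ 4 * (1 + z.1 ^ 2)⁻¹ := by
    refine (abs_sub _ _).trans ?_
    rw [abs_mul, abs_mul]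
    nlinarith [abs_nonneg (stripP z), abs_nonneg (stripQ z)]
  nlinarith [sq_nonneg ε]

/-- The derivative of `stripAs` along the strip. -/
noncomputable def stripAss (ε : ℝ) (z : ℝ × ℝ) : ℝ :=
  ε ^ 2 / 2 * (stripP z ^ 2 + stripQ z ^ 2 + Real.pi / 2 *
    (stripRe z * (stripIm z * stripQ z - stripRe z * stripP z)
      - stripIm z * (stripP z * stripIm z + stripRe z * stripQ z)))

/-- The last two derivatives add up to the Laplacian of a, which is ε²|w'|² because a is ε²(|w|² -
1)/4 with w anti-holomorphic. -/
theorem modelStrip_fst_derivs (ε s : ℝ) {t : ℝ} (hz : (s, t) ∈ stripDom) :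
    HasDerivAt (fun x => (modelStrip ε (x, t)).1) (stripAs ε (s, t)) s ∧
      HasDerivAt (fun x => (modelStrip ε (s, x)).1) (stripAt ε (s, t)) t ∧
      HasDerivAt (fun x => stripAs ε (x, t)) (stripAss ε (s, t)) s ∧
      HasDerivAt (fun x => stripAt ε (s, x))
        (ε ^ 2 * (stripP (s, t) ^ 2 + stripQ (s, t) ^ 2) - stripAss ε (s, t)) t := by
  obtain ⟨hT, hX⟩ := strip_hasDerivAt_horizontal s hz
  obtain ⟨kT, kX⟩ := strip_hasDerivAt_vertical s hz
  have hP : HasDerivAt (fun x => stripP (x, t)) _ s :=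
    (((hT.fun_pow 2).const_sub 1).fun_add (hX.fun_pow 2)).const_mul (Real.pi / 4)
  have hQ : HasDerivAt (fun x => stripQ (x, t)) _ s := (hT.fun_mul hX).const_mul (-(Real.pi / 2))
  have kP : HasDerivAt (fun x => stripP (s, x)) _ t :=
    (((kT.fun_pow 2).const_sub 1).fun_add (kX.fun_pow 2)).const_mul (Real.pi / 4)
  have kQ : HasDerivAt (fun x => stripQ (s, x)) _ t := (kT.fun_mul kX).const_mul (-(Real.pi / 2))
  refine ⟨?_, ?_, ?_, ?_⟩
  · have h := ((((hT.fun_pow 2).fun_add (hX.fun_pow 2)).sub_const 1).div_const 4).const_mul (ε ^ 2)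
    refine (h.congr_of_eventuallyEq ?_).congr_deriv ?_
    · have hc : ContinuousAt (fun x : ℝ => (x, t)) s := by fun_prop
      filter_upwards [hc.preimage_mem_nhds (isOpen_stripDom.mem_nhds hz)] with x hx
        using modelStrip_fst ε hx
    · simp [stripAs]
      ring
  · have h := ((((kT.fun_pow 2).fun_add (kX.fun_pow 2)).sub_const 1).div_const 4).const_mul (ε ^ 2)
    refine (h.congr_of_eventuallyEq ?_).congr_deriv ?_
    · have hc : ContinuousAt (fun x : ℝ => (s, x)) t := by fun_prop
      filter_upwards [hc.preimage_mem_nhds (isOpen_stripDom.mem_nhds hz)] with x hx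
        using modelStrip_fst ε hx
    · simp [stripAt]
      ring
  · refine (((hT.fun_mul hP).fun_add (hX.fun_mul hQ)).const_mul (ε ^ 2 / 2)).congr_deriv ?_
    simp only [stripAss]
    push_cast
    ring
  · refine (((kT.fun_mul kQ).fun_sub (kX.fun_mul kP)).const_mul (ε ^ 2 / 2)).congr_deriv ?_
    simp only [stripAss]
    push_cast
    ring

theorem continuousOn_strip_functions (ε : ℝ) : ContinuousOn stripP strip ∧
    ContinuousOn stripQ strip ∧ ContinuousOn (stripAs ε) strip ∧ ContinuousOn (stripAt ε) strip ∧
    ContinuousOn (stripAss ε) strip ∧ ContinuousOn (fun z => (modelStrip ε z).1) strip := by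
  have h1 : ContinuousOn stripRe strip := contDiffOn_stripRe.continuousOn.mono strip_subset_stripDom
  have h2 : ContinuousOn stripIm strip := contDiffOn_stripIm.continuousOn.mono strip_subset_stripDom
  have hP : ContinuousOn stripP strip := by unfold stripP; fun_prop
  have hQ : ContinuousOn stripQ strip := by unfold stripQ; fun_prop
  refine ⟨hP, hQ, by unfold stripAs; fun_prop, by unfold stripAt; fun_prop,
    by unfold stripAss; fun_prop, ?_⟩
  exact ((contDiffOn_modelStrip_right ε).continuousOn.mono strip_subset_stripDom).fst

theorem abs_stripAss_le (ε : ℝ) {z : ℝ × ℝ} (hz : z ∈ strip) :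
    |stripAss ε z| ≤ 20 * ε ^ 2 * (1 + z.1 ^ 2)⁻¹ := by
  have hw := inv_stripDen_le hz
  have hv := inv_stripDen_le_one hz
  have hv0 : 0 < (stripDen z)⁻¹ := inv_pos.2 (strip_subset_stripDom hz)
  have h1 := abs_le.1 (abs_stripRe_le hz)
  have h2 := abs_le.1 (abs_stripIm_le_one hz)
  have h3 := abs_stripP_le hz
  have h4 := abs_stripQ_le hz
  have key : ∀ {x : ℝ}, |x| ≤ 2 * (stripDen z)⁻¹ → x ^ 2 ≤ 4 * (stripDen z)⁻¹ := by
    intro x hx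
    rw [← sq_abs]
    nlinarith [abs_nonneg x]
  have kb : ∀ {a b x : ℝ}, |a| ≤ 1 → |b| ≤ 1 → |x| ≤ 2 * (stripDen z)⁻¹ →
      |a * b * x| ≤ 2 * (stripDen z)⁻¹ := by
    intro a b x ha hb hx
    rw [abs_mul, abs_mul]
    calc |a| * |b| * |x| ≤ 1 * 1 * (2 * (stripDen z)⁻¹) := by gcongr
      _ = _ := by ring
  have t1 := abs_le.1 (kb (abs_stripRe_le hz) (abs_stripIm_le_one hz) h4)
  have t2 := abs_le.1 (kb (abs_stripRe_le hz) (abs_stripRe_le hz) h3)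
  have t3 := abs_le.1 (kb (abs_stripIm_le_one hz) (abs_stripIm_le_one hz) h3)
  have t4 := key h3
  have t5 := key h4
  set V := stripRe z * (stripIm z * stripQ z - stripRe z * stripP z)
      - stripIm z * (stripP z * stripIm z + stripRe z * stripQ z) with hV
  have hV' : V = - (stripRe z * stripRe z * stripP z) - stripIm z * stripIm z * stripP z := by
    rw [hV]; ring
  have hVb : |V| ≤ 4 * (stripDen z)⁻¹ := by
    rw [abs_le]
    constructor <;> linarith
  have hpi : |Real.pi / 2 * V| ≤ 8 * (stripDen z)⁻¹ := by
    rw [abs_mul, abs_of_pos (by linarith [Real.pi_pos])]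
    calc Real.pi / 2 * |V| ≤ 2 * (4 * (stripDen z)⁻¹) := by
          gcongr
          linarith [Real.pi_le_four]
      _ = _ := by ring
  have hsum : |stripP z ^ 2 + stripQ z ^ 2 + Real.pi / 2 * V| ≤ 16 * (stripDen z)⁻¹ := by
    rw [abs_le] at hpi ⊢
    constructor <;> nlinarith [sq_nonneg (stripP z), sq_nonneg (stripQ z)]
  rw [stripAss, ← hV, abs_mul, abs_of_nonneg (by positivity : 0 ≤ ε ^ 2 / 2)]
  calc ε ^ 2 / 2 * |stripP z ^ 2 + stripQ z ^ 2 + Real.pi / 2 * V|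
      ≤ ε ^ 2 / 2 * (16 * (1 + z.1 ^ 2)⁻¹) := by gcongr; linarith
    _ ≤ 20 * ε ^ 2 * (1 + z.1 ^ 2)⁻¹ := by
      have : 0 ≤ ε ^ 2 * (1 + z.1 ^ 2)⁻¹ := by positivity
      linarith

/-- The energy density is the divergence of φ(a)∇a. As |φ| ≤ 1, the flux through the sides is
bounded by a multiple of the integral of (1 + s²)⁻¹ that does not depend on φ. -/
theorem modelEnergy_bound {ε : ℝ} (hε : |ε| ≤ 1) : ∃ C : ℝ, ∀ φ : ℝ → ℝ, ContDiff ℝ ∞ φ →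
    (∀ x, φ x ∈ Icc (0 : ℝ) 1) → IntegrableOn (modelEnergy φ ε) strip ∧
      ∫ z in strip, modelEnergy φ ε z ≤ C := by
  refine ⟨∫ s : ℝ, 2 * (2 * ε ^ 2) * (1 + s ^ 2)⁻¹, fun φ hφ hφ1 => ?_⟩
  obtain ⟨cP, cQ, cAs, cAt, cAss, cA⟩ := continuousOn_strip_functions ε
  have hφc : Continuous φ := hφ.continuous
  have hφ'c : Continuous (deriv φ) := hφ.continuous_deriv (by simp)
  have hφd : Differentiable ℝ φ := hφ.differentiable (by simp)
  have hε2 : ε ^ 2 ≤ 1 := (sq_le_one_iff_abs_le_one ε).2 hε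
  -- This bound on φ' depends on φ; it enters only into integrability and not into `C`.
  obtain ⟨K, hK⟩ := (isCompact_Icc (a := (-1 : ℝ)) (b := 1)).exists_bound_of_continuousOn
    hφ'c.continuousOn
  have hA1 : ∀ z ∈ strip, (modelStrip ε z).1 ∈ Icc (-1 : ℝ) 1 := by
    intro z hz
    rw [modelStrip_fst ε (strip_subset_stripDom hz)]
    have h1 := abs_le.1 (abs_stripRe_le hz)
    have h2 := abs_le.1 (abs_stripIm_le_one hz)
    have h3 : |(stripRe z ^ 2 + stripIm z ^ 2 - 1) / 4| ≤ 1 := by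
      rw [abs_le]
      constructor <;> nlinarith
    rw [mem_Icc, ← abs_le, abs_mul, abs_of_nonneg (sq_nonneg ε)]
    exact mul_le_one₀ hε2 (abs_nonneg _) h3
  have hK0 : 0 ≤ K := (norm_nonneg _).trans (hK 0 (by norm_num))
  let P : ℝ × ℝ → ℝ := fun z => φ (modelStrip ε z).1 * stripAs ε z
  let R : ℝ × ℝ → ℝ := fun z => φ (modelStrip ε z).1 * stripAt ε z
  let P' : ℝ × ℝ → ℝ := fun z => deriv φ (modelStrip ε z).1 * stripAs ε z * stripAs ε z
    + φ (modelStrip ε z).1 * stripAss ε z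
  let R' : ℝ × ℝ → ℝ := fun z => deriv φ (modelStrip ε z).1 * stripAt ε z * stripAt ε z
    + φ (modelStrip ε z).1 * (ε ^ 2 * (stripP z ^ 2 + stripQ z ^ 2) - stripAss ε z)
  have hsum : modelEnergy φ ε = fun z => P' z + R' z := by
    funext z
    simp only [modelEnergy, P', R']
    ring
  have hmem : ∀ s, ∀ t ∈ Icc (0 : ℝ) 1, (s, t) ∈ stripDom := fun s t ht =>
    strip_subset_stripDom ⟨mem_univ _, ht⟩
  have hP : ∀ s, ∀ t ∈ Icc (0 : ℝ) 1, HasDerivAt (fun x => P (x, t)) (P' (s, t)) s := by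
    intro s t ht
    obtain ⟨h1, -, h3, -⟩ := modelStrip_fst_derivs ε s (hmem s t ht)
    exact ((hφd _).hasDerivAt.comp s h1).mul h3
  have hR : ∀ s, ∀ t ∈ Icc (0 : ℝ) 1, HasDerivAt (fun x => R (s, x)) (R' (s, t)) t := by
    intro s t ht
    obtain ⟨-, h2, -, h4⟩ := modelStrip_fst_derivs ε s (hmem s t ht)
    exact ((hφd _).hasDerivAt.comp t h2).mul h4
  have hφa : ∀ x, |φ x| ≤ 1 := fun x => abs_le.2 ⟨by linarith [(hφ1 x).1], (hφ1 x).2⟩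
  have hsq : ∀ z : ℝ × ℝ, ∀ x : ℝ, |x| ≤ 2 * ε ^ 2 * (1 + z.1 ^ 2)⁻¹ →
      |x * x| ≤ 4 * (1 + z.1 ^ 2)⁻¹ := by
    intro z x hx
    have hv : (1 + z.1 ^ 2)⁻¹ ≤ 1 := inv_le_one_of_one_le₀ (by nlinarith [sq_nonneg z.1])
    have hv0 : 0 < (1 + z.1 ^ 2)⁻¹ := by positivity
    have hx' : |x| ≤ 2 * (1 + z.1 ^ 2)⁻¹ := hx.trans (by nlinarith)
    rw [abs_mul]
    nlinarith [abs_nonneg x]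
  have hPQ : ∀ z ∈ strip, ε ^ 2 * (stripP z ^ 2 + stripQ z ^ 2) ≤ 8 * (1 + z.1 ^ 2)⁻¹ := by
    intro z hz
    have hw := inv_stripDen_le hz
    have hv := inv_stripDen_le_one hz
    have hv0 : 0 < (stripDen z)⁻¹ := inv_pos.2 (strip_subset_stripDom hz)
    have key : ∀ {x : ℝ}, |x| ≤ 2 * (stripDen z)⁻¹ → x ^ 2 ≤ 4 * (stripDen z)⁻¹ := by
      intro x hx
      rw [← sq_abs]
      nlinarith [abs_nonneg x]
    have t4 := key (abs_stripP_le hz)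
    have t5 := key (abs_stripQ_le hz)
    nlinarith [sq_nonneg (stripP z), sq_nonneg (stripQ z)]
  have hAss : ∀ z ∈ strip, |stripAss ε z| ≤ 20 * (1 + z.1 ^ 2)⁻¹ := fun z hz =>
    (abs_stripAss_le ε hz).trans (by
      have : 0 ≤ (1 + z.1 ^ 2)⁻¹ := by positivity
      nlinarith)
  have hb : ∀ z ∈ strip, ∀ x y : ℝ, |x| ≤ 2 * ε ^ 2 * (1 + z.1 ^ 2)⁻¹ →
      |y| ≤ 28 * (1 + z.1 ^ 2)⁻¹ →
      |deriv φ (modelStrip ε z).1 * x * x + φ (modelStrip ε z).1 * y|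
        ≤ (K * 4 + 28) * (1 + z.1 ^ 2)⁻¹ := by
    intro z hz x y hx hy
    have e1 := hK _ (hA1 z hz)
    rw [Real.norm_eq_abs] at e1
    calc _ ≤ |deriv φ (modelStrip ε z).1 * x * x| + |φ (modelStrip ε z).1 * y| := abs_add_le _ _
      _ = |deriv φ (modelStrip ε z).1| * |x * x| + |φ (modelStrip ε z).1| * |y| := by
        rw [mul_assoc, abs_mul, abs_mul (φ _)]
      _ ≤ K * (4 * (1 + z.1 ^ 2)⁻¹) + 1 * (28 * (1 + z.1 ^ 2)⁻¹) := by
        gcongr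
        · exact hsq z x hx
        · exact hφa _
      _ = _ := by ring
  have cφ : ContinuousOn (fun z => φ (modelStrip ε z).1) strip := hφc.comp_continuousOn cA
  have cφ' : ContinuousOn (fun z => deriv φ (modelStrip ε z).1) strip := hφ'c.comp_continuousOn cA
  have hP' : IntegrableOn P' strip := by
    refine integrableOn_strip_of_le (K := K * 4 + 28)
      (((cφ'.mul cAs).mul cAs).add (cφ.mul cAss)) fun z hz => ?_
    refine hb z hz _ _ (abs_stripAs_le ε hz) ((hAss z hz).trans ?_)
    have : 0 ≤ (1 + z.1 ^ 2)⁻¹ := by positivity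
    linarith
  have hR' : IntegrableOn R' strip := by
    refine integrableOn_strip_of_le (K := K * 4 + 28) (((cφ'.mul cAt).mul cAt).add (cφ.mul
      ((continuousOn_const.mul ((cP.pow 2).add (cQ.pow 2))).sub cAss))) fun z hz => ?_
    refine hb z hz _ _ (abs_stripAt_le ε hz) ?_
    have h1 := abs_le.1 (hAss z hz)
    have h2 := hPQ z hz
    have h3 : 0 ≤ ε ^ 2 * (stripP z ^ 2 + stripQ z ^ 2) := by positivity
    rw [abs_le]
    constructor <;> linarith
  have hbound : ∀ z, ∀ x : ℝ, |x| ≤ 2 * ε ^ 2 * (1 + z.1 ^ 2)⁻¹ →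
      |φ (modelStrip ε z).1 * x| ≤ 2 * ε ^ 2 * (1 + z.1 ^ 2)⁻¹ := by
    intro z x hx
    rw [abs_mul]
    exact (mul_le_of_le_one_left (abs_nonneg _) (hφa _)).trans hx
  rw [hsum]
  exact ⟨hP'.add hR', integral_strip_divergence_le hP hR hP' hR'
    (fun z hz => hbound z _ (abs_stripAs_le ε hz)) fun z hz => hbound z _ (abs_stripAt_le ε hz)⟩

end StripEnergy

/-! ### Model strips read in a chart of the manifold. -/

section ChartStrip

variable {M : Type*} [TopologicalSpace M]

/-- The model strip, read in a chart of `M`. -/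
noncomputable def chartStrip (Φ : OpenPartialHomeomorph M E3) (ε : ℝ) (z : ℝ × ℝ) : ℝ × M :=
  ((modelStrip ε z).1, Φ.symm (modelStrip ε z).2)

/-- The model strip of parameter `ε` lies in the domain of the coordinates. -/
def IsChartStrip (Φ : OpenPartialHomeomorph M E3) (ε : ℝ) : Prop :=
  ∀ z ∈ strip, (modelStrip ε z).2 ∈ Φ.target

variable {Φ : OpenPartialHomeomorph M E3} {ε : ℝ}

theorem chartStrip_mem (h : IsChartStrip Φ ε) {z : ℝ × ℝ} (hz : z ∈ strip) :
    (chartStrip Φ ε z).2 ∈ Φ.source := Φ.map_target (h z hz)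

theorem chart_chartStrip (h : IsChartStrip Φ ε) {z : ℝ × ℝ} (hz : z ∈ strip) :
    Φ (chartStrip Φ ε z).2 = (modelStrip ε z).2 := Φ.right_inv (h z hz)

theorem exists_forall_isChartStrip (h0 : (0 : E3) ∈ Φ.target) :
    ∃ c : ℝ, 0 < c ∧ c ≤ 1 ∧ ∀ ε, |ε| ≤ c → IsChartStrip Φ ε := by
  obtain ⟨ρ, hρ, hb⟩ := Metric.isOpen_iff.1 Φ.open_target 0 h0
  -- Points of the strip of parameter `ε` have norm at most `3 * |ε|`, so `ρ / 4` keeps them inside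
  -- the ball of radius `ρ`.
  refine ⟨min 1 (ρ / 4), lt_min one_pos (by positivity), min_le_left _ _, fun ε hε z hz => hb ?_⟩
  rw [mem_ball_zero_iff]
  have h1 := norm_modelStrip_snd_le (hε.trans (min_le_left _ _)) hz
  have h2 := hε.trans (min_le_right _ _)
  linarith

/-- A common point would lie on both quadrics θ² + x² - 4a = ε² and θ² + x² - 4a = ε'². -/
theorem disjoint_chartStrip {ε' : ℝ} (h : IsChartStrip Φ ε) (h' : IsChartStrip Φ ε')
    (hne : ε ^ 2 ≠ ε' ^ 2) : Disjoint (chartStrip Φ ε '' strip) (chartStrip Φ ε' '' strip) := by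
  rw [Set.disjoint_left]
  rintro _ ⟨z, hz, rfl⟩ ⟨w, hw, hwz⟩
  refine hne ?_
  rw [← modelStrip_quadric ε (strip_subset_stripDom hz),
    ← modelStrip_quadric ε' (strip_subset_stripDom hw), ← chart_chartStrip h hz,
    ← chart_chartStrip h' hw, hwz]
  have h1 : (modelStrip ε' w).1 = (modelStrip ε z).1 :=
    congrArg (fun V : ℝ × M => V.1) hwz
  rw [h1]

variable [ChartedSpace E3 M]

theorem contMDiffOn_chartStrip (hΦ : Φ ∈ IsManifold.maximalAtlas (𝓡 3) ∞ M) {s : Set ℝ}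
    (h : ∀ ε ∈ s, IsChartStrip Φ ε) : ContMDiffOn 𝓘(ℝ, ℝ × (ℝ × ℝ)) (𝓘(ℝ, ℝ).prod (𝓡 3)) ∞
      (fun q : ℝ × (ℝ × ℝ) => chartStrip Φ q.1 q.2) (s ×ˢ strip) := by
  have h1 := (contDiffOn_modelStrip.mono (prod_mono (subset_univ s) strip_subset_stripDom))
  refine ContMDiffOn.prodMk (contMDiffOn_iff_contDiffOn.2 h1.fst) ?_
  exact (contMDiffOn_symm_of_mem_maximalAtlas hΦ).comp (contMDiffOn_iff_contDiffOn.2 h1.snd)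
    fun q hq => h q.1 hq.1 q.2 hq.2

theorem contMDiffOn_chartStrip_right (hΦ : Φ ∈ IsManifold.maximalAtlas (𝓡 3) ∞ M)
    (h : IsChartStrip Φ ε) :
    ContMDiffOn 𝓘(ℝ, ℝ × ℝ) (𝓘(ℝ, ℝ).prod (𝓡 3)) ∞ (chartStrip Φ ε) strip := by
  have h1 := (contDiffOn_modelStrip_right ε).mono strip_subset_stripDom
  refine ContMDiffOn.prodMk (contMDiffOn_iff_contDiffOn.2 h1.fst) ?_
  exact (contMDiffOn_symm_of_mem_maximalAtlas hΦ).comp (contMDiffOn_iff_contDiffOn.2 h1.snd)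
    fun z hz => h z hz

theorem dStrip_chartStrip_fst {z : ℝ × ℝ} (hz : z ∈ strip) (c : ℝ × ℝ) :
    (dStrip (chartStrip Φ ε) z c).1 = fderiv ℝ (fun w => (modelStrip ε w).1) z c := by
  have h1 : DifferentiableAt ℝ (fun w => (modelStrip ε w).1) z :=
    (differentiableAt_modelStrip ε (strip_subset_stripDom hz)).fst
  exact DFunLike.congr_fun (h1.fderivWithin (uniqueDiffOn_strip z hz)) c

theorem dStrip_chartStrip_snd (hΦ : Φ ∈ IsManifold.maximalAtlas (𝓡 3) ∞ M)
    (h : IsChartStrip Φ ε) {z : ℝ × ℝ} (hz : z ∈ strip) (c : ℝ × ℝ) :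
    (dStrip (chartStrip Φ ε) z c).2 = mfderiv 𝓘(ℝ, E3) (𝓡 3) Φ.symm (modelStrip ε z).2
      (fderiv ℝ (fun w => (modelStrip ε w).2) z c) := by
  have h1 : DifferentiableAt ℝ (fun w => (modelStrip ε w).2) z :=
    (differentiableAt_modelStrip ε (strip_subset_stripDom hz)).snd
  have h2 := (mdifferentiable_of_mem_maximalAtlas hΦ).mdifferentiableAt_symm (h z hz)
  have h3 := mfderiv_comp (I := 𝓘(ℝ, ℝ × ℝ)) (I' := 𝓘(ℝ, E3)) (I'' := 𝓡 3) z
    (f := fun w => (modelStrip ε w).2) h2 h1.mdifferentiableAt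
  have h4 := mfderivWithin_eq_mfderiv (I := 𝓘(ℝ, ℝ × ℝ)) (I' := 𝓡 3) (s := strip)
    (uniqueDiffOn_strip z hz).uniqueMDiffWithinAt (h2.comp z h1.mdifferentiableAt)
  exact (DFunLike.congr_fun h4 c).trans ((DFunLike.congr_fun h3 c).trans
    (congrArg _ (DFunLike.congr_fun (mfderiv_eq_fderiv
      (f := fun w => (modelStrip ε w).2) (x := z)) c)))

theorem coordD_mfderiv_symm (hΦ : Φ ∈ IsManifold.maximalAtlas (𝓡 3) ∞ M) {x : E3}
    (hx : x ∈ Φ.target) (w : E3) :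
    coordD Φ (Φ.symm x) (mfderiv 𝓘(ℝ, E3) (𝓡 3) Φ.symm x w) = w :=
  DFunLike.congr_fun ((mdifferentiable_of_mem_maximalAtlas hΦ).comp_symm_deriv hx) w

theorem coordD_dStrip (hΦ : Φ ∈ IsManifold.maximalAtlas (𝓡 3) ∞ M)
    (h : IsChartStrip Φ ε) {z : ℝ × ℝ} (hz : z ∈ strip) (c : ℝ × ℝ) :
    coordD Φ (chartStrip Φ ε z).2 (dStrip (chartStrip Φ ε) z c).2 =
      !₂[ε * (stripP z * c.1 + stripQ z * c.2), ε * (stripQ z * c.1 - stripP z * c.2),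
        -ε ^ 2 / 2 * (stripRe z * (stripQ z * c.1 - stripP z * c.2)
          + stripIm z * (stripP z * c.1 + stripQ z * c.2))] := by
  rw [dStrip_chartStrip_snd hΦ h hz, ← fderiv_modelStrip_snd ε (strip_subset_stripDom hz)]
  exact coordD_mfderiv_symm hΦ (h z hz) _

/-- The (θ, x)-part of the derivative has determinant -ε²(P² + Q²), where P > 0. A left inverse
defined near the image and continuous at its points, `stripInv` of (θ/ε, x/ε), gives the
homeomorphism onto the image. -/
theorem isEmbeddedStrip_chartStrip (hΦ : Φ ∈ IsManifold.maximalAtlas (𝓡 3) ∞ M)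
    (h : IsChartStrip Φ ε) (hε : ε ≠ 0) : IsEmbeddedStrip (chartStrip Φ ε) where
  smooth := contMDiffOn_chartStrip_right hΦ h
  immersed z hz := by
    intro c d hcd
    have h1 := congrArg (fun V : ℝ × TangentSpace (𝓡 3) (chartStrip Φ ε z).2 =>
      coordD Φ (chartStrip Φ ε z).2 V.2) hcd
    simp only [coordD_dStrip hΦ h hz] at h1
    have e0 : ε * (stripP z * c.1 + stripQ z * c.2) = ε * (stripP z * d.1 + stripQ z * d.2) := by
      simpa using congrArg (fun v : E3 => v 0) h1
    have e1 : ε * (stripQ z * c.1 - stripP z * c.2) = ε * (stripQ z * d.1 - stripP z * d.2) := by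
      simpa using congrArg (fun v : E3 => v 1) h1
    have e0 := mul_left_cancel₀ hε e0
    have e1 := mul_left_cancel₀ hε e1
    have hp : stripP z ^ 2 + stripQ z ^ 2 ≠ 0 := by
      have := stripP_pos hz
      positivity
    refine Prod.ext (mul_left_cancel₀ hp ?_) (mul_left_cancel₀ hp ?_)
    · linear_combination stripP z * e0 + stripQ z * e1
    · linear_combination stripQ z * e0 - stripP z * e1
  embedded := by
    let G : ℝ × M → ℝ × ℝ := fun V => stripInv (Φ V.2 0 / ε, Φ V.2 1 / ε)
    have hval : ∀ z ∈ strip, ((Φ (chartStrip Φ ε z).2 0 / ε, Φ (chartStrip Φ ε z).2 1 / ε) : ℝ × ℝ)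
        = (stripRe z, stripIm z) := by
      intro z hz
      rw [chart_chartStrip h hz, modelStrip_zero, modelStrip_one, mul_div_cancel_left₀ _ hε,
        mul_div_cancel_left₀ _ hε]
    have hG : ∀ z ∈ strip, G (chartStrip Φ ε z) = z := by
      intro z hz
      simp only [G]
      rw [hval z hz, stripInv_apply hz]
    have hGc : ∀ z ∈ strip, ContinuousAt G (chartStrip Φ ε z) := by
      intro z hz
      have h1 : ContinuousAt (fun V : ℝ × M => Φ V.2) (chartStrip Φ ε z) :=
        ContinuousAt.comp (f := Prod.snd) (Φ.continuousAt (chartStrip_mem h hz)) continuousAt_snd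
      have h0 : ∀ i, ContinuousAt (fun V : ℝ × M => Φ V.2 i / ε) (chartStrip Φ ε z) := fun i =>
        ((EuclideanSpace.proj (𝕜 := ℝ) i).continuous.continuousAt.comp h1).div_const ε
      refine ContinuousAt.comp (g := stripInv) ?_ ((h0 0).prodMk (h0 1))
      rw [hval z hz]
      exact continuousAt_stripInv hz
    have hcont : Continuous (strip.domRestrict (chartStrip Φ ε)) :=
      (contMDiffOn_chartStrip_right hΦ h).continuousOn.domRestrict
    refine ⟨isInducing_iff_nhds.2 fun z => le_antisymm (map_le_iff_le_comap.1 hcont.continuousAt) ?_,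
      fun z w hzw => ?_⟩
    · rw [nhds_subtype, ← hG z z.2]
      refine (comap_mono (tendsto_iff_comap.1 (hGc z z.2))).trans ?_
      rw [comap_comap]
      refine le_of_eq ?_
      congr 1
      funext w
      exact hG w w.2
    · have := congrArg G hzw
      exact Subtype.ext ((hG z z.2).symm.trans (this.trans (hG w w.2)))

theorem shrinksTo_chartStrip (hΦ : Φ ∈ IsManifold.maximalAtlas (𝓡 3) ∞ M) {p : M}
    (hp : p ∈ Φ.source) (hp0 : Φ p = 0) {c : ℝ}
    (h : ∀ τ ∈ Ioo (0 : ℝ) 1, IsChartStrip Φ (c * τ)) :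
    ShrinksTo (fun τ => chartStrip Φ (c * τ)) p := by
  have hev : ∀ᶠ τ in 𝓝[>] (0 : ℝ), τ ∈ Ioo (0 : ℝ) 1 := Ioo_mem_nhdsGT one_pos
  refine ⟨Φ, hΦ, hp, ?_, fun m => ?_⟩
  · filter_upwards [hev] with τ hτ z hz using chartStrip_mem (h τ hτ) hz
  -- In coordinates the strip is εA + ε²B with A and B fixed smooth functions of (`stripRe`,
  -- `stripIm`), whose derivatives of each order are bounded on the strip.
  let A : ℝ × ℝ → ℝ × E3 := fun w => (0, !₂[w.1, w.2, 0])
  let B : ℝ × ℝ → ℝ × E3 := fun w => ((w.1 ^ 2 + w.2 ^ 2 - 1) / 4, !₂[0, 0, -(w.1 * w.2) / 2])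
  have hA : ContDiff ℝ ∞ A := by
    refine contDiff_const.prodMk (contDiff_euclidean.2 fun i => ?_)
    fin_cases i <;> simp <;> fun_prop
  have hB : ContDiff ℝ ∞ B := by
    refine ContDiff.prodMk (by fun_prop) (contDiff_euclidean.2 fun i => ?_)
    fin_cases i <;> simp <;> fun_prop
  have hv : ContDiffOn ℝ ∞ (fun z => (stripRe z, stripIm z)) strip :=
    (contDiffOn_stripRe.prodMk contDiffOn_stripIm).mono strip_subset_stripDom
  have hAv : ContDiffOn ℝ ∞ (fun z => A (stripRe z, stripIm z)) strip := hA.comp_contDiffOn hv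
  have hBv : ContDiffOn ℝ ∞ (fun z => B (stripRe z, stripIm z)) strip := hB.comp_contDiffOn hv
  obtain ⟨KA, hKA⟩ := exists_bound_iteratedFDerivWithin_strip m hA
  obtain ⟨KB, hKB⟩ := exists_bound_iteratedFDerivWithin_strip m hB
  have hz0 : ((0 : ℝ), (0 : ℝ)) ∈ strip := ⟨mem_univ _, by simp⟩
  have hKA0 : 0 ≤ KA := (norm_nonneg _).trans (hKA _ hz0)
  have hKB0 : 0 ≤ KB := (norm_nonneg _).trans (hKB _ hz0)
  have hbound : ∀ τ ∈ Ioo (0 : ℝ) 1, ∀ z ∈ strip, ‖iteratedFDerivWithin ℝ m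
      (fun z => ((chartStrip Φ (c * τ) z).1, Φ (chartStrip Φ (c * τ) z).2)) strip z‖
        ≤ |c * τ| * KA + (c * τ) ^ 2 * KB := by
    intro τ hτ z hz
    have h1 : EqOn (fun z => ((chartStrip Φ (c * τ) z).1, Φ (chartStrip Φ (c * τ) z).2))
        ((c * τ) • (fun z => A (stripRe z, stripIm z))
          + (c * τ) ^ 2 • (fun z => B (stripRe z, stripIm z))) strip := by
      intro w hw
      refine Prod.ext ?_ ?_
      · simp only [chartStrip, modelStrip_fst _ (strip_subset_stripDom hw), A, B, Pi.add_apply,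
          Pi.smul_apply, Prod.fst_add, Prod.smul_fst, smul_eq_mul]
        ring
      · refine (chart_chartStrip (h τ hτ) hw).trans ?_
        ext i
        fin_cases i
        · simpa [A, B] using modelStrip_zero (c * τ) w
        · simpa [A, B] using modelStrip_one (c * τ) w
        · refine (modelStrip_two (c * τ) w).trans ?_
          simp [A, B]
          ring
    have hA' := (hAv.of_le (m := m) (by exact_mod_cast le_top)) z hz
    have hB' := (hBv.of_le (m := m) (by exact_mod_cast le_top)) z hz
    have e1 := iteratedFDerivWithin_add_apply
      (f := (c * τ) • fun z => A (stripRe z, stripIm z))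
      (g := (c * τ) ^ 2 • fun z => B (stripRe z, stripIm z))
      (hA'.const_smul (c * τ)) (hB'.const_smul ((c * τ) ^ 2)) uniqueDiffOn_strip hz
    have e2 := iteratedFDerivWithin_const_smul_apply (a := c * τ) hA' uniqueDiffOn_strip hz
    have e3 := iteratedFDerivWithin_const_smul_apply (a := (c * τ) ^ 2) hB' uniqueDiffOn_strip hz
    rw [iteratedFDerivWithin_congr h1 hz, e1]
    refine le_of_eq_of_le (congrArg norm (congrArg₂ (· + ·) e2 e3)) ?_
    refine (norm_add_le _ _).trans ?_
    rw [norm_smul, norm_smul, Real.norm_eq_abs, Real.norm_eq_abs, abs_sq]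
    exact add_le_add (mul_le_mul_of_nonneg_left (hKA z hz) (abs_nonneg _))
      (mul_le_mul_of_nonneg_left (hKB z hz) (sq_nonneg _))
  have hzero : iteratedFDerivWithin ℝ m (fun _ : ℝ × ℝ => ((0 : ℝ), Φ p)) strip = 0 := by
    rw [hp0]
    exact iteratedFDerivWithin_fun_zero
  rw [hzero, Metric.tendstoUniformlyOn_iff]
  intro δ hδ
  have hlim : Tendsto (fun τ : ℝ => |c * τ| * KA + (c * τ) ^ 2 * KB) (𝓝[>] 0) (𝓝 0) := by
    have : Continuous (fun τ : ℝ => |c * τ| * KA + (c * τ) ^ 2 * KB) := by fun_prop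
    refine tendsto_nhdsWithin_of_tendsto_nhds ?_
    simpa using this.tendsto 0
  filter_upwards [hev, hlim.eventually (gt_mem_nhds hδ)] with τ hτ hτδ z hz
  rw [Pi.zero_apply, dist_zero_left]
  exact (hbound τ hτ z hz).trans_lt hτδ

end ChartStrip

/-! ### Charts and local parametrizations of surfaces with boundary. -/

section ChartsOfSurfaces

variable {F : Type*} [TopologicalSpace F] [ChartedSpace (EuclideanHalfSpace 2) F]

theorem isBoundaryPoint_halfSpace_iff (x : EuclideanHalfSpace 2) :
    (𝓡∂ 2).IsBoundaryPoint x ↔ x.1 0 = 0 := by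
  rw [ModelWithCorners.isBoundaryPoint_iff, frontier_range_modelWithCornersEuclideanHalfSpace]
  exact eq_comm

/-- Charts of the maximal atlas are local diffeomorphisms to the half-plane, and these preserve
boundary points. -/
theorem mem_boundary_iff_of_mem_maximalAtlas [IsManifold (𝓡∂ 2) ∞ F]
    {φ : OpenPartialHomeomorph F (EuclideanHalfSpace 2)}
    (hφ : φ ∈ IsManifold.maximalAtlas (𝓡∂ 2) ∞ F) {z : F} (hz : z ∈ φ.source) :
    z ∈ (𝓡∂ 2).boundary F ↔ φ.extend (𝓡∂ 2) z 0 = 0 := by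
  let ψ : PartialDiffeomorph (𝓡∂ 2) (𝓡∂ 2) F (EuclideanHalfSpace 2) ∞ :=
    { φ.toPartialEquiv with
      open_source := φ.open_source
      open_target := φ.open_target
      contMDiffOn_toFun := contMDiffOn_of_mem_maximalAtlas hφ
      contMDiffOn_invFun := contMDiffOn_symm_of_mem_maximalAtlas hφ }
  have h : IsLocalDiffeomorphAt (𝓡∂ 2) (𝓡∂ 2) ∞ φ z := ⟨ψ, hz, fun _ _ => rfl⟩
  exact (h.isBoundaryPoint_iff (by simp)).trans (isBoundaryPoint_halfSpace_iff _)

theorem mem_range_halfSpace_iff (w : E2) : w ∈ range (𝓡∂ 2) ↔ 0 ≤ w 0 := by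
  rw [range_modelWithCornersEuclideanHalfSpace]
  exact Iff.rfl

theorem mfderiv_extend_injective {φ : OpenPartialHomeomorph F (EuclideanHalfSpace 2)}
    (hφ : φ ∈ IsManifold.maximalAtlas (𝓡∂ 2) ∞ F) {z : F} (hz : z ∈ φ.source) :
    Function.Injective (mfderiv (𝓡∂ 2) 𝓘(ℝ, E2) (φ.extend (𝓡∂ 2)) z) := by
  have h1 : MDifferentiableAt (𝓡∂ 2) 𝓘(ℝ, E2) (φ.extend (𝓡∂ 2)) z :=
    (φ.contMDiffAt_extend hφ hz).mdifferentiableAt (by simp)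
  have h2 : MDifferentiableWithinAt 𝓘(ℝ, E2) (𝓡∂ 2) (φ.extend (𝓡∂ 2)).symm
      ((𝓡∂ 2) '' φ.target) (φ.extend (𝓡∂ 2) z) :=
    (contMDiffOn_extend_symm hφ).mdifferentiableOn (by simp) (φ.extend (𝓡∂ 2) z)
      ⟨φ z, φ.map_source hz, rfl⟩
  have hs : φ.source ∈ 𝓝 z := φ.open_source.mem_nhds hz
  have h3 := (h2.hasMFDerivWithinAt.comp z (h1.hasMFDerivAt.hasMFDerivWithinAt (s := φ.source))
    fun y hy => ⟨φ y, φ.map_source hy, rfl⟩).hasMFDerivAt hs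
  have h4 := h3.congr_of_eventuallyEq (f₁ := id) (by
    filter_upwards [hs] with y hy
    exact ((φ.extend (𝓡∂ 2)).left_inv (by rwa [φ.extend_source])).symm)
  have h5 := hasMFDerivAt_unique h4 (hasMFDerivAt_id z)
  exact Function.LeftInverse.injective (g := mfderivWithin 𝓘(ℝ, E2) (𝓡∂ 2)
    (φ.extend (𝓡∂ 2)).symm ((𝓡∂ 2) '' φ.target) (φ.extend (𝓡∂ 2) z))
    fun v => DFunLike.congr_fun h5 v

theorem mfderiv_extend_surjective {φ : OpenPartialHomeomorph F (EuclideanHalfSpace 2)}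
    (hφ : φ ∈ IsManifold.maximalAtlas (𝓡∂ 2) ∞ F) {z : F} (hz : z ∈ φ.source) :
    Function.Surjective (mfderiv (𝓡∂ 2) 𝓘(ℝ, E2) (φ.extend (𝓡∂ 2)) z) := by
  let A : E2 →ₗ[ℝ] E2 := (mfderiv (𝓡∂ 2) 𝓘(ℝ, E2) (φ.extend (𝓡∂ 2)) z).toLinearMap
  have hA : Function.Injective A := mfderiv_extend_injective hφ hz
  have hs : Function.Surjective A := LinearMap.injective_iff_surjective.1 hA
  exact hs

variable {M : Type*} [TopologicalSpace M] [ChartedSpace E3 M] {f : F → M}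

theorem coordD_mfderiv_eq_of_param {Φ : OpenPartialHomeomorph M E3}
    (hΦ : Φ ∈ IsManifold.maximalAtlas (𝓡 3) ∞ M)
    {φ : OpenPartialHomeomorph F (EuclideanHalfSpace 2)}
    (hφ : φ ∈ IsManifold.maximalAtlas (𝓡∂ 2) ∞ F) {W : Set E2} {G : E2 → E3} (hW : IsOpen W)
    (hG : ContDiffOn ℝ ∞ G W) (hpar : ∀ z' ∈ φ.source, f z' ∈ Φ.source →
      φ.extend (𝓡∂ 2) z' ∈ W ∧ Φ (f z') = G (φ.extend (𝓡∂ 2) z'))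
    {z : F} (hz : z ∈ φ.source) (hfz : f z ∈ Φ.source)
    (hf : MDifferentiableAt (𝓡∂ 2) (𝓡 3) f z) (v : TangentSpace (𝓡∂ 2) z) :
    coordD Φ (f z) (mfderiv (𝓡∂ 2) (𝓡 3) f z v) = fderiv ℝ G (φ.extend (𝓡∂ 2) z)
      (mfderiv (𝓡∂ 2) 𝓘(ℝ, E2) (φ.extend (𝓡∂ 2)) z v) := by
  have h1 : HasMFDerivAt (𝓡∂ 2) 𝓘(ℝ, E3) (Φ ∘ f) z _ :=
    ((mdifferentiable_of_mem_maximalAtlas hΦ).mdifferentiableAt hfz).hasMFDerivAt.comp z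
      hf.hasMFDerivAt
  have hGd : DifferentiableAt ℝ G (φ.extend (𝓡∂ 2) z) :=
    (hG.contDiffAt (hW.mem_nhds (hpar z hz hfz).1)).differentiableAt (by simp)
  have h2 := hGd.hasFDerivAt.hasMFDerivAt.comp z
    ((φ.contMDiffAt_extend hφ hz).mdifferentiableAt (by simp)).hasMFDerivAt
  have h3 := h2.congr_of_eventuallyEq (f₁ := Φ ∘ f) (by
    filter_upwards [φ.open_source.mem_nhds hz,
      hf.continuousAt.preimage_mem_nhds (Φ.open_source.mem_nhds hfz)] with y hy hy'
    exact (hpar y hy hy').2)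
  exact DFunLike.congr_fun (hasMFDerivAt_unique h1 h3) v

variable [IsManifold (𝓡 3) ∞ M]

/-- In suitable charts, an immersed surface with boundary is the restriction to a half-plane of
an immersion of an open subset of the plane. -/
theorem exists_local_param {z : F} (hf : IsImmersionAt (𝓡∂ 2) (𝓡 3) ∞ f z)
    {Φ : OpenPartialHomeomorph M E3} (hΦ : Φ ∈ IsManifold.maximalAtlas (𝓡 3) ∞ M) :
    ∃ φ ∈ IsManifold.maximalAtlas (𝓡∂ 2) ∞ F, z ∈ φ.source ∧
      ∃ (W : Set E2) (G : E2 → E3), IsOpen W ∧ ContDiffOn ℝ ∞ G W ∧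
        (∀ w ∈ W, Function.Injective (fderiv ℝ G w)) ∧
        ∀ z' ∈ φ.source, f z' ∈ Φ.source →
          φ.extend (𝓡∂ 2) z' ∈ W ∧ Φ (f z') = G (φ.extend (𝓡∂ 2) z') := by
  obtain ⟨C, _, _, hc⟩ := hf
  set φ := hc.domChart with hφ
  set ψ := hc.codChart with hψ
  have hψa : ψ ∈ IsManifold.maximalAtlas (𝓡 3) ∞ M := hc.codChart_mem_maximalAtlas
  -- In immersion charts the surface is this linear inclusion restricted to the half-plane. The
  -- inclusion is defined on the whole plane, which lets `G` extend across the boundary.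
  let ι : E2 → E3 := fun w => hc.equiv (w, 0)
  let π : E3 → E2 := fun x => (hc.equiv.symm x).1
  have hι : ContDiff ℝ ∞ ι := hc.equiv.contDiff.comp (contDiff_id.prodMk contDiff_const)
  have hπ : ContDiff ℝ ∞ π := contDiff_fst.comp hc.equiv.symm.contDiff
  let T := ψ.symm.trans Φ
  have hTs : ContDiffOn ℝ ∞ T T.source :=
    ((contMDiffOn_of_mem_maximalAtlas hΦ).comp
      ((contMDiffOn_symm_of_mem_maximalAtlas hψa).mono fun x hx => hx.1)
        fun x hx => hx.2).contDiffOn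
  have hTt : ContDiffOn ℝ ∞ T.symm T.target :=
    ((contMDiffOn_of_mem_maximalAtlas hψa).comp
      ((contMDiffOn_symm_of_mem_maximalAtlas hΦ).mono fun x hx => hx.1)
        fun x hx => hx.2).contDiffOn
  have hWo : IsOpen (ι ⁻¹' T.source) := T.open_source.preimage hι.continuous
  have hG : ContDiffOn ℝ ∞ (fun w => T (ι w)) (ι ⁻¹' T.source) :=
    hTs.comp hι.contDiffOn fun w hw => hw
  refine ⟨φ, hc.domChart_mem_maximalAtlas, hc.mem_domChart_source, ι ⁻¹' T.source,
    fun w => T (ι w), hWo, hG, fun w hw => ?_, fun z' hz' hfz' => ?_⟩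
  · have h1 : HasFDerivAt (fun w => T (ι w)) (fderiv ℝ (fun w => T (ι w)) w) w :=
      ((hG.contDiffAt (hWo.mem_nhds hw)).differentiableAt (by simp)).hasFDerivAt
    have h2 : DifferentiableAt ℝ (fun x => π (T.symm x)) (T (ι w)) :=
      ((hπ.comp_contDiffOn hTt).contDiffAt
        (T.open_target.mem_nhds (T.map_source hw))).differentiableAt (by simp)
    have h3 := h2.hasFDerivAt.comp w h1
    have h4 := h3.congr_of_eventuallyEq (f₁ := id) (by
      filter_upwards [hWo.mem_nhds hw] with y hy
      have h5 : T.symm (T (ι y)) = ι y := T.left_inv hy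
      simp only [Function.comp, h5, ι, π, id, ContinuousLinearEquiv.symm_apply_apply])
    have h5 := h4.unique (hasFDerivAt_id w)
    exact Function.LeftInverse.injective (g := fderiv ℝ (fun x => π (T.symm x)) (T (ι w)))
      fun v => DFunLike.congr_fun h5 v
  · have h1 : ψ (f z') = ι (φ.extend (𝓡∂ 2) z') := by
      have hz2 : z' ∈ (φ.extend (𝓡∂ 2)).source := by rwa [φ.extend_source]
      have := hc.writtenInCharts ((φ.extend (𝓡∂ 2)).map_source hz2)
      simp only [Function.comp] at this
      rw [(φ.extend (𝓡∂ 2)).left_inv hz2] at this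
      exact this
    have h2 : f z' ∈ ψ.source := hc.source_subset_preimage_source hz'
    have h3 : ψ.symm (ψ (f z')) = f z' := ψ.left_inv h2
    refine ⟨?_, ?_⟩
    · rw [mem_preimage, ← h1]
      refine ⟨ψ.map_source h2, ?_⟩
      change ψ.symm (ψ (f z')) ∈ Φ.source
      rwa [h3]
    · refine Eq.trans ?_ (congrArg T h1)
      change Φ (f z') = Φ (ψ.symm (ψ (f z')))
      rw [h3]

theorem IsImmersionAt.mfderiv_injective {z : F} (hf : IsImmersionAt (𝓡∂ 2) (𝓡 3) ∞ f z) :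
    Function.Injective (mfderiv (𝓡∂ 2) (𝓡 3) f z) := by
  have hΦ := IsManifold.chart_mem_maximalAtlas (I := 𝓡 3) (n := ∞) (f z)
  obtain ⟨φ, hφ, hz, W, G, hW, hG, hGi, hpar⟩ := exists_local_param hf hΦ
  have hfz := mem_chart_source E3 (f z)
  intro v w hvw
  refine mfderiv_extend_injective hφ hz (hGi _ (hpar z hz hfz).1 ?_)
  have hd := hf.contMDiffAt.mdifferentiableAt (by simp)
  rw [← coordD_mfderiv_eq_of_param hΦ hφ hW hG hpar hz hfz hd,
    ← coordD_mfderiv_eq_of_param hΦ hφ hW hG hpar hz hfz hd]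
  exact congrArg _ hvw

end ChartsOfSurfaces

/-! ### Tangent planes of the surface and of the knot in a normal chart. -/

section NormalCharts

variable {M : Type*} [TopologicalSpace M] [ChartedSpace E3 M]
  {F : Type*} [TopologicalSpace F] [ChartedSpace (EuclideanHalfSpace 2) F]

/-- Comparing components in one chart replaces the transport between tangent spaces at equal base
points. -/
theorem tangentBundle_ext {Φ : OpenPartialHomeomorph M E3}
    (hΦ : Φ ∈ IsManifold.maximalAtlas (𝓡 3) ∞ M) {q q' : M} (hq : q ∈ Φ.source) (h : q = q')
    {v : TangentSpace (𝓡 3) q} {v' : TangentSpace (𝓡 3) q'}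
    (hv : coordD Φ q v = coordD Φ q' v') :
    (⟨q, v⟩ : TangentBundle (𝓡 3) M) = ⟨q', v'⟩ := by
  subst h
  rw [coordD_injective hΦ hq hv]

/-- The part of the definition of a normal chart which concerns the contact form, the knot and
the surface. -/
structure IsSurfaceChart (lam : OneForm M) (k : ℝ → M) (f : F → M) (p : M) (σ : ℝ)
    (Φ : OpenPartialHomeomorph M E3) : Prop extends IsContactChart lam Φ where
  mem_source : p ∈ Φ.source
  center : Φ p = 0
  knot : ∀ q ∈ Φ.source, q ∈ range k ↔ Φ q 1 = 0 ∧ Φ q 2 = 0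
  oriented : ∀ r : ℝ, k r ∈ Φ.source → 0 < coordD Φ (k r) (velocity k r) 0
  surface : ∀ q ∈ Φ.source,
    q ∈ range f ↔ Φ q 2 = -(1 / 2) * Φ q 0 * Φ q 1 ∧ σ * Φ q 1 ≤ 0

namespace IsSurfaceChart

variable {lam : OneForm M} {k : ℝ → M} {f : F → M} {p : M} {σ : ℝ}
  {Φ : OpenPartialHomeomorph M E3}

/-- Differentiation of the equation y + θx/2 = 0, which holds identically along the surface. -/
theorem tangent (h : IsSurfaceChart lam k f p σ Φ) {z : F} (hz : f z ∈ Φ.source)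
    (hf : MDifferentiableAt (𝓡∂ 2) (𝓡 3) f z) (v : TangentSpace (𝓡∂ 2) z) :
    coordD Φ (f z) (mfderiv (𝓡∂ 2) (𝓡 3) f z v) 2 = -(1 / 2) *
      (Φ (f z) 0 * coordD Φ (f z) (mfderiv (𝓡∂ 2) (𝓡 3) f z v) 1
        + Φ (f z) 1 * coordD Φ (f z) (mfderiv (𝓡∂ 2) (𝓡 3) f z v) 0) := by
  have hp : ∀ i, HasFDerivAt (fun x : E3 => x i) (EuclideanSpace.proj (𝕜 := ℝ) i) (Φ (f z)) :=
    fun i => (EuclideanSpace.proj (𝕜 := ℝ) i).hasFDerivAt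
  have h1 : HasFDerivAt (fun x : E3 => x 2 + 1 / 2 * (x 0 * x 1)) _ (Φ (f z)) :=
    (hp 2).add (((hp 0).mul (hp 1)).const_mul (1 / 2))
  have h2 := h1.hasMFDerivAt.comp z
    (((mdifferentiable_of_mem_maximalAtlas h.mem_atlas).mdifferentiableAt hz).hasMFDerivAt.comp z
      hf.hasMFDerivAt)
  have h3 := h2.congr_of_eventuallyEq (f₁ := fun _ => (0 : ℝ)) (by
    filter_upwards [hf.continuousAt.preimage_mem_nhds (Φ.open_source.mem_nhds hz)] with y hy
    have := ((h.surface (f y) hy).1 ⟨y, rfl⟩).1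
    simp only [Function.comp]
    rw [this]
    ring)
  have h4 := DFunLike.congr_fun (hasMFDerivAt_unique h3 (hasMFDerivAt_const (0 : ℝ) z)) v
  have h5 : coordD Φ (f z) (mfderiv (𝓡∂ 2) (𝓡 3) f z v) 2 + 1 / 2 *
      (Φ (f z) 0 * coordD Φ (f z) (mfderiv (𝓡∂ 2) (𝓡 3) f z v) 1
        + Φ (f z) 1 * coordD Φ (f z) (mfderiv (𝓡∂ 2) (𝓡 3) f z v) 0) = 0 := h4
  linarith

/-- On tangent vectors the y-component is determined by the other two, so injectivity of the
differential passes to its (θ, x)-part, which is then onto by dimension. -/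
theorem exists_tangent (h : IsSurfaceChart lam k f p σ Φ) {z : F} (hz : f z ∈ Φ.source)
    (hf : MDifferentiableAt (𝓡∂ 2) (𝓡 3) f z)
    (hi : Function.Injective (mfderiv (𝓡∂ 2) (𝓡 3) f z)) {w : E3}
    (hw : w 2 = -(1 / 2) * (Φ (f z) 0 * w 1 + Φ (f z) 1 * w 0)) :
    ∃ v : TangentSpace (𝓡∂ 2) z, coordD Φ (f z) (mfderiv (𝓡∂ 2) (𝓡 3) f z v) = w := by
  let A : E2 →ₗ[ℝ] E3 := ((modelDeriv Φ (f z)).comp (mfderiv (𝓡∂ 2) (𝓡 3) f z)).toLinearMap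
  have hA : ∀ v : E2, A v = coordD Φ (f z) (mfderiv (𝓡∂ 2) (𝓡 3) f z v) := fun _ => rfl
  have hA2 : ∀ v : E2, A v 2 = -(1 / 2) * (Φ (f z) 0 * A v 1 + Φ (f z) 1 * A v 0) :=
    fun v => h.tangent hz hf v
  have hAi : Function.Injective A := fun v v' hv => hi (coordD_injective h.mem_atlas hz hv)
  let B : E2 →ₗ[ℝ] Fin 2 → ℝ :=
    LinearMap.pi ![(EuclideanSpace.proj (𝕜 := ℝ) (0 : Fin 3)).toLinearMap ∘ₗ A,
      (EuclideanSpace.proj (𝕜 := ℝ) (1 : Fin 3)).toLinearMap ∘ₗ A]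
  have hB0 : ∀ v, B v 0 = A v 0 := fun _ => rfl
  have hB1 : ∀ v, B v 1 = A v 1 := fun _ => rfl
  have hBi : Function.Injective B := by
    intro v v' hv
    have e0 : A v 0 = A v' 0 := by rw [← hB0, hv, hB0]
    have e1 : A v 1 = A v' 1 := by rw [← hB1, hv, hB1]
    refine hAi ?_
    ext i
    fin_cases i
    · exact e0
    · exact e1
    · exact (hA2 v).trans (by rw [e0, e1]; exact (hA2 v').symm)
  have hBs : Function.Surjective B :=
    (LinearMap.injective_iff_surjective_of_finrank_eq_finrank (by simp)).1 hBi
  obtain ⟨v, hv⟩ := hBs ![w 0, w 1]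
  refine ⟨v, ?_⟩
  have e0 : A v 0 = w 0 := by rw [← hB0, hv]; rfl
  have e1 : A v 1 = w 1 := by rw [← hB1, hv]; rfl
  ext i
  fin_cases i
  · exact e0
  · exact e1
  · exact (hA2 v).trans (by rw [e0, e1]; exact hw.symm)

/-- At a singular point the contact vector ∂_θ - x∂_y would be tangent to y = -θx/2, which forces x
= x/2. -/
theorem not_isSingularPt (h : IsSurfaceChart lam k f p σ Φ) {z : F} (hz : f z ∈ Φ.source)
    (hf : MDifferentiableAt (𝓡∂ 2) (𝓡 3) f z) (hx : Φ (f z) 1 ≠ 0) : ¬ IsSingularPt lam f z := by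
  intro hs
  obtain ⟨w, hw⟩ := (hs (coordInv Φ (f z) !₂[1, 0, -Φ (f z) 1])).2 (by
    rw [h.form _ hz, coordD_coordInv h.mem_atlas hz]
    simp)
  have h1 := h.tangent hz hf w
  rw [hw, coordD_coordInv h.mem_atlas hz] at h1
  simp at h1
  apply hx
  linarith

theorem coordD_velocity (h : IsSurfaceChart lam k f p σ Φ) (hk : IsLegendrianKnot lam k) {r : ℝ}
    (hr : k r ∈ Φ.source) :
    coordD Φ (k r) (velocity k r) = coordD Φ (k r) (velocity k r) 0 • stdVec 0 := by
  have hd : MDifferentiableAt 𝓘(ℝ, ℝ) (𝓡 3) k r := hk.smooth.mdifferentiable (by simp) r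
  have h0 := (h.knot (k r) hr).1 ⟨r, rfl⟩
  have h1 : coordD Φ (k r) (velocity k r) 1 = 0 := by
    have hp : HasFDerivAt (fun x : E3 => x 1) (EuclideanSpace.proj (𝕜 := ℝ) (1 : Fin 3))
      (Φ (k r)) := (EuclideanSpace.proj (𝕜 := ℝ) (1 : Fin 3)).hasFDerivAt
    have h2 := hp.hasMFDerivAt.comp r
      (((mdifferentiable_of_mem_maximalAtlas h.mem_atlas).mdifferentiableAt hr).hasMFDerivAt.comp r
        hd.hasMFDerivAt)
    have h3 := h2.congr_of_eventuallyEq (f₁ := fun _ => (0 : ℝ)) (by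
      filter_upwards [hd.continuousAt.preimage_mem_nhds (Φ.open_source.mem_nhds hr)] with y hy
      exact ((h.knot (k y) hy).1 ⟨y, rfl⟩).1.symm)
    exact DFunLike.congr_fun (hasMFDerivAt_unique h3 (hasMFDerivAt_const (0 : ℝ) r)) (1 : ℝ)
  have h2 : coordD Φ (k r) (velocity k r) 2 = 0 := by
    have := h.form _ hr (velocity k r)
    rw [hk.legendrian, h0.1] at this
    linarith
  ext i
  fin_cases i
  · simp
  · simpa using h1
  · simpa using h2

end IsSurfaceChart

theorem IsNormalChart.isSurfaceChart {lam : OneForm M} {J : EndField M} {k : ℝ → M} {f : F → M}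
    {p : M} {σ : ℝ} {Φ : OpenPartialHomeomorph M E3} (h : IsNormalChart lam J k f p σ Φ) :
    IsSurfaceChart lam k f p σ Φ where
  mem_atlas := h.mem_atlas
  form := h.form
  mem_source := h.mem_source
  center := h.center
  knot := h.knot
  oriented := h.oriented
  surface := h.surface

end NormalCharts

/-! ### The strips solve the boundary value problem. -/

section Solutions

variable {M : Type*} [TopologicalSpace M] [ChartedSpace E3 M] [IsManifold (𝓡 3) ∞ M]
  {F : Type*} [TopologicalSpace F] [ChartedSpace (EuclideanHalfSpace 2) F]
  {lam : OneForm M} {J : EndField M} {k : ℝ → M} {f : F → M} {p : M} {σ ε : ℝ}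
  {Φ : OpenPartialHomeomorph M E3}

theorem IsContactChart.lam_reeb (h : IsContactChart lam Φ) {q : M} (hq : q ∈ Φ.source) :
    lam q (reeb lam q) = 1 := by
  rw [h.form q hq, h.coordD_reeb hq]
  simp

theorem IsContactChart.coordD_contactProj (h : IsContactChart lam Φ) {q : M} (hq : q ∈ Φ.source)
    (v : TangentSpace (𝓡 3) q) :
    coordD Φ q (contactProj lam q v) = coordD Φ q v - lam q v • stdVec 2 := by
  rw [contactProj, coordD_sub, coordD_smul, h.coordD_reeb hq]

theorem IsContactChart.lam_contactProj (h : IsContactChart lam Φ) {q : M} (hq : q ∈ Φ.source)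
    (v : TangentSpace (𝓡 3) q) : lam q (contactProj lam q v) = 0 := by
  rw [contactProj, map_sub, map_smul, h.lam_reeb hq]
  simp

theorem IsContactChart.lam_dStrip (h : IsContactChart lam Φ) (hε : IsChartStrip Φ ε) {z : ℝ × ℝ}
    (hz : z ∈ strip) (c : ℝ × ℝ) :
    lam (chartStrip Φ ε z).2 (dStrip (chartStrip Φ ε) z c).2 = ε ^ 2 / 2 *
      (stripIm z * (stripP z * c.1 + stripQ z * c.2)
        - stripRe z * (stripQ z * c.1 - stripP z * c.2)) := by
  rw [h.form _ (chartStrip_mem hε hz), coordD_dStrip h.mem_atlas hε hz, chart_chartStrip hε hz,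
    modelStrip_one]
  simp
  ring

/-- Since λ(∂_t u) = ∂_s a and λ(∂_s u) = -∂_t a, the term with φ' is |∇a|²; the other term is dx ∧
dθ on the derivatives, ε²(P² + Q²). -/
theorem IsContactChart.energyDensity_chartStrip (h : IsContactChart lam Φ)
    (hε : IsChartStrip Φ ε) {z : ℝ × ℝ} (hz : z ∈ strip) (φ : ℝ → ℝ) :
    energyDensity lam φ (chartStrip Φ ε) z = modelEnergy φ ε z := by
  rw [energyDensity, partialS, partialT, h.lam_dStrip hε hz, h.lam_dStrip hε hz,
    dStrip_chartStrip_fst hz, dStrip_chartStrip_fst hz,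
    fderiv_modelStrip_fst _ (strip_subset_stripDom hz),
    fderiv_modelStrip_fst _ (strip_subset_stripDom hz), h.extD_eq (chartStrip_mem hε hz),
    coordD_dStrip h.mem_atlas hε hz, coordD_dStrip h.mem_atlas hε hz]
  simp [modelEnergy, stripAs, stripAt, chartStrip]
  ring

theorem IsContactChart.hasFiniteEnergy (h : IsContactChart lam Φ) (hε : IsChartStrip Φ ε)
    (hε1 : |ε| ≤ 1) : HasFiniteEnergy lam (chartStrip Φ ε) := by
  obtain ⟨C, hC⟩ := modelEnergy_bound hε1
  refine ⟨C, fun φ hφ hφ1 _ => ?_⟩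
  have heq : EqOn (energyDensity lam φ (chartStrip Φ ε)) (modelEnergy φ ε) strip := fun z hz =>
    h.energyDensity_chartStrip hε hz φ
  rw [integrableOn_congr_fun heq isClosed_strip.measurableSet,
    setIntegral_congr_fun isClosed_strip.measurableSet heq]
  exact hC φ hφ hφ1

/-- The component along ∂_τ is ∂_s a = λ(∂_t u), the components along θ and x are the Cauchy–Riemann
equations, and the one along y follows because J takes values in the kernel of λ. -/
theorem IsNormalChart.holomorphic (h : IsNormalChart lam J k f p σ Φ) (hJ : IsCompatible lam J)
    (hε : IsChartStrip Φ ε) {z : ℝ × ℝ} (hz : z ∈ strip) :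
    partialS (chartStrip Φ ε) z
      + symplJ lam J (chartStrip Φ ε z).2 (partialT (chartStrip Φ ε) z) = 0 := by
  have hc : IsContactChart lam Φ := h.isSurfaceChart.toIsContactChart
  have hq := chartStrip_mem hε hz
  have hz' := strip_subset_stripDom hz
  set q := (chartStrip Φ ε z).2 with hqdef
  have hS := coordD_dStrip hc.mem_atlas hε hz (1, 0)
  have hT := coordD_dStrip hc.mem_atlas hε hz (0, 1)
  have hlT := hc.lam_dStrip hε hz (0, 1)
  have haS : (partialS (chartStrip Φ ε) z).1 = _ :=
    (dStrip_chartStrip_fst hz (1, 0)).trans (fderiv_modelStrip_fst ε hz' (1, 0))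
  have haT : (partialT (chartStrip Φ ε) z).1 = _ :=
    (dStrip_chartStrip_fst hz (0, 1)).trans (fderiv_modelStrip_fst ε hz' (0, 1))
  set S := partialS (chartStrip Φ ε) z with hSdef
  set V := partialT (chartStrip Φ ε) z with hVdef
  change coordD Φ q S.2 = _ at hS
  change coordD Φ q V.2 = _ at hT
  change lam q V.2 = _ at hlT
  have hW0 := hc.lam_contactProj hq V.2
  obtain ⟨hJ0, hJ1⟩ := h.complex q hq _ hW0
  have hJ2 := hc.form q hq (J q (contactProj lam q V.2))
  rw [hJ.map_ker q _ hW0, hJ0] at hJ2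
  rw [hc.coordD_contactProj hq, hT] at hJ0 hJ1 hJ2
  have hx1 : Φ q 1 = ε * stripIm z := by
    rw [hqdef, chart_chartStrip hε hz, modelStrip_one]
  rw [hx1] at hJ2
  simp at haS haT hS hT hlT hJ0 hJ1 hJ2
  refine Prod.ext ?_ ?_
  · change S.1 + -lam q V.2 = 0
    rw [haS, hlT]
    ring
  · change S.2 + (V.1 • reeb lam q + J q (contactProj lam q V.2)) = 0
    rw [← coordD_eq_zero hc.mem_atlas hq, coordD_add, coordD_add, coordD_smul, hc.coordD_reeb hq]
    ext i
    fin_cases i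
    · simp [hS, hJ0]
    · simp [hS, hJ1]
    · simp [hS, haT]
      linear_combination -hJ2

/-- At `t = 0` both x and y vanish. At `t = 1` one has a = 0 and `stripIm < 0`, so the sign
condition on `ε` puts the arc on the side σx ≤ 0 of the surface, and x ≠ 0 excludes singular points.
-/
theorem IsNormalChart.isSolution (h : IsNormalChart lam J k f p σ Φ) (hJ : IsCompatible lam J)
    (hf : ContMDiff (𝓡∂ 2) (𝓡 3) ∞ f) (hε : IsChartStrip Φ ε) (hε1 : |ε| ≤ 1)
    (hσ : 0 < σ * ε) : IsSolution lam J k f (chartStrip Φ ε) where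
  smooth := contMDiffOn_chartStrip_right h.mem_atlas hε
  holomorphic z hz := h.holomorphic hJ hε hz
  boundary_zero s := by
    have hz : ((s, 0) : ℝ × ℝ) ∈ strip := ⟨mem_univ _, by simp⟩
    refine (h.knot _ (chartStrip_mem hε hz)).2 ?_
    rw [chart_chartStrip hε hz, modelStrip_one, modelStrip_two]
    simp [stripIm]
  boundary_one s := by
    have hz : ((s, 1) : ℝ × ℝ) ∈ strip := ⟨mem_univ _, by simp⟩
    have hz' := strip_subset_stripDom hz
    have hq := chartStrip_mem hε hz
    have hε0 : ε ≠ 0 := fun h0 => by simp [h0] at hσ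
    have hD : 0 < stripDen (s, 1) := hz'
    have hX : stripIm (s, 1) < 0 := by
      simp only [stripIm, mul_one, Real.sin_pi_div_two]
      exact div_neg_of_neg_of_pos (by norm_num) hD
    refine ⟨?_, ?_⟩
    · change (modelStrip ε (s, 1)).1 = 0
      rw [modelStrip_fst ε hz', stripRe_sq_add_stripIm_sq hz']
      simp
    · obtain ⟨z, hzq⟩ := (h.surface _ hq).2 (by
        rw [chart_chartStrip hε hz, modelStrip_zero, modelStrip_one, modelStrip_two]
        refine ⟨by ring, ?_⟩
        nlinarith)
      refine ⟨z, ?_, hzq⟩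
      refine h.isSurfaceChart.not_isSingularPt (by rwa [hzq]) (hf.mdifferentiable (by simp) z) ?_
      rw [hzq, chart_chartStrip hε hz, modelStrip_one]
      exact mul_ne_zero hε0 hX.ne
  energy := h.isSurfaceChart.toIsContactChart.hasFiniteEnergy hε hε1

/-- The θ-component of ∂_s u is εP, which never vanishes, and subtracting a multiple of the Reeb
field ∂_y does not change it. -/
theorem IsContactChart.contactProj_partialS_ne_zero (h : IsContactChart lam Φ)
    (hε : IsChartStrip Φ ε) (hε0 : ε ≠ 0) {z : ℝ × ℝ} (hz : z ∈ strip) :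
    contactProj lam (chartStrip Φ ε z).2 (partialS (chartStrip Φ ε) z).2 ≠ 0 := by
  have hq := chartStrip_mem hε hz
  intro h0
  have h1 := h.coordD_contactProj hq (partialS (chartStrip Φ ε) z).2
  rw [h0, coordD_zero, partialS, coordD_dStrip h.mem_atlas hε hz] at h1
  have h2 := congrArg (fun v : E3 => v 0) h1
  simp at h2
  rcases h2 with h2 | h2
  · exact hε0 h2
  · exact (stripP_pos hz).ne' h2

end Solutions

/-! ### Behaviour at the ends; the sign `ι = ±1` treats both at once. -/

section StripAsymptotics

/-- The rescaled inverse denominator at the end of the strip of sign `ι`. -/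
noncomputable def stripKappa (ι : ℝ) (z : ℝ × ℝ) : ℝ :=
  Real.exp (ι * (Real.pi * z.1 / 2)) / stripDen z

variable {ι : ℝ} {l : Filter ℝ}

theorem cosh_sign_mul (hι : ι = 1 ∨ ι = -1) (x : ℝ) : Real.cosh x = Real.cosh (ι * x) := by
  rcases hι with rfl | rfl <;> simp

theorem sinh_sign_mul (hι : ι = 1 ∨ ι = -1) (x : ℝ) : Real.sinh x = ι * Real.sinh (ι * x) := by
  rcases hι with rfl | rfl <;> simp

theorem stripDen_eq_exp (hι : ι = 1 ∨ ι = -1) (z : ℝ × ℝ) :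
    stripDen z = Real.cos (Real.pi * z.2 / 2)
      + (Real.exp (ι * (Real.pi * z.1 / 2)) + Real.exp (-(ι * (Real.pi * z.1 / 2)))) / 2 := by
  rw [stripDen, cosh_sign_mul hι, Real.cosh_eq]

theorem stripRe_eq_exp (hι : ι = 1 ∨ ι = -1) (z : ℝ × ℝ) :
    stripRe z = ι * ((Real.exp (ι * (Real.pi * z.1 / 2))
      - Real.exp (-(ι * (Real.pi * z.1 / 2)))) / 2) / stripDen z := by
  rw [stripRe, sinh_sign_mul hι, Real.sinh_eq]

theorem tendsto_exp_end (hl : Tendsto (fun s => ι * s) l atTop) :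
    Tendsto (fun z : ℝ × ℝ => Real.exp (-(ι * (Real.pi * z.1 / 2)))) (l ×ˢ 𝓟 (Icc 0 1)) (𝓝 0) := by
  have h1 : Tendsto (fun s => Real.exp (-(ι * (Real.pi * s / 2)))) l (𝓝 0) := by
    refine Real.tendsto_exp_neg_atTop_nhds_zero.comp ?_
    have := hl.const_mul_atTop (by positivity : 0 < Real.pi / 2)
    refine this.congr fun s => by ring
  exact h1.comp tendsto_fst

theorem eventually_mem_strip : ∀ᶠ z in l ×ˢ 𝓟 (Icc (0 : ℝ) 1), z ∈ strip := by
  have : ∀ᶠ z : ℝ × ℝ in l ×ˢ 𝓟 (Icc (0 : ℝ) 1), z.2 ∈ Icc (0 : ℝ) 1 :=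
    tendsto_snd.eventually (eventually_principal.2 fun t ht => ht)
  filter_upwards [this] with z hz using ⟨mem_univ _, hz⟩

/-- For factors depending on `t` only, which have no limit along the filter but are bounded; this
gives the uniformity in `t`. -/
theorem tendsto_bdd_mul {α : Type*} {L : Filter α} {b g : α → ℝ} {K : ℝ} (hb : ∀ z, |b z| ≤ K)
    (hg : Tendsto g L (𝓝 0)) : Tendsto (fun z => b z * g z) L (𝓝 0) := by
  refine squeeze_zero_norm (a := fun z => K * |g z|) (fun z => ?_) ?_
  · rw [norm_mul]
    exact mul_le_mul_of_nonneg_right (hb z) (norm_nonneg _)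
  · simpa using hg.abs.const_mul K

/-- With E the decaying exponential, the denominator over the growing exponential is cos(πt/2) E +
(1 + E²)/2, which tends to 1/2. -/
theorem tendsto_stripKappa (hι : ι = 1 ∨ ι = -1) (hl : Tendsto (fun s => ι * s) l atTop) :
    Tendsto (stripKappa ι) (l ×ˢ 𝓟 (Icc 0 1)) (𝓝 2) := by
  have hE := tendsto_exp_end hl
  have h1 : Tendsto (fun z : ℝ × ℝ => (Real.cos (Real.pi * z.2 / 2)
      * Real.exp (-(ι * (Real.pi * z.1 / 2)))
      + (1 + Real.exp (-(ι * (Real.pi * z.1 / 2))) ^ 2) / 2)⁻¹) (l ×ˢ 𝓟 (Icc 0 1)) (𝓝 2) := by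
    have h2 := (tendsto_bdd_mul (b := fun z : ℝ × ℝ => Real.cos (Real.pi * z.2 / 2)) (K := 1)
      (fun z => Real.abs_cos_le_one _) hE).add (((hE.pow 2).const_add 1).div_const 2)
    have h3 := h2.inv₀ (by norm_num)
    convert h3 using 2
    norm_num
  refine h1.congr fun z => ?_
  rw [stripKappa, stripDen_eq_exp hι, Real.exp_neg]
  have := Real.exp_pos (ι * (Real.pi * z.1 / 2))
  rw [← inv_div]
  field_simp

theorem tendsto_stripRe (hι : ι = 1 ∨ ι = -1) (hl : Tendsto (fun s => ι * s) l atTop) :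
    Tendsto stripRe (l ×ˢ 𝓟 (Icc 0 1)) (𝓝 ι) := by
  have hE := tendsto_exp_end hl
  have hκ := tendsto_stripKappa hι hl
  have h1 := (((hE.pow 2).const_sub 1).div_const 2).mul hκ |>.const_mul ι
  have h2 : ι * ((1 - 0 ^ 2) / 2 * 2) = ι := by norm_num
  rw [h2] at h1
  refine h1.congr fun z => ?_
  rw [stripRe_eq_exp hι, stripKappa, Real.exp_neg]
  have := Real.exp_pos (ι * (Real.pi * z.1 / 2))
  field_simp

theorem inv_stripDen_eq (ι : ℝ) (z : ℝ × ℝ) : (stripDen z)⁻¹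
    = Real.exp (-(ι * (Real.pi * z.1 / 2))) * stripKappa ι z := by
  rw [stripKappa, Real.exp_neg]
  have := Real.exp_pos (ι * (Real.pi * z.1 / 2))
  field_simp

theorem tendsto_inv_stripDen (hι : ι = 1 ∨ ι = -1) (hl : Tendsto (fun s => ι * s) l atTop) :
    Tendsto (fun z => (stripDen z)⁻¹) (l ×ˢ 𝓟 (Icc 0 1)) (𝓝 0) := by
  have := (tendsto_exp_end hl).mul (tendsto_stripKappa hι hl)
  rw [zero_mul] at this
  exact this.congr fun z => (inv_stripDen_eq ι z).symm

theorem tendsto_stripIm (hι : ι = 1 ∨ ι = -1) (hl : Tendsto (fun s => ι * s) l atTop) :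
    Tendsto stripIm (l ×ˢ 𝓟 (Icc 0 1)) (𝓝 0) := by
  refine (tendsto_bdd_mul (b := fun z : ℝ × ℝ => -Real.sin (Real.pi * z.2 / 2)) (K := 1)
    (fun z => ?_) (tendsto_inv_stripDen hι hl)).congr fun z => ?_
  · rw [abs_neg]
    exact Real.abs_sin_le_one _
  · simp only [stripIm, div_eq_mul_inv]

variable {M : Type*} [TopologicalSpace M] [ChartedSpace E3 M] {Φ : OpenPartialHomeomorph M E3}
  {ε : ℝ}

theorem hasDecayRate_chartStrip (hΦ : Φ ∈ IsManifold.maximalAtlas (𝓡 3) ∞ M)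
    (hε : IsChartStrip Φ ε) (hε0 : ε ≠ 0) (hι : ι = 1 ∨ ι = -1)
    (hl : Tendsto (fun s => ι * s) l atTop) {p : M} (hp : p ∈ Φ.source)
    (hpΦ : Φ p = (ι * ε) • stdVec 0) :
    HasDecayRate (chartStrip Φ ε) l p (-(ι * (Real.pi / 2))) := by
  have hι2 := mul_self_eq_one_iff.2 hι
  -- The leading coefficients in powers of the decaying exponential. The first component vanishes
  -- only where the cosine does, and there the x-component does not.
  let e : ℝ → ℝ × E3 := fun t => (-(ε ^ 2 * Real.cos (Real.pi * t / 2)),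
    !₂[-(2 * ι * ε * Real.cos (Real.pi * t / 2)), -(2 * ε * Real.sin (Real.pi * t / 2)),
      ι * ε ^ 2 * Real.sin (Real.pi * t / 2)])
  let w : ℝ → ℝ := fun s => ι * (Real.pi * s / 2)
  -- The remainder is defined so that the required expansion is an identity; only its limit has to
  -- be computed.
  let r : ℝ × ℝ → ℝ × E3 := fun z =>
    Real.exp (w z.1) • ((modelStrip ε z).1, (modelStrip ε z).2 - (ι * ε) • stdVec 0) - e z.2
  refine ⟨Φ, hΦ, hp, fun _ => -(ι * (Real.pi / 2)), e, r, 0, contDiff_const, tendsto_const_nhds,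
    ?_, ?_, ?_, ?_⟩
  · refine Continuous.continuousOn (Continuous.prodMk (by fun_prop) ?_)
    refine (PiLp.continuous_toLp 2 _).comp (continuous_pi fun i => ?_)
    fin_cases i <;> simp <;> fun_prop
  · intro t ht h0
    have h1 : ε ^ 2 * Real.cos (Real.pi * t / 2) = 0 := by
      have := congrArg Prod.fst h0
      simpa [e] using this
    have h2 : ε * Real.sin (Real.pi * t / 2) = 0 := by
      have := congrArg (fun v : ℝ × E3 => v.2 1) h0
      simpa [e] using this
    have h3 : Real.cos (Real.pi * t / 2) = 0 :=
      (mul_eq_zero.1 h1).resolve_left (pow_ne_zero 2 hε0)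
    have h4 : Real.sin (Real.pi * t / 2) = 0 := (mul_eq_zero.1 h2).resolve_left hε0
    have := Real.sin_sq_add_cos_sq (Real.pi * t / 2)
    rw [h3, h4] at this
    norm_num at this
  · have hE := tendsto_exp_end hl
    have hκ := tendsto_stripKappa hι hl
    have hT := tendsto_stripRe hι hl
    have hκ2 : Tendsto (fun z => stripKappa ι z - 2) (l ×ˢ 𝓟 (Icc 0 1)) (𝓝 0) := by
      simpa using hκ.sub_const 2
    have hTκ : Tendsto (fun z => stripRe z * stripKappa ι z - ι * 2) (l ×ˢ 𝓟 (Icc 0 1)) (𝓝 0) := by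
      simpa using (hT.mul hκ).sub_const (ι * 2)
    have hEκ : Tendsto (fun z : ℝ × ℝ => Real.exp (-(ι * (Real.pi * z.1 / 2))) * stripKappa ι z)
        (l ×ˢ 𝓟 (Icc 0 1)) (𝓝 0) := by
      simpa using hE.mul hκ
    have hC : ∀ z : ℝ × ℝ, |Real.cos (Real.pi * z.2 / 2)| ≤ 1 := fun z => Real.abs_cos_le_one _
    have hS : ∀ z : ℝ × ℝ, |Real.sin (Real.pi * z.2 / 2)| ≤ 1 := fun z => Real.abs_sin_le_one _
    have ha := (tendsto_bdd_mul hC hκ2).const_mul (-(ε ^ 2 / 2))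
    have h0 := ((hEκ.add (tendsto_bdd_mul hC hκ2)).const_mul (-(ι * ε))).smul_const (stdVec 0 : E3)
    have h1 := ((tendsto_bdd_mul hS hκ2).const_mul (-ε)).smul_const (stdVec 1 : E3)
    have h2 := ((tendsto_bdd_mul hS hTκ).const_mul (ε ^ 2 / 2)).smul_const (stdVec 2 : E3)
    have hall := ha.prodMk_nhds ((h0.add h1).add h2)
    simp only [add_zero, mul_zero, zero_smul] at hall
    refine hall.congr' ?_
    filter_upwards [eventually_mem_strip] with z hz
    have hz' := strip_subset_stripDom hz
    have hD : stripDen z ≠ 0 := ne_of_gt hz'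
    have hexp := Real.exp_pos (ι * (Real.pi * z.1 / 2))
    have hDe := stripDen_eq_exp hι z
    have hκe : Real.exp (w z.1) = stripKappa ι z * stripDen z := by
      rw [stripKappa, div_mul_cancel₀ _ hD]
    have hTe : stripRe z * stripDen z = ι * ((Real.exp (ι * (Real.pi * z.1 / 2))
        - Real.exp (-(ι * (Real.pi * z.1 / 2)))) / 2) := by
      rw [stripRe_eq_exp hι, div_mul_cancel₀ _ hD]
    have hXe : stripIm z * stripDen z = -Real.sin (Real.pi * z.2 / 2) := by
      rw [stripIm, div_mul_cancel₀ _ hD]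
    refine Prod.ext ?_ ?_
    · simp only [r, e, Prod.fst_sub, Prod.smul_fst, smul_eq_mul, hκe, modelStrip_fst ε hz',
        stripRe_sq_add_stripIm_sq hz']
      field_simp
      ring
    · ext i
      fin_cases i
      · simp only [r, e, hκe]
        simp [modelStrip_zero]
        linear_combination (-stripKappa ι z * ε) * hTe + stripKappa ι z * ι * ε * hDe
      · simp only [r, e, hκe]
        simp [modelStrip_one]
        linear_combination (-stripKappa ι z * ε) * hXe
      · simp only [r, e, hκe]
        simp [modelStrip_two]
        linear_combination (stripKappa ι z * ε ^ 2 / 2 * stripRe z) * hXe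
  · have h01 : ∀ s, ∀ t ∈ Icc (0 : ℝ) 1, ((s, t) : ℝ × ℝ) ∈ strip := fun s t ht => ⟨mem_univ _, ht⟩
    refine Eventually.of_forall fun s t ht => ⟨chartStrip_mem hε (h01 s t ht), ?_⟩
    have hint : ∫ x in (0 : ℝ)..s, -(ι * (Real.pi / 2)) = -w s := by
      rw [intervalIntegral.integral_const, smul_eq_mul]
      simp only [w]
      ring
    rw [hint, chart_chartStrip hε (h01 s t ht), hpΦ]
    simp only [r, add_sub_cancel]
    rw [smul_smul, ← Real.exp_add, neg_add_cancel, Real.exp_zero, one_smul]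
    rfl

end StripAsymptotics

/-! ### The Maslov index, and the family of strips in a normal chart. -/

section StripMaslov

variable {M : Type*} [TopologicalSpace M] [ChartedSpace E3 M] [IsManifold (𝓡 3) ∞ M]
  {F : Type*} [TopologicalSpace F] [ChartedSpace (EuclideanHalfSpace 2) F]
  {lam : OneForm M} {J : EndField M} {k : ℝ → M} {f : F → M} {p : M} {σ ε : ℝ}
  {Φ : OpenPartialHomeomorph M E3}

/-- The coordinates of the derivative of the model strip with respect to the parameter. -/
noncomputable def stripNormalCoord (ε : ℝ) (z : ℝ × ℝ) : ℝ × E3 :=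
  (ε / 2 * (stripRe z ^ 2 + stripIm z ^ 2 - 1),
    !₂[stripRe z, stripIm z, -(ε * (stripRe z * stripIm z))])

/-- The derivative of the strips with respect to the parameter. -/
noncomputable def stripNormal (Φ : OpenPartialHomeomorph M E3) (ε : ℝ) (z : ℝ × ℝ) :
    ℝ × TangentSpace (𝓡 3) (chartStrip Φ ε z).2 :=
  ((stripNormalCoord ε z).1,
    mfderiv 𝓘(ℝ, E3) (𝓡 3) Φ.symm (modelStrip ε z).2 (stripNormalCoord ε z).2)

theorem continuousOn_stripNormalCoord (ε : ℝ) : ContinuousOn (stripNormalCoord ε) strip := by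
  have h1 : ContinuousOn stripRe strip := contDiffOn_stripRe.continuousOn.mono strip_subset_stripDom
  have h2 : ContinuousOn stripIm strip := contDiffOn_stripIm.continuousOn.mono strip_subset_stripDom
  refine ContinuousOn.prodMk (by fun_prop)
    ((PiLp.continuous_toLp 2 _).comp_continuousOn (continuousOn_pi.2 fun i => ?_))
  fin_cases i <;> simp <;> fun_prop

theorem coordD_stripNormal (hΦ : Φ ∈ IsManifold.maximalAtlas (𝓡 3) ∞ M) (hε : IsChartStrip Φ ε)
    {z : ℝ × ℝ} (hz : z ∈ strip) :
    coordD Φ (chartStrip Φ ε z).2 (stripNormal Φ ε z).2 = (stripNormalCoord ε z).2 :=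
  coordD_mfderiv_symm hΦ (hε z hz) _

/-- At the end of sign `ι` the pair (`stripRe`, `stripIm`) tends to (ι, 0), so the strip tends to
the knot point with θ = ιε and the normal field to ι∂_θ; this is where the opposite signs of the
limits at the two ends come from. -/
theorem tendsto_stripNormal {ι : ℝ} {l : Filter ℝ} (hΦ : Φ ∈ IsManifold.maximalAtlas (𝓡 3) ∞ M)
    (hι : ι = 1 ∨ ι = -1) (hl : Tendsto (fun s => ι * s) l atTop)
    (hend : (ι * ε) • (stdVec 0 : E3) ∈ Φ.target) :
    Tendsto (fun z => (stripNormal Φ ε z).1) (l ×ˢ 𝓟 (Icc 0 1)) (𝓝 0) ∧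
      Tendsto (sectionM (chartStrip Φ ε) (stripNormal Φ ε)) (l ×ˢ 𝓟 (Icc 0 1))
        (𝓝 ⟨Φ.symm ((ι * ε) • stdVec 0),
          mfderiv 𝓘(ℝ, E3) (𝓡 3) Φ.symm ((ι * ε) • stdVec 0) (ι • stdVec 0)⟩) := by
  have hT := tendsto_stripRe hι hl
  have hX := tendsto_stripIm hι hl
  have hι2 : ι ^ 2 = 1 := by rw [sq]; exact mul_self_eq_one_iff.2 hι
  refine ⟨?_, ?_⟩
  · have := (((hT.pow 2).add (hX.pow 2)).sub_const 1).const_mul (ε / 2)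
    rw [hι2] at this
    simpa [stripNormal, stripNormalCoord] using this
  · have h1 : Tendsto (fun z => (modelStrip ε z).2) (l ×ˢ 𝓟 (Icc 0 1))
        (𝓝 ((ι * ε) • stdVec 0)) := by
      have h := (((hT.const_mul ε).smul_const (stdVec 0 : E3)).add
        ((hX.const_mul ε).smul_const (stdVec 1 : E3))).add
          (((hT.mul hX).const_mul (-ε ^ 2 / 2)).smul_const (stdVec 2 : E3))
      simp only [mul_zero, zero_smul, add_zero] at h
      rw [mul_comm ε ι] at h
      refine h.congr fun z => ?_
      ext i
      fin_cases i
      · simp [modelStrip_zero]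
      · simp [modelStrip_one]
      · simp [modelStrip_two]
    have h2 : Tendsto (fun z => (stripNormalCoord ε z).2) (l ×ˢ 𝓟 (Icc 0 1))
        (𝓝 (ι • stdVec 0)) := by
      have h := ((hT.smul_const (stdVec 0 : E3)).add (hX.smul_const (stdVec 1 : E3))).add
          (((hT.mul hX).const_mul (-ε)).smul_const (stdVec 2 : E3))
      simp only [mul_zero, zero_smul, add_zero] at h
      refine h.congr fun z => ?_
      ext i
      fin_cases i <;> simp [stripNormalCoord]
    have h3 := (contMDiffOn_tangent_symm hΦ).continuousOn.continuousAt
      ((Φ.open_target.prod isOpen_univ).mem_nhds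
        (show ((ι * ε) • (stdVec 0 : E3), ι • (stdVec 0 : E3)) ∈ Φ.target ×ˢ univ from
          ⟨hend, mem_univ _⟩))
    exact h3.tendsto.comp (h1.prodMk_nhds h2)

/-- The differential of θ² + x² - 4a vanishes on the tangent plane of the strip and takes the value
2ε on this field. -/
theorem stripNormal_notMem_span (hΦ : Φ ∈ IsManifold.maximalAtlas (𝓡 3) ∞ M)
    (hε : IsChartStrip Φ ε) (hε0 : ε ≠ 0) {z : ℝ × ℝ} (hz : z ∈ strip) :
    stripNormal Φ ε z ∉ Submodule.span ℝ
      {partialS (chartStrip Φ ε) z, partialT (chartStrip Φ ε) z} := by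
  intro hmem
  obtain ⟨a, b, hab⟩ := Submodule.mem_span_pair.1 hmem
  have hz' := strip_subset_stripDom hz
  have h1 := congrArg (fun V => V.1) hab
  have h2 := congrArg (fun V => coordD Φ (chartStrip Φ ε z).2 V.2) hab
  simp only [Prod.snd_add, Prod.smul_snd, coordD_add, coordD_smul, coordD_stripNormal hΦ hε hz]
    at h2
  simp only [Prod.fst_add, Prod.smul_fst] at h1
  rw [partialS, partialT, coordD_dStrip hΦ hε hz, coordD_dStrip hΦ hε hz] at h2
  rw [partialS, partialT, dStrip_chartStrip_fst hz, dStrip_chartStrip_fst hz,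
    fderiv_modelStrip_fst ε hz', fderiv_modelStrip_fst ε hz'] at h1
  have e0 := congrArg (fun v : E3 => v 0) h2
  have e1 := congrArg (fun v : E3 => v 1) h2
  simp [stripNormal, stripNormalCoord] at h1 e0 e1
  refine hε0 ?_
  linear_combination 2 * h1 - ε * stripRe z * e0 - ε * stripIm z * e1

/-- The velocity of the knot is a positive multiple of ∂_θ, so a multiple of ∂_θ is a multiple of
the velocity with the same sign; the factor `c > 0` records this. -/
theorem IsSurfaceChart.mem_knotTangent (h : IsSurfaceChart lam k f p σ Φ)
    (hk : IsLegendrianKnot lam k) {q : M} (hq : q ∈ Φ.source) (hq1 : Φ q 1 = 0) (hq2 : Φ q 2 = 0)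
    {v : TangentSpace (𝓡 3) q} {a : ℝ} (hv : coordD Φ q v = a • stdVec 0) :
    ∃ r c : ℝ, q = k r ∧ 0 < c ∧ (⟨q, v⟩ : TangentBundle (𝓡 3) M) = ⟨k r, (c * a) • velocity k r⟩ := by
  obtain ⟨r, hr⟩ := (h.knot q hq).2 ⟨hq1, hq2⟩
  have hkr : k r ∈ Φ.source := hr ▸ hq
  have hpos := h.oriented r hkr
  refine ⟨r, (coordD Φ (k r) (velocity k r) 0)⁻¹, hr.symm, inv_pos.2 hpos,
    tangentBundle_ext h.mem_atlas hq hr.symm ?_⟩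
  rw [hv, coordD_smul, h.coordD_velocity hk hkr, smul_smul]
  congr 1
  simp
  field_simp

/-- All strips have their upper boundary in {0} × D, so their derivative in the parameter is tangent
to it. No rotation is needed: γ = 1 and φ = 0. -/
theorem IsNormalChart.hasMaslovIndex (h : IsNormalChart lam J k f p σ Φ)
    (hk : IsLegendrianKnot lam k) (hf : ContMDiff (𝓡∂ 2) (𝓡 3) ∞ f)
    (hfi : ∀ z, Function.Injective (mfderiv (𝓡∂ 2) (𝓡 3) f z)) (hε : IsChartStrip Φ ε)
    (hσ : 0 < σ * ε) (hp : ε • (stdVec 0 : E3) ∈ Φ.target)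
    (hm : (-ε) • (stdVec 0 : E3) ∈ Φ.target) :
    HasMaslovIndex lam J k f (chartStrip Φ ε) 0 := by
  have hs := h.isSurfaceChart
  have hΦ := h.mem_atlas
  have hε0 : ε ≠ 0 := fun h0 => by simp [h0] at hσ
  have key : ∀ ι : ℝ, (ι * ε) • (stdVec 0 : E3) ∈ Φ.target → ∃ r c : ℝ,
      k r ∈ Φ.source ∧ Φ (k r) = (ι * ε) • stdVec 0 ∧ 0 < c ∧
      (⟨Φ.symm ((ι * ε) • stdVec 0),
          mfderiv 𝓘(ℝ, E3) (𝓡 3) Φ.symm ((ι * ε) • stdVec 0) (ι • stdVec 0)⟩ :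
        TangentBundle (𝓡 3) M) = ⟨k r, (c * ι) • velocity k r⟩ := by
    intro ι hι
    have hq := Φ.map_target hι
    have hΦq : Φ (Φ.symm ((ι * ε) • stdVec 0)) = (ι * ε) • stdVec 0 := Φ.right_inv hι
    obtain ⟨r, c, hr, hc, hrc⟩ := hs.mem_knotTangent hk hq (by rw [hΦq]; simp)
      (by rw [hΦq]; simp) (coordD_mfderiv_symm hΦ hι (ι • stdVec 0))
    exact ⟨r, c, hr ▸ hq, hr ▸ hΦq, hc, hrc⟩
  have hp' : ((1 : ℝ) * ε) • (stdVec 0 : E3) ∈ Φ.target := by rwa [one_mul]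
  have hm' : ((-1 : ℝ) * ε) • (stdVec 0 : E3) ∈ Φ.target := by rwa [neg_one_mul]
  have lp : Tendsto (fun s : ℝ => (1 : ℝ) * s) atTop atTop := by
    simp only [one_mul]
    exact tendsto_id
  have lm : Tendsto (fun s : ℝ => (-1 : ℝ) * s) atBot atTop := by
    simpa using tendsto_neg_atBot_atTop
  obtain ⟨rp, cp, hrp, hΦrp, hcp, hvp⟩ := key 1 hp'
  obtain ⟨rm, cm, hrm, hΦrm, hcm, hvm⟩ := key (-1) hm'
  obtain ⟨tp1, tp2⟩ := tendsto_stripNormal hΦ (Or.inl rfl) lp hp'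
  obtain ⟨tm1, tm2⟩ := tendsto_stripNormal hΦ (Or.inr rfl) lm hm'
  rw [hvp] at tp2
  rw [hvm] at tm2
  refine ⟨rp, rm, ?_, ?_, stripNormal Φ ε, fun _ => 1, fun _ => 0, 0, 0, ?_, continuous_const,
    fun _ => one_ne_zero, fun s => ?_, continuous_const, fun s => by simp, tendsto_const_nhds,
    tendsto_const_nhds, by simp⟩
  · simpa using hasDecayRate_chartStrip hΦ hε hε0 (Or.inl rfl) lp hrp hΦrp
  · simpa using hasDecayRate_chartStrip hΦ hε hε0 (Or.inr rfl) lm hrm hΦrm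
  · refine ⟨(continuousOn_stripNormalCoord ε).fst, ?_,
      fun z hz => stripNormal_notMem_span hΦ hε hε0 hz, fun s => ?_, tp1, tm1, ?_, ?_⟩
    · exact (contMDiffOn_tangent_symm hΦ).continuousOn.comp
        ((((contDiffOn_modelStrip_right ε).continuousOn.mono strip_subset_stripDom).snd).prodMk
          (continuousOn_stripNormalCoord ε).snd) fun z hz => ⟨hε z hz, mem_univ _⟩
    · have hz : ((s, 0) : ℝ × ℝ) ∈ strip := ⟨mem_univ _, by simp⟩
      have hX : stripIm (s, 0) = 0 := by simp [stripIm]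
      obtain ⟨r, c, -, -, hrc⟩ := hs.mem_knotTangent hk (chartStrip_mem hε hz)
        (v := (stripNormal Φ ε (s, 0)).2) (a := stripRe (s, 0))
        (by rw [chart_chartStrip hε hz, modelStrip_one, hX, mul_zero])
        (by rw [chart_chartStrip hε hz, modelStrip_two, hX, mul_zero, mul_zero]) (by
          rw [coordD_stripNormal hΦ hε hz]
          ext i
          fin_cases i <;> simp [stripNormalCoord, hX])
      exact ⟨r, _, hrc⟩
    · exact ⟨cp, hcp, by simpa using tp2⟩
    · exact ⟨cm, hcm, by simpa using tm2⟩
  · have hz : ((s, 1) : ℝ × ℝ) ∈ strip := ⟨mem_univ _, by simp⟩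
    have hz' := strip_subset_stripDom hz
    have hq := chartStrip_mem hε hz
    have hD : 0 < stripDen (s, 1) := hz'
    have hX : stripIm (s, 1) < 0 := by
      simp only [stripIm, mul_one, Real.sin_pi_div_two]
      exact div_neg_of_neg_of_pos (by norm_num) hD
    obtain ⟨z, hzq⟩ := (h.surface _ hq).2 (by
      rw [chart_chartStrip hε hz, modelStrip_zero, modelStrip_one, modelStrip_two]
      refine ⟨by ring, ?_⟩
      nlinarith)
    have hzs : f z ∈ Φ.source := by rwa [hzq]
    obtain ⟨v, hv⟩ := hs.exists_tangent hzs (hf.mdifferentiable (by simp) z) (hfi z)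
      (w := (stripNormalCoord ε (s, 1)).2) (by
        rw [hzq, chart_chartStrip hε hz, modelStrip_zero, modelStrip_one]
        simp [stripNormalCoord]
        ring)
    simp only [Complex.one_re, Complex.one_im, one_smul, zero_smul, add_zero]
    refine ⟨?_, ⟨z, v⟩, ?_⟩
    · change ε / 2 * (stripRe (s, 1) ^ 2 + stripIm (s, 1) ^ 2 - 1) = 0
      rw [stripRe_sq_add_stripIm_sq hz']
      simp
    · exact tangentBundle_ext hΦ hzs hzq (hv.trans (coordD_stripNormal hΦ hε hz).symm)

/-- Around a boundary point of the surface with a normal chart there is a family of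
holomorphic strips with all the required properties. -/
theorem IsNormalChart.exists_strips (h : IsNormalChart lam J k f p σ Φ) (hJ : IsCompatible lam J)
    (hk : IsLegendrianKnot lam k) (hf : ContMDiff (𝓡∂ 2) (𝓡 3) ∞ f)
    (hfi : ∀ z, Function.Injective (mfderiv (𝓡∂ 2) (𝓡 3) f z)) (hσ : σ = 1 ∨ σ = -1) :
    ∃ U : ℝ → ℝ × ℝ → ℝ × M,
      (∀ τ ∈ Ioo (0 : ℝ) 1, IsSolution lam J k f (U τ) ∧ IsEmbeddedStrip (U τ)) ∧
      (∀ τ ∈ Ioo (0 : ℝ) 1, ∀ τ' ∈ Ioo (0 : ℝ) 1, τ ≠ τ' →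
        Disjoint (U τ '' strip) (U τ' '' strip)) ∧
      ShrinksTo U p ∧
      ContMDiffOn 𝓘(ℝ, ℝ × (ℝ × ℝ)) (𝓘(ℝ, ℝ).prod (𝓡 3)) ∞
        (fun q : ℝ × (ℝ × ℝ) => U q.1 q.2) (Ioo 0 1 ×ˢ strip) ∧
      (∀ τ ∈ Ioo (0 : ℝ) 1, ∀ z ∈ strip,
        contactProj lam (U τ z).2 (partialS (U τ) z).2 ≠ 0) ∧
      (∀ τ ∈ Ioo (0 : ℝ) 1, HasMaslovIndex lam J k f (U τ) 0) ∧
      ∃ (Φ : OpenPartialHomeomorph M E3) (σ c : ℝ),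
        (σ = 1 ∨ σ = -1) ∧ 0 < c ∧ IsNormalChart lam J k f p σ Φ ∧
        ∀ τ ∈ Ioo (0 : ℝ) 1, ∀ z ∈ strip, (U τ z).2 ∈ Φ.source ∧
          ((U τ z).1, Φ (U τ z).2) = modelStrip (σ * c * τ) z := by
  have h0 : (0 : E3) ∈ Φ.target := h.center ▸ Φ.map_source h.mem_source
  obtain ⟨c₁, hc₁, hc₁1, hc₁s⟩ := exists_forall_isChartStrip h0
  obtain ⟨ρ, hρ, hball⟩ := Metric.isOpen_iff.1 Φ.open_target 0 h0
  -- `c₁` keeps the strips inside the chart, and `ρ / 2` does the same for their limit points at the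
  -- ends, which are not part of the strips.
  set c := min c₁ (ρ / 2) with hc
  have hc0 : 0 < c := lt_min hc₁ (by positivity)
  have hσσ : σ * σ = 1 := mul_self_eq_one_iff.2 hσ
  have hσa : |σ| = 1 := by rcases hσ with rfl | rfl <;> simp
  have habs : ∀ τ ∈ Ioo (0 : ℝ) 1, |σ * c * τ| ≤ c := by
    intro τ hτ
    rw [abs_mul, abs_mul, hσa, one_mul, abs_of_pos hc0, abs_of_pos hτ.1]
    exact mul_le_of_le_one_right hc0.le hτ.2.le
  have hch : ∀ τ ∈ Ioo (0 : ℝ) 1, IsChartStrip Φ (σ * c * τ) := fun τ hτ =>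
    hc₁s _ ((habs τ hτ).trans (min_le_left _ _))
  have hpos : ∀ τ ∈ Ioo (0 : ℝ) 1, 0 < σ * (σ * c * τ) := by
    intro τ hτ
    have : σ * (σ * c * τ) = (σ * σ) * (c * τ) := by ring
    rw [this, hσσ, one_mul]
    exact mul_pos hc0 hτ.1
  have hne : ∀ τ ∈ Ioo (0 : ℝ) 1, σ * c * τ ≠ 0 := fun τ hτ h0 => by
    have := hpos τ hτ
    rw [h0, mul_zero] at this
    exact lt_irrefl _ this
  have htgt : ∀ x : ℝ, |x| ≤ c → x • (stdVec 0 : E3) ∈ Φ.target := by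
    intro x hx
    refine hball ?_
    have hn : ‖(stdVec 0 : E3)‖ = 1 := by simp [stdVec]
    rw [mem_ball_zero_iff, norm_smul, hn, mul_one, Real.norm_eq_abs]
    have := hx.trans (min_le_right _ _)
    linarith
  refine ⟨fun τ => chartStrip Φ (σ * c * τ), fun τ hτ => ⟨h.isSolution hJ hf (hch τ hτ)
    ((habs τ hτ).trans ((min_le_left _ _).trans hc₁1)) (hpos τ hτ),
    isEmbeddedStrip_chartStrip h.mem_atlas (hch τ hτ) (hne τ hτ)⟩, fun τ hτ τ' hτ' hne' => ?_,
    shrinksTo_chartStrip h.mem_atlas h.mem_source h.center hch, ?_, fun τ hτ z hz => ?_,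
    fun τ hτ => ?_, Φ, σ, c, hσ, hc0, h, fun τ hτ z hz =>
      ⟨chartStrip_mem (hch τ hτ) hz, ?_⟩⟩
  · refine disjoint_chartStrip (hch τ hτ) (hch τ' hτ') fun heq => hne' ?_
    have e1 : ∀ x, (σ * c * x) ^ 2 = c ^ 2 * x ^ 2 := fun x => by
      rw [mul_pow, mul_pow, sq σ, hσσ, one_mul]
    rw [e1, e1] at heq
    have e2 := mul_left_cancel₀ (pow_ne_zero 2 hc0.ne') heq
    exact (pow_left_inj₀ hτ.1.le hτ'.1.le two_ne_zero).1 e2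
  · have h1 := contMDiffOn_chartStrip h.mem_atlas
      (s := (fun τ => σ * c * τ) '' Ioo (0 : ℝ) 1) (by rintro _ ⟨τ, hτ, rfl⟩; exact hch τ hτ)
    have h2 : ContDiff ℝ ∞ (fun q : ℝ × (ℝ × ℝ) => (σ * c * q.1, q.2)) := by fun_prop
    exact h1.comp (contMDiffOn_iff_contDiffOn.2 h2.contDiffOn)
      fun q hq => ⟨⟨q.1, hq.1, rfl⟩, hq.2⟩
  · exact h.isSurfaceChart.toIsContactChart.contactProj_partialS_ne_zero (hch τ hτ) (hne τ hτ) hz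
  · exact h.hasMaslovIndex hk hf hfi (hch τ hτ) (hpos τ hτ) (htgt _ (habs τ hτ))
      (htgt _ (by rw [abs_neg]; exact habs τ hτ))
  · change ((modelStrip (σ * c * τ) z).1, Φ (chartStrip Φ (σ * c * τ) z).2) = _
    rw [chart_chartStrip (hch τ hτ) hz]

end StripMaslov

/-! ### Smooth dependence of components on tangent vectors. -/

section SmoothComponents

variable {M : Type*} [TopologicalSpace M] [ChartedSpace E3 M] [IsManifold (𝓡 3) ∞ M]
  {Φ Ψ : OpenPartialHomeomorph M E3}

/-- The components of a tangent vector in a chart depend smoothly on the vector. -/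
theorem contMDiffOn_coordD (hΦ : Φ ∈ IsManifold.maximalAtlas (𝓡 3) ∞ M) :
    ContMDiffOn (𝓡 3).tangent 𝓘(ℝ, E3) ∞
      (fun v : TangentBundle (𝓡 3) M => coordD Φ v.proj v.2)
      (Bundle.TotalSpace.proj ⁻¹' Φ.source) := by
  have h1 := (contMDiffOn_of_mem_maximalAtlas hΦ).contMDiffOn_tangentMapWithin
    (m := ∞) (by simp) Φ.open_source.uniqueMDiffOn
  have h2 := (contMDiff_snd_tangentBundle_modelSpace E3 𝓘(ℝ, E3) (n := ∞)).comp_contMDiffOn h1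
  refine h2.congr fun v hv => ?_
  have h3 : mfderivWithin (𝓡 3) 𝓘(ℝ, E3) Φ Φ.source v.proj
      = mfderiv (𝓡 3) 𝓘(ℝ, E3) Φ v.proj := mfderivWithin_of_isOpen Φ.open_source hv
  simp only [Function.comp, tangentMapWithin, h3]
  rfl

theorem contMDiffOn_coordInv (hΦ : Φ ∈ IsManifold.maximalAtlas (𝓡 3) ∞ M) :
    ContMDiffOn ((𝓡 3).prod 𝓘(ℝ, E3)) (𝓡 3).tangent ∞
      (fun y : M × E3 => (⟨y.1, coordInv Φ y.1 y.2⟩ : TangentBundle (𝓡 3) M))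
      (Φ.source ×ˢ univ) := by
  have h1 : ContMDiffOn ((𝓡 3).prod 𝓘(ℝ, E3)) 𝓘(ℝ, E3 × E3) ∞
      (fun y : M × E3 => (Φ y.1, y.2)) (Φ.source ×ˢ univ) :=
    ((contMDiffOn_of_mem_maximalAtlas hΦ).comp contMDiffOn_fst fun y hy => hy.1).prodMk_space
      contMDiffOn_snd
  refine ((contMDiffOn_tangent_symm hΦ).comp h1
    fun y hy => ⟨Φ.map_source hy.1, mem_univ _⟩).congr fun y hy => ?_
  have h2 : ∀ (q q' : M) (u : E3), q = q' →
      (⟨q, (coordInv Φ y.1 u : E3)⟩ : TangentBundle (𝓡 3) M) = ⟨q', (coordInv Φ y.1 u : E3)⟩ := by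
    rintro q _ u rfl
    rfl
  exact h2 _ _ _ (Φ.left_inv hy.1).symm

theorem contMDiffOn_coordD_coordInv (hΦ : Φ ∈ IsManifold.maximalAtlas (𝓡 3) ∞ M)
    (hΨ : Ψ ∈ IsManifold.maximalAtlas (𝓡 3) ∞ M) (u : E3) :
    ContMDiffOn (𝓡 3) 𝓘(ℝ, E3) ∞ (fun q => coordD Φ q (coordInv Ψ q u))
      (Φ.source ∩ Ψ.source) := by
  have h1 : ContMDiffOn (𝓡 3) ((𝓡 3).prod 𝓘(ℝ, E3)) ∞ (fun q : M => (q, u))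
      (Φ.source ∩ Ψ.source) := contMDiffOn_id.prodMk contMDiffOn_const
  exact (contMDiffOn_coordD hΦ).comp ((contMDiffOn_coordInv hΨ).comp h1
    fun q hq => ⟨hq.2, mem_univ _⟩) fun q hq => hq.1

end SmoothComponents

/-! ### The complex structure of a metric on the contact planes. -/

section ContactMetric

variable {M : Type*} [TopologicalSpace M] [ChartedSpace E3 M] [IsManifold (𝓡 3) ∞ M]
  {lam : OneForm M} {Φ : M → OpenPartialHomeomorph M E3}
  {ρ : SmoothPartitionOfUnity M (𝓡 3) M}

/-- A component of tangent vectors in a chart, as a linear form. -/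
noncomputable def coordForm (Φ : M → E3) (j : Fin 3) (q : M) : TangentSpace (𝓡 3) q →L[ℝ] ℝ :=
  (EuclideanSpace.proj (𝕜 := ℝ) j).comp (modelDeriv Φ q)

/-- The bilinear form `∑ᵢ ρᵢ (dθᵢ² + dxᵢ²)`, which is a metric on the contact planes when the
`(θᵢ, xᵢ, yᵢ)` are contact charts. -/
noncomputable def contactMetric (Φ : M → OpenPartialHomeomorph M E3)
    (ρ : SmoothPartitionOfUnity M (𝓡 3) M) (q : M) (v : TangentSpace (𝓡 3) q) :
    TangentSpace (𝓡 3) q →L[ℝ] ℝ :=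
  ∑ i ∈ ρ.finsupport q, ρ i q • (coordD (Φ i) q v 0 • coordForm (Φ i) 0 q
    + coordD (Φ i) q v 1 • coordForm (Φ i) 1 q)

theorem contactMetric_apply (q : M) (v w : TangentSpace (𝓡 3) q) :
    contactMetric Φ ρ q v w = ∑ i ∈ ρ.finsupport q, ρ i q *
      (coordD (Φ i) q v 0 * coordD (Φ i) q w 0 + coordD (Φ i) q v 1 * coordD (Φ i) q w 1) := by
  rw [contactMetric, sum_apply]
  rfl

theorem contactMetric_comm (q : M) (v w : TangentSpace (𝓡 3) q) :
    contactMetric Φ ρ q v w = contactMetric Φ ρ q w v := by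
  simp only [contactMetric_apply]
  exact Finset.sum_congr rfl fun i _ => by ring

/-- Two frame vectors which span the contact planes up to the Reeb direction. -/
noncomputable def frameMetric (Φ : M → OpenPartialHomeomorph M E3)
    (ρ : SmoothPartitionOfUnity M (𝓡 3) M) (Ψ : OpenPartialHomeomorph M E3) (i j : Fin 3)
    (q : M) : ℝ :=
  contactMetric Φ ρ q (coordInv Ψ q (stdVec i)) (coordInv Ψ q (stdVec j))

/-- The determinant of the metric in the frame given by a chart. -/
noncomputable def frameDet (Φ : M → OpenPartialHomeomorph M E3)
    (ρ : SmoothPartitionOfUnity M (𝓡 3) M) (Ψ : OpenPartialHomeomorph M E3) (q : M) : ℝ :=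
  frameMetric Φ ρ Ψ 0 0 q * frameMetric Φ ρ Ψ 1 1 q - frameMetric Φ ρ Ψ 0 1 q ^ 2

/-- The complex structure determined by the conformal class of the metric. -/
noncomputable def metricJ (Φ : M → OpenPartialHomeomorph M E3)
    (ρ : SmoothPartitionOfUnity M (𝓡 3) M) : EndField M := fun q =>
  (1 / √(frameDet Φ ρ (Φ q) q)) • (coordInv (Φ q) q).comp
    ((contactMetric Φ ρ q (coordInv (Φ q) q (stdVec 1))).smulRight (!₂[1, 0, -Φ q q 1] : E3)
      - (contactMetric Φ ρ q (coordInv (Φ q) q (stdVec 0))).smulRight (stdVec 1))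

variable (hΦ : ∀ p, IsContactChart lam (Φ p)) (hρ : ∀ i, tsupport (ρ i) ⊆ (Φ i).source)
  {Ψ Ψ' : OpenPartialHomeomorph M E3} (hΨ : IsContactChart lam Ψ) (hΨ' : IsContactChart lam Ψ')
  {q : M} (hq : q ∈ Ψ.source) (hq' : q ∈ Ψ'.source)

include hΨ hq in
theorem eq_frame (v : TangentSpace (𝓡 3) q) :
    v = coordD Ψ q v 0 • coordInv Ψ q (stdVec 0) + coordD Ψ q v 1 • coordInv Ψ q (stdVec 1)
      + coordD Ψ q v 2 • reeb lam q := by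
  apply coordD_injective hΨ.mem_atlas hq
  rw [coordD_add, coordD_add, coordD_smul, coordD_smul, coordD_smul,
    coordD_coordInv hΨ.mem_atlas hq, coordD_coordInv hΨ.mem_atlas hq, hΨ.coordD_reeb hq]
  exact eq_sum_stdVec _

include hρ in
theorem mem_source_of_mem_finsupport {i : M} (hi : i ∈ ρ.finsupport q) : q ∈ (Φ i).source :=
  hρ i (subset_tsupport _ ((ρ.mem_finsupport q).1 hi))

include hΦ hρ in
-- In each contact chart the Reeb field is ∂_y, which dθ and dx annihilate. So in the formulas ∂_θ
-- may stand for the contact vector ∂_θ - x∂_y.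
theorem contactMetric_reeb (v : TangentSpace (𝓡 3) q) :
    contactMetric Φ ρ q v (reeb lam q) = 0 := by
  rw [contactMetric_apply]
  refine Finset.sum_eq_zero fun i hi => ?_
  rw [(hΦ i).coordD_reeb (mem_source_of_mem_finsupport hρ hi)]
  simp

include hΦ hρ hΨ hq in
theorem contactMetric_eq (v w : TangentSpace (𝓡 3) q) :
    contactMetric Φ ρ q v w = coordD Ψ q w 0 * contactMetric Φ ρ q v (coordInv Ψ q (stdVec 0))
      + coordD Ψ q w 1 * contactMetric Φ ρ q v (coordInv Ψ q (stdVec 1)) := by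
  conv_lhs => rw [eq_frame hΨ hq w]
  rw [map_add, map_add, map_smul, map_smul, map_smul, contactMetric_reeb hΦ hρ]
  simp

include hΦ hρ hΨ hq in
theorem contactMetric_eq_frameMetric (v w : TangentSpace (𝓡 3) q) :
    contactMetric Φ ρ q v w =
      coordD Ψ q v 0 * coordD Ψ q w 0 * frameMetric Φ ρ Ψ 0 0 q
      + (coordD Ψ q v 0 * coordD Ψ q w 1 + coordD Ψ q v 1 * coordD Ψ q w 0)
        * frameMetric Φ ρ Ψ 0 1 q
      + coordD Ψ q v 1 * coordD Ψ q w 1 * frameMetric Φ ρ Ψ 1 1 q := by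
  rw [contactMetric_eq hΦ hρ hΨ hq v w, contactMetric_comm q v, contactMetric_comm q v,
    contactMetric_eq hΦ hρ hΨ hq _ v, contactMetric_eq hΦ hρ hΨ hq _ v]
  have h := contactMetric_comm (Φ := Φ) (ρ := ρ) q (coordInv Ψ q (stdVec 1))
    (coordInv Ψ q (stdVec 0))
  simp only [frameMetric]
  rw [h]
  ring

include hΨ hΨ' hq hq' in
/-- Coordinate changes between contact charts preserve the area of the contact planes. -/
theorem coordD_frame_det :
    coordD Ψ' q (coordInv Ψ q (stdVec 0)) 0 * coordD Ψ' q (coordInv Ψ q (stdVec 1)) 1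
      - coordD Ψ' q (coordInv Ψ q (stdVec 0)) 1 * coordD Ψ' q (coordInv Ψ q (stdVec 1)) 0 = 1 := by
  have h1 := hΨ.extD_eq hq (coordInv Ψ q (stdVec 1)) (coordInv Ψ q (stdVec 0))
  rw [hΨ'.extD_eq hq', coordD_coordInv hΨ.mem_atlas hq, coordD_coordInv hΨ.mem_atlas hq] at h1
  simp at h1
  linarith

include hΦ hρ hΨ hΨ' hq hq' in
-- A Gram determinant is multiplied by the square of the determinant of the change of frame, which
-- is one between contact charts.
theorem frameDet_eq : frameDet Φ ρ Ψ q = frameDet Φ ρ Ψ' q := by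
  have h := coordD_frame_det hΨ hΨ' hq hq'
  have e : ∀ i j, frameMetric Φ ρ Ψ i j q = _ := fun i j =>
    contactMetric_eq_frameMetric hΦ hρ hΨ' hq' (coordInv Ψ q (stdVec i)) (coordInv Ψ q (stdVec j))
  rw [frameDet, e, e, e, frameDet]
  generalize coordD Ψ' q (coordInv Ψ q (stdVec 0)) 0 = a at *
  generalize coordD Ψ' q (coordInv Ψ q (stdVec 1)) 1 = b at *
  generalize coordD Ψ' q (coordInv Ψ q (stdVec 0)) 1 = c at *
  generalize coordD Ψ' q (coordInv Ψ q (stdVec 1)) 0 = d at *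
  generalize frameMetric Φ ρ Ψ' 0 0 q = x
  generalize frameMetric Φ ρ Ψ' 0 1 q = y
  generalize frameMetric Φ ρ Ψ' 1 1 q = z
  linear_combination (x * z - y ^ 2) * (a * b - c * d + 1) * h

include hΦ hρ hΨ hq in
theorem contactMetric_pos {v : TangentSpace (𝓡 3) q}
    (hv : coordD Ψ q v 0 ≠ 0 ∨ coordD Ψ q v 1 ≠ 0) : 0 < contactMetric Φ ρ q v v := by
  obtain ⟨i, hi⟩ := ρ.exists_pos_of_mem (mem_univ q)
  have him : i ∈ ρ.finsupport q := (ρ.mem_finsupport q).2 hi.ne'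
  have hqi := mem_source_of_mem_finsupport hρ him
  rw [contactMetric_apply]
  refine Finset.sum_pos' (fun j _ => mul_nonneg (ρ.nonneg j q)
    (add_nonneg (mul_self_nonneg _) (mul_self_nonneg _))) ⟨i, him, mul_pos hi ?_⟩
  by_contra hn
  have h0 : coordD (Φ i) q v 0 = 0 := by nlinarith [mul_self_nonneg (coordD (Φ i) q v 1)]
  have h1 : coordD (Φ i) q v 1 = 0 := by nlinarith [mul_self_nonneg (coordD (Φ i) q v 0)]
  have h2 := eq_frame (hΦ i) hqi v
  rw [h0, h1, zero_smul, zero_smul, zero_add, zero_add] at h2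
  rw [h2, coordD_smul, hΨ.coordD_reeb hq] at hv
  simp at hv

include hΦ hρ hΨ hq in
-- The Gram–Schmidt vector `G₀₀ ∂_x - G₀₁ ∂_θ` has squared length `G₀₀` times the determinant.
theorem frameDet_pos : 0 < frameDet Φ ρ Ψ q := by
  have h0 : 0 < frameMetric Φ ρ Ψ 0 0 q := contactMetric_pos hΦ hρ hΨ hq (by
    rw [coordD_coordInv hΨ.mem_atlas hq]
    simp)
  have h1 := contactMetric_pos hΦ hρ hΨ hq (v := frameMetric Φ ρ Ψ 0 0 q •
    coordInv Ψ q (stdVec 1) - frameMetric Φ ρ Ψ 0 1 q • coordInv Ψ q (stdVec 0)) (by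
    rw [coordD_sub, coordD_smul, coordD_smul, coordD_coordInv hΨ.mem_atlas hq,
      coordD_coordInv hΨ.mem_atlas hq]
    right
    simpa using h0.ne')
  rw [contactMetric_eq_frameMetric hΦ hρ hΨ hq, coordD_sub, coordD_smul, coordD_smul,
    coordD_coordInv hΨ.mem_atlas hq, coordD_coordInv hΨ.mem_atlas hq] at h1
  simp at h1
  have h2 : 0 < frameMetric Φ ρ Ψ 0 0 q * frameDet Φ ρ Ψ q := by
    rw [frameDet]
    linarith
  exact pos_of_mul_pos_right h2 h0.le

variable (hc : ∀ p, p ∈ (Φ p).source)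

include hΦ hρ hΨ hq hc in
-- `metricJ` is defined through the chart attached to `q`, which may jump with `q`. The relations
-- λ(Jv) = 0 and dλ(w, Jv) = g(v, w)/√det do not mention the chart and determine Jv, so the same
-- formula holds in every contact chart.
theorem coordD_metricJ (v : TangentSpace (𝓡 3) q) : coordD Ψ q (metricJ Φ ρ q v) =
    (1 / √(frameDet Φ ρ Ψ q)) •
      (contactMetric Φ ρ q v (coordInv Ψ q (stdVec 1)) • (!₂[1, 0, -Ψ q 1] : E3)
        - contactMetric Φ ρ q v (coordInv Ψ q (stdVec 0)) • stdVec 1) := by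
  have h1 : coordD (Φ q) q (metricJ Φ ρ q v) = (1 / √(frameDet Φ ρ (Φ q) q)) •
      (contactMetric Φ ρ q v (coordInv (Φ q) q (stdVec 1)) • (!₂[1, 0, -Φ q q 1] : E3)
        - contactMetric Φ ρ q v (coordInv (Φ q) q (stdVec 0)) • stdVec 1) := by
    have h2 : metricJ Φ ρ q v = (1 / √(frameDet Φ ρ (Φ q) q)) • coordInv (Φ q) q
        (contactMetric Φ ρ q (coordInv (Φ q) q (stdVec 1)) v • (!₂[1, 0, -Φ q q 1] : E3)
        - contactMetric Φ ρ q (coordInv (Φ q) q (stdVec 0)) v • stdVec 1) := rfl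
    rw [h2, coordD_smul, coordD_coordInv (hΦ q).mem_atlas (hc q), contactMetric_comm q v,
      contactMetric_comm q v]
  have hl : lam q (metricJ Φ ρ q v) = 0 := by
    rw [(hΦ q).form q (hc q), h1]
    simp
    ring
  have hd : ∀ w, lam.extD q w (metricJ Φ ρ q v)
      = (1 / √(frameDet Φ ρ Ψ q)) * contactMetric Φ ρ q v w := by
    intro w
    rw [(hΦ q).extD_eq (hc q), h1, contactMetric_eq hΦ hρ (hΦ q) (hc q) v w,
      frameDet_eq hΦ hρ hΨ (hΦ q) hq (hc q)]
    simp
    ring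
  have hd0 := hd (coordInv Ψ q (stdVec 0))
  have hd1 := hd (coordInv Ψ q (stdVec 1))
  rw [hΨ.extD_eq hq, coordD_coordInv hΨ.mem_atlas hq] at hd0 hd1
  rw [hΨ.form q hq] at hl
  simp at hd0 hd1
  rw [hd1] at hl
  ext i
  fin_cases i
  · simpa using hd1
  · simp
    linarith
  · simp
    linarith

include hΦ hρ hc in
theorem isCompatible_metricJ_aux (p : M) :
    metricJ Φ ρ p (reeb lam p) = 0 ∧ (∀ v, lam p (metricJ Φ ρ p v) = 0) ∧
    (∀ v w, lam.extD p w (metricJ Φ ρ p v)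
      = (1 / √(frameDet Φ ρ (Φ p) p)) * contactMetric Φ ρ p v w) := by
  have hJ := fun v => coordD_metricJ hΦ hρ (hΦ p) (hc p) hc v
  refine ⟨?_, fun v => ?_, fun v w => ?_⟩
  · rw [← coordD_eq_zero (hΦ p).mem_atlas (hc p), hJ, contactMetric_comm p (reeb lam p),
      contactMetric_comm p (reeb lam p), contactMetric_reeb hΦ hρ, contactMetric_reeb hΦ hρ]
    simp
  · rw [(hΦ p).form p (hc p), hJ]
    simp
    ring
  · rw [(hΦ p).extD_eq (hc p), hJ, contactMetric_eq hΦ hρ (hΦ p) (hc p) v w]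
    simp
    ring

include hΦ hρ hc in
-- In the contact frame J is 1/√det times a matrix of trace zero whose determinant is that of the
-- metric, so its square is minus the identity.
theorem metricJ_sq (p : M) (v : TangentSpace (𝓡 3) p) (hv : lam p v = 0) :
    metricJ Φ ρ p (metricJ Φ ρ p v) = -v := by
  have hJ := fun v => coordD_metricJ hΦ hρ (hΦ p) (hc p) hc v
  have hd := frameDet_pos hΦ hρ (hΦ p) (hc p)
  have hs : √(frameDet Φ ρ (Φ p) p) * √(frameDet Φ ρ (Φ p) p) = frameDet Φ ρ (Φ p) p :=
    Real.mul_self_sqrt hd.le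
  have hs0 : √(frameDet Φ ρ (Φ p) p) ≠ 0 := (Real.sqrt_pos.2 hd).ne'
  have hG := fun w => contactMetric_eq_frameMetric (Φ := Φ) (ρ := ρ) hΦ hρ (hΦ p) (hc p) v w
  have hG' := fun w => contactMetric_eq_frameMetric (Φ := Φ) (ρ := ρ) hΦ hρ (hΦ p) (hc p)
    (metricJ Φ ρ p v) w
  have hl := (isCompatible_metricJ_aux hΦ hρ hc p).2.1 (metricJ Φ ρ p v)
  rw [(hΦ p).form p (hc p)] at hl hv
  have h0 : coordD (Φ p) p (metricJ Φ ρ p (metricJ Φ ρ p v)) 0 = -coordD (Φ p) p v 0 := by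
    rw [hJ (metricJ Φ ρ p v), hG', hG', hJ v, hG, hG]
    simp only [coordD_coordInv (hΦ p).mem_atlas (hc p)]
    simp
    field_simp
    rw [sq, hs, frameDet]
    ring
  have h1 : coordD (Φ p) p (metricJ Φ ρ p (metricJ Φ ρ p v)) 1 = -coordD (Φ p) p v 1 := by
    rw [hJ (metricJ Φ ρ p v), hG', hG', hJ v, hG, hG]
    simp only [coordD_coordInv (hΦ p).mem_atlas (hc p)]
    simp
    field_simp
    rw [sq, hs, frameDet]
    ring
  apply coordD_injective (hΦ p).mem_atlas (hc p)
  rw [coordD_neg]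
  ext i
  fin_cases i
  · simpa using h0
  · simpa using h1
  · simp
    rw [h0] at hl
    linarith

include hΦ hρ hΨ in
theorem contMDiffOn_frameMetric (i j : Fin 3) :
    ContMDiffOn (𝓡 3) 𝓘(ℝ, ℝ) ∞ (frameMetric Φ ρ Ψ i j) Ψ.source := by
  intro q hq
  have h1 : ∀ l, q ∈ tsupport (ρ l) → ContMDiffAt (𝓡 3) 𝓘(ℝ, ℝ) ∞ (fun q' =>
      coordD (Φ l) q' (coordInv Ψ q' (stdVec i)) 0 * coordD (Φ l) q' (coordInv Ψ q' (stdVec j)) 0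
      + coordD (Φ l) q' (coordInv Ψ q' (stdVec i)) 1
        * coordD (Φ l) q' (coordInv Ψ q' (stdVec j)) 1) q := by
    intro l hl
    have hn : (Φ l).source ∩ Ψ.source ∈ 𝓝 q :=
      ((Φ l).open_source.inter Ψ.open_source).mem_nhds ⟨hρ l hl, hq⟩
    have h2 : ∀ i' m : Fin 3, ContMDiffAt (𝓡 3) 𝓘(ℝ, ℝ) ∞ (fun q' =>
        coordD (Φ l) q' (coordInv Ψ q' (stdVec i')) m) q := fun i' m =>
      (EuclideanSpace.proj (𝕜 := ℝ) m).contMDiff.contMDiffAt.comp q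
        ((contMDiffOn_coordD_coordInv (hΦ l).mem_atlas hΨ.mem_atlas (stdVec i')).contMDiffAt hn)
    exact ((h2 i 0).mul (h2 j 0)).add ((h2 i 1).mul (h2 j 1))
  have h3 := ρ.contMDiffAt_finsum h1
  refine (h3.congr_of_eventuallyEq (Eventually.of_forall fun q' => ?_)).contMDiffWithinAt
  rw [frameMetric, contactMetric_apply]
  exact ρ.sum_finsupport_smul_eq_finsum q' (fun l q' =>
    coordD (Φ l) q' (coordInv Ψ q' (stdVec i)) 0 * coordD (Φ l) q' (coordInv Ψ q' (stdVec j)) 0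
      + coordD (Φ l) q' (coordInv Ψ q' (stdVec i)) 1
        * coordD (Φ l) q' (coordInv Ψ q' (stdVec j)) 1)

include hΦ hρ hc in
-- Near a base point the formula of `coordD_metricJ` is used in one fixed contact chart, where its
-- coefficients are smooth.
theorem contMDiff_metricJ : ContMDiff (𝓡 3).tangent (𝓡 3).tangent ∞
    (fun v : TangentBundle (𝓡 3) M =>
      (⟨v.proj, metricJ Φ ρ v.proj v.2⟩ : TangentBundle (𝓡 3) M)) := by
  intro v₀
  set Ψ := Φ v₀.proj with hΨdef
  have hΨ : IsContactChart lam Ψ := hΦ _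
  set S : Set (TangentBundle (𝓡 3) M) := Bundle.TotalSpace.proj ⁻¹' Ψ.source with hS
  have hproj : ContMDiff (𝓡 3).tangent (𝓡 3) ∞
      (Bundle.TotalSpace.proj : TangentBundle (𝓡 3) M → M) :=
    Bundle.contMDiff_proj _
  have hSo : IsOpen S := Ψ.open_source.preimage hproj.continuous
  have hv₀ : v₀ ∈ S := hc v₀.proj
  have hm : ∀ i j, ContMDiffOn (𝓡 3).tangent 𝓘(ℝ, ℝ) ∞
      (fun v : TangentBundle (𝓡 3) M => frameMetric Φ ρ Ψ i j v.proj) S := fun i j =>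
    (contMDiffOn_frameMetric hΦ hρ hΨ i j).comp hproj.contMDiffOn fun v hv => hv
  have hco : ∀ m : Fin 3, ContMDiffOn (𝓡 3).tangent 𝓘(ℝ, ℝ) ∞
      (fun v : TangentBundle (𝓡 3) M => coordD Ψ v.proj v.2 m) S := fun m =>
    (EuclideanSpace.proj (𝕜 := ℝ) m).contMDiff.comp_contMDiffOn (contMDiffOn_coordD hΨ.mem_atlas)
  have hx : ContMDiffOn (𝓡 3).tangent 𝓘(ℝ, ℝ) ∞
      (fun v : TangentBundle (𝓡 3) M => Ψ v.proj 1) S :=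
    (EuclideanSpace.proj (𝕜 := ℝ) (1 : Fin 3)).contMDiff.comp_contMDiffOn
      ((contMDiffOn_of_mem_maximalAtlas hΨ.mem_atlas).comp hproj.contMDiffOn fun v hv => hv)
  have hd : ContMDiffOn (𝓡 3).tangent 𝓘(ℝ, ℝ) ∞
      (fun v : TangentBundle (𝓡 3) M => 1 / √(frameDet Φ ρ Ψ v.proj)) S := by
    have h1 : ContMDiffOn (𝓡 3).tangent 𝓘(ℝ, ℝ) ∞
        (fun v : TangentBundle (𝓡 3) M => frameDet Φ ρ Ψ v.proj) S :=
      (((hm 0 0).mul (hm 1 1)).sub ((hm 0 1).mul (hm 0 1))).congr fun v _ => by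
        simp [frameDet, sq]
    have h2 : ContDiffOn ℝ ∞ (fun x : ℝ => 1 / √x) (Ioi 0) := fun x hx =>
      (contDiffAt_const.div (Real.contDiffAt_sqrt (ne_of_gt hx))
        (Real.sqrt_pos.2 hx).ne').contDiffWithinAt
    exact h2.contMDiffOn.comp h1 fun v hv => frameDet_pos hΦ hρ hΨ hv
  have hg : ∀ j, ContMDiffOn (𝓡 3).tangent 𝓘(ℝ, ℝ) ∞ (fun v : TangentBundle (𝓡 3) M =>
      coordD Ψ v.proj v.2 0 * frameMetric Φ ρ Ψ j 0 v.proj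
        + coordD Ψ v.proj v.2 1 * frameMetric Φ ρ Ψ j 1 v.proj) S := fun j =>
    ((hco 0).mul (hm j 0)).add ((hco 1).mul (hm j 1))
  have hvec : ContMDiffOn (𝓡 3).tangent 𝓘(ℝ, E3) ∞ (fun v : TangentBundle (𝓡 3) M =>
      coordD Ψ v.proj (metricJ Φ ρ v.proj v.2)) S := by
    have h1 : ∀ (a : TangentBundle (𝓡 3) M → ℝ) (u : E3), ContMDiffOn (𝓡 3).tangent 𝓘(ℝ, ℝ) ∞ a S
        → ContMDiffOn (𝓡 3).tangent 𝓘(ℝ, E3) ∞ (fun v => a v • u) S := fun a u ha =>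
      ha.smul contMDiffOn_const
    refine ((h1 _ (stdVec 0) (hd.mul (hg 1))).sub ((h1 _ (stdVec 2) (hd.mul (hx.mul (hg 1)))).add
      (h1 _ (stdVec 1) (hd.mul (hg 0))))).congr fun v hv => ?_
    rw [coordD_metricJ hΦ hρ hΨ hv hc, contactMetric_comm v.proj v.2,
      contactMetric_comm v.proj v.2, contactMetric_eq hΦ hρ hΨ hv _ v.2,
      contactMetric_eq hΦ hρ hΨ hv _ v.2]
    ext i
    fin_cases i <;> simp [frameMetric] <;> first | ring1 | (left; ring1)
  have hfin := ((contMDiffOn_coordInv hΨ.mem_atlas).comp (hproj.contMDiffOn.prodMk hvec)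
    fun v hv => ⟨hv, mem_univ _⟩).contMDiffAt (hSo.mem_nhds hv₀)
  refine hfin.congr_of_eventuallyEq ?_
  filter_upwards [hSo.mem_nhds hv₀] with v hv
  refine tangentBundle_ext hΨ.mem_atlas hv rfl ?_
  exact (coordD_coordInv hΨ.mem_atlas hv _).symm

include hΦ hρ hc in
theorem isCompatible_metricJ : IsCompatible lam (metricJ Φ ρ) where
  smooth := contMDiff_metricJ hΦ hρ hc
  map_reeb p := (isCompatible_metricJ_aux hΦ hρ hc p).1
  map_ker p v _ := (isCompatible_metricJ_aux hΦ hρ hc p).2.1 v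
  sq p v hv := metricJ_sq hΦ hρ hc p v hv
  symm p v w _ _ := by
    rw [(isCompatible_metricJ_aux hΦ hρ hc p).2.2, (isCompatible_metricJ_aux hΦ hρ hc p).2.2,
      contactMetric_comm]
  pos p v hv hv0 := by
    rw [(isCompatible_metricJ_aux hΦ hρ hc p).2.2]
    refine mul_pos (one_div_pos.2 (Real.sqrt_pos.2 (frameDet_pos hΦ hρ (hΦ p) (hc p)))) ?_
    refine contactMetric_pos hΦ hρ (hΦ p) (hc p) ?_
    by_contra! hn
    rw [(hΦ p).form p (hc p), hn.1] at hv
    apply hv0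
    rw [← coordD_eq_zero (hΦ p).mem_atlas (hc p)]
    ext i
    fin_cases i
    · exact hn.1
    · exact hn.2
    · simpa using hv

include hΦ hρ hc in
/-- Where only one function of the partition of unity is nonzero, the complex structure is the
standard one. -/
theorem coordD_metricJ_of_eq_one {p : M} (hp : ∀ i, i ≠ p → ρ i q = 0) (v : TangentSpace (𝓡 3) q) :
    q ∈ (Φ p).source ∧ coordD (Φ p) q (metricJ Φ ρ q v) 0 = coordD (Φ p) q v 1 ∧
      coordD (Φ p) q (metricJ Φ ρ q v) 1 = -coordD (Φ p) q v 0 := by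
  have hsub : ρ.finsupport q ⊆ {p} := by
    intro i hi
    rw [Finset.mem_singleton]
    by_contra h
    exact (ρ.mem_finsupport q).1 hi (hp i h)
  have hone : ρ p q = 1 := by
    have := ρ.sum_finsupport' q (mem_univ q) hsub
    simpa using this
  have hmem : p ∈ ρ.finsupport q := (ρ.mem_finsupport q).2 (by
    change ρ p q ≠ 0
    rw [hone]
    exact one_ne_zero)
  have heq : ρ.finsupport q = {p} := Finset.Subset.antisymm hsub (by simpa using hmem)
  have hq := mem_source_of_mem_finsupport hρ hmem
  have hG : ∀ v w, contactMetric Φ ρ q v w = coordD (Φ p) q v 0 * coordD (Φ p) q w 0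
      + coordD (Φ p) q v 1 * coordD (Φ p) q w 1 := by
    intro v w
    rw [contactMetric_apply, heq, Finset.sum_singleton, hone, one_mul]
  have hd : frameDet Φ ρ (Φ p) q = 1 := by
    simp only [frameDet, frameMetric, hG, coordD_coordInv (hΦ p).mem_atlas hq]
    simp
  refine ⟨hq, ?_, ?_⟩
  · rw [coordD_metricJ hΦ hρ (hΦ p) hq hc, hd, hG, hG]
    simp [coordD_coordInv (hΦ p).mem_atlas hq]
  · rw [coordD_metricJ hΦ hρ (hΦ p) hq hc, hd, hG, hG]
    simp [coordD_coordInv (hΦ p).mem_atlas hq]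

end ContactMetric

/-! ### Compatible complex structures that are standard near finitely many points. -/

section ExistenceOfComplexStructure

variable {M : Type*} [TopologicalSpace M] [T2Space M] [SecondCountableTopology M]
  [ChartedSpace E3 M] [IsManifold (𝓡 3) ∞ M] {lam : OneForm M}

/-- There are compatible complex structures which are standard in given contact charts near
finitely many points. -/
theorem IsContactForm.exists_isCompatible (hlam : IsContactForm lam) {P : Set M} (hP : P.Finite)
    (Φ : M → OpenPartialHomeomorph M E3)
    (hΦ : ∀ p ∈ P, IsContactChart lam (Φ p) ∧ p ∈ (Φ p).source) :
    ∃ J : EndField M, IsCompatible lam J ∧ ∀ p ∈ P, ∃ V : Set M, IsOpen V ∧ p ∈ V ∧ ∀ q ∈ V,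
      ∀ v : TangentSpace (𝓡 3) q, lam q v = 0 →
      coordD (Φ p) q (J q v) 0 = coordD (Φ p) q v 1 ∧
        coordD (Φ p) q (J q v) 1 = -coordD (Φ p) q v 0 := by
  classical
  choose Φ₀ hΦ₀ using hlam.exists_chart
  let Φ₁ : M → OpenPartialHomeomorph M E3 := fun p => if p ∈ P then Φ p else Φ₀ p
  have h1 : ∀ p, IsContactChart lam (Φ₁ p) ∧ p ∈ (Φ₁ p).source := by
    intro p
    by_cases h : p ∈ P
    · simpa [Φ₁, h] using hΦ p h
    · simpa [Φ₁, h] using hΦ₀ p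
  have h2 : ∀ p ∈ P, Φ₁ p = Φ p := fun p hp => by simp [Φ₁, hp]
  have : LocallyCompactSpace M := ChartedSpace.locallyCompactSpace E3 M
  obtain ⟨A, hA, hAd⟩ := hP.t2_separation
  have hK : ∀ p, ∃ K ∈ 𝓝 p, IsClosed K ∧ K ⊆ A p ∩ (Φ₁ p).source := fun p =>
    exists_mem_nhds_isClosed_subset (((hA p).2.inter (Φ₁ p).open_source).mem_nhds
      ⟨(hA p).1, (h1 p).2⟩)
  choose K hKn hKc hKs using hK
  -- Removing the sets `K p'` of the other chosen points leaves, on `K p`, only the partition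
  -- function of index `p`. The sets still cover because the `K p'` are disjoint.
  let W : M → Set M := fun p => (Φ₁ p).source \ ⋃ p' ∈ P \ {p}, K p'
  have hWo : ∀ p, IsOpen (W p) := fun p => (Φ₁ p).open_source.sdiff
    ((hP.subset sdiff_subset).isClosed_biUnion fun p' _ => hKc p')
  have hcover : univ ⊆ ⋃ p, W p := by
    intro q _
    by_cases h : ∃ p ∈ P, q ∈ K p
    · obtain ⟨p, hp, hq⟩ := h
      refine mem_iUnion.2 ⟨p, (hKs p hq).2, ?_⟩
      simp only [mem_iUnion, not_exists]
      rintro p' ⟨hp', hne⟩ hq'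
      exact disjoint_left.1 (hAd hp' hp hne) (hKs p' hq').1 (hKs p hq).1
    · push Not at h
      refine mem_iUnion.2 ⟨q, (h1 q).2, ?_⟩
      simp only [mem_iUnion, not_exists]
      exact fun p' hp' => h p' hp'.1
  obtain ⟨ρ, hρ⟩ := SmoothPartitionOfUnity.exists_isSubordinate (𝓡 3) isClosed_univ W hWo hcover
  have hρs : ∀ i, tsupport (ρ i) ⊆ (Φ₁ i).source := fun i => (hρ i).trans sdiff_subset
  refine ⟨metricJ Φ₁ ρ, isCompatible_metricJ (fun p => (h1 p).1) hρs fun p => (h1 p).2,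
    fun p hp => ⟨interior (K p), isOpen_interior, mem_interior_iff_mem_nhds.2 (hKn p),
      fun q hq v _ => ?_⟩⟩
  rw [← h2 p hp]
  refine (coordD_metricJ_of_eq_one (fun p => (h1 p).1) hρs (fun p => (h1 p).2)
    (fun i hi => ?_) v).2
  by_contra hne
  have hmem : q ∈ W i := hρ i (subset_tsupport _ hne)
  refine hmem.2 (mem_iUnion₂.2 ⟨p, ⟨hp, fun h => hi h.symm⟩, interior_subset hq⟩)

end ExistenceOfComplexStructure

/-! ### Cutoff functions of small logarithmic slope. -/

section LogarithmicCutoff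

variable {E : Type*} [NormedAddCommGroup E] [InnerProductSpace ℝ E]

theorem exists_bound_deriv_smoothTransition :
    ∃ C : ℝ, 0 < C ∧ ∀ x, |deriv Real.smoothTransition x| ≤ C := by
  have hc : Continuous (deriv Real.smoothTransition) :=
    (Real.smoothTransition.contDiff (n := 1)).continuous_deriv (by simp)
  obtain ⟨C, hC⟩ := (isCompact_Icc (a := (0 : ℝ)) (b := 1)).exists_bound_of_continuousOn
    hc.continuousOn
  refine ⟨|C| + 1, by positivity, fun x => ?_⟩
  by_cases hx : x ∈ Icc (0 : ℝ) 1
  · have := hC x hx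
    rw [Real.norm_eq_abs] at this
    linarith [le_abs_self C]
  · have h0 : deriv Real.smoothTransition x = 0 := by
      rw [mem_Icc, not_and_or, not_le, not_le] at hx
      rcases hx with hx | hx
      · have : Real.smoothTransition =ᶠ[𝓝 x] fun _ => 0 := by
          filter_upwards [Iio_mem_nhds hx] with y hy
          exact Real.smoothTransition.zero_of_nonpos (le_of_lt hy)
        rw [this.deriv_eq, deriv_const]
      · have : Real.smoothTransition =ᶠ[𝓝 x] fun _ => 1 := by
          filter_upwards [Ioi_mem_nhds hx] with y hy
          exact Real.smoothTransition.one_of_one_le (le_of_lt hy)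
        rw [this.deriv_eq, deriv_const]
    rw [h0, abs_zero]
    positivity

/-- Logarithmic cutoff functions: their derivative is small compared to the inverse distance
from the origin. -/
theorem exists_log_cutoff {ε δ : ℝ} (hε : 0 < ε) (hδ : 0 < δ) :
    ∃ χ : E → ℝ, ContDiff ℝ ∞ χ ∧ (∀ p, χ p ∈ Icc (0 : ℝ) 1) ∧ (∀ᶠ p in 𝓝 0, χ p = 1) ∧
      (∀ p, δ ≤ ‖p‖ → χ p = 0) ∧ ∀ p, ‖p‖ * ‖fderiv ℝ χ p‖ ≤ ε := by
  classical
  obtain ⟨C, hC, hCb⟩ := exists_bound_deriv_smoothTransition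
  -- The derivative of the cutoff has norm at most `2 * κ * C / ‖p‖`, so this value gives the bound
  -- `ε`.
  set κ : ℝ := ε / (2 * C) with hκ
  have hκ0 : 0 < κ := by positivity
  let l : E → ℝ := fun p => κ * (Real.log (δ ^ 2) - Real.log (‖p‖ ^ 2))
  let χ : E → ℝ := fun p => if p = 0 then 1 else Real.smoothTransition (l p)
  have hl : ∀ p : E, p ≠ 0 → HasFDerivAt l
      (κ • (-((‖p‖ ^ 2)⁻¹ • ((2 : ℝ) • innerSL ℝ p)))) p := by
    intro p hp
    have h1 := (hasStrictFDerivAt_norm_sq p).hasFDerivAt.log (pow_ne_zero 2 (norm_ne_zero_iff.2 hp))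
    refine ((h1.const_sub (Real.log (δ ^ 2))).const_mul κ).congr_fderiv ?_
    simp [two_smul]
  have hχ : ∀ p : E, p ≠ 0 → χ =ᶠ[𝓝 p] fun p => Real.smoothTransition (l p) := by
    intro p hp
    filter_upwards [isOpen_ne.mem_nhds hp] with y hy
    exact if_neg hy
  have h1 : ∀ᶠ p in 𝓝 (0 : E), χ p = 1 := by
    -- On the ball of this radius the argument of the transition function is at least one.
    have hr : 0 < δ * Real.exp (-(1 / (2 * κ))) := by positivity
    filter_upwards [Metric.ball_mem_nhds (0 : E) hr] with p hp
    by_cases hp0 : p = 0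
    · exact if_pos hp0
    · refine (if_neg hp0).trans (Real.smoothTransition.one_of_one_le ?_)
      have hpn : 0 < ‖p‖ := norm_pos_iff.2 hp0
      have h2 : Real.log ‖p‖ ≤ Real.log δ - 1 / (2 * κ) := by
        rw [mem_ball_zero_iff] at hp
        have := Real.log_le_log hpn hp.le
        rwa [Real.log_mul hδ.ne' (Real.exp_pos _).ne', Real.log_exp, ← sub_eq_add_neg] at this
      have h3 : κ * (1 / (2 * κ)) = 1 / 2 := by field_simp
      simp only [l, Real.log_pow]
      push_cast
      nlinarith
  refine ⟨χ, ?_, fun p => ?_, h1, fun p hp => ?_, fun p => ?_⟩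
  · rw [contDiff_iff_contDiffAt]
    intro p
    by_cases hp : p = 0
    · subst hp
      exact contDiffAt_const.congr_of_eventuallyEq h1
    · refine ContDiffAt.congr_of_eventuallyEq ?_ (hχ p hp)
      refine Real.smoothTransition.contDiff.contDiffAt.comp p ?_
      exact contDiffAt_const.mul (contDiffAt_const.sub
        ((contDiff_norm_sq ℝ).contDiffAt.log (pow_ne_zero 2 (norm_ne_zero_iff.2 hp))))
  · simp only [χ]
    split_ifs
    · simp
    · exact ⟨Real.smoothTransition.nonneg _, Real.smoothTransition.le_one _⟩
  · have hp0 : p ≠ 0 := norm_pos_iff.1 (hδ.trans_le hp)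
    refine (if_neg hp0).trans (Real.smoothTransition.zero_of_nonpos ?_)
    refine mul_nonpos_of_nonneg_of_nonpos hκ0.le ?_
    have := Real.log_le_log (by positivity) (pow_le_pow_left₀ hδ.le hp 2)
    linarith
  · by_cases hp : p = 0
    · simp [hp, hε.le]
    · have hS : HasDerivAt Real.smoothTransition (deriv Real.smoothTransition (l p)) (l p) :=
        ((Real.smoothTransition.contDiff (n := 1)).differentiable (by simp) _).hasDerivAt
      have h2 := (hS.comp_hasFDerivAt p (hl p hp)).congr_of_eventuallyEq (hχ p hp)
      rw [h2.fderiv, norm_smul, norm_smul, norm_neg, norm_smul, norm_smul, innerSL_apply_norm]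
      have hpn : ‖p‖ ≠ 0 := norm_ne_zero_iff.2 hp
      have h3 : ‖p‖ * (‖deriv Real.smoothTransition (l p)‖ * (‖κ‖ * (‖(‖p‖ ^ 2)⁻¹‖ *
          (‖(2 : ℝ)‖ * ‖p‖)))) = 2 * κ * ‖deriv Real.smoothTransition (l p)‖ := by
        rw [Real.norm_of_nonneg hκ0.le, Real.norm_of_nonneg (show 0 ≤ (‖p‖ ^ 2)⁻¹ by positivity),
          Real.norm_of_nonneg (by norm_num : (0 : ℝ) ≤ 2)]
        field_simp
      rw [h3]
      calc 2 * κ * ‖deriv Real.smoothTransition (l p)‖ ≤ 2 * κ * C := by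
            gcongr
            exact hCb _
        _ = ε := by rw [hκ]; field_simp

end LogarithmicCutoff

/-! ### Interpolation of graphs at an elliptic point. -/

section GraphForm

/-- The restriction of `dy + x dθ` to the graph `y = h (θ, x)`. -/
noncomputable def graphForm (h : E2 → ℝ) (p : E2) : E2 →L[ℝ] ℝ :=
  fderiv ℝ h p + p 1 • EuclideanSpace.proj (𝕜 := ℝ) (0 : Fin 2)

/-- The coordinate vectors of the plane. -/
noncomputable def planeVec (i : Fin 2) : E2 := EuclideanSpace.single i 1

@[simp]
theorem planeVec_apply (i j : Fin 2) : planeVec i j = if j = i then 1 else 0 := by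
  simp [planeVec]

theorem norm_planeVec (i : Fin 2) : ‖planeVec i‖ = 1 := by
  simp [planeVec]

theorem eq_sum_planeVec (v : E2) : v = v 0 • planeVec 0 + v 1 • planeVec 1 := by
  ext i
  fin_cases i <;> simp

theorem abs_apply_le_norm (p : E2) (i : Fin 2) : |p i| ≤ ‖p‖ := EuclideanSpace.norm_eq p ▸ by
  rw [← Real.sqrt_sq_eq_abs]
  refine Real.sqrt_le_sqrt ?_
  rw [Fin.sum_univ_two]
  fin_cases i <;> simp [sq_nonneg]

theorem norm_le_add_abs (p : E2) : ‖p‖ ≤ |p 0| + |p 1| := by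
  conv_lhs => rw [eq_sum_planeVec p]
  refine (norm_add_le _ _).trans_eq ?_
  rw [norm_smul, norm_smul, norm_planeVec, norm_planeVec, mul_one, mul_one]
  rfl

theorem hasFDerivAt_planeProd (p : E2) : HasFDerivAt (fun p : E2 => -(1 / 2) * (p 0 * p 1))
    (-(1 / 2 : ℝ) • (p 0 • EuclideanSpace.proj (𝕜 := ℝ) (1 : Fin 2)
      + p 1 • EuclideanSpace.proj (𝕜 := ℝ) (0 : Fin 2))) p := by
  have hp : ∀ i, HasFDerivAt (fun x : E2 => x i) (EuclideanSpace.proj (𝕜 := ℝ) i) p :=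
    fun i => (EuclideanSpace.proj (𝕜 := ℝ) i).hasFDerivAt
  exact ((hp 0).mul (hp 1)).const_mul (-(1 / 2))

theorem abs_le_of_fderiv_le {h : E2 → ℝ} (hh : Differentiable ℝ h) (h0 : h 0 = 0) {C r : ℝ}
    (hb : ∀ p, ‖p‖ < r → ‖fderiv ℝ h p‖ ≤ C * ‖p‖) (hC : 0 ≤ C) {p : E2} (hp : ‖p‖ < r) :
    |h p| ≤ C * ‖p‖ ^ 2 := by
  have h1 := (convex_closedBall (0 : E2) ‖p‖).norm_image_sub_le_of_norm_fderiv_le (𝕜 := ℝ)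
    (f := h) (C := C * ‖p‖) (fun x _ => hh x) (fun x hx => by
      rw [mem_closedBall_zero_iff] at hx
      exact (hb x (hx.trans_lt hp)).trans (by gcongr)) (x := 0) (y := p)
    (by simp) (by simp)
  rw [h0, sub_zero, sub_zero, Real.norm_eq_abs] at h1
  linarith [h1, sq ‖p‖, mul_assoc C ‖p‖ ‖p‖]

/-- The linear map p ↦ (a p₁, a' p₀ + c p₁) is triangular with diagonal entries of absolute value at
least `b`. Solving for p₁ and then for p₀ bounds ‖p‖ by its values. -/
theorem norm_mul_sq_le_of_triangular {p : E2} {a b c a' c' ε : ℝ} (hb : 0 < b) (ha : b ≤ |a|)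
    (ha' : b ≤ |a'|) (hc : |c| ≤ c') (h0 : |p 1 * a| ≤ 2 * ε * ‖p‖)
    (h1 : |p 0 * a' + p 1 * c| ≤ 2 * ε * ‖p‖) :
    ‖p‖ * b ^ 2 ≤ 2 * ε * (2 * b + c') * ‖p‖ := by
  have hc' : 0 ≤ c' := (abs_nonneg c).trans hc
  rw [abs_mul] at h0
  have k0 : |p 1| * b ≤ 2 * ε * ‖p‖ := le_trans (by gcongr) h0
  have k1 : |p 0| * b ≤ 2 * ε * ‖p‖ + |p 1| * c' := by
    have h2 : |p 0 * a'| ≤ 2 * ε * ‖p‖ + |p 1 * c| := by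
      have := abs_sub (p 0 * a' + p 1 * c) (p 1 * c)
      rw [add_sub_cancel_right] at this
      linarith
    have h3 : |p 1 * c| ≤ |p 1| * c' := by
      rw [abs_mul]
      gcongr
    rw [abs_mul] at h2
    have h4 : |p 0| * b ≤ |p 0| * |a'| := by gcongr
    linarith
  calc ‖p‖ * b ^ 2 ≤ (|p 0| + |p 1|) * b ^ 2 := by
        gcongr
        exact norm_le_add_abs p
    _ = (|p 0| * b) * b + (|p 1| * b) * b := by ring
    _ ≤ (2 * ε * ‖p‖ + |p 1| * c') * b + (2 * ε * ‖p‖) * b := by gcongr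
    _ = 4 * ε * ‖p‖ * b + (|p 1| * b) * c' := by ring
    _ ≤ 4 * ε * ‖p‖ * b + (2 * ε * ‖p‖) * c' := by gcongr
    _ = _ := by ring

/-- A graph with an elliptic singularity at the origin can be changed near the origin to the
graph of `-θx/2` without creating further singularities. -/
theorem exists_interpolation {h : E2 → ℝ} (hh : ContDiff ℝ ∞ h) (h0 : h 0 = 0)
    (hd : fderiv ℝ h 0 = 0) (hθ : fderiv ℝ (fderiv ℝ h) 0 (planeVec 0) (planeVec 0) = 0)
    (hm : fderiv ℝ (fderiv ℝ h) 0 (planeVec 0) (planeVec 1) ∈ Ioo (-1 : ℝ) 0)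
    {δ₀ : ℝ} (hδ₀ : 0 < δ₀) :
    ∃ δ ∈ Ioo 0 δ₀, ∃ u : E2 → ℝ, ContDiff ℝ ∞ u ∧ (∀ p, δ ≤ ‖p‖ → u p = 0) ∧
      (∀ᶠ p in 𝓝 0, h p + u p = -(1 / 2) * (p 0 * p 1)) ∧
      (∀ p, ‖p‖ ≤ δ → |h p| ≤ δ ∧ |u p| ≤ δ) ∧ (∀ p, p 1 = 0 → h p = 0 → u p = 0) ∧
      ∀ p, ‖p‖ ≤ δ → p ≠ 0 → graphForm (fun p => h p + u p) p ≠ 0 := by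
  set A := fderiv ℝ (fderiv ℝ h) 0 with hA
  set m := A (planeVec 0) (planeVec 1) with hmdef
  set c := A (planeVec 1) (planeVec 1) with hc
  have hsymm : A (planeVec 1) (planeVec 0) = m :=
    (hh.contDiffAt.isSymmSndFDerivAt (by simpa using two_le_infty)).eq _ _
  have hA0 : ∀ p : E2, A p (planeVec 0) = p 1 * m := by
    intro p
    conv_lhs => rw [eq_sum_planeVec p]
    simp [hθ, hsymm]
  have hA1 : ∀ p : E2, A p (planeVec 1) = p 0 * m + p 1 * c := by
    intro p
    conv_lhs => rw [eq_sum_planeVec p]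
    simp [hmdef, hc]
  have hDD : HasFDerivAt (fderiv ℝ h) A 0 :=
    ((hh.fderiv_right (m := ∞) (by simp)).differentiable (by simp) 0).hasFDerivAt
  -- A lower bound for |x| and |x + 1| for all x between m and -1/2; it is positive because m lies
  -- in (-1, 0).
  set b := min (min (-m) (1 + m)) (1 / 2) with hbdef
  have hb : 0 < b := lt_min (lt_min (by linarith [hm.2]) (by linarith [hm.1])) (by norm_num)
  have hb1 : b ≤ -m := (min_le_left _ _).trans (min_le_left _ _)
  have hb2 : b ≤ 1 + m := (min_le_left _ _).trans (min_le_right _ _)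
  have hb3 : b ≤ 1 / 2 := min_le_right _ _
  set C := ‖A‖ + 2 with hCdef
  have hC : 0 < C := by positivity
  -- Small enough that the conclusion of `norm_mul_sq_le_of_triangular` fails for every p ≠ 0; the
  -- summand 1 makes the inequality strict.
  set ε := b ^ 2 / (2 * (2 * b + |c| + 1)) with hεdef
  have hε : 0 < ε := by positivity
  have hεb : 2 * ε * (2 * b + |c|) < b ^ 2 := by
    have : 2 * ε * (2 * b + |c| + 1) = b ^ 2 := by
      rw [hεdef]
      field_simp
    nlinarith
  have hlo := hDD.isLittleO
  simp only [hd, sub_zero] at hlo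
  obtain ⟨r, hr, hrb⟩ := Metric.eventually_nhds_iff.1
    ((hlo.bound hε).and (hlo.bound one_pos))
  simp only [dist_zero_right] at hrb
  have hDh : ∀ p, ‖p‖ < r → ‖fderiv ℝ h p‖ ≤ (‖A‖ + 1) * ‖p‖ := by
    intro p hp
    have h1 := (hrb hp).2
    have h2 := A.le_opNorm p
    have h3 := norm_add_le (fderiv ℝ h p - A p) (A p)
    rw [sub_add_cancel] at h3
    linarith
  have hhb : ∀ p, ‖p‖ < r → |h p| ≤ (‖A‖ + 1) * ‖p‖ ^ 2 := fun p hp =>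
    abs_le_of_fderiv_le (hh.differentiable (by simp)) h0 hDh (by positivity) hp
  let w : E2 → ℝ := fun p => -(1 / 2) * (p 0 * p 1) - h p
  have hwb : ∀ p, ‖p‖ < r → |w p| ≤ C * ‖p‖ ^ 2 := by
    intro p hp
    have h1 := hhb p hp
    have h2 : |p 0 * p 1| ≤ ‖p‖ ^ 2 := by
      rw [abs_mul, sq]
      exact mul_le_mul (abs_apply_le_norm p 0) (abs_apply_le_norm p 1) (abs_nonneg _)
        (norm_nonneg _)
    have h3 := abs_sub (-(1 / 2) * (p 0 * p 1)) (h p)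
    rw [abs_mul, abs_neg, abs_of_pos (by norm_num : (0 : ℝ) < 1 / 2)] at h3
    change |w p| ≤ _ at h3
    rw [hCdef]
    nlinarith [sq_nonneg ‖p‖]
  -- The bound `δ ≤ 1 / C` turns the quadratic estimates for `h` and `w` into bounds by `δ` itself.
  set δ := min (δ₀ / 2) (min (r / 2) (1 / C)) with hδdef
  have hδ : 0 < δ := lt_min (by positivity) (lt_min (by positivity) (by positivity))
  have hδ0 : δ < δ₀ := (min_le_left _ _).trans_lt (by linarith)
  have hδr : δ < r := ((min_le_right _ _).trans (min_le_left _ _)).trans_lt (by linarith)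
  have hδC : C * δ ≤ 1 := by
    have : δ ≤ 1 / C := (min_le_right _ _).trans (min_le_right _ _)
    calc C * δ ≤ C * (1 / C) := by gcongr
      _ = 1 := by field_simp
  have hsq : ∀ p : E2, ‖p‖ ≤ δ → C * ‖p‖ ^ 2 ≤ δ := by
    intro p hp
    have : ‖p‖ ^ 2 ≤ δ ^ 2 := pow_le_pow_left₀ (norm_nonneg _) hp 2
    calc C * ‖p‖ ^ 2 ≤ C * δ ^ 2 := by gcongr
      _ = (C * δ) * δ := by ring
      _ ≤ 1 * δ := by gcongr
      _ = δ := one_mul δ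
  -- With slope `ε / C` and `|w p| ≤ C * ‖p‖ ^ 2`, the term with dχ is at most `ε * ‖p‖`, as small
  -- as the error of linearizing dh. An ordinary cutoff would only give a multiple of ‖p‖ that is
  -- not small.
  obtain ⟨χ, hχs, hχ01, hχ1, hχ0, hχd⟩ := exists_log_cutoff (E := E2)
    (ε := ε / C) (δ := δ) (by positivity) hδ
  have hq : ContDiff ℝ ∞ (fun p : E2 => -(1 / 2) * (p 0 * p 1)) := by fun_prop
  have hw : ContDiff ℝ ∞ w := hq.sub hh
  refine ⟨δ, ⟨hδ, hδ0⟩, fun p => χ p * w p, hχs.mul hw, fun p hp => ?_, ?_, fun p hp => ?_,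
    fun p hp1 hp2 => ?_, fun p hp hp0 => ?_⟩
  · simp only [hχ0 p hp, zero_mul]
  · filter_upwards [hχ1] with p hp
    simp only [hp, w]
    ring
  · have hpr := hp.trans_lt hδr
    refine ⟨(hhb p hpr).trans (le_trans ?_ (hsq p hp)), ?_⟩
    · gcongr
      linarith
    · rw [abs_mul, abs_of_nonneg (hχ01 p).1]
      calc χ p * |w p| ≤ 1 * |w p| := by
            gcongr
            exact (hχ01 p).2
        _ ≤ δ := by
            rw [one_mul]
            exact (hwb p hpr).trans (hsq p hp)
  · simp [w, hp1, hp2]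
  · intro hzero
    have hpr := hp.trans_lt hδr
    have hpn : 0 < ‖p‖ := norm_pos_iff.2 hp0
    have hder : HasFDerivAt (fun p => h p + χ p * w p)
        (fderiv ℝ h p + (χ p • (-(1 / 2 : ℝ) • (p 0 • EuclideanSpace.proj (𝕜 := ℝ) (1 : Fin 2)
          + p 1 • EuclideanSpace.proj (𝕜 := ℝ) (0 : Fin 2)) - fderiv ℝ h p)
          + w p • fderiv ℝ χ p)) p := by
      have h1 : HasFDerivAt h (fderiv ℝ h p) p := (hh.differentiable (by simp) p).hasFDerivAt
      have h2 : HasFDerivAt χ (fderiv ℝ χ p) p := (hχs.differentiable (by simp) p).hasFDerivAt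
      exact h1.add (h2.mul ((hasFDerivAt_planeProd p).sub h1))
    have herr : ∀ i, |(1 - χ p) * (fderiv ℝ h p - A p) (planeVec i)
        + w p * fderiv ℝ χ p (planeVec i)| ≤ 2 * ε * ‖p‖ := by
      intro i
      have h1 : |(fderiv ℝ h p - A p) (planeVec i)| ≤ ε * ‖p‖ := by
        refine ((fderiv ℝ h p - A p).le_opNorm (planeVec i)).trans ?_
        rw [norm_planeVec, mul_one]
        exact (hrb hpr).1
      have h2 : |fderiv ℝ χ p (planeVec i)| ≤ ‖fderiv ℝ χ p‖ := by
        refine ((fderiv ℝ χ p).le_opNorm (planeVec i)).trans ?_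
        rw [norm_planeVec, mul_one]
      have h3 : |w p * fderiv ℝ χ p (planeVec i)| ≤ ε * ‖p‖ := by
        rw [abs_mul]
        calc |w p| * |fderiv ℝ χ p (planeVec i)| ≤ (C * ‖p‖ ^ 2) * ‖fderiv ℝ χ p‖ := by
              gcongr
              exact hwb p hpr
          _ = C * ‖p‖ * (‖p‖ * ‖fderiv ℝ χ p‖) := by ring
          _ ≤ C * ‖p‖ * (ε / C) := by
              gcongr
              exact hχd p
          _ = ε * ‖p‖ := by field_simp
      have h4 : |(1 - χ p) * (fderiv ℝ h p - A p) (planeVec i)| ≤ ε * ‖p‖ := by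
        rw [abs_mul, abs_of_nonneg (by linarith [(hχ01 p).2])]
        calc (1 - χ p) * |(fderiv ℝ h p - A p) (planeVec i)| ≤ 1 * (ε * ‖p‖) := by
              gcongr
              linarith [(hχ01 p).1]
          _ = ε * ‖p‖ := one_mul _
      have h5 := abs_add_le ((1 - χ p) * (fderiv ℝ h p - A p) (planeVec i))
        (w p * fderiv ℝ χ p (planeVec i))
      linarith
    set t := χ p with ht
    have ht0 : 0 ≤ t := (hχ01 p).1
    have ht1 : t ≤ 1 := (hχ01 p).2
    -- The linear part at a zero: (1 - t)m - t/2 is a convex combination of m and -1/2, so the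
    -- diagonal coefficients of the triangular system stay away from zero.
    have e0 : p 1 * ((1 - t) * m - t / 2 + 1)
        + ((1 - t) * (fderiv ℝ h p - A p) (planeVec 0) + w p * fderiv ℝ χ p (planeVec 0)) = 0 := by
      have := congrArg (fun L : E2 →L[ℝ] ℝ => L (planeVec 0)) hzero
      simp only [graphForm, hder.fderiv] at this
      simp at this
      simp only [sub_apply, hA0]
      linear_combination this
    have e1 : p 0 * ((1 - t) * m - t / 2) + p 1 * ((1 - t) * c)
        + ((1 - t) * (fderiv ℝ h p - A p) (planeVec 1) + w p * fderiv ℝ χ p (planeVec 1)) = 0 := by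
      have := congrArg (fun L : E2 →L[ℝ] ℝ => L (planeVec 1)) hzero
      simp only [graphForm, hder.fderiv] at this
      simp at this
      simp only [sub_apply, hA1]
      linear_combination this
    have f0 := herr 0
    have f1 := herr 1
    rw [← neg_eq_of_add_eq_zero_right e0, abs_neg] at f0
    rw [← neg_eq_of_add_eq_zero_right e1, abs_neg] at f1
    have a1 := mul_le_mul_of_nonneg_left hb1 (sub_nonneg.2 ht1)
    have a2 := mul_le_mul_of_nonneg_left hb2 (sub_nonneg.2 ht1)
    have a3 := mul_le_mul_of_nonneg_left hb3 ht0
    have g0 : b ≤ |(1 - t) * m - t / 2 + 1| := by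
      have : b ≤ (1 - t) * m - t / 2 + 1 := by linarith
      exact this.trans (le_abs_self _)
    have g1 : b ≤ |(1 - t) * m - t / 2| := by
      have : b ≤ -((1 - t) * m - t / 2) := by linarith
      exact this.trans (neg_le_abs _)
    have k3 := norm_mul_sq_le_of_triangular hb g0 g1 (c := (1 - t) * c) (c' := |c|) (by
      rw [abs_mul, abs_of_nonneg (by linarith : 0 ≤ 1 - t)]
      exact mul_le_of_le_one_left (abs_nonneg c) (by linarith)) f0 f1
    have k4 := mul_lt_mul_of_pos_right hεb hpn
    linarith

end GraphForm

/-! ### The projection to the (θ, x)-plane. -/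

section PlaneProjection

/-- The projection `(θ, x, y) ↦ (θ, x)`. -/
noncomputable def planePr : E3 →L[ℝ] E2 :=
  (EuclideanSpace.proj (𝕜 := ℝ) (0 : Fin 3)).smulRight (planeVec 0)
    + (EuclideanSpace.proj (𝕜 := ℝ) (1 : Fin 3)).smulRight (planeVec 1)

@[simp]
theorem planePr_zero (q : E3) : planePr q 0 = q 0 := by
  simp [planePr]

@[simp]
theorem planePr_one (q : E3) : planePr q 1 = q 1 := by
  simp [planePr]

theorem ext_of_planePr {q q' : E3} (h : planePr q = planePr q') (h2 : q 2 = q' 2) : q = q' := by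
  ext i
  fin_cases i
  · simpa using congrArg (fun p : E2 => p 0) h
  · simpa using congrArg (fun p : E2 => p 1) h
  · exact h2

theorem graphForm_apply (h : E2 → ℝ) (p v : E2) :
    graphForm h p v = fderiv ℝ h p v + p 1 * v 0 := rfl

theorem contDiff_graphForm {h : E2 → ℝ} (hh : ContDiff ℝ ∞ h) : ContDiff ℝ ∞ (graphForm h) :=
  (hh.fderiv_right (by simp)).add
    ((EuclideanSpace.proj (𝕜 := ℝ) (1 : Fin 2)).contDiff.smul contDiff_const)

theorem fderiv_graphForm {h : E2 → ℝ} (hh : ContDiff ℝ ∞ h) (p u v : E2) :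
    fderiv ℝ (graphForm h) p u v = fderiv ℝ (fderiv ℝ h) p u v + u 1 * v 0 := by
  have h1 : HasFDerivAt (fderiv ℝ h) (fderiv ℝ (fderiv ℝ h) p) p :=
    ((hh.fderiv_right (m := ∞) (by simp)).differentiable (by simp) p).hasFDerivAt
  have h2 : HasFDerivAt (fun x : E2 => x 1) (EuclideanSpace.proj (𝕜 := ℝ) (1 : Fin 2)) p :=
    (EuclideanSpace.proj (𝕜 := ℝ) (1 : Fin 2)).hasFDerivAt
  have h3 : HasFDerivAt (graphForm h) _ p :=
    h1.add (h2.smul_const (EuclideanSpace.proj (𝕜 := ℝ) (0 : Fin 2)))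
  rw [h3.fderiv]
  rfl

end PlaneProjection

/-! ### Surfaces which are graphs in a contact chart. -/

section Graphs

variable {M : Type*} [TopologicalSpace M] [ChartedSpace E3 M]
  {F : Type*} [TopologicalSpace F] [ChartedSpace (EuclideanHalfSpace 2) F]
  {lam : OneForm M} {f : F → M} {Φ : OpenPartialHomeomorph M E3} {h : E2 → ℝ} {z : F}

/-- The horizontal components of the derivative of a surface. -/
noncomputable def horizontalDeriv (Φ : OpenPartialHomeomorph M E3) (f : F → M) (z : F) :
    TangentSpace (𝓡∂ 2) z →L[ℝ] E2 :=
  planePr.comp ((modelDeriv Φ (f z)).comp (mfderiv (𝓡∂ 2) (𝓡 3) f z))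

theorem horizontalDeriv_apply (v : TangentSpace (𝓡∂ 2) z) : horizontalDeriv Φ f z v
    = planePr (coordD Φ (f z) (mfderiv (𝓡∂ 2) (𝓡 3) f z v)) := rfl

theorem coordD_mfderiv_two (hΦ : Φ ∈ IsManifold.maximalAtlas (𝓡 3) ∞ M) (hz : f z ∈ Φ.source)
    (hf : MDifferentiableAt (𝓡∂ 2) (𝓡 3) f z) (hh : ContDiff ℝ ∞ h)
    (hg : ∀ᶠ z' in 𝓝 z, Φ (f z') 2 = h (planePr (Φ (f z')))) (v : TangentSpace (𝓡∂ 2) z) :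
    coordD Φ (f z) (mfderiv (𝓡∂ 2) (𝓡 3) f z v) 2
      = fderiv ℝ h (planePr (Φ (f z))) (horizontalDeriv Φ f z v) := by
  have h1 := ((mdifferentiable_of_mem_maximalAtlas hΦ).mdifferentiableAt hz).hasMFDerivAt.comp z
    hf.hasMFDerivAt
  have h2 : HasFDerivAt (fun x : E3 => h (planePr x))
      ((fderiv ℝ h (planePr (Φ (f z)))).comp planePr) (Φ (f z)) :=
    (hh.differentiable (by simp) _).hasFDerivAt.comp _ planePr.hasFDerivAt
  have h3 : HasFDerivAt (fun x : E3 => x 2) (EuclideanSpace.proj (𝕜 := ℝ) (2 : Fin 3))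
    (Φ (f z)) := (EuclideanSpace.proj (𝕜 := ℝ) (2 : Fin 3)).hasFDerivAt
  have h4 := (h2.hasMFDerivAt.comp z h1).congr_of_eventuallyEq
    (f₁ := fun z' => Φ (f z') 2) (hg.mono fun z' hz' => hz')
  exact DFunLike.congr_fun (hasMFDerivAt_unique (h3.hasMFDerivAt.comp z h1) h4) v

namespace IsContactChart

theorem lam_mfderiv (hΦ : IsContactChart lam Φ) (hz : f z ∈ Φ.source)
    (hf : MDifferentiableAt (𝓡∂ 2) (𝓡 3) f z) (hh : ContDiff ℝ ∞ h)
    (hg : ∀ᶠ z' in 𝓝 z, Φ (f z') 2 = h (planePr (Φ (f z')))) (v : TangentSpace (𝓡∂ 2) z) :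
    lam (f z) (mfderiv (𝓡∂ 2) (𝓡 3) f z v)
      = graphForm h (planePr (Φ (f z))) (horizontalDeriv Φ f z v) := by
  rw [hΦ.form _ hz, coordD_mfderiv_two hΦ.mem_atlas hz hf hh hg, graphForm_apply,
    planePr_one, horizontalDeriv_apply, planePr_zero]

/-- For a graph the y-component of a tangent vector is dh of the horizontal part, so the horizontal
part determines the vector. -/
theorem horizontalDeriv_injective (hΦ : IsContactChart lam Φ) (hz : f z ∈ Φ.source)
    (hf : MDifferentiableAt (𝓡∂ 2) (𝓡 3) f z)
    (hi : Function.Injective (mfderiv (𝓡∂ 2) (𝓡 3) f z)) (hh : ContDiff ℝ ∞ h)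
    (hg : ∀ᶠ z' in 𝓝 z, Φ (f z') 2 = h (planePr (Φ (f z')))) :
    Function.Injective (horizontalDeriv Φ f z) := by
  intro v w hvw
  refine hi (coordD_injective hΦ.mem_atlas hz (ext_of_planePr hvw ?_))
  rw [coordD_mfderiv_two hΦ.mem_atlas hz hf hh hg, coordD_mfderiv_two hΦ.mem_atlas hz hf hh hg]
  exact congrArg _ hvw

theorem horizontalDeriv_surjective (hΦ : IsContactChart lam Φ) (hz : f z ∈ Φ.source)
    (hf : MDifferentiableAt (𝓡∂ 2) (𝓡 3) f z)
    (hi : Function.Injective (mfderiv (𝓡∂ 2) (𝓡 3) f z)) (hh : ContDiff ℝ ∞ h)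
    (hg : ∀ᶠ z' in 𝓝 z, Φ (f z') 2 = h (planePr (Φ (f z')))) :
    Function.Surjective (horizontalDeriv Φ f z) := by
  let A : E2 →ₗ[ℝ] E2 := (horizontalDeriv Φ f z).toLinearMap
  have hA : Function.Injective A := hΦ.horizontalDeriv_injective hz hf hi hh hg
  have hs : Function.Surjective A := LinearMap.injective_iff_surjective.1 hA
  exact hs

/-- The singular points of a graph are the zeros of the restricted contact form. -/
theorem isSingularPt_iff (hΦ : IsContactChart lam Φ) (hz : f z ∈ Φ.source)
    (hf : MDifferentiableAt (𝓡∂ 2) (𝓡 3) f z)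
    (hi : Function.Injective (mfderiv (𝓡∂ 2) (𝓡 3) f z)) (hh : ContDiff ℝ ∞ h)
    (hg : ∀ᶠ z' in 𝓝 z, Φ (f z') 2 = h (planePr (Φ (f z')))) :
    IsSingularPt lam f z ↔ graphForm h (planePr (Φ (f z))) = 0 := by
  have hs := hΦ.horizontalDeriv_surjective hz hf hi hh hg
  have hl := hΦ.lam_mfderiv hz hf hh hg
  constructor
  · intro hsing
    ext u
    obtain ⟨v, rfl⟩ := hs u
    rw [← hl]
    exact (hsing _).1 ⟨v, rfl⟩
  · intro h0 v
    constructor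
    · rintro ⟨w, rfl⟩
      rw [hl, h0]
      rfl
    · intro hv
      obtain ⟨w, hw⟩ := hs (planePr (coordD Φ (f z) v))
      refine ⟨w, coordD_injective hΦ.mem_atlas hz (ext_of_planePr hw ?_)⟩
      have h1 : lam (f z) (mfderiv (𝓡∂ 2) (𝓡 3) f z w) = 0 := by
        rw [hl, h0]
        rfl
      have h2 := congrArg (fun p : E2 => p 0) hw
      simp only [horizontalDeriv_apply, planePr_zero] at h2
      rw [hΦ.form _ hz] at hv h1
      rw [h2] at h1
      linarith

end IsContactChart

/-! ### The determinant deciding on ellipticity, for graphs. -/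

section FoliationMatrix

variable [IsManifold (𝓡∂ 2) ∞ F] [IsManifold (𝓡 3) ∞ M]

/-- The determinant of a bilinear form scales by the square of the determinant of the frame; its
sign is therefore independent of coordinates. -/
theorem det_bilinear (B : E2 →L[ℝ] E2 →L[ℝ] ℝ) (u v : E2) :
    B u u * B v v - B u v * B v u = (u 0 * v 1 - u 1 * v 0) ^ 2 *
      (B (planeVec 0) (planeVec 0) * B (planeVec 1) (planeVec 1)
        - B (planeVec 0) (planeVec 1) * B (planeVec 1) (planeVec 0)) := by
  have hB : ∀ a b : E2, B a b = a 0 * (b 0 * B (planeVec 0) (planeVec 0)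
      + b 1 * B (planeVec 0) (planeVec 1)) + a 1 * (b 0 * B (planeVec 1) (planeVec 0)
      + b 1 * B (planeVec 1) (planeVec 1)) := by
    intro a b
    conv_lhs => rw [eq_sum_planeVec a, eq_sum_planeVec b]
    simp
  rw [hB u u, hB v v, hB u v, hB v u]
  ring

/-- The foliation matrix at a singular point of a graph. -/
theorem IsContactChart.det_foliationMatrix (hΦ : IsContactChart lam Φ) (hz : f z ∈ Φ.source)
    (hf : ContMDiff (𝓡∂ 2) (𝓡 3) ∞ f)
    (hi : Function.Injective (mfderiv (𝓡∂ 2) (𝓡 3) f z)) (hh : ContDiff ℝ ∞ h)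
    (hg : ∀ᶠ z' in 𝓝 z, Φ (f z') 2 = h (planePr (Φ (f z'))))
    (h0 : graphForm h (planePr (Φ (f z))) = 0) :
    ∃ d : ℝ, d ≠ 0 ∧ (foliationMatrix lam f z).det = d ^ 2 *
      (fderiv ℝ (graphForm h) (planePr (Φ (f z))) (planeVec 0) (planeVec 0)
        * fderiv ℝ (graphForm h) (planePr (Φ (f z))) (planeVec 1) (planeVec 1)
      - fderiv ℝ (graphForm h) (planePr (Φ (f z))) (planeVec 0) (planeVec 1)
        * fderiv ℝ (graphForm h) (planePr (Φ (f z))) (planeVec 1) (planeVec 0)) := by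
  set ψ := extChartAt (𝓡∂ 2) z with hψ
  set R : Set E2 := range (𝓡∂ 2) with hR
  set w₀ := ψ z with hw₀
  have hRu : UniqueDiffOn ℝ R := (𝓡∂ 2).uniqueDiffOn
  have hw₀R : w₀ ∈ R := mem_range_self _
  have hψz : ψ.symm w₀ = z := extChartAt_to_inv z
  let c : E2 → E3 := fun w => Φ (f (ψ.symm w))
  let κ : E2 → E2 := fun w => planePr (c w)
  have hgood : ∀ᶠ z' in 𝓝 z, f z' ∈ Φ.source ∧ Φ (f z') 2 = h (planePr (Φ (f z'))) :=
    Filter.Eventually.and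
      (hf.continuous.continuousAt.preimage_mem_nhds (Φ.open_source.mem_nhds hz)) hg
  have hψc : ContinuousWithinAt ψ.symm R w₀ :=
    (continuousAt_extChartAt_symm z).continuousWithinAt
  have hev : ∀ᶠ w in 𝓝[R] w₀, w ∈ ψ.target ∧ ∀ᶠ z' in 𝓝 (ψ.symm w),
      f z' ∈ Φ.source ∧ Φ (f z') 2 = h (planePr (Φ (f z'))) := by
    refine Filter.Eventually.and (extChartAt_target_mem_nhdsWithin z) ?_
    have h1 := hgood.eventually_nhds
    rw [← hψz] at h1
    exact hψc.eventually h1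
  have hFd : ∀ w ∈ ψ.target, ContMDiffWithinAt 𝓘(ℝ, E2) (𝓡 3) ∞ (f ∘ ψ.symm) R w := by
    intro w hw
    have h1 : ContMDiffWithinAt 𝓘(ℝ, E2) (𝓡 3) ∞ (f ∘ ψ.symm) ψ.target w :=
      (hf.comp_contMDiffOn (contMDiffOn_extChartAt_symm z)) w hw
    exact h1.mono_of_mem_nhdsWithin (extChartAt_target_mem_nhdsWithin_of_mem hw)
  have hcd : ∀ w ∈ ψ.target, f (ψ.symm w) ∈ Φ.source → ContDiffWithinAt ℝ ∞ c R w := by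
    intro w hw hfw
    have h1 : ContMDiffAt (𝓡 3) 𝓘(ℝ, E3) ∞ Φ (f (ψ.symm w)) :=
      (contMDiffOn_of_mem_maximalAtlas hΦ.mem_atlas).contMDiffAt (Φ.open_source.mem_nhds hfw)
    exact contMDiffWithinAt_iff_contDiffWithinAt.1 (h1.comp_contMDiffWithinAt w (hFd w hw))
  have hκd : ∀ w ∈ ψ.target, f (ψ.symm w) ∈ Φ.source → ContDiffWithinAt ℝ ∞ κ R w :=
    fun w hw hfw => planePr.contDiff.contDiffAt.comp_contDiffWithinAt w (hcd w hw hfw)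
  -- The foliation form is the pullback of the graph form by the horizontal coordinate map κ of the
  -- surface.
  have hform : ∀ᶠ w in 𝓝[R] w₀, foliationForm lam f z w
      = (graphForm h (κ w)).comp (fderivWithin ℝ κ R w) := by
    filter_upwards [hev, self_mem_nhdsWithin] with w hw hwR
    obtain ⟨hwt, hwe⟩ := hw
    have hfw : f (ψ.symm w) ∈ Φ.source := hwe.self_of_nhds.1
    have hu : UniqueMDiffWithinAt 𝓘(ℝ, E2) R w := (hRu w hwR).uniqueMDiffWithinAt
    have hFm : HasMFDerivWithinAt 𝓘(ℝ, E2) (𝓡 3) (f ∘ ψ.symm) R w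
        (mfderivWithin 𝓘(ℝ, E2) (𝓡 3) (f ∘ ψ.symm) R w) :=
      ((hFd w hwt).mdifferentiableWithinAt (by simp)).hasMFDerivWithinAt
    have hcm := ((mdifferentiable_of_mem_maximalAtlas hΦ.mem_atlas).mdifferentiableAt
      hfw).hasMFDerivAt.comp_hasMFDerivWithinAt w hFm
    have hcf : HasFDerivWithinAt c (fderivWithin ℝ c R w) R w :=
      ((hcd w hwt hfw).differentiableWithinAt (by simp)).hasFDerivWithinAt
    have hce : ∀ u : E2, coordD Φ (f (ψ.symm w))
        (mfderivWithin 𝓘(ℝ, E2) (𝓡 3) (f ∘ ψ.symm) R w u) = fderivWithin ℝ c R w u := fun u =>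
      DFunLike.congr_fun (hu.eq hcm hcf.hasMFDerivWithinAt) u
    have hκf : fderivWithin ℝ κ R w = planePr.comp (fderivWithin ℝ c R w) :=
      (planePr.hasFDerivAt.comp_hasFDerivWithinAt w hcf).fderivWithin (hRu w hwR)
    have h2 : fderivWithin ℝ (fun w => c w 2) R w = fderivWithin ℝ (fun w => h (κ w)) R w := by
      refine Filter.EventuallyEq.fderivWithin_eq ?_ hwe.self_of_nhds.2
      have h3 : ContinuousWithinAt ψ.symm R w :=
        ((contMDiffOn_extChartAt_symm (n := ∞) z).continuousOn w hwt).mono_of_mem_nhdsWithin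
          (extChartAt_target_mem_nhdsWithin_of_mem hwt)
      exact (h3.eventually hwe).mono fun w' hw' => hw'.2
    have h4 : fderivWithin ℝ (fun w => c w 2) R w
        = (EuclideanSpace.proj (𝕜 := ℝ) (2 : Fin 3)).comp (fderivWithin ℝ c R w) :=
      ((EuclideanSpace.proj (𝕜 := ℝ) (2 : Fin 3)).hasFDerivAt.comp_hasFDerivWithinAt w
        hcf).fderivWithin (hRu w hwR)
    have h5 : fderivWithin ℝ (fun w => h (κ w)) R w
        = (fderiv ℝ h (κ w)).comp (fderivWithin ℝ κ R w) :=
      ((hh.differentiable (by simp) (κ w)).hasFDerivAt.comp_hasFDerivWithinAt w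
        ((hκd w hwt hfw).differentiableWithinAt (by simp)).hasFDerivWithinAt).fderivWithin
        (hRu w hwR)
    rw [h4, h5] at h2
    ext u
    have h6 := DFunLike.congr_fun h2 u
    change lam (f (ψ.symm w)) (mfderivWithin 𝓘(ℝ, E2) (𝓡 3) (f ∘ ψ.symm) R w u) = _
    rw [hΦ.form _ hfw, hce, ContinuousLinearMap.comp_apply, graphForm_apply, hκf]
    rw [hκf] at h6
    change fderivWithin ℝ c R w u 2 = _ at h6
    rw [h6]
    have h7 : κ w 1 = Φ (f (ψ.symm w)) 1 := planePr_one _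
    rw [h7, ContinuousLinearMap.comp_apply, ContinuousLinearMap.comp_apply, planePr_zero]
  have hw₀t : w₀ ∈ ψ.target := mem_extChartAt_target z
  have hfw₀ : f (ψ.symm w₀) ∈ Φ.source := by rwa [hψz]
  have hκ₀ := hκd w₀ hw₀t hfw₀
  set K := fderivWithin ℝ κ R w₀ with hK
  have hκw : κ w₀ = planePr (Φ (f z)) := by
    simp only [κ, c, hψz]
  have hKd : HasFDerivWithinAt (fderivWithin ℝ κ R)
      (fderivWithin ℝ (fderivWithin ℝ κ R) R w₀) R w₀ :=
    ((hκ₀.fderivWithin_right (m := ∞) hRu (by simp) hw₀R).differentiableWithinAt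
      (by simp)).hasFDerivWithinAt
  have hηd : HasFDerivWithinAt (fun w => graphForm h (κ w))
      ((fderiv ℝ (graphForm h) (κ w₀)).comp K) R w₀ :=
    ((contDiff_graphForm hh).differentiable (by simp) _).hasFDerivAt.comp_hasFDerivWithinAt w₀
      (hκ₀.differentiableWithinAt (by simp)).hasFDerivWithinAt
  have hD := hηd.clm_comp hKd
  -- The graph form vanishes at this point, so the second derivative of κ drops out and only its
  -- first derivative `K` remains.
  have hmat : ∀ i j, foliationMatrix lam f z i j
      = fderiv ℝ (graphForm h) (κ w₀) (K (planeVec i)) (K (planeVec j)) := by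
    intro i j
    have h1 : fderivWithin ℝ (foliationForm lam f z) R w₀ = _ :=
      (Filter.EventuallyEq.fderivWithin_eq hform (hform.self_of_nhdsWithin hw₀R)).trans
        (hD.fderivWithin (hRu w₀ hw₀R))
    change fderivWithin ℝ (foliationForm lam f z) R w₀ (planeVec i) (planeVec j) = _
    rw [h1, hκw, h0]
    simp [hK]
  have hKs : Function.Surjective K := by
    intro u
    obtain ⟨v, hv⟩ := hΦ.horizontalDeriv_surjective hz (hf.mdifferentiable (by simp) z) hi hh hg u
    have hψm : HasMFDerivWithinAt (𝓡∂ 2) 𝓘(ℝ, E2) ψ univ z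
        (mfderiv (𝓡∂ 2) 𝓘(ℝ, E2) ψ z) :=
      ((contMDiffAt_extChartAt (n := ∞)).mdifferentiableAt
        (by simp)).hasMFDerivAt.hasMFDerivWithinAt
    have h1 := ((hκ₀.differentiableWithinAt (by simp)).hasFDerivWithinAt.hasMFDerivWithinAt.comp z
      hψm (fun y _ => mem_range_self _)).hasMFDerivAt Filter.univ_mem
    have h2 : HasMFDerivAt (𝓡∂ 2) 𝓘(ℝ, E2) (fun z' => planePr (Φ (f z'))) z
        (horizontalDeriv Φ f z) :=
      planePr.hasFDerivAt.hasMFDerivAt.comp z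
        (((mdifferentiable_of_mem_maximalAtlas hΦ.mem_atlas).mdifferentiableAt
          hz).hasMFDerivAt.comp z (hf.mdifferentiable (by simp) z).hasMFDerivAt)
    have h3 := h1.congr_of_eventuallyEq (f₁ := fun z' => planePr (Φ (f z'))) (by
      filter_upwards [extChartAt_source_mem_nhds (I := 𝓡∂ 2) z] with y hy
      have : ψ.symm (ψ y) = y := ψ.left_inv hy
      simp only [Function.comp, κ, c, this])
    refine ⟨mfderiv (𝓡∂ 2) 𝓘(ℝ, E2) ψ z v, ?_⟩
    exact (DFunLike.congr_fun (hasMFDerivAt_unique h2 h3) v).symm.trans hv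
  refine ⟨K (planeVec 0) 0 * K (planeVec 1) 1 - K (planeVec 0) 1 * K (planeVec 1) 0, ?_, ?_⟩
  · intro hdet
    obtain ⟨a, ha⟩ := hKs (planeVec 0)
    obtain ⟨b, hb⟩ := hKs (planeVec 1)
    rw [eq_sum_planeVec a, map_add, map_smul, map_smul] at ha
    rw [eq_sum_planeVec b, map_add, map_smul, map_smul] at hb
    have a0 := congrArg (fun p : E2 => p 0) ha
    have a1 := congrArg (fun p : E2 => p 1) ha
    have b0 := congrArg (fun p : E2 => p 0) hb
    have b1 := congrArg (fun p : E2 => p 1) hb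
    simp at a0 a1 b0 b1
    have h1 : (a 0 * K (planeVec 0) 0 + a 1 * K (planeVec 1) 0)
        * (b 0 * K (planeVec 0) 1 + b 1 * K (planeVec 1) 1)
        - (a 0 * K (planeVec 0) 1 + a 1 * K (planeVec 1) 1)
        * (b 0 * K (planeVec 0) 0 + b 1 * K (planeVec 1) 0)
        = (a 0 * b 1 - a 1 * b 0) *
          (K (planeVec 0) 0 * K (planeVec 1) 1 - K (planeVec 0) 1 * K (planeVec 1) 0) := by ring
    rw [hdet, a0, a1, b0, b1] at h1
    norm_num at h1
  · rw [Matrix.det_fin_two, hmat, hmat, hmat, hmat, det_bilinear, hκw]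

end FoliationMatrix

end Graphs

/-! ### The knot near one of its points. -/

section KnotNeighbourhoods

variable {M : Type*} [TopologicalSpace M] [T2Space M] [ChartedSpace E3 M]
  {lam : OneForm M} {k : ℝ → M}

/-- Points of the knot near `k r₀` have parameters near `r₀`. -/
theorem IsLegendrianKnot.exists_nhds_param (hk : IsLegendrianKnot lam k) (r₀ : ℝ) {δ : ℝ}
    (hδ : 0 < δ) :
    ∃ V ∈ 𝓝 (k r₀), ∀ r, k r ∈ V → ∃ n : ℤ, |r + n - r₀| < δ := by
  -- One full period around `r₀` without the δ-neighbourhood of `r₀`. Its image is compact and, by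
  -- injectivity modulo the period, misses `k r₀`.
  let C : Set ℝ := Icc (r₀ - 1 / 2) (r₀ + 1 / 2) ∩ {r | δ ≤ |r - r₀|}
  have hC : IsCompact C := isCompact_Icc.inter_right
    (isClosed_le continuous_const (by fun_prop))
  have hinj : ∀ r r', k r = k r' → ∃ n : ℤ, r = r' + n := by
    intro r r' h
    have hf : ∀ x, k (Int.fract x) = k x := by
      intro x
      have := hk.periodic.sub_zsmul_eq (x := x) ⌊x⌋
      rwa [zsmul_one] at this
    have h1 := hk.injOn ⟨Int.fract_nonneg r, Int.fract_lt_one r⟩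
      ⟨Int.fract_nonneg r', Int.fract_lt_one r'⟩ (by rw [hf, hf, h])
    refine ⟨⌊r⌋ - ⌊r'⌋, ?_⟩
    push_cast
    rw [Int.fract, Int.fract] at h1
    linarith
  have hmem : k r₀ ∉ k '' C := by
    rintro ⟨r, ⟨hr, hr'⟩, hkr⟩
    obtain ⟨n, hn⟩ := hinj r r₀ hkr
    have h1 : |(n : ℝ)| < 1 := by
      rw [abs_lt]
      constructor <;> linarith [hr.1, hr.2]
    have h2 : n = 0 := by
      have : |n| < 1 := by exact_mod_cast h1
      exact Int.abs_lt_one_iff.1 this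
    rw [h2] at hn
    simp only [mem_ofPred_eq, hn, Int.cast_zero, add_zero, sub_self, abs_zero] at hr'
    linarith
  refine ⟨(k '' C)ᶜ, (hC.image hk.smooth.continuous).isClosed.isOpen_compl.mem_nhds hmem,
    fun r hr => ?_⟩
  -- This shift moves `r` into the period centred at `r₀`.
  refine ⟨-round (r - r₀), ?_⟩
  by_contra! hn
  have h1 := abs_sub_round (r - r₀)
  rw [abs_le] at h1
  refine hr ⟨r + ((-round (r - r₀) : ℤ) : ℝ), ⟨⟨?_, ?_⟩, hn⟩, ?_⟩
  · push_cast
    linarith [h1.1]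
  · push_cast
    linarith [h1.2]
  · have := hk.periodic.zsmul (-round (r - r₀)) r
    simpa using this

variable [IsManifold (𝓡 3) ∞ M] {Φ : OpenPartialHomeomorph M E3}

theorem IsLegendrianKnot.coordD_velocity_eq_deriv (hk : IsLegendrianKnot lam k)
    (hΦ : Φ ∈ IsManifold.maximalAtlas (𝓡 3) ∞ M) {r : ℝ} (hr : k r ∈ Φ.source) :
    coordD Φ (k r) (velocity k r) = deriv (fun r => Φ (k r)) r := by
  have h1 := mfderiv_comp (I := 𝓘(ℝ, ℝ)) (I' := 𝓡 3) (I'' := 𝓘(ℝ, E3)) r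
    ((mdifferentiable_of_mem_maximalAtlas hΦ).mdifferentiableAt hr)
    (hk.smooth.mdifferentiable (by simp) r)
  rw [← fderiv_apply_one_eq_deriv]
  exact ((DFunLike.congr_fun (mfderiv_eq_fderiv (f := Φ ∘ k) (x := r)) (1 : ℝ)).symm.trans
    (DFunLike.congr_fun h1 (1 : ℝ))).symm

/-- Near a point of the knot, a chart which straightens a piece of the knot straightens all
of it. -/
theorem IsLegendrianKnot.exists_nhds_axis (hk : IsLegendrianKnot lam k)
    (hΦ : Φ ∈ IsManifold.maximalAtlas (𝓡 3) ∞ M) {r₀ : ℝ} (hr₀ : k r₀ ∈ Φ.source)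
    (hax : ∀ᶠ r in 𝓝 r₀, Φ (k r) = (r - r₀) • stdVec 0) :
    ∃ V ∈ 𝓝 (k r₀), ∀ q ∈ V, q ∈ Φ.source ∧ (q ∈ range k ↔ Φ q 1 = 0 ∧ Φ q 2 = 0) ∧
      ∀ r, k r = q → 0 < coordD Φ (k r) (velocity k r) 0 := by
  have hev : ∀ᶠ r in 𝓝 r₀, k r ∈ Φ.source ∧ Φ (k r) = (r - r₀) • stdVec 0 ∧
      deriv (fun r => Φ (k r)) r = stdVec 0 := by
    filter_upwards [hk.smooth.continuous.continuousAt.preimage_mem_nhds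
      (Φ.open_source.mem_nhds hr₀), hax, hax.eventually_nhds] with r h1 h2 h3
    refine ⟨h1, h2, ?_⟩
    have h4 : HasDerivAt (fun r : ℝ => (r - r₀) • stdVec 0) (stdVec 0) r := by
      simpa using ((hasDerivAt_id r).sub_const r₀).smul_const (stdVec 0)
    rw [Filter.EventuallyEq.deriv_eq h3, h4.deriv]
  obtain ⟨δ, hδ, hδb⟩ := Metric.eventually_nhds_iff.1 hev
  simp only [Real.dist_eq] at hδb
  obtain ⟨V, hV, hVr⟩ := hk.exists_nhds_param r₀ hδ
  have hper : ∀ (r : ℝ) (n : ℤ), k (r + n) = k r := fun r n => by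
    simpa using hk.periodic.zsmul n r
  have hΦ0 : Φ (k r₀) = 0 := by
    rw [hax.self_of_nhds, sub_self, zero_smul]
  have hcoord : ∀ᶠ q in 𝓝 (k r₀), |Φ q 0| < δ := by
    have h1 : ContinuousAt (fun q => |Φ q 0|) (k r₀) :=
      (continuous_abs.comp (EuclideanSpace.proj (𝕜 := ℝ) (0 : Fin 3)).continuous).continuousAt.comp
        (Φ.continuousAt hr₀)
    refine h1.eventually_lt continuousAt_const ?_
    simpa [hΦ0] using hδ
  -- The bound on θ serves the converse: a point of the axis with |θ| < δ is the knot point of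
  -- parameter θ + r₀.
  refine ⟨V ∩ Φ.source ∩ {q | |Φ q 0| < δ},
    inter_mem (inter_mem hV (Φ.open_source.mem_nhds hr₀)) hcoord, ?_⟩
  rintro q ⟨⟨hqV, hqΦ⟩, hqδ⟩
  refine ⟨hqΦ, ⟨?_, ?_⟩, ?_⟩
  · rintro ⟨r, rfl⟩
    obtain ⟨n, hn⟩ := hVr r hqV
    rw [← hper r n, (hδb hn).2.1]
    simp
  · rintro ⟨h1, h2⟩
    have h3 : |Φ q 0 + r₀ - r₀| < δ := by
      rw [add_sub_cancel_right]
      exact hqδ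
    refine ⟨Φ q 0 + r₀, Φ.injOn (hδb h3).1 hqΦ ?_⟩
    rw [(hδb h3).2.1]
    ext i
    fin_cases i
    · simp
    · simpa using h1.symm
    · simpa using h2.symm
  · rintro r rfl
    obtain ⟨n, hn⟩ := hVr r hqV
    have h1 : (fun r => Φ (k r)) = fun r => Φ (k (r + n)) := by
      funext r
      rw [hper]
    rw [hk.coordD_velocity_eq_deriv hΦ hqΦ, h1,
      deriv_comp_add_const (f := fun r => Φ (k r)) (n : ℝ) r, (hδb hn).2.2]
    simp

end KnotNeighbourhoods

/-! ### The surface near a singular boundary point is half of a graph. -/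

section SurfaceNeighbourhoods

variable {M : Type*} [TopologicalSpace M] [ChartedSpace E3 M] [IsManifold (𝓡 3) ∞ M]
  {F : Type*} [TopologicalSpace F] [ChartedSpace (EuclideanHalfSpace 2) F]
  [IsManifold (𝓡∂ 2) ∞ F]
  {lam : OneForm M} {f : F → M} {Φ : OpenPartialHomeomorph M E3}

/-- Projection to the boundary line does not increase the distance to a centre on this line. -/
theorem euclideanHalfPlane_sub_mem {w₀ w : E2} {r : ℝ} (h0 : w₀ 0 = 0)
    (hw : w ∈ Metric.ball w₀ r) : w - w 0 • planeVec 0 ∈ Metric.ball w₀ r := by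
  rw [Metric.mem_ball, EuclideanSpace.dist_eq, Fin.sum_univ_two] at hw ⊢
  refine lt_of_le_of_lt (Real.sqrt_le_sqrt ?_) hw
  simp [h0]
  positivity

/-- A function on the plane which vanishes on an axis and increases or decreases across it has
opposite signs on the two sides. -/
theorem nonneg_iff_of_fderiv_pos {G : E2 → ℝ} {w₀ : E2} {r a : ℝ} (h0 : w₀ 0 = 0)
    (hd : ∀ w ∈ Metric.ball w₀ r, DifferentiableAt ℝ G w)
    (ha : ∀ w ∈ Metric.ball w₀ r, 0 < a * fderiv ℝ G w (planeVec 0))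
    (hz : ∀ w ∈ Metric.ball w₀ r, w 0 = 0 → G w = 0) {w : E2} (hw : w ∈ Metric.ball w₀ r) :
    0 ≤ w 0 ↔ 0 ≤ a * G w := by
  have hw' := euclideanHalfPlane_sub_mem h0 hw
  obtain ⟨x, hx, hxe⟩ := domain_mvt (f := G) (s := Metric.ball w₀ r)
    (f' := fderiv ℝ G) (fun y hy => (hd y hy).hasFDerivAt.hasFDerivWithinAt)
    (convex_ball w₀ r) hw' hw
  rw [hz _ hw' (by simp), sub_zero, sub_sub_cancel, map_smul, smul_eq_mul] at hxe
  have hpos := ha x ((convex_ball w₀ r).segment_subset hw' hw hx)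
  rw [hxe, mul_left_comm]
  constructor
  · intro h
    exact mul_nonneg h hpos.le
  · intro h
    exact nonneg_of_mul_nonneg_left h hpos

/-- Near a singular boundary point which lies on an axis, a surface with boundary on this axis is
one half of a graph. -/
theorem IsContactChart.exists_nhds_graph (hΦ : IsContactChart lam Φ)
    (hf : IsSmoothEmbedding (𝓡∂ 2) (𝓡 3) ∞ f) {z₀ : F} (hz₀ : z₀ ∈ (𝓡∂ 2).boundary F)
    (hs : IsSingularPt lam f z₀) (hp : f z₀ ∈ Φ.source) (hp0 : Φ (f z₀) = 0)
    (hax : ∀ᶠ z in 𝓝 z₀, z ∈ (𝓡∂ 2).boundary F → Φ (f z) 1 = 0) :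
    ∃ (σ : ℝ) (h : E2 → ℝ), (σ = 1 ∨ σ = -1) ∧ ContDiff ℝ ∞ h ∧ ∃ V ∈ 𝓝 (f z₀), ∀ q ∈ V,
      q ∈ Φ.source ∧ (q ∈ range f ↔ Φ q 2 = h (planePr (Φ q)) ∧ σ * Φ q 1 ≤ 0) := by
  obtain ⟨φ, hφ, hz₀φ, W, G, hW, hG, hGi, hpar⟩ :=
    exists_local_param (hf.isImmersion.isImmersionAt z₀) hΦ.mem_atlas
  have hfd : MDifferentiableAt (𝓡∂ 2) (𝓡 3) f z₀ :=
    (hf.isImmersion.isImmersionAt z₀).contMDiffAt.mdifferentiableAt (by simp)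
  set e := φ.extend (𝓡∂ 2) with he
  set w₀ := e z₀ with hw₀
  obtain ⟨hw₀W, hGw₀⟩ := hpar z₀ hz₀φ hp
  have hw₀0 : w₀ 0 = 0 := (mem_boundary_iff_of_mem_maximalAtlas hφ hz₀φ).1 hz₀
  have hes : ∀ z, z ∈ φ.source → e.symm (e z) = z := fun z hz =>
    e.left_inv (by rwa [he, φ.extend_source])
  have hGd : ∀ w ∈ W, DifferentiableAt ℝ G w := fun w hw =>
    (hG.contDiffAt (hW.mem_nhds hw)).differentiableAt (by simp)
  -- At the singular point x = 0, so the contact plane is {dy = 0}. The projection to (θ, x) is then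
  -- injective on the tangent plane, and the surface is locally a graph.
  have hG2 : ∀ u, fderiv ℝ G w₀ u 2 = 0 := by
    intro u
    obtain ⟨v, rfl⟩ := mfderiv_extend_surjective hφ hz₀φ u
    have h1 := coordD_mfderiv_eq_of_param hΦ.mem_atlas hφ hW hG hpar hz₀φ hp hfd v
    have h2 := (hs _).1 ⟨v, rfl⟩
    rw [hΦ.form _ hp, hp0] at h2
    rw [h1, PiLp.zero_apply, zero_mul, add_zero] at h2
    exact h2
  let κ : E2 → E2 := fun w => planePr (G w)
  have hκ : ContDiffOn ℝ ∞ κ W := planePr.contDiff.comp_contDiffOn hG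
  obtain ⟨B, hB⟩ := injective_continuousLinearEquiv (planePr.comp (fderiv ℝ G w₀)) (by
    intro v hv
    refine hGi w₀ hw₀W (ext_of_planePr ?_ ?_)
    · rw [map_zero, map_zero]
      exact hv
    · rw [hG2, map_zero]
      rfl)
  obtain ⟨Ψ, hw₀Ψ, hΨW, hΨκ, -, hΨs⟩ := exists_openPartialHomeomorph_contDiffOn hW hκ hw₀W B
    (by
      rw [hB]
      exact planePr.hasFDerivAt.comp w₀ (hGd w₀ hw₀W).hasFDerivAt)
  have hκ0 : κ w₀ = 0 := by
    simp only [κ]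
    rw [← hGw₀, hp0, map_zero]
  have hΨ0 : (0 : E2) ∈ Ψ.target := by
    rw [← hκ0, ← hΨκ]
    exact Ψ.map_source hw₀Ψ
  obtain ⟨h, hh, hhe⟩ := exists_contDiff_eventuallyEq Ψ.open_target
    (f := fun x => G (Ψ.symm x) 2)
    ((EuclideanSpace.proj (𝕜 := ℝ) (2 : Fin 3)).contDiff.comp_contDiffOn
      (hG.comp hΨs fun x hx => hΨW (Ψ.map_target hx))) hΨ0
  -- parameters near `w₀` in the half-plane come from points of the surface
  have hsurj : ∀ V ∈ 𝓝 z₀, ∀ᶠ w in 𝓝 w₀, 0 ≤ w 0 →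
      ∃ z ∈ φ.source, z ∈ V ∧ f z ∈ Φ.source ∧ e z = w := by
    intro V hV
    have hc : ContinuousAt e.symm w₀ := φ.continuousAt_extend_symm hz₀φ
    have h1 : V ∩ f ⁻¹' Φ.source ∈ 𝓝 (e.symm w₀) := by
      rw [hes z₀ hz₀φ]
      exact inter_mem hV (hfd.continuousAt.preimage_mem_nhds (Φ.open_source.mem_nhds hp))
    have h2 : e.target ∈ 𝓝[range (𝓡∂ 2)] w₀ := φ.extend_target_mem_nhdsWithin hz₀φ
    rw [mem_nhdsWithin_iff_eventually] at h2
    filter_upwards [hc.preimage_mem_nhds h1, h2] with w hw1 hw2 hw3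
    have hwt := hw2 ((mem_range_halfSpace_iff w).2 hw3)
    have hws : e.symm w ∈ φ.source := by
      rw [← φ.extend_source (I := 𝓡∂ 2)]
      exact e.map_target hwt
    exact ⟨e.symm w, hws, hw1.1, hw1.2, e.right_inv hwt⟩
  have hzero : ∀ᶠ w in 𝓝 w₀, w 0 = 0 → G w 1 = 0 := by
    filter_upwards [hsurj _ hax] with w hw hw0
    obtain ⟨z, hzφ, hzV, hzΦ, rfl⟩ := hw hw0.ge
    rw [← (hpar z hzφ hzΦ).2]
    exact hzV ((mem_boundary_iff_of_mem_maximalAtlas hφ hzφ).2 hw0)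
  have hG1d : ∀ w ∈ W, HasFDerivAt (fun w => G w 1)
      ((EuclideanSpace.proj (𝕜 := ℝ) (1 : Fin 3)).comp (fderiv ℝ G w)) w := fun w hw =>
    (EuclideanSpace.proj (𝕜 := ℝ) (1 : Fin 3)).hasFDerivAt.comp w (hGd w hw).hasFDerivAt
  set a := fderiv ℝ G w₀ (planeVec 0) 1 with ha
  -- The boundary runs inside x = 0, so ∂₁ of the x-component vanishes; invertibility of the
  -- horizontal derivative leaves ∂₀ to be nonzero.
  have ha0 : a ≠ 0 := by
    have h1 : fderiv ℝ G w₀ (planeVec 1) 1 = 0 := by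
      have hl : HasDerivAt (fun t : ℝ => w₀ + t • planeVec 1) (planeVec 1) 0 := by
        simpa using ((hasDerivAt_id (0 : ℝ)).smul_const (planeVec 1)).const_add w₀
      have hl0 : w₀ + (0 : ℝ) • planeVec 1 = w₀ := by simp
      have h2 : HasDerivAt (fun t : ℝ => G (w₀ + t • planeVec 1) 1)
          (fderiv ℝ G w₀ (planeVec 1) 1) 0 := by
        have h3 := hG1d w₀ hw₀W
        rw [← hl0] at h3
        have h4 := h3.comp_hasDerivAt (0 : ℝ) hl
        rw [hl0] at h4
        exact h4
      have h5 : (fun t : ℝ => G (w₀ + t • planeVec 1) 1) =ᶠ[𝓝 0] fun _ => 0 := by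
        have h6 : Tendsto (fun t : ℝ => w₀ + t • planeVec 1) (𝓝 0) (𝓝 w₀) := by
          have := hl.continuousAt.tendsto
          rwa [hl0] at this
        filter_upwards [h6.eventually hzero] with t ht
        exact ht (by simp [hw₀0])
      exact h2.unique ((hasDerivAt_const (0 : ℝ) (0 : ℝ)).congr_of_eventuallyEq h5)
    intro h0
    have h2 : ∀ u : E2, B u 1 = 0 := by
      intro u
      have h3 : B u = planePr (fderiv ℝ G w₀ u) := DFunLike.congr_fun hB u
      rw [h3, planePr_one, eq_sum_planeVec u, map_add, map_smul, map_smul]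
      simp [h1, ← ha, h0]
    obtain ⟨u, hu⟩ := B.surjective (planeVec 1)
    have := h2 u
    rw [hu] at this
    simp at this
  have hapos : ∀ᶠ w in 𝓝 w₀, 0 < a * fderiv ℝ G w (planeVec 0) 1 := by
    have h1 : ContinuousAt (fun w => a * fderiv ℝ G w (planeVec 0) 1) w₀ := by
      have h2 : ContinuousAt (fderiv ℝ G) w₀ :=
        (hG.continuousOn_fderiv_of_isOpen hW (by simp)).continuousAt (hW.mem_nhds hw₀W)
      exact continuousAt_const.mul
        ((EuclideanSpace.proj (𝕜 := ℝ) (1 : Fin 3)).continuous.continuousAt.comp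
          (h2.clm_apply continuousAt_const))
    refine continuousAt_const.eventually_lt h1 ?_
    rw [← ha]
    exact mul_self_pos.2 ha0
  obtain ⟨r, hr, hball⟩ := Metric.mem_nhds_iff.1 (inter_mem (inter_mem hapos hzero)
    (inter_mem (Ψ.open_source.mem_nhds hw₀Ψ) (hsurj univ univ_mem)))
  have hsign : ∀ w ∈ Metric.ball w₀ r, 0 ≤ w 0 ↔ 0 ≤ a * G w 1 := fun w hw =>
    nonneg_iff_of_fderiv_pos (G := fun w => G w 1) hw₀0
      (fun w hw => (hG1d w (hΨW (hball hw).2.1)).differentiableAt)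
      (fun w hw => by
        rw [(hG1d w (hΨW (hball hw).2.1)).fderiv]
        exact (hball hw).1.1) (fun w hw => (hball hw).1.2) hw
  let Ω : Set E2 := {x | x ∈ Ψ.target ∧ Ψ.symm x ∈ Metric.ball w₀ r ∧ h x = G (Ψ.symm x) 2}
  have hΩ : Ω ∈ 𝓝 (0 : E2) := by
    have h1 : Ψ.symm 0 = w₀ := by
      rw [← hκ0, ← hΨκ]
      exact Ψ.left_inv hw₀Ψ
    have h2 : Metric.ball w₀ r ∈ 𝓝 (Ψ.symm 0) := by
      rw [h1]
      exact Metric.ball_mem_nhds w₀ hr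
    filter_upwards [Ψ.open_target.mem_nhds hΨ0,
      (Ψ.symm.continuousAt hΨ0).preimage_mem_nhds h2, hhe] with x hx1 hx2 hx3
    exact ⟨hx1, hx2, hx3⟩
  -- Here the embedding property enters: no other part of the surface comes close to this point.
  obtain ⟨V₁, hV₁, hV₁f⟩ : ∃ V₁ ∈ 𝓝 (f z₀), ∀ z, f z ∈ V₁ →
      z ∈ φ.source ∧ e z ∈ Metric.ball w₀ r := by
    have h1 : φ.source ∩ e ⁻¹' Metric.ball w₀ r ∈ 𝓝 z₀ :=
      inter_mem (φ.open_source.mem_nhds hz₀φ)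
        ((φ.contMDiffAt_extend hφ hz₀φ).continuousAt.preimage_mem_nhds
          (Metric.ball_mem_nhds w₀ hr))
    rw [hf.isEmbedding.isInducing.nhds_eq_comap] at h1
    obtain ⟨V₁, hV₁, hsub⟩ := h1
    exact ⟨V₁, hV₁, fun z hz => hsub hz⟩
  have hV₂ : ∀ᶠ q in 𝓝 (f z₀), q ∈ Φ.source ∧ planePr (Φ q) ∈ Ω := by
    have h1 : ContinuousAt (fun q => planePr (Φ q)) (f z₀) :=
      planePr.continuous.continuousAt.comp (Φ.continuousAt hp)
    have h2 : Ω ∈ 𝓝 (planePr (Φ (f z₀))) := by rwa [hp0, map_zero]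
    exact (Φ.open_source.eventually_mem hp).and (h1.preimage_mem_nhds h2)
  have hκeq : ∀ w ∈ Metric.ball w₀ r, Ψ.symm (planePr (G w)) = w := by
    intro w hw
    have := Ψ.left_inv (hball hw).2.1
    rwa [hΨκ] at this
  have hmain : ∀ q, q ∈ V₁ → q ∈ Φ.source → planePr (Φ q) ∈ Ω →
      (q ∈ range f ↔ Φ q 2 = h (planePr (Φ q)) ∧ 0 ≤ a * Φ q 1) := by
    intro q hq1 hq2 hq3
    constructor
    · rintro ⟨z, rfl⟩
      obtain ⟨hzφ, hzb⟩ := hV₁f z hq1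
      have h1 := (hpar z hzφ hq2).2
      rw [hq3.2.2, h1, hκeq _ hzb]
      refine ⟨rfl, (hsign _ hzb).1 ((mem_range_halfSpace_iff _).1 (mem_range_self _))⟩
    · rintro ⟨h1, h2⟩
      obtain ⟨hx1, hx2, hx3⟩ := hq3
      set w := Ψ.symm (planePr (Φ q)) with hw
      have h3 : planePr (G w) = planePr (Φ q) := by
        have := Ψ.right_inv hx1
        rwa [hΨκ] at this
      have h4 : G w = Φ q := ext_of_planePr h3 (by rw [h1, hx3])
      have h5 : 0 ≤ w 0 := (hsign w hx2).2 (by rwa [h4])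
      obtain ⟨z, hzφ, -, hzΦ, hzw⟩ := (hball hx2).2.2 h5
      refine ⟨z, Φ.injOn hzΦ hq2 ?_⟩
      rw [(hpar z hzφ hzΦ).2, hzw, h4]
  -- The surface is the side a x ≥ 0, so σ is the opposite of the sign of a.
  rcases ha0.lt_or_gt with hneg | hpos
  · refine ⟨1, h, Or.inl rfl, hh, _, inter_mem hV₁ hV₂, ?_⟩
    rintro q ⟨hq1, hq2, hq3⟩
    refine ⟨hq2, (hmain q hq1 hq2 hq3).trans (and_congr_right fun _ => ?_)⟩
    rw [one_mul]
    constructor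
    · intro h1
      by_contra! h2
      nlinarith
    · intro h1
      nlinarith
  · refine ⟨-1, h, Or.inr rfl, hh, _, inter_mem hV₁ hV₂, ?_⟩
    rintro q ⟨hq1, hq2, hq3⟩
    refine ⟨hq2, (hmain q hq1 hq2 hq3).trans (and_congr_right fun _ => ?_)⟩
    constructor
    · intro h1
      have := nonneg_of_mul_nonneg_right h1 hpos
      linarith
    · intro h1
      have : 0 ≤ Φ q 1 := by linarith
      positivity

end SurfaceNeighbourhoods

/-! ### Local changes are small in the compact-open topology. -/

section CompactOpen

/-- A continuous map stays in a given neighbourhood in the compact-open topology when it is changed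
only near a point, moving points only near that point. -/
theorem ContinuousMap.exists_nhds_of_mem_nhds {X Y : Type*} [TopologicalSpace X]
    [TopologicalSpace Y] [T2Space Y] (f : C(X, Y)) {N : Set C(X, Y)} (hN : N ∈ 𝓝 f) (p : Y) :
    ∃ V ∈ 𝓝 p, ∀ g : C(X, Y), (∀ x, g x = f x ∨ f x ∈ V ∧ g x ∈ V) → g ∈ N := by
  let S : Set Y → Set C(X, Y) := fun V => {g | ∀ x, g x = f x ∨ f x ∈ V ∧ g x ∈ V}
  have hS : Monotone S := fun V V' h g hg x => (hg x).imp id fun hx => ⟨h hx.1, h hx.2⟩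
  -- As convergence of a filter the claim needs checking only on subbasic sets `{g | MapsTo g K U}`.
  -- If p is in U, take U itself; otherwise the complement of f(K), so that nothing changes on K.
  have hle : Tendsto id ((𝓝 p).lift' S) (𝓝 f) := by
    rw [ContinuousMap.tendsto_nhds_compactOpen]
    intro K hK U hU hKU
    change {g : C(X, Y) | MapsTo g K U} ∈ (𝓝 p).lift' S
    rw [Filter.mem_lift'_sets hS]
    by_cases hp : p ∈ U
    · refine ⟨U, hU.mem_nhds hp, fun g hg x hx => ?_⟩
      rcases hg x with h | h
      · rw [h]
        exact hKU hx
      · exact h.2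
    · have hpK : p ∉ f '' K := by
        rintro ⟨x, hx, rfl⟩
        exact hp (hKU hx)
      refine ⟨(f '' K)ᶜ, (hK.image f.continuous).isClosed.isOpen_compl.mem_nhds hpK,
        fun g hg x hx => ?_⟩
      rcases hg x with h | h
      · rw [h]
        exact hKU hx
      · exact absurd (mem_image_of_mem f hx) h.1
  obtain ⟨V, hV, hVN⟩ := (Filter.mem_lift'_sets hS).1 (hle hN)
  exact ⟨V, hV, fun g hg => hVN hg⟩

end CompactOpen

/-! ### Singular and elliptic points are local; immersions composed with local diffeomorphisms. -/

section Locality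

variable {M : Type*} [TopologicalSpace M] [ChartedSpace E3 M]
  {F : Type*} [TopologicalSpace F] [ChartedSpace (EuclideanHalfSpace 2) F]
  {lam : OneForm M} {f g : F → M} {z : F}

theorem OneForm.congr_point (lam : OneForm M) {q q' : M} (h : q = q') (v : E3) :
    (lam q : E3 →L[ℝ] ℝ) v = (lam q' : E3 →L[ℝ] ℝ) v := by
  rw [h]

theorem isSingularPt_congr (h : g =ᶠ[𝓝 z] f) : IsSingularPt lam g z ↔ IsSingularPt lam f z := by
  have h1 : mfderiv (𝓡∂ 2) (𝓡 3) g z = mfderiv (𝓡∂ 2) (𝓡 3) f z := h.mfderiv_eq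
  have h2 := lam.congr_point h.self_of_nhds
  constructor
  · intro hs v
    exact (by rw [← h1]; exact hs v : _ ↔ lam (g z) v = 0).trans (by
      have h3 : lam (g z) v = lam (f z) v := h2 v
      rw [h3])
  · intro hs v
    exact (by rw [h1]; exact hs v : _ ↔ lam (f z) v = 0).trans (by
      have h3 : lam (g z) v = lam (f z) v := h2 v
      rw [h3])

variable [IsManifold (𝓡∂ 2) ∞ F]

theorem foliationForm_congr (h : g =ᶠ[𝓝 z] f) :
    foliationForm lam g z =ᶠ[𝓝[range (𝓡∂ 2)] (extChartAt (𝓡∂ 2) z z)] foliationForm lam f z := by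
  have h0 : (extChartAt (𝓡∂ 2) z).symm (extChartAt (𝓡∂ 2) z z) = z := extChartAt_to_inv z
  have h1 := h.eventually_nhds
  rw [← h0] at h1
  filter_upwards [extChartAt_target_mem_nhdsWithin z,
    (continuousAt_extChartAt_symm (I := 𝓡∂ 2) z).continuousWithinAt.eventually h1] with w hwt hw
  have h2 : ContinuousWithinAt (extChartAt (𝓡∂ 2) z).symm (range (𝓡∂ 2)) w :=
    ((contMDiffOn_extChartAt_symm (I := 𝓡∂ 2) (n := ∞) z).continuousOn w
      hwt).mono_of_mem_nhdsWithin (extChartAt_target_mem_nhdsWithin_of_mem hwt)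
  have h3 : mfderivWithin 𝓘(ℝ, E2) (𝓡 3) (g ∘ (extChartAt (𝓡∂ 2) z).symm) (range (𝓡∂ 2)) w
      = mfderivWithin 𝓘(ℝ, E2) (𝓡 3) (f ∘ (extChartAt (𝓡∂ 2) z).symm) (range (𝓡∂ 2)) w :=
    Filter.EventuallyEq.mfderivWithin_eq (h2.eventually hw) hw.self_of_nhds
  ext u
  refine Eq.trans ?_ (lam.congr_point hw.self_of_nhds
    (mfderivWithin 𝓘(ℝ, E2) (𝓡 3) (f ∘ (extChartAt (𝓡∂ 2) z).symm) (range (𝓡∂ 2)) w u))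
  exact congrArg _ (DFunLike.congr_fun h3 u)

theorem isEllipticPt_congr (h : g =ᶠ[𝓝 z] f) : IsEllipticPt lam g z ↔ IsEllipticPt lam f z := by
  have h1 := foliationForm_congr (lam := lam) h
  have h2 : foliationMatrix lam g z = foliationMatrix lam f z := by
    ext i j
    simp only [foliationMatrix, Matrix.of_apply]
    rw [h1.fderivWithin_eq (h1.self_of_nhdsWithin (mem_range_self _))]
  rw [IsEllipticPt, IsEllipticPt, isSingularPt_congr h, h2]

variable [IsManifold (𝓡 3) ∞ M]

/-- The composition of an immersion with a local diffeomorphism is an immersion. -/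
theorem IsImmersionAtOfComplement.comp_openPartialHomeomorph {C : Type*} [NormedAddCommGroup C]
    [NormedSpace ℝ C] (hc : IsImmersionAtOfComplement C (𝓡∂ 2) (𝓡 3) ∞ f z)
    (hfc : Continuous f) {T : OpenPartialHomeomorph M M}
    (hT : ContMDiffOn (𝓡 3) (𝓡 3) ∞ T T.source)
    (hT' : ContMDiffOn (𝓡 3) (𝓡 3) ∞ T.symm T.target) (hz : f z ∈ T.source) :
    IsImmersionAtOfComplement C (𝓡∂ 2) (𝓡 3) ∞ (T ∘ f) z := by
  have hψ := hc.codChart_mem_maximalAtlas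
  have hφ := hc.domChart_mem_maximalAtlas
  have hO : IsOpen (f ⁻¹' T.source) := T.open_source.preimage hfc
  -- Precomposing the codomain chart with the inverse of `T` leaves the expression of the map in
  -- charts unchanged.
  refine IsImmersionAtOfComplement.mk_of_charts hc.equiv
    (hc.domChart.restrOpen (f ⁻¹' T.source) hO) (T.symm.trans hc.codChart)
    ⟨hc.mem_domChart_source, hz⟩ ?_ ?_ ?_ ?_ ?_
  · refine ⟨T.map_source hz, ?_⟩
    change T.symm (T (f z)) ∈ hc.codChart.source
    rw [T.left_inv hz]
    exact hc.mem_codChart_source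
  · rw [IsManifold.mem_maximalAtlas_iff_contMDiffOn]
    exact ⟨(contMDiffOn_of_mem_maximalAtlas hφ).mono inter_subset_left,
      (contMDiffOn_symm_of_mem_maximalAtlas hφ).mono fun x hx => hx.1⟩
  · rw [IsManifold.mem_maximalAtlas_iff_contMDiffOn]
    exact ⟨(contMDiffOn_of_mem_maximalAtlas hψ).comp (hT'.mono fun x hx => hx.1) fun x hx => hx.2,
      hT.comp ((contMDiffOn_symm_of_mem_maximalAtlas hψ).mono fun x hx => hx.1) fun x hx => hx.2⟩
  · rintro y ⟨hy, hyT⟩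
    refine ⟨T.map_source hyT, ?_⟩
    change T.symm (T (f y)) ∈ hc.codChart.source
    rw [T.left_inv hyT]
    exact hc.source_subset_preimage_source hy
  · intro w hw
    set φ' := hc.domChart.restrOpen (f ⁻¹' T.source) hO
    have h1 : (φ'.extend (𝓡∂ 2)).symm w ∈ φ'.source := by
      rw [← φ'.extend_source (I := 𝓡∂ 2)]
      exact (φ'.extend (𝓡∂ 2)).map_target hw
    have h2 : w ∈ (hc.domChart.extend (𝓡∂ 2)).target := by
      rw [OpenPartialHomeomorph.extend_target] at hw ⊢
      exact ⟨hw.1.1, hw.2⟩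
    have h3 := hc.writtenInCharts h2
    refine Eq.trans ?_ h3
    have h4 : T.symm (T (f ((φ'.extend (𝓡∂ 2)).symm w))) = f ((φ'.extend (𝓡∂ 2)).symm w) :=
      T.left_inv h1.2
    change hc.codChart (T.symm (T (f ((φ'.extend (𝓡∂ 2)).symm w)))) = _
    rw [h4]
    rfl

end Locality

/-! ### Vertical shears of three-space. -/

section Shear

/-- The shear `(θ, x, y) ↦ (θ, x, y + u (θ, x))`. -/
noncomputable def shear (u : E2 → ℝ) (q : E3) : E3 := q + u (planePr q) • stdVec 2

variable {u : E2 → ℝ}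

@[simp]
theorem planePr_shear (q : E3) : planePr (shear u q) = planePr q := by
  ext i
  fin_cases i <;> simp [shear]

@[simp]
theorem shear_two (q : E3) : shear u q 2 = q 2 + u (planePr q) := by
  simp [shear]

theorem shear_neg_shear (q : E3) : shear (fun p => -u p) (shear u q) = q :=
  ext_of_planePr (by simp) (by simp)

theorem shear_shear_neg (q : E3) : shear u (shear (fun p => -u p) q) = q :=
  ext_of_planePr (by simp) (by simp)

theorem shear_of_eq_zero {q : E3} (h : u (planePr q) = 0) : shear u q = q := by
  simp [shear, h]

theorem contDiff_shear (hu : ContDiff ℝ ∞ u) : ContDiff ℝ ∞ (shear u) :=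
  contDiff_id.add ((hu.comp planePr.contDiff).smul contDiff_const)

/-- The shear as a homeomorphism. -/
noncomputable def shearHomeomorph (hu : ContDiff ℝ ∞ u) : E3 ≃ₜ E3 where
  toFun := shear u
  invFun := shear fun p => -u p
  left_inv := shear_neg_shear
  right_inv := shear_shear_neg
  continuous_toFun := (contDiff_shear hu).continuous
  continuous_invFun := (contDiff_shear hu.neg).continuous

theorem norm_le_planePr_add (q : E3) : ‖q‖ ≤ ‖planePr q‖ + |q 2| := by
  have h1 : q = (q 0 • stdVec 0 + q 1 • stdVec 1) + q 2 • stdVec 2 := eq_sum_stdVec q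
  have h2 : ‖q 0 • stdVec 0 + q 1 • stdVec 1‖ = ‖planePr q‖ := by
    rw [EuclideanSpace.norm_eq, EuclideanSpace.norm_eq, Fin.sum_univ_two, Fin.sum_univ_three]
    simp
  calc ‖q‖ = ‖(q 0 • stdVec 0 + q 1 • stdVec 1) + q 2 • stdVec 2‖ := by rw [← h1]
    _ ≤ ‖q 0 • stdVec 0 + q 1 • stdVec 1‖ + ‖q 2 • stdVec 2‖ := norm_add_le _ _
    _ = ‖planePr q‖ + |q 2| := by
      rw [h2, norm_smul]
      simp [stdVec]

end Shear

/-! ### Graph charts along the knot and the criterion -1 < m < 0 for ellipticity. -/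

section GraphCharts

variable {M : Type*} [TopologicalSpace M] [ChartedSpace E3 M]
  {F : Type*} [TopologicalSpace F] [ChartedSpace (EuclideanHalfSpace 2) F]

/-- A contact chart around a point of the knot in which the knot is the `θ`-axis and the surface
is one half of the graph of `h`. -/
structure IsGraphChart (lam : OneForm M) (k : ℝ → M) (f : F → M) (p : M) (σ : ℝ) (h : E2 → ℝ)
    (Φ : OpenPartialHomeomorph M E3) : Prop extends IsContactChart lam Φ where
  mem_source : p ∈ Φ.source
  center : Φ p = 0
  knot : ∀ q ∈ Φ.source, q ∈ range k ↔ Φ q 1 = 0 ∧ Φ q 2 = 0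
  oriented : ∀ r : ℝ, k r ∈ Φ.source → 0 < coordD Φ (k r) (velocity k r) 0
  smooth : ContDiff ℝ ∞ h
  surface : ∀ q ∈ Φ.source, q ∈ range f ↔ Φ q 2 = h (planePr (Φ q)) ∧ σ * Φ q 1 ≤ 0

variable [IsManifold (𝓡 3) ∞ M] [IsManifold (𝓡∂ 2) ∞ F] {lam : OneForm M} {k : ℝ → M}
  {f : F → M} {p : M} {σ : ℝ} {h : E2 → ℝ} {Φ : OpenPartialHomeomorph M E3}

theorem IsContactForm.exists_isGraphChart [T2Space M] (hlam : IsContactForm lam)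
    (hk : IsLegendrianKnot lam k) (hf : IsSmoothEmbedding (𝓡∂ 2) (𝓡 3) ∞ f)
    (hbd : f '' (𝓡∂ 2).boundary F = range k) {z₀ : F} (hz₀ : z₀ ∈ (𝓡∂ 2).boundary F)
    (hs : IsSingularPt lam f z₀) :
    ∃ (σ : ℝ) (h : E2 → ℝ) (Φ : OpenPartialHomeomorph M E3), (σ = 1 ∨ σ = -1) ∧
      IsGraphChart lam k f (f z₀) σ h Φ := by
  obtain ⟨r₀, hr₀⟩ : f z₀ ∈ range k := by
    rw [← hbd]
    exact mem_image_of_mem f hz₀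
  obtain ⟨Φ, hΦ, hsrc, h0, hax⟩ := hk.exists_chart hlam r₀
  obtain ⟨V₁, hV₁, hV₁q⟩ := hk.exists_nhds_axis hΦ.mem_atlas hsrc hax
  rw [hr₀] at hsrc h0 hV₁
  obtain ⟨σ, h, hσ, hh, V₂, hV₂, hV₂q⟩ := hΦ.exists_nhds_graph hf hz₀ hs hsrc h0 (by
    filter_upwards [hf.isEmbedding.continuous.continuousAt.preimage_mem_nhds hV₁] with z hz hzb
    refine ((hV₁q _ hz).2.1.1 ?_).1
    rw [← hbd]
    exact mem_image_of_mem f hzb)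
  have hV : V₁ ∩ V₂ ∈ 𝓝 (f z₀) := inter_mem hV₁ hV₂
  have hsub := interior_subset (s := V₁ ∩ V₂)
  refine ⟨σ, h, Φ.restrOpen (interior (V₁ ∩ V₂)) isOpen_interior, hσ,
    hΦ.mono isOpen_interior, ⟨hsrc, mem_interior_iff_mem_nhds.2 hV⟩, h0, fun q hq => ?_,
    fun r hr => ?_, hh, fun q hq => ?_⟩
  · exact (hV₁q q (hsub hq.2).1).2.1
  · exact (hV₁q _ (hsub hr.2).1).2.2 r rfl
  · exact (hV₂q q (hsub hq.2).2).2

namespace IsGraphChart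

theorem eventually (hc : IsGraphChart lam k f p σ h Φ) (hf : Continuous f) {z : F}
    (hz : f z ∈ Φ.source) : ∀ᶠ z' in 𝓝 z, Φ (f z') 2 = h (planePr (Φ (f z'))) := by
  filter_upwards [hf.continuousAt.preimage_mem_nhds (Φ.open_source.mem_nhds hz)] with z' hz'
  exact ((hc.surface _ hz').1 ⟨z', rfl⟩).1

theorem apply_zero (hc : IsGraphChart lam k f p σ h Φ) (hp : p ∈ range f) : h 0 = 0 := by
  have := ((hc.surface p hc.mem_source).1 hp).1
  rw [hc.center, map_zero] at this
  exact this.symm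

theorem graphForm_zero (h : E2 → ℝ) : graphForm h 0 = fderiv ℝ h 0 := by
  ext v
  rw [graphForm_apply, PiLp.zero_apply, zero_mul, add_zero]

variable {z₀ : F}

theorem fderiv_zero (hc : IsGraphChart lam k f (f z₀) σ h Φ) (hf : ContMDiff (𝓡∂ 2) (𝓡 3) ∞ f)
    (hi : Function.Injective (mfderiv (𝓡∂ 2) (𝓡 3) f z₀)) (hs : IsSingularPt lam f z₀) :
    fderiv ℝ h 0 = 0 := by
  have := (hc.toIsContactChart.isSingularPt_iff hc.mem_source (hf.mdifferentiable (by simp) z₀)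
    hi hc.smooth (hc.eventually hf.continuous hc.mem_source)).1 hs
  rwa [hc.center, map_zero, graphForm_zero] at this

/-- The knot is the θ-axis and lies on the surface, so h vanishes identically along this axis near
the origin. -/
theorem fderiv_fderiv_zero (hc : IsGraphChart lam k f p σ h Φ) (hkf : range k ⊆ range f) :
    fderiv ℝ (fderiv ℝ h) 0 (planeVec 0) (planeVec 0) = 0 := by
  have h0 : (0 : E3) ∈ Φ.target := by
    rw [← hc.center]
    exact Φ.map_source hc.mem_source
  have hev : ∀ᶠ t : ℝ in 𝓝 0, h (t • planeVec 0) = 0 := by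
    have h1 : Tendsto (fun t : ℝ => t • stdVec 0) (𝓝 0) (𝓝 0) := by
      have : Continuous fun t : ℝ => t • stdVec 0 := by fun_prop
      simpa using this.tendsto 0
    filter_upwards [h1.eventually (Φ.open_target.mem_nhds h0)] with t ht
    have h2 := Φ.map_target ht
    have h3 : Φ (Φ.symm (t • stdVec 0)) = t • stdVec 0 := Φ.right_inv ht
    have h4 := (hc.surface _ h2).1 (hkf ((hc.knot _ h2).2 (by rw [h3]; simp)))
    rw [h3] at h4
    have h5 : planePr (t • stdVec 0) = t • planeVec 0 := by
      ext i
      fin_cases i <;> simp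
    rw [h5] at h4
    simpa using h4.1.symm
  have hl : ∀ t : ℝ, HasDerivAt (fun t : ℝ => t • planeVec 0) (planeVec 0) t := fun t => by
    simpa using (hasDerivAt_id t).smul_const (planeVec 0)
  have h1 : ∀ t : ℝ, HasDerivAt (fun t : ℝ => h (t • planeVec 0))
      (fderiv ℝ h (t • planeVec 0) (planeVec 0)) t := fun t =>
    (hc.smooth.differentiable (by simp) _).hasFDerivAt.comp_hasDerivAt t (hl t)
  have h2 : ∀ᶠ t : ℝ in 𝓝 0, fderiv ℝ h (t • planeVec 0) (planeVec 0) = 0 := by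
    filter_upwards [hev.eventually_nhds] with t ht
    exact (h1 t).unique ((hasDerivAt_const t (0 : ℝ)).congr_of_eventuallyEq ht)
  have h3 : HasDerivAt (fun t : ℝ => fderiv ℝ h (t • planeVec 0))
      (fderiv ℝ (fderiv ℝ h) ((0 : ℝ) • planeVec 0) (planeVec 0)) 0 :=
    ((hc.smooth.fderiv_right (m := ∞) (by simp)).differentiable (by simp)
      _).hasFDerivAt.comp_hasDerivAt (0 : ℝ) (hl 0)
  have h4 := h3.clm_apply (hasDerivAt_const (0 : ℝ) (planeVec 0))
  have h5 := h4.unique ((hasDerivAt_const (0 : ℝ) (0 : ℝ)).congr_of_eventuallyEq h2)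
  simpa using h5

/-- The determinant which decides on ellipticity, for a graph over a half-plane bounded by a
Legendrian curve. -/
theorem det_foliationMatrix (hc : IsGraphChart lam k f (f z₀) σ h Φ)
    (hf : ContMDiff (𝓡∂ 2) (𝓡 3) ∞ f)
    (hi : Function.Injective (mfderiv (𝓡∂ 2) (𝓡 3) f z₀)) (hs : IsSingularPt lam f z₀)
    (hkf : range k ⊆ range f) :
    ∃ d : ℝ, d ≠ 0 ∧ (foliationMatrix lam f z₀).det = -(d ^ 2 *
      (fderiv ℝ (fderiv ℝ h) 0 (planeVec 0) (planeVec 1)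
        * (fderiv ℝ (fderiv ℝ h) 0 (planeVec 0) (planeVec 1) + 1))) := by
  have hg := hc.eventually hf.continuous hc.mem_source
  obtain ⟨d, hd, hdet⟩ := hc.toIsContactChart.det_foliationMatrix hc.mem_source hf hi hc.smooth hg
    ((hc.toIsContactChart.isSingularPt_iff hc.mem_source (hf.mdifferentiable (by simp) z₀)
      hi hc.smooth hg).1 hs)
  refine ⟨d, hd, ?_⟩
  have hsymm : fderiv ℝ (fderiv ℝ h) 0 (planeVec 1) (planeVec 0)
      = fderiv ℝ (fderiv ℝ h) 0 (planeVec 0) (planeVec 1) :=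
    (hc.smooth.contDiffAt.isSymmSndFDerivAt (by simpa using two_le_infty)).eq _ _
  rw [hdet, hc.center, map_zero]
  simp only [fderiv_graphForm hc.smooth, hsymm, hc.fderiv_fderiv_zero hkf]
  simp

/-- The determinant is -d²m(m + 1) with d ≠ 0, so it is positive only for m between -1 and 0. -/
theorem mem_Ioo_of_elliptic (hc : IsGraphChart lam k f (f z₀) σ h Φ)
    (hf : ContMDiff (𝓡∂ 2) (𝓡 3) ∞ f)
    (hi : Function.Injective (mfderiv (𝓡∂ 2) (𝓡 3) f z₀)) (he : IsEllipticPt lam f z₀)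
    (hkf : range k ⊆ range f) :
    fderiv ℝ (fderiv ℝ h) 0 (planeVec 0) (planeVec 1) ∈ Ioo (-1 : ℝ) 0 := by
  obtain ⟨d, hd, hdet⟩ := hc.det_foliationMatrix hf hi he.1 hkf
  have h1 := he.2
  rw [hdet] at h1
  have h2 : 0 < d ^ 2 := by positivity
  set m := fderiv ℝ (fderiv ℝ h) 0 (planeVec 0) (planeVec 1)
  have h3 : m * (m + 1) < 0 := by
    by_contra! h4
    nlinarith [mul_nonneg h2.le h4]
  constructor
  · nlinarith [sq_nonneg (m + 1)]
  · nlinarith [sq_nonneg m]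

/-- For the model function m = -1/2, and m(m + 1) is negative. -/
theorem isEllipticPt_of_eventuallyEq (hc : IsGraphChart lam k f (f z₀) σ h Φ)
    (hf : ContMDiff (𝓡∂ 2) (𝓡 3) ∞ f)
    (hi : Function.Injective (mfderiv (𝓡∂ 2) (𝓡 3) f z₀)) (hkf : range k ⊆ range f)
    (hh : h =ᶠ[𝓝 0] fun p => -(1 / 2) * (p 0 * p 1)) : IsEllipticPt lam f z₀ := by
  have h1 : fderiv ℝ h =ᶠ[𝓝 0] fun p : E2 =>
      -(1 / 2 : ℝ) • (p 0 • EuclideanSpace.proj (𝕜 := ℝ) (1 : Fin 2)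
      + p 1 • EuclideanSpace.proj (𝕜 := ℝ) (0 : Fin 2)) := by
    filter_upwards [hh.eventuallyEq_nhds] with p hp
    rw [hp.fderiv_eq, (hasFDerivAt_planeProd p).fderiv]
  have hp : ∀ i, HasFDerivAt (fun x : E2 => x i) (EuclideanSpace.proj (𝕜 := ℝ) i) 0 :=
    fun i => (EuclideanSpace.proj (𝕜 := ℝ) i).hasFDerivAt
  have h2 := ((((hp 0).smul_const (EuclideanSpace.proj (𝕜 := ℝ) (1 : Fin 2))).add
    ((hp 1).smul_const (EuclideanSpace.proj (𝕜 := ℝ) (0 : Fin 2)))).const_smul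
      (-(1 / 2 : ℝ))).congr_of_eventuallyEq h1
  have h3 : fderiv ℝ (fderiv ℝ h) 0 (planeVec 0) (planeVec 1) = -(1 / 2) := by
    rw [h2.fderiv]
    simp
  have hs : IsSingularPt lam f z₀ := by
    refine (hc.toIsContactChart.isSingularPt_iff hc.mem_source (hf.mdifferentiable (by simp) z₀)
      hi hc.smooth (hc.eventually hf.continuous hc.mem_source)).2 ?_
    rw [hc.center, map_zero, graphForm_zero, h1.self_of_nhds]
    simp
  refine ⟨hs, ?_⟩
  obtain ⟨d, hd, hdet⟩ := hc.det_foliationMatrix hf hi hs hkf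
  rw [hdet, h3]
  have : 0 < d ^ 2 := by positivity
  linarith

end IsGraphChart

end GraphCharts

/-! ### Shearing the surface inside a chart. -/

section ChartShear

variable {M : Type*} [TopologicalSpace M] [ChartedSpace E3 M]
  {F : Type*} [TopologicalSpace F] [ChartedSpace (EuclideanHalfSpace 2) F]
  {lam : OneForm M} {k : ℝ → M} {f : F → M} {p : M} {σ δ : ℝ} {h u : E2 → ℝ}
  {Φ : OpenPartialHomeomorph M E3}

open scoped Classical in
/-- The shear `y ↦ y + u (θ, x)` in a chart, extended by the identity. -/
noncomputable def chartShear (Φ : OpenPartialHomeomorph M E3) (u : E2 → ℝ) (q : M) : M :=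
  if q ∈ Φ.source then Φ.symm (shear u (Φ q)) else q

theorem chartShear_of_notMem {q : M} (hq : q ∉ Φ.source) : chartShear Φ u q = q := if_neg hq

theorem chartShear_of_mem {q : M} (hq : q ∈ Φ.source) :
    chartShear Φ u q = Φ.symm (shear u (Φ q)) := if_pos hq

theorem chartShear_of_eq_zero {q : M} (hu : u (planePr (Φ q)) = 0) : chartShear Φ u q = q := by
  by_cases hq : q ∈ Φ.source
  · rw [chartShear_of_mem hq, shear_of_eq_zero hu, Φ.left_inv hq]
  · exact chartShear_of_notMem hq

/-- The shear in a chart as a local diffeomorphism. -/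
noncomputable def chartShearHomeo (Φ : OpenPartialHomeomorph M E3) (hu : ContDiff ℝ ∞ u) :
    OpenPartialHomeomorph M M :=
  (Φ.trans (shearHomeomorph hu).toOpenPartialHomeomorph).trans Φ.symm

theorem mem_chartShearHomeo_source (hu : ContDiff ℝ ∞ u) {q : M} :
    q ∈ (chartShearHomeo Φ hu).source ↔ q ∈ Φ.source ∧ shear u (Φ q) ∈ Φ.target := by
  constructor
  · rintro ⟨⟨h1, -⟩, h2⟩
    exact ⟨h1, h2⟩
  · rintro ⟨h1, h2⟩
    exact ⟨⟨h1, mem_univ _⟩, h2⟩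

theorem chartShearHomeo_apply (hu : ContDiff ℝ ∞ u) {q : M} (hq : q ∈ Φ.source) :
    chartShearHomeo Φ hu q = chartShear Φ u q := (chartShear_of_mem hq).symm

theorem contMDiffOn_chartShearHomeo (hΦ : Φ ∈ IsManifold.maximalAtlas (𝓡 3) ∞ M)
    (hu : ContDiff ℝ ∞ u) : ContMDiffOn (𝓡 3) (𝓡 3) ∞ (chartShearHomeo Φ hu)
      (chartShearHomeo Φ hu).source := by
  refine (contMDiffOn_symm_of_mem_maximalAtlas hΦ).comp
    ((contDiff_shear hu).contMDiff.comp_contMDiffOn ((contMDiffOn_of_mem_maximalAtlas hΦ).mono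
      fun q hq => ((mem_chartShearHomeo_source hu).1 hq).1))
    fun q hq => ((mem_chartShearHomeo_source hu).1 hq).2

theorem contMDiffOn_chartShearHomeo_symm (hΦ : Φ ∈ IsManifold.maximalAtlas (𝓡 3) ∞ M)
    (hu : ContDiff ℝ ∞ u) : ContMDiffOn (𝓡 3) (𝓡 3) ∞ (chartShearHomeo Φ hu).symm
      (chartShearHomeo Φ hu).target := by
  refine (contMDiffOn_symm_of_mem_maximalAtlas hΦ).comp
    ((contDiff_shear hu.neg).contMDiff.comp_contMDiffOn ((contMDiffOn_of_mem_maximalAtlas hΦ).mono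
      fun q hq => hq.1)) fun q hq => hq.2.2

/-- The chart contains a closed ball so large that the shear, which is supported in a smaller
ball, can be carried out in it along the surface. -/
structure IsShearable (lam : OneForm M) (k : ℝ → M) (f : F → M) (p : M) (σ : ℝ) (h : E2 → ℝ)
    (Φ : OpenPartialHomeomorph M E3) (u : E2 → ℝ) (δ : ℝ) : Prop
    extends IsGraphChart lam k f p σ h Φ where
  smooth' : ContDiff ℝ ∞ u
  ball_subset : Metric.closedBall (0 : E3) (3 * δ) ⊆ Φ.target
  support : ∀ x, δ ≤ ‖x‖ → u x = 0
  bound : ∀ x, ‖x‖ ≤ δ → |h x| ≤ δ ∧ |u x| ≤ δ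
  axis : ∀ x : E2, x 1 = 0 → h x = 0 → u x = 0

namespace IsShearable

/-- The part of the chart in which the surface is changed. -/
def box (Φ : OpenPartialHomeomorph M E3) (δ : ℝ) : Set M :=
  Φ.symm '' Metric.closedBall (0 : E3) (3 * δ)

variable (hc : IsShearable lam k f p σ h Φ u δ)

include hc

theorem mem_box_iff {q : M} : q ∈ box Φ δ ↔ q ∈ Φ.source ∧ ‖Φ q‖ ≤ 3 * δ := by
  constructor
  · rintro ⟨x, hx, rfl⟩
    have hxt := hc.ball_subset hx
    rw [Φ.right_inv hxt]
    exact ⟨Φ.map_target hxt, mem_closedBall_zero_iff.1 hx⟩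
  · rintro ⟨h1, h2⟩
    exact ⟨Φ q, mem_closedBall_zero_iff.2 h2, Φ.left_inv h1⟩

theorem isClosed_box [T2Space M] : IsClosed (box Φ δ) :=
  ((isCompact_closedBall (0 : E3) (3 * δ)).image_of_continuousOn
    (Φ.symm.continuousOn.mono hc.ball_subset)).isClosed

variable {q : M}

/-- Where u ≠ 0 the horizontal part has norm below δ, and |h| and |u| are at most δ. This accounts
for the radius 3δ: a point of the surface and its image both stay in the ball. -/
theorem mem_box_of_ne_zero (hq : q ∈ Φ.source) (hs : Φ q 2 = h (planePr (Φ q)))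
    (hu : u (planePr (Φ q)) ≠ 0) :
    q ∈ box Φ δ ∧ shear u (Φ q) ∈ Metric.closedBall (0 : E3) (3 * δ) := by
  have h1 : ‖planePr (Φ q)‖ < δ := by
    by_contra! h1
    exact hu (hc.support _ h1)
  obtain ⟨h2, h3⟩ := hc.bound _ h1.le
  constructor
  · rw [hc.mem_box_iff]
    refine ⟨hq, (norm_le_planePr_add _).trans ?_⟩
    rw [hs]
    linarith [norm_nonneg (planePr (Φ q))]
  · rw [mem_closedBall_zero_iff]
    refine (norm_le_planePr_add _).trans ?_
    rw [planePr_shear, shear_two, hs]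
    have := abs_add_le (h (planePr (Φ q))) (u (planePr (Φ q)))
    linarith

theorem shear_mem_target (hq : q ∈ Φ.source) (hs : Φ q 2 = h (planePr (Φ q))) :
    shear u (Φ q) ∈ Φ.target := by
  by_cases hu : u (planePr (Φ q)) = 0
  · rw [shear_of_eq_zero hu]
    exact Φ.map_source hq
  · exact hc.ball_subset (hc.mem_box_of_ne_zero hq hs hu).2

theorem chartShear_mem (hq : q ∈ Φ.source) (hs : q ∈ range f) : chartShear Φ u q ∈ Φ.source := by
  rw [chartShear_of_mem hq]
  exact Φ.map_target (hc.shear_mem_target hq ((hc.surface q hq).1 hs).1)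

theorem chart_chartShear (hq : q ∈ Φ.source) (hs : q ∈ range f) :
    Φ (chartShear Φ u q) = shear u (Φ q) := by
  rw [chartShear_of_mem hq]
  exact Φ.right_inv (hc.shear_mem_target hq ((hc.surface q hq).1 hs).1)

theorem chartShear_of_notMem_box (hq : q ∉ box Φ δ) (hs : q ∈ range f) :
    chartShear Φ u q = q := by
  by_cases hqs : q ∈ Φ.source
  · refine chartShear_of_eq_zero ?_
    by_contra hu
    exact hq (hc.mem_box_of_ne_zero hqs ((hc.surface q hqs).1 hs).1 hu).1
  · exact chartShear_of_notMem hqs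

theorem chartShear_mem_box (hq : q ∈ box Φ δ) (hs : q ∈ range f) :
    chartShear Φ u q ∈ box Φ δ := by
  have hqs := (hc.mem_box_iff.1 hq).1
  by_cases hu : u (planePr (Φ q)) = 0
  · rwa [chartShear_of_eq_zero hu]
  · rw [hc.mem_box_iff, hc.chart_chartShear hqs hs]
    exact ⟨hc.chartShear_mem hqs hs,
      mem_closedBall_zero_iff.1 (hc.mem_box_of_ne_zero hqs ((hc.surface q hqs).1 hs).1 hu).2⟩

theorem chartShear_mem_source_iff (hs : q ∈ range f) :
    chartShear Φ u q ∈ Φ.source ↔ q ∈ Φ.source := by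
  refine ⟨fun hq => ?_, fun hq => hc.chartShear_mem hq hs⟩
  by_contra hn
  rw [chartShear_of_notMem hn] at hq
  exact hn hq

/-- On the surface the shear preserves both the chart domain and its complement; it is the identity
on the latter and undone by the opposite shear on the former. -/
theorem injOn_chartShear : InjOn (chartShear Φ u) (range f) := by
  intro q hq q' hq' heq
  have h1 := hc.chartShear_mem_source_iff hq
  have h2 := hc.chartShear_mem_source_iff hq'
  rw [heq, h2] at h1
  by_cases hqs : q ∈ Φ.source
  · have hqs' := h1.2 hqs
    refine Φ.injOn hqs hqs' ?_
    have h3 := congrArg Φ heq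
    rw [hc.chart_chartShear hqs hq, hc.chart_chartShear hqs' hq'] at h3
    have h4 := congrArg (shear fun p => -u p) h3
    rwa [shear_neg_shear, shear_neg_shear] at h4
  · rw [chartShear_of_notMem hqs, chartShear_of_notMem fun h => hqs (h1.1 h)] at heq
    exact heq

theorem mem_range_iff (hq : q ∈ Φ.source) : q ∈ range (chartShear Φ u ∘ f) ↔
    Φ q 2 = h (planePr (Φ q)) + u (planePr (Φ q)) ∧ σ * Φ q 1 ≤ 0 := by
  constructor
  · rintro ⟨z, rfl⟩
    have hz : f z ∈ Φ.source := (hc.chartShear_mem_source_iff (mem_range_self z)).1 hq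
    have h1 := (hc.surface _ hz).1 (mem_range_self z)
    have h2 := hc.chart_chartShear hz (mem_range_self z)
    simp only [Function.comp, h2, planePr_shear, shear_two, h1.1, true_and]
    have h3 : shear u (Φ (f z)) 1 = Φ (f z) 1 := by
      rw [← planePr_one, planePr_shear, planePr_one]
    rw [h3]
    exact h1.2
  · rintro ⟨h1, h2⟩
    set x := shear (fun p => -u p) (Φ q) with hx
    have hxp : planePr x = planePr (Φ q) := planePr_shear _
    have hx2 : x 2 = h (planePr x) := by
      rw [hxp, hx, shear_two, h1]
      ring
    have hxt : x ∈ Φ.target := by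
      by_cases hu : u (planePr (Φ q)) = 0
      · have : x = Φ q := shear_of_eq_zero (by simpa using hu)
        rw [this]
        exact Φ.map_source hq
      · refine hc.ball_subset ?_
        have h3 : ‖planePr (Φ q)‖ < δ := by
          by_contra! h3
          exact hu (hc.support _ h3)
        have h4 := (hc.bound _ h3.le).1
        rw [mem_closedBall_zero_iff]
        refine (norm_le_planePr_add _).trans ?_
        rw [hx2, hxp]
        linarith [norm_nonneg (planePr (Φ q))]
    have h5 : Φ (Φ.symm x) = x := Φ.right_inv hxt
    obtain ⟨z, hz⟩ := (hc.surface _ (Φ.map_target hxt)).2 (by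
      rw [h5]
      refine ⟨hx2, ?_⟩
      rwa [← planePr_one, hxp, planePr_one])
    refine ⟨z, ?_⟩
    rw [Function.comp, hz, chartShear_of_mem (Φ.map_target hxt), h5, hx, shear_shear_neg,
      Φ.left_inv hq]

theorem isGraphChart_comp :
    IsGraphChart lam k (chartShear Φ u ∘ f) p σ (fun x => h x + u x) Φ where
  mem_atlas := hc.mem_atlas
  form := hc.form
  mem_source := hc.mem_source
  center := hc.center
  knot := hc.knot
  oriented := hc.oriented
  smooth := hc.smooth.add hc.smooth'
  surface _ hq := hc.mem_range_iff hq

/-- On the knot x = 0 and h = y = 0, and u vanishes at such points. -/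
theorem chartShear_of_mem_knot (hk : q ∈ range k) (hs : q ∈ range f) : chartShear Φ u q = q := by
  by_cases hq : q ∈ Φ.source
  · refine chartShear_of_eq_zero (hc.axis _ ?_ ?_)
    · rw [planePr_one]
      exact ((hc.knot q hq).1 hk).1
    · rw [← ((hc.surface q hq).1 hs).1]
      exact ((hc.knot q hq).1 hk).2
  · exact chartShear_of_notMem hq

variable [T2Space M]

theorem eventuallyEq_of_notMem_box (hf : Continuous f) {z : F} (hz : f z ∉ box Φ δ) :
    chartShear Φ u ∘ f =ᶠ[𝓝 z] f := by
  filter_upwards [hf.continuousAt.preimage_mem_nhds (hc.isClosed_box.isOpen_compl.mem_nhds hz)]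
    with z' hz'
  exact hc.chartShear_of_notMem_box hz' (mem_range_self z')

theorem eventuallyEq_of_mem (hf : Continuous f) {z : F} (hz : f z ∈ Φ.source) :
    chartShearHomeo Φ hc.smooth' ∘ f =ᶠ[𝓝 z] chartShear Φ u ∘ f := by
  filter_upwards [hf.continuousAt.preimage_mem_nhds (Φ.open_source.mem_nhds hz)] with z' hz'
  exact chartShearHomeo_apply hc.smooth' hz'

theorem mem_homeo_source {z : F} (hz : f z ∈ Φ.source) :
    f z ∈ (chartShearHomeo Φ hc.smooth').source :=
  (mem_chartShearHomeo_source hc.smooth').2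
    ⟨hz, hc.shear_mem_target hz ((hc.surface _ hz).1 (mem_range_self z)).1⟩

theorem continuous_comp (hf : Continuous f) : Continuous (chartShear Φ u ∘ f) := by
  rw [continuous_iff_continuousAt]
  intro z
  by_cases hz : f z ∈ Φ.source
  · have hm := hc.mem_homeo_source hz
    exact (((chartShearHomeo Φ hc.smooth').continuousAt hm).comp hf.continuousAt).congr
      (hc.eventuallyEq_of_mem hf hz)
  · exact hf.continuousAt.congr (hc.eventuallyEq_of_notMem_box hf fun hb =>
      hz (hc.mem_box_iff.1 hb).1).symm

/-- Near each point the new map is either the old one or its composition with a local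
diffeomorphism, hence an immersion; an injective continuous map from a compact to a Hausdorff space
is an embedding. -/
theorem isSmoothEmbedding_comp [CompactSpace F] [IsManifold (𝓡 3) ∞ M] [IsManifold (𝓡∂ 2) ∞ F]
    (hf : IsSmoothEmbedding (𝓡∂ 2) (𝓡 3) ∞ f) :
    IsSmoothEmbedding (𝓡∂ 2) (𝓡 3) ∞ (chartShear Φ u ∘ f) := by
  have hfc := hf.isEmbedding.continuous
  refine ⟨?_, (hc.continuous_comp hfc).isClosedEmbedding ?_ |>.isEmbedding⟩
  · refine ⟨hf.isImmersion.complement, inferInstance, inferInstance, fun z => ?_⟩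
    have hz := hf.isImmersion.isImmersionOfComplement_complement z
    by_cases hzs : f z ∈ Φ.source
    · exact (IsImmersionAtOfComplement.comp_openPartialHomeomorph hz hfc
        (contMDiffOn_chartShearHomeo hc.mem_atlas hc.smooth')
        (contMDiffOn_chartShearHomeo_symm hc.mem_atlas hc.smooth')
        (hc.mem_homeo_source hzs)).congr_of_eventuallyEq (hc.eventuallyEq_of_mem hfc hzs)
    · exact hz.congr_of_eventuallyEq (hc.eventuallyEq_of_notMem_box hfc fun hb =>
        hzs (hc.mem_box_iff.1 hb).1).symm
  · intro z z' h
    exact hf.isEmbedding.injective (hc.injOn_chartShear (mem_range_self z) (mem_range_self z') h)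

variable [CompactSpace F] [IsManifold (𝓡 3) ∞ M] [IsManifold (𝓡∂ 2) ∞ F] {z₀ : F}

/-- The change of the surface keeps its singular points. -/
theorem isSingularPt_comp_iff (hf : IsSmoothEmbedding (𝓡∂ 2) (𝓡 3) ∞ f) (hp : p = f z₀)
    (hs₀ : IsSingularPt lam f z₀) (hO : ∀ z, f z ∈ box Φ δ → IsSingularPt lam f z → z = z₀)
    (hu : ∀ᶠ x in 𝓝 0, h x + u x = -(1 / 2) * (x 0 * x 1))
    (hne : ∀ x, ‖x‖ ≤ δ → x ≠ 0 → graphForm (fun x => h x + u x) x ≠ 0) (z : F) :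
    IsSingularPt lam (chartShear Φ u ∘ f) z ↔ IsSingularPt lam f z := by
  have hfc := hf.isEmbedding.continuous
  by_cases hz : f z ∈ box Φ δ
  · have hg := hc.isSmoothEmbedding_comp hf
    have hzs := (hc.mem_box_iff.1 hz).1
    have hgz : chartShear Φ u (f z) ∈ Φ.source := hc.chartShear_mem hzs (mem_range_self z)
    have hgc := hc.isGraphChart_comp
    have h1 := hgc.toIsContactChart.isSingularPt_iff (z := z) hgz
      ((hg.isImmersion.contMDiff.mdifferentiable (by simp)) z)
      (IsImmersionAt.mfderiv_injective (hg.isImmersion.isImmersionAt z)) hgc.smooth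
      (hgc.eventually hg.isEmbedding.continuous hgz)
    have h2 := hc.toIsContactChart.isSingularPt_iff (z := z) hzs
      ((hf.isImmersion.contMDiff.mdifferentiable (by simp)) z)
      (IsImmersionAt.mfderiv_injective (hf.isImmersion.isImmersionAt z)) hc.smooth
      (hc.toIsGraphChart.eventually hfc hzs)
    have h3 : planePr (Φ ((chartShear Φ u ∘ f) z)) = planePr (Φ (f z)) := by
      rw [Function.comp, hc.chart_chartShear hzs (mem_range_self z), planePr_shear]
    rw [h3] at h1
    -- Over the origin there is only the singular point z₀ itself, where the model graph is again
    -- tangent to ξ.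
    by_cases h0 : planePr (Φ (f z)) = 0
    · have hz₀ : z = z₀ := by
        refine hf.isEmbedding.injective (Φ.injOn hzs (hp ▸ hc.mem_source) (ext_of_planePr ?_ ?_))
        · rw [h0, ← hp, hc.center, map_zero]
        · have h4 := ((hc.surface _ hzs).1 (mem_range_self z)).1
          rw [h0, hc.toIsGraphChart.apply_zero ⟨z₀, hp.symm⟩] at h4
          rw [h4, ← hp, hc.center]
          rfl
      refine ⟨fun _ => hz₀ ▸ hs₀, fun _ => h1.2 ?_⟩
      rw [h0, IsGraphChart.graphForm_zero, Filter.EventuallyEq.fderiv_eq hu,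
        (hasFDerivAt_planeProd 0).fderiv]
      simp
    · have hns : ¬ IsSingularPt lam f z := by
        intro hs
        have hz₀ := hO z hz hs
        refine h0 ?_
        rw [hz₀, ← hp, hc.center, map_zero]
      refine ⟨fun hs => ?_, fun hs => absurd hs hns⟩
      -- Inside the disc the interpolation has no zeros except the origin; outside it u vanishes
      -- locally and the graph form is the old one.
      by_cases hδ : ‖planePr (Φ (f z))‖ ≤ δ
      · exact absurd (h1.1 hs) (hne _ hδ h0)
      · refine h2.2 ?_
        have h4 : (fun x => h x + u x) =ᶠ[𝓝 (planePr (Φ (f z)))] h := by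
          filter_upwards [(isOpen_lt continuous_const continuous_norm).mem_nhds (not_le.1 hδ)]
            with x hx
          rw [hc.support x (le_of_lt hx), add_zero]
        have h5 := h1.1 hs
        rwa [graphForm, h4.fderiv_eq] at h5
  · exact isSingularPt_congr (hc.eventuallyEq_of_notMem_box hfc hz)

theorem comp_eq_of_isSingularPt (hp : p = f z₀)
    (hO : ∀ z, f z ∈ box Φ δ → IsSingularPt lam f z → z = z₀) {z : F}
    (hs : IsSingularPt lam f z) : chartShear Φ u (f z) = f z := by
  by_cases hz : f z ∈ box Φ δ
  · refine chartShear_of_eq_zero (hc.axis _ ?_ ?_)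
    · rw [hO z hz hs, ← hp, hc.center]
      simp
    · rw [hO z hz hs, ← hp, hc.center, map_zero]
      exact hc.toIsGraphChart.apply_zero ⟨z₀, hp.symm⟩
  · exact hc.chartShear_of_notMem_box hz (mem_range_self z)

end IsShearable

theorem IsGraphChart.isSurfaceChart_restrOpen (hc : IsGraphChart lam k f p σ h Φ)
    [IsManifold (𝓡 3) ∞ M] (hh : ∀ᶠ x in 𝓝 0, h x = -(1 / 2) * (x 0 * x 1)) :
    ∃ Φ' : OpenPartialHomeomorph M E3, IsSurfaceChart lam k f p σ Φ' := by
  have h1 : ∀ᶠ q in 𝓝 p, h (planePr (Φ q)) = -(1 / 2) * (planePr (Φ q) 0 * planePr (Φ q) 1) := by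
    have h2 : ContinuousAt (fun q => planePr (Φ q)) p :=
      planePr.continuous.continuousAt.comp (Φ.continuousAt hc.mem_source)
    have h3 : ∀ᶠ x in 𝓝 (planePr (Φ p)), h x = -(1 / 2) * (x 0 * x 1) := by
      rw [hc.center, map_zero]
      exact hh
    exact h2.eventually h3
  obtain ⟨V, hV, hVo, hpV⟩ := mem_nhds_iff.1 h1
  refine ⟨Φ.restrOpen V hVo, hc.toIsContactChart.mono hVo, ⟨hc.mem_source, hpV⟩, hc.center,
    fun q hq => hc.knot q hq.1, fun r hr => hc.oriented r hr.1, fun q hq => ?_⟩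
  have h3 : h (planePr (Φ q)) = _ := hV hq.2
  refine (hc.surface q hq.1).trans ?_
  rw [h3, planePr_zero, planePr_one, mul_assoc]
  rfl

/-- Used to carry a normal chart over to a surface modified elsewhere: the chart is cut down to a
set where the images agree. -/
theorem IsSurfaceChart.mono [IsManifold (𝓡 3) ∞ M] (hc : IsSurfaceChart lam k f p σ Φ)
    {s : Set M} (hs : IsOpen s) (hp : p ∈ s) {g : F → M}
    (hg : ∀ q ∈ s, q ∈ range g ↔ q ∈ range f) :
    IsSurfaceChart lam k g p σ (Φ.restrOpen s hs) where
  toIsContactChart := hc.toIsContactChart.mono hs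
  mem_source := ⟨hc.mem_source, hp⟩
  center := hc.center
  knot q hq := hc.knot q hq.1
  oriented r hr := hc.oriented r hr.1
  surface q hq := (hg q hq.2).trans (hc.surface q hq.1)

end ChartShear

/-! ### Normal form of the surface at its elliptic boundary points. -/

section Modification

variable {M : Type*} [TopologicalSpace M] [T2Space M] [ChartedSpace E3 M]
  [IsManifold (𝓡 3) ∞ M]
  {F : Type*} [TopologicalSpace F] [CompactSpace F] [ChartedSpace (EuclideanHalfSpace 2) F]
  [IsManifold (𝓡∂ 2) ∞ F] {lam : OneForm M} {k : ℝ → M}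

/-- A surface can be brought into normal form near an elliptic boundary point, by a small change
near this point. -/
theorem IsContactForm.exists_modification (hlam : IsContactForm lam) (hk : IsLegendrianKnot lam k)
    (f : C(F, M)) (hf : IsSmoothEmbedding (𝓡∂ 2) (𝓡 3) ∞ f)
    (hbd : f '' (𝓡∂ 2).boundary F = range k) {z₀ : F} (hz₀ : z₀ ∈ (𝓡∂ 2).boundary F)
    (he : IsEllipticPt lam f z₀) {N : Set C(F, M)} (hN : N ∈ 𝓝 f) {O : Set M}
    (hO : O ∈ 𝓝 (f z₀)) (hOs : ∀ z, f z ∈ O → IsSingularPt lam f z → z = z₀) :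
    ∃ (g : C(F, M)) (Q : Set M), g ∈ N ∧ IsClosed Q ∧ Q ⊆ O ∧
      IsSmoothEmbedding (𝓡∂ 2) (𝓡 3) ∞ g ∧ (∀ z, f z ∉ Q → g z = f z) ∧
      (∀ z, f z ∈ Q → g z ∈ Q) ∧ (∀ z ∈ (𝓡∂ 2).boundary F, g z = f z) ∧
      (∀ z, IsSingularPt lam g z ↔ IsSingularPt lam f z) ∧
      (∀ z, IsSingularPt lam f z → g z = f z) ∧
      (∀ z, IsEllipticPt lam g z ↔ IsEllipticPt lam f z) ∧
      ∃ (σ : ℝ) (Φ : OpenPartialHomeomorph M E3), (σ = 1 ∨ σ = -1) ∧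
        IsSurfaceChart lam k g (f z₀) σ Φ := by
  have hfs : ContMDiff (𝓡∂ 2) (𝓡 3) ∞ f := hf.isImmersion.contMDiff
  have hfi := IsImmersionAt.mfderiv_injective (hf.isImmersion.isImmersionAt z₀)
  have hkf : range k ⊆ range f := by
    rw [← hbd]
    exact image_subset_range _ _
  obtain ⟨σ, h, Φ, hσ, hc⟩ := hlam.exists_isGraphChart hk hf hbd hz₀ he.1
  obtain ⟨V, hV, hVN⟩ := f.exists_nhds_of_mem_nhds hN (f z₀)
  -- The ball must lie over V, which controls the C⁰-distance, and over O, which contains no other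
  -- singular point.
  obtain ⟨δ₀, hδ₀, hball⟩ : ∃ δ₀ > 0, ∀ x ∈ Metric.closedBall (0 : E3) (3 * δ₀),
      x ∈ Φ.target ∧ Φ.symm x ∈ O ∩ V := by
    have h0 : (0 : E3) ∈ Φ.target := by
      rw [← hc.center]
      exact Φ.map_source hc.mem_source
    have h1 : O ∩ V ∈ 𝓝 (Φ.symm 0) := by
      rw [← hc.center, Φ.left_inv hc.mem_source]
      exact inter_mem hO hV
    obtain ⟨r, hr, hrb⟩ := Metric.nhds_basis_closedBall.mem_iff.1
      (inter_mem (Φ.open_target.mem_nhds h0) ((Φ.symm.continuousAt h0).preimage_mem_nhds h1))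
    refine ⟨r / 3, by positivity, fun x hx => hrb ?_⟩
    rwa [mul_div_cancel₀ r three_ne_zero] at hx
  obtain ⟨δ, ⟨hδ, hδδ₀⟩, u, hus, hu0, hu1, hub, hua, hune⟩ :=
    exists_interpolation hc.smooth (hc.apply_zero (mem_range_self z₀))
      (hc.fderiv_zero hfs hfi he.1) (hc.fderiv_fderiv_zero hkf)
      (hc.mem_Ioo_of_elliptic hfs hfi he hkf) hδ₀
  have hsub : Metric.closedBall (0 : E3) (3 * δ) ⊆ Metric.closedBall 0 (3 * δ₀) :=
    Metric.closedBall_subset_closedBall (by linarith)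
  have hS : IsShearable lam k f (f z₀) σ h Φ u δ :=
    ⟨hc, hus, fun x hx => (hball x (hsub hx)).1, hu0, hub, hua⟩
  have hQ : IsShearable.box Φ δ ⊆ O ∩ V := by
    rintro q ⟨x, hx, rfl⟩
    exact (hball x (hsub hx)).2
  have hOQ : ∀ z, f z ∈ IsShearable.box Φ δ → IsSingularPt lam f z → z = z₀ := fun z hz =>
    hOs z (hQ hz).1
  have hg := hS.isSmoothEmbedding_comp hf
  have hsing := hS.isSingularPt_comp_iff hf rfl he.1 hOQ hu1 hune
  have hfix : ∀ z, IsSingularPt lam f z → chartShear Φ u (f z) = f z := fun z =>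
    hS.comp_eq_of_isSingularPt rfl hOQ
  refine ⟨⟨chartShear Φ u ∘ f, hg.isEmbedding.continuous⟩, IsShearable.box Φ δ, ?_,
    hS.isClosed_box, fun q hq => (hQ hq).1, hg, fun z hz =>
      hS.chartShear_of_notMem_box hz (mem_range_self z), fun z hz =>
      hS.chartShear_mem_box hz (mem_range_self z), fun z hz => ?_, hsing, hfix, fun z => ?_,
      σ, ?_⟩
  · refine hVN _ fun z => ?_
    by_cases hz : f z ∈ IsShearable.box Φ δ
    · exact Or.inr ⟨(hQ hz).2, (hQ (hS.chartShear_mem_box hz (mem_range_self z))).2⟩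
    · exact Or.inl (hS.chartShear_of_notMem_box hz (mem_range_self z))
  · refine hS.chartShear_of_mem_knot ?_ (mem_range_self z)
    rw [← hbd]
    exact mem_image_of_mem f hz
  · by_cases hz : f z ∈ IsShearable.box Φ δ
    · by_cases hzs : IsSingularPt lam f z
      · have hz₀' := hOQ z hz hzs
        subst hz₀'
        refine iff_of_true ?_ he
        have hgc := hS.isGraphChart_comp
        rw [← hfix z he.1] at hgc
        exact hgc.isEllipticPt_of_eventuallyEq (z₀ := z) hg.isImmersion.contMDiff
          (IsImmersionAt.mfderiv_injective (hg.isImmersion.isImmersionAt z)) (by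
            intro q hq
            rw [← hbd] at hq
            obtain ⟨y, hy, rfl⟩ := hq
            refine ⟨y, hS.chartShear_of_mem_knot ?_ (mem_range_self y)⟩
            rw [← hbd]
            exact mem_image_of_mem f hy) hu1
      · exact iff_of_false (fun h => hzs ((hsing z).1 h.1)) fun h => hzs h.1
    · exact isEllipticPt_congr (hS.eventuallyEq_of_notMem_box hf.isEmbedding.continuous hz)
  · obtain ⟨Φ', hΦ'⟩ := hS.isGraphChart_comp.isSurfaceChart_restrOpen hu1
    exact ⟨Φ', hσ, hΦ'⟩

/-- A surface can be brought into normal form near its elliptic boundary points. -/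
theorem IsContactForm.exists_normal_surface (hlam : IsContactForm lam)
    (hk : IsLegendrianKnot lam k) (f : C(F, M)) (hf : IsSmoothEmbedding (𝓡∂ 2) (𝓡 3) ∞ f)
    (hbd : f '' (𝓡∂ 2).boundary F = range k) (hfin : {z : F | IsSingularPt lam f z}.Finite)
    {N : Set C(F, M)} (hN : N ∈ 𝓝 f) :
    ∃ g : C(F, M), g ∈ N ∧ IsSmoothEmbedding (𝓡∂ 2) (𝓡 3) ∞ g ∧
      (∀ z ∈ (𝓡∂ 2).boundary F, g z = f z) ∧
      (∀ z, IsSingularPt lam g z ↔ IsSingularPt lam f z) ∧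
      (∀ z, IsSingularPt lam f z → g z = f z) ∧
      (∀ z, IsEllipticPt lam g z ↔ IsEllipticPt lam f z) ∧
      ∀ z ∈ (𝓡∂ 2).boundary F, IsEllipticPt lam f z →
        ∃ (σ : ℝ) (Φ : OpenPartialHomeomorph M E3), (σ = 1 ∨ σ = -1) ∧
          IsSurfaceChart lam k g (g z) σ Φ := by
  -- An open neighbourhood is a neighbourhood of each intermediate surface as well, so the induction
  -- can continue within it.
  obtain ⟨N', hN'N, hN'o, hfN'⟩ := mem_nhds_iff.1 hN
  have hE : {z | z ∈ (𝓡∂ 2).boundary F ∧ IsEllipticPt lam f z}.Finite :=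
    hfin.subset fun z hz => hz.2.1
  suffices H : ∀ S : Set F, S.Finite → S ⊆ {z | z ∈ (𝓡∂ 2).boundary F ∧ IsEllipticPt lam f z} →
      ∃ g : C(F, M), g ∈ N' ∧ IsSmoothEmbedding (𝓡∂ 2) (𝓡 3) ∞ g ∧
        (∀ z ∈ (𝓡∂ 2).boundary F, g z = f z) ∧
        (∀ z, IsSingularPt lam g z ↔ IsSingularPt lam f z) ∧
        (∀ z, IsSingularPt lam f z → g z = f z) ∧
        (∀ z, IsEllipticPt lam g z ↔ IsEllipticPt lam f z) ∧
        ∀ z ∈ S, ∃ (σ : ℝ) (Φ : OpenPartialHomeomorph M E3), (σ = 1 ∨ σ = -1) ∧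
          IsSurfaceChart lam k g (g z) σ Φ by
    obtain ⟨g, h1, h2, h3, h4, h5, h6, h7⟩ := H _ hE Subset.rfl
    exact ⟨g, hN'N h1, h2, h3, h4, h5, h6, fun z hz hze => h7 z ⟨hz, hze⟩⟩
  intro S hS
  induction S, hS using Set.Finite.induction_on with
  | empty =>
    intro _
    exact ⟨f, hfN', hf, fun _ _ => rfl, fun _ => Iff.rfl, fun _ _ => rfl, fun _ => Iff.rfl,
      fun z hz => absurd hz (notMem_empty z)⟩
  | @insert z₀ S hz₀S hSfin ih =>
    intro hsub
    obtain ⟨g, hgN, hg, hgb, hgs, hgfix, hge, hgc⟩ := ih ((subset_insert _ _).trans hsub)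
    obtain ⟨hz₀b, hz₀e⟩ := hsub (mem_insert z₀ S)
    let P : Set M := g '' ({z | IsSingularPt lam f z} \ {z₀})
    -- The next modification takes place off the remaining singular points, so it cannot disturb the
    -- points already treated.
    have hP : IsClosed P := ((hfin.subset sdiff_subset).image g).isClosed
    have hz₀P : g z₀ ∈ Pᶜ := by
      rintro ⟨z, ⟨-, hz⟩, hzz⟩
      exact hz (hg.isEmbedding.injective hzz)
    have hgbd : g '' (𝓡∂ 2).boundary F = range k := by
      rw [← hbd]
      exact image_congr hgb
    obtain ⟨g', Q, hg'N, hQc, hQP, hg', hg'Q, hg'Q', hg'b, hg's, hg'fix, hg'e, σ, Φ, hσ, hΦ⟩ :=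
      hlam.exists_modification hk g hg hgbd hz₀b ((hge z₀).2 hz₀e) (hN'o.mem_nhds hgN)
        (hP.isOpen_compl.mem_nhds hz₀P) (fun z hz hzs => by
          by_contra hne
          exact hz ⟨z, ⟨(hgs z).1 hzs, hne⟩, rfl⟩)
    refine ⟨g', hg'N, hg', fun z hz => (hg'b z hz).trans (hgb z hz),
      fun z => (hg's z).trans (hgs z), fun z hz =>
        (hg'fix z ((hgs z).2 hz)).trans (hgfix z hz), fun z => (hg'e z).trans (hge z), ?_⟩
    intro z hz
    rcases mem_insert_iff.1 hz with rfl | hzS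
    · refine ⟨σ, Φ, hσ, ?_⟩
      rwa [hg'b z hz₀b]
    · obtain ⟨σ', Φ', hσ', hΦ'⟩ := hgc z hzS
      have hzb := (hsub (mem_insert_of_mem z₀ hzS))
      -- Off Q the old and the new surface have the same image, since points over Q stay in Q and
      -- the others do not move.
      refine ⟨σ', Φ'.restrOpen Qᶜ hQc.isOpen_compl, hσ', ?_⟩
      rw [hg'b z hzb.1]
      refine hΦ'.mono hQc.isOpen_compl (fun hq => ?_) fun q hq => ⟨?_, ?_⟩
      · exact hQP hq ⟨z, ⟨hzb.2.1, fun h => hz₀S (h ▸ hzS)⟩, rfl⟩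
      · rintro ⟨y, rfl⟩
        by_cases hy : g y ∈ Q
        · exact absurd (hg'Q' y hy) hq
        · exact ⟨y, (hg'Q y hy).symm⟩
      · rintro ⟨y, rfl⟩
        exact ⟨y, hg'Q y hq⟩

end Modification

theorem theorem1p1
    {M : Type*} [TopologicalSpace M] [T2Space M] [SecondCountableTopology M]
    [ChartedSpace E3 M] [IsManifold (𝓡 3) ∞ M]
    (lam : OneForm M) (hlam : IsContactForm lam)
    (k : ℝ → M) (hk : IsLegendrianKnot lam k)
    {F : Type*} [TopologicalSpace F] [T2Space F] [CompactSpace F]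
    [ChartedSpace (EuclideanHalfSpace 2) F] [IsManifold (𝓡∂ 2) ∞ F]
    (f : C(F, M)) (hf : IsSmoothEmbedding (𝓡∂ 2) (𝓡 3) ∞ f)
    (hbd : f '' (𝓡∂ 2).boundary F = range k)
    (hfin : {z : F | IsSingularPt lam f z}.Finite) :
    -- for every neighbourhood of `f` in the `C^0` topology
    ∀ N ∈ 𝓝 f, ∃ (g : C(F, M)) (J : EndField M),
      g ∈ N ∧ IsSmoothEmbedding (𝓡∂ 2) (𝓡 3) ∞ g ∧
      (∀ z ∈ (𝓡∂ 2).boundary F, g z = f z) ∧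
      g '' {z | IsSingularPt lam g z} = f '' {z | IsSingularPt lam f z} ∧
      (∀ z ∈ (𝓡∂ 2).boundary F, IsEllipticPt lam g z ↔ IsEllipticPt lam f z) ∧
      IsCompatible lam J ∧
      ∀ e ∈ (𝓡∂ 2).boundary F, IsEllipticPt lam g e →
        ∃ U : ℝ → ℝ × ℝ → ℝ × M,
          (∀ τ ∈ Ioo (0 : ℝ) 1, IsSolution lam J k g (U τ) ∧ IsEmbeddedStrip (U τ)) ∧
          (∀ τ ∈ Ioo (0 : ℝ) 1, ∀ τ' ∈ Ioo (0 : ℝ) 1, τ ≠ τ' →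
            Disjoint (U τ '' strip) (U τ' '' strip)) ∧
          ShrinksTo U (g e) ∧
          ContMDiffOn 𝓘(ℝ, ℝ × (ℝ × ℝ)) (𝓘(ℝ, ℝ).prod (𝓡 3)) ∞
            (fun q : ℝ × (ℝ × ℝ) => U q.1 q.2) (Ioo 0 1 ×ˢ strip) ∧
          (∀ τ ∈ Ioo (0 : ℝ) 1, ∀ z ∈ strip,
            contactProj lam (U τ z).2 (partialS (U τ) z).2 ≠ 0) ∧
          (∀ τ ∈ Ioo (0 : ℝ) 1, HasMaslovIndex lam J k g (U τ) 0) ∧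
          ∃ (Φ : OpenPartialHomeomorph M E3) (σ c : ℝ),
            (σ = 1 ∨ σ = -1) ∧ 0 < c ∧ IsNormalChart lam J k g (g e) σ Φ ∧
            ∀ τ ∈ Ioo (0 : ℝ) 1, ∀ z ∈ strip, (U τ z).2 ∈ Φ.source ∧
              ((U τ z).1, Φ (U τ z).2) = modelStrip (σ * c * τ) z := by
  classical
  intro N hN
  obtain ⟨g, hgN, hg, hgb, hsing, hgs, hell, hchart⟩ :=
    hlam.exists_normal_surface hk f hf hbd hfin hN
  have hP : (g '' {z | z ∈ (𝓡∂ 2).boundary F ∧ IsEllipticPt lam f z}).Finite :=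
    (hfin.subset fun z hz => hz.2.1).image g
  set P : Set M := g '' {z | z ∈ (𝓡∂ 2).boundary F ∧ IsEllipticPt lam f z} with hPdef
  have hex : ∀ p : M, ∃ (σ : ℝ) (Φ : OpenPartialHomeomorph M E3),
      p ∈ P → (σ = 1 ∨ σ = -1) ∧ IsSurfaceChart lam k g p σ Φ := by
    intro p
    by_cases hp : p ∈ P
    · obtain ⟨z, hz, rfl⟩ := hp
      obtain ⟨σ, Φ, h⟩ := hchart z hz.1 hz.2
      exact ⟨σ, Φ, fun _ => h⟩
    -- Placeholders: off P nothing is required of the sign and the chart.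
    · exact ⟨0, chartAt E3 p, fun h => absurd h hp⟩
  choose σ Φ hΦ using hex
  obtain ⟨J, hJ, hJP⟩ := hlam.exists_isCompatible hP Φ fun p hp =>
    ⟨(hΦ p hp).2.toIsContactChart, (hΦ p hp).2.mem_source⟩
  refine ⟨g, J, hgN, hg, hgb, ?_, fun z _ => hell z, hJ, fun e heb hee => ?_⟩
  · simp only [hsing]
    exact image_congr fun z hz => hgs z hz
  · have he : g e ∈ P := ⟨e, ⟨heb, (hell e).1 hee⟩, rfl⟩
    obtain ⟨V, hVo, hpV, hV⟩ := hJP (g e) he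
    obtain ⟨hσ, hc⟩ := hΦ (g e) he
    -- J is known to be standard only on V, so the chart is cut down to V before it becomes a normal
    -- chart.
    have hc' := hc.mono hVo hpV (g := g) fun _ _ => Iff.rfl
    have hn : IsNormalChart lam J k g (g e) (σ (g e)) ((Φ (g e)).restrOpen V hVo) :=
      { mem_atlas := hc'.mem_atlas
        mem_source := hc'.mem_source
        center := hc'.center
        form := hc'.form
        knot := hc'.knot
        oriented := hc'.oriented
        surface := hc'.surface
        complex := fun q hq v hv => hV q hq.2 v hv }
    exact hn.exists_strips hJ hk hg.isImmersion.contMDiff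
      (fun z => IsImmersionAt.mfderiv_injective (hg.isImmersion.isImmersionAt z)) hσ
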